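/- Let $M$ be a compact connected (Hausdorff) topological surface with boundary, for instance a closed disk, and let $f\colon M\to\mathbf R^3$ be a locally convex immersion, i.e. a continuous locally one-to-one map which sends a neighborhood of each point of $M$ into the boundary of a convex body (a compact convex set with interior points) in $\mathbf R^3$. Suppose that $f|_{\partial M}$ is of class $\mathcal C^2$ with nonvanishing differential and nowhere vanishing curvature, and that no point of $\partial M$ has a neighborhood which $f$ maps into a plane. For a plane $H$ with a chosen normal $n$, let $H^+$ be the closed side of $H$ into which $n$ points, and $H^-$ the other closed side. A nondegenerate cap in $\mathbf R^3$ with plane $H$ and half-space $H^+$ is a topological disk embedded in the boundary of some convex body, which meets $H$ precisely along its boundary circle and lies in $H^+$. A degenerate cap in $\mathbf R^3$ with plane $H$ is a nonempty compact convex subset of $H$. A closed connected set $C\subset M$ is a cap of $M$ with half-space $H^+$ if $f$ maps $C$ injectively onto a cap in $\mathbf R^3$ which is either nondegenerate with plane $H$ and half-space $H^+$, or degenerate with plane $H$ and such that $f(U\setminus C)\cap H^+=\emptyset$ for some neighborhood $U$ of $C$ in $M$. A cap is maximal if it is contained in no other cap of $M$. For $p\in\partial M$ let $T_pf$ be the tangent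 cone at $f(p)$ of $f(U)$, for small neighborhoods $U$ of $p$, regarded as a set of vectors; let the conormal $\nu$ be the unit vector orthogonal to the curve $f|_{\partial M}$ at $p$ which lies in $T_pf$; and let $n$ be the unit vector orthogonal to $T_pf$ such that $\langle n,f(x)-f(p)\rangle\le 0$ for all $x\in M$ near $p$. For $0\le\theta\le\pi$ put $n_p(\theta)=\cos\theta\,n+\sin\theta\,\nu$, let $H_p(\theta)$ be the plane through $f(p)$ with normal $n_p(\theta)$, and let $C_p(\theta)$ be the component of $f^{-1}(H_p(\theta)^+)$ which contains $p$. Let $\Theta_p$ be the set of all $\theta\in[0,\pi]$ such that $C_p(\theta)$ is a cap of $M$ with half-space $H_p(\theta)^+$ (a cap of angle $\theta$ at $p$). **Theorem.** For each $p\in\partial M$ vectors $\nu$ and $n$ as above exist, the set $\Theta_p$ is nonempty and, with $\overline\theta=\sup\Theta_p$, contains the interval $(0,\overline\theta)$. Through $p$ there passes a maximal cap $C$ of $M$, which is the limit of the caps $C_p(\theta)$ as $\theta\in\Theta_p$ tends to its supremum $\overline\theta$, in the Hausdorff (equivalently, Vietoris) topology on compact subsets of $M$. (In particular $C=C_p(0)$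 if $\overline\theta=0$.) -/

import Mathlib

open Set Filter Topology
open scoped Manifold

/-- Euclidean three-space. -/
abbrev R3 : Type := EuclideanSpace ℝ (Fin 3)

/-- The boundary `∂M` of a surface with boundary `M`. -/
abbrev bdry (M : Type*) [TopologicalSpace M] [ChartedSpace (EuclideanHalfSpace 2) M] : Set M :=
  (𝓡∂ 2).boundary M

/-- The plane `{x | ⟨n, x⟩ = c}`. -/
def plane (n : R3) (c : ℝ) : Set R3 := {x | inner ℝ n x = c}

/-- The closed side `H⁺ = {x | ⟨n, x⟩ ≥ c}` of the plane `H = {x | ⟨n, x⟩ = c}`, into which the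
normal `n` points. -/
def halfSpace (n : R3) (c : ℝ) : Set R3 := {x | c ≤ inner ℝ n x}

/-- A convex body: a compact convex set with interior points. -/
structure IsConvexBody (K : Set R3) : Prop where
  isCompact : IsCompact K
  convex : Convex ℝ K
  interior_nonempty : (interior K).Nonempty

section Immersions

variable {M : Type*} [TopologicalSpace M]

/-- A locally convex immersion: a continuous, locally one-to-one map which sends a neighborhood of
each point into the boundary of a convex body. -/
structure IsLocallyConvexImmersion (f : M → R3) : Prop where
  continuous : Continuous f
  locally_injective : ∀ p, ∃ U ∈ 𝓝 p, InjOn f U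
  locally_convex : ∀ p, ∃ U ∈ 𝓝 p, ∃ K, IsConvexBody K ∧ f '' U ⊆ frontier K

/-- `S` is a nondegenerate cap of `ℝ³` with plane `{⟨n, x⟩ = c}` and half-space `{⟨n, x⟩ ≥ c}`:
a topological disk, embedded in the boundary of a convex body, which meets the plane precisely
along the boundary circle of the disk, and which lies in the half-space. -/
def IsNondegenerateCap (S : Set R3) (n : R3) (c : ℝ) : Prop :=
  (∃ K, IsConvexBody K ∧ S ⊆ frontier K) ∧
  (∃ g : Metric.closedBall (0 : EuclideanSpace ℝ (Fin 2)) 1 → R3,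
    Continuous g ∧ Function.Injective g ∧ range g = S ∧
      ∀ x, g x ∈ plane n c ↔ ‖(x : EuclideanSpace ℝ (Fin 2))‖ = 1) ∧
  S ⊆ halfSpace n c

/-- `S` is a degenerate cap of `ℝ³` with a plane `{⟨n, x⟩ = c}`: a nonempty compact convex subset
of the plane (a point, a line segment or a convex disk). -/
def IsDegenerateCap (S : Set R3) (n : R3) (c : ℝ) : Prop :=
  S.Nonempty ∧ IsCompact S ∧ Convex ℝ S ∧ S ⊆ plane n c

/-- `C` is a cap of `M` with half-space `{⟨n, x⟩ ≥ c}`: a closed connected set, mapped by `f`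
injectively onto a cap of `ℝ³` with this half-space; if `f(C)` is degenerate, then moreover
`f(U - C)` is disjoint from the half-space for some neighborhood `U` of `C`. -/
structure IsCapWith (f : M → R3) (C : Set M) (n : R3) (c : ℝ) : Prop where
  isClosed : IsClosed C
  isConnected : IsConnected C
  normal_ne_zero : n ≠ 0
  injOn : InjOn f C
  image_isCap : IsNondegenerateCap (f '' C) n c ∨
    (IsDegenerateCap (f '' C) n c ∧ ∃ U ∈ 𝓝ˢ C, Disjoint (f '' (U \ C)) (halfSpace n c))

/-- `C` is a cap of `M`. -/
def IsCap (f : M → R3) (C : Set M) : Prop := ∃ n c, IsCapWith f C n c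

/-- `C` is a maximal cap of `M`: a cap which is contained in no other cap. -/
def IsMaximalCap (f : M → R3) (C : Set M) : Prop :=
  IsCap f C ∧ ∀ C', IsCap f C' → C ⊆ C' → C' = C

/-- The tangent cone `T_p f` of `f` at `p`, translated to the origin: the tangent cone at `f(p)` of
`f(U)`, where `U` is a small neighborhood of `p`. The cone decreases with `U` and is the
same for all small `U`, hence the intersection. -/
def tangentCone (f : M → R3) (p : M) : Set R3 :=
  ⋂ U ∈ 𝓝 p, posTangentConeAt (f '' U) (f p)

/-- `n` is the outward unit normal of the tangent plane `H_p(0)`, the plane through `f(p)`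
which contains `T_p f`; it points away from the side on which `f` lies locally. -/
structure IsOutwardNormal (f : M → R3) (p : M) (n : R3) : Prop where
  norm_eq_one : ‖n‖ = 1
  orthogonal : ∀ v ∈ tangentCone f p, inner ℝ n v = 0
  supports : ∀ᶠ x in 𝓝 p, inner ℝ n (f x - f p) ≤ 0

/-- The normal `n_p(θ) = cos θ n + sin θ ν` of the plane `H_p(θ)`. The latter plane arises from
`H_p(0)` by a rotation about the tangent line of the boundary curve through the angle `θ`,
which turns `ν` into `ν_p(θ) = cos θ ν - sin θ n` and `n` into `n_p(θ)`. -/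
noncomputable def rotatedNormal (ν n : R3) (θ : ℝ) : R3 := Real.cos θ • n + Real.sin θ • ν

/-- The set `C_p(θ)`: the component of `f⁻¹(H_p(θ)⁺)` which contains `p`. -/
noncomputable def capAt (f : M → R3) (p : M) (ν n : R3) (θ : ℝ) : Set M :=
  connectedComponentIn
    (f ⁻¹' halfSpace (rotatedNormal ν n θ) (inner ℝ (rotatedNormal ν n θ) (f p))) p

/-- The angles `0 ≤ θ ≤ π` of the caps at `p`: those for which `C_p(θ)` is a cap with
half-space `H_p(θ)⁺`. -/
def capAngles (f : M → R3) (p : M) (ν n : R3) : Set ℝ :=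
  {θ ∈ Icc 0 Real.pi | IsCapWith f (capAt f p ν n θ)
    (rotatedNormal ν n θ) (inner ℝ (rotatedNormal ν n θ) (f p))}

end Immersions

section Boundary

variable {M : Type*} [TopologicalSpace M] [ChartedSpace (EuclideanHalfSpace 2) M]

/-- `f` is locally nonflat along `∂M`: no neighborhood of a boundary point is mapped into a
plane. -/
def LocallyNonflatAlongBoundary (f : M → R3) : Prop :=
  ∀ p ∈ bdry M, ∀ U ∈ 𝓝 p, ¬ ∃ n c, n ≠ 0 ∧ f '' U ⊆ plane n c

/-- The curve in `ℝ³` obtained from `f` and a parametrization `φ` of a part of `∂M`. -/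
def boundaryCurve (f : M → R3) (φ : ℝ → bdry M) : ℝ → R3 := fun t => f (φ t)

/-- `φ` parametrizes an open arc of `∂M` so that `f ∘ φ` is a regular `C^k` curve. -/
structure IsRegularParam (f : M → R3) (k : ℕ) (φ : ℝ → bdry M) : Prop where
  isOpenEmbedding : IsOpenEmbedding φ
  contDiff : ContDiff ℝ k (boundaryCurve f φ)
  deriv_ne_zero : ∀ t, deriv (boundaryCurve f φ) t ≠ 0

/-- `f|_{∂M}` is of regularity class `C^k`: `k` times continuously differentiable with nonvanishing
differential, in suitable parameters around each boundary point. -/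
def BoundaryRegular (f : M → R3) (k : ℕ) : Prop :=
  ∀ p : bdry M, ∃ φ, IsRegularParam f k φ ∧ φ 0 = p

/-- `f|_{∂M}` has no inflections: its curvature vanishes nowhere, i.e. the velocity and the
acceleration are linearly independent. -/
def NoBoundaryInflections (f : M → R3) : Prop :=
  ∀ φ, IsRegularParam f 2 φ → ∀ t, LinearIndependent ℝ
    ![deriv (boundaryCurve f φ) t, deriv (deriv (boundaryCurve f φ)) t]

/-- `ν` is the conormal of `f` at the boundary point `p`: the unit normal vector of `f|_{∂M}` which
points into `T_p f`. -/
structure IsConormal (f : M → R3) (p : bdry M) (ν : R3) : Prop where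
  norm_eq_one : ‖ν‖ = 1
  mem_tangentCone : ν ∈ tangentCone f (p : M)
  orthogonal : ∀ φ, IsRegularParam f 1 φ → φ 0 = p → inner ℝ ν (deriv (boundaryCurve f φ) 0) = 0

end Boundary

/-!
Caps are encoded by the bodies which they bound: a nondegenerate cap is the closure of the part of
the boundary of a convex body above a plane (`CapBody`, `openCap`), and `CapModel` says that `f`
maps `C` injectively onto such a closure. That the closure is a disk is
`CapBody.isNondegenerateCap`; conversely each nondegenerate cap has this form
(`IsNondegenerateCap.exists_capBody`), by invariance of domain in the plane, which is proved with
winding numbers.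

Near `p` the surface is a neighborhood in the boundary of a convex body, cut along the boundary
curve (`LocalModel`). As the curvature does not vanish and `f` is not flat near `p`, the tangent
cone is the half-plane spanned by the tangent line and a unit conormal `ν`. The frame `T`, `n`, `ν`
of `LocalModel.exists_boundaryFrame` contains the required normal and conormal.

Some angle occurs. If `f` meets the tangent plane near `p` in a convex set, the component of the
contact set through `p` is a convex face (`IsRegularImmersion.exists_flat_face`, by a local-to-global
argument in the manner of Tietze), so the angle `0` occurs. Otherwise a slightly rotated plane cuts
a small cap from the convex body near `p`. It lies on the surface, as the boundary curve does not
rise above this plane near `p` (`BoundaryFrame.eventually_mem_capAngles`).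

The plane of a nondegenerate cap `C` through `p` contains the tangent line at `p`, hence is
`H_p(θ')` for some `θ' > 0` (`BoundaryFrame.exists_direction`). The body of `C` lies below the
tangent plane, and its base below each plane `H_p(θ)` with `0 < θ < θ'`. Thus near `C` the surface
does not rise above `H_p(θ)` outside `C`, so `C_p(θ)` is the part of `C` above that plane and is
again a cap (`BoundaryFrame.capModel_capAt`). This fills the interval up to the supremum `τ`.

If `τ > 0`, the caps `C_p(θ)`, `0 < θ < τ`, increase, and so do their bodies. The closure of the
union of the caps covers the boundary of the limit body off the limit of the bases
(`CapFamily.coversOff`). If this limit base lay in a line, that closure would cover the whole sphere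
bounding the limit body injectively, and `p` would not be a boundary point
(`CoversOff.injOn_of_section`, `CoversOff.notMem_bdry`, `CapFamily.exists_inner_ne_zero`). Hence the
limit body has a base with relative interior points, and the limit is a nondegenerate cap
(`CapFamily.capModel_limit`). A nondegenerate cap through `p` is the closure of the union of the
smaller caps at `p` (`BoundaryFrame.cap_eq_closure`), and a degenerate one lies in the tangent plane
(`BoundaryFrame.inner_eq_of_convex`); both facts give maximality of the limit. Since the caps
increase to it, they converge to it in the Vietoris topology. If `τ = 0`, then `0` is the only
angle, no nondegenerate cap passes through `p`, and `C_p(0)` contains every degenerate one.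
-/

open Metric (ball closedBall sphere ball_mem_nhds closedBall_mem_nhds isOpen_ball
  isClosed_closedBall mem_ball mem_closedBall mem_ball_self mem_closedBall_self
  sphere_subset_closedBall ball_subset_closedBall)
open Real (sin cos sin_pos_of_pos_of_lt_pi norm_eq_abs)
open scoped RealInnerProductSpace

/-! ### Invariance of domain in the plane -/

/-- `u` has a continuous logarithm on `s`. -/
def HasContLog {X : Type*} [TopologicalSpace X] (s : Set X) (u : X → ℂ) : Prop :=
  ∃ l : X → ℂ, ContinuousOn l s ∧ ∀ x ∈ s, u x = Complex.exp (l x)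

theorem HasContLog.of_near {X : Type*} [TopologicalSpace X] {s : Set X} {u v : X → ℂ}
    (h : HasContLog s u) (hu : ContinuousOn u s) (hv : ContinuousOn v s)
    (huv : ∀ x ∈ s, ‖v x - u x‖ < ‖u x‖) : HasContLog s v := by
  obtain ⟨l, hl, hlu⟩ := h
  have hne : ∀ x ∈ s, u x ≠ 0 := fun x hx => by rw [hlu x hx]; exact Complex.exp_ne_zero _
  have hsl : ∀ x ∈ s, v x / u x ∈ Complex.slitPlane := fun x hx => by
    have h1 : ‖v x / u x - 1‖ < 1 := by
      rw [div_sub_one (hne x hx), norm_div, div_lt_one (norm_pos_iff.2 (hne x hx))]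
      exact huv x hx
    left
    have h2 := (abs_le.1 ((Complex.abs_re_le_norm _).trans h1.le)).1
    have h3 := lt_of_le_of_lt (Complex.abs_re_le_norm _) h1
    have h4 := (abs_lt.1 h3).1
    simp only [Complex.sub_re, Complex.one_re] at h4
    linarith
  refine ⟨fun x => l x + Complex.log (v x / u x), ?_, ?_⟩
  · exact hl.add ((hv.div hu hne).clog hsl)
  · intro x hx
    have h0 : v x / u x ≠ 0 := Complex.slitPlane_ne_zero (hsl x hx)
    rw [Complex.exp_add, Complex.exp_log h0, ← hlu x hx, mul_div_cancel₀ _ (hne x hx)]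

theorem HasContLog.of_homotopy {X : Type*} [PseudoMetricSpace X] {s : Set X} (hs : IsCompact s)
    {H : ℝ → X → ℂ} (hc : ContinuousOn (fun q : ℝ × X => H q.1 q.2) (Icc 0 1 ×ˢ s))
    (hne : ∀ t ∈ Icc (0 : ℝ) 1, ∀ x ∈ s, H t x ≠ 0) (h0 : HasContLog s (H 0)) :
    HasContLog s (H 1) := by
  have hcomp : IsCompact (Icc (0 : ℝ) 1 ×ˢ s) := isCompact_Icc.prod hs
  rcases s.eq_empty_or_nonempty with rfl | ⟨x0, hx0⟩
  · exact ⟨0, by simp, by simp⟩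
  obtain ⟨q0, hq0, hmin⟩ := hcomp.exists_isMinOn ⟨(0, x0), by simp, hx0⟩ hc.norm
  have hm : 0 < ‖H q0.1 q0.2‖ := norm_pos_iff.2 (hne _ hq0.1 _ hq0.2)
  set m := ‖H q0.1 q0.2‖
  have hu := hcomp.uniformContinuousOn_of_continuous hc
  rw [Metric.uniformContinuousOn_iff] at hu
  obtain ⟨δ, hδ, hu⟩ := hu m hm
  obtain ⟨N, hN⟩ := exists_nat_gt (1 / δ)
  have hNpos : (0 : ℝ) < N := lt_trans (by positivity) hN
  have hcont : ∀ t ∈ Icc (0 : ℝ) 1, ContinuousOn (H t) s := fun t ht =>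
    hc.comp (f := fun x => ((t, x) : ℝ × X)) (by fun_prop) (fun x hx => ⟨ht, hx⟩)
  have key : ∀ k : ℕ, k ≤ N → HasContLog s (H ((k : ℝ) / N)) := by
    intro k
    induction k with
    | zero => intro _; simpa using h0
    | succ k ih =>
      intro hk
      have e1 : ((k : ℝ) / N) ∈ Icc (0 : ℝ) 1 := by
        refine ⟨by positivity, (div_le_one hNpos).2 ?_⟩
        exact_mod_cast (by omega : k ≤ N)
      have e2 : (((k + 1 : ℕ) : ℝ) / N) ∈ Icc (0 : ℝ) 1 := by
        refine ⟨by positivity, (div_le_one hNpos).2 ?_⟩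
        exact_mod_cast hk
      refine (ih (by omega)).of_near (hcont _ e1) (hcont _ e2) fun x hx => ?_
      have h1 : dist (((k + 1 : ℕ) : ℝ) / N, x) ((k : ℝ) / N, x) < δ := by
        rw [Prod.dist_eq, dist_self, max_eq_left dist_nonneg, Real.dist_eq, ← sub_div]
        push_cast
        rw [add_sub_cancel_left, abs_of_pos (by positivity), div_lt_comm₀ hNpos hδ]
        exact hN
      have h2 := hu _ ⟨e2, hx⟩ _ ⟨e1, hx⟩ h1
      rw [dist_eq_norm] at h2
      exact lt_of_lt_of_le h2 (isMinOn_iff.1 hmin (_, x) ⟨e1, hx⟩)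
  have := key N le_rfl
  rwa [div_self hNpos.ne'] at this

theorem not_hasContLog_of_odd {u : ℂ → ℂ} (hodd : ∀ x ∈ sphere (0 : ℂ) 1, u (-x) = -u x) :
    ¬ HasContLog (sphere (0 : ℂ) 1) u := by
  rintro ⟨l, hl, hlu⟩
  have hneg : ∀ x ∈ sphere (0 : ℂ) 1, -x ∈ sphere (0 : ℂ) 1 := by
    intro x hx; simpa using hx
  have hconn : IsPreconnected (sphere (0 : ℂ) 1) :=
    isPreconnected_sphere (by simp [Complex.rank_real_complex]) 0 1
  have hd : ContinuousOn (fun x => (l (-x) - l x).im) (sphere (0 : ℂ) 1) :=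
    Complex.continuous_im.comp_continuousOn ((hl.comp continuous_neg.continuousOn hneg).sub hl)
  have h1 : (1 : ℂ) ∈ sphere (0 : ℂ) 1 := by simp
  have hmem : (0 : ℝ) ∈ (fun x => (l (-x) - l x).im) '' sphere (0 : ℂ) 1 := by
    rcases le_total 0 ((l (-1) - l 1).im) with h | h
    · refine hconn.intermediate_value (hneg _ h1) h1 hd ⟨?_, h⟩
      simp only [neg_neg, Complex.sub_im] at h ⊢; linarith
    · refine hconn.intermediate_value h1 (hneg _ h1) hd ⟨h, ?_⟩
      simp only [neg_neg, Complex.sub_im] at h ⊢; linarith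
  obtain ⟨x, hx, hx0⟩ := hmem
  have e1 : Complex.exp (l (-x) - l x) = -1 := by
    rw [Complex.exp_sub, ← hlu _ hx, ← hlu _ (hneg x hx), hodd x hx, neg_div, div_self]
    rw [hlu x hx]; exact Complex.exp_ne_zero _
  have e2 : (Complex.exp (l (-x) - l x)).re = Real.exp (l (-x) - l x).re := by
    simp only at hx0
    rw [Complex.exp_re, hx0]; simp
  rw [e1] at e2
  have := Real.exp_pos (l (-x) - l x).re
  simp only [Complex.neg_re, Complex.one_re] at e2
  linarith

/-- An injective continuous map of the closed unit disk has the image of the center in the interior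
of its image: on the circle, `f x - f 0` is homotopic without zeros to the odd map
`f (x/2) - f (-x/2)`, which has no continuous logarithm, while `f x - y` has one if `f` omits the
value `y`. -/
theorem image_closedBall_mem_nhds {f : ℂ → ℂ} (hf : ContinuousOn f (closedBall 0 1))
    (hi : InjOn f (closedBall 0 1)) : f '' closedBall 0 1 ∈ 𝓝 (f 0) := by
  set S := sphere (0 : ℂ) 1
  have hS : IsCompact S := isCompact_sphere 0 1
  have hSB : S ⊆ closedBall 0 1 := sphere_subset_closedBall
  have h0B : (0 : ℂ) ∈ closedBall (0 : ℂ) 1 := by simp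
  have hnolog : ¬ HasContLog S (fun x => f x - f 0) := by
    intro hlog
    set H : ℝ → ℂ → ℂ := fun t x =>
      f (((1 + t)⁻¹ : ℝ) * x) - f (((-t * (1 + t)⁻¹ : ℝ) : ℂ) * x) with hH
    have hmem1 : ∀ t ∈ Icc (0 : ℝ) 1, ∀ x ∈ S, (((1 + t)⁻¹ : ℝ) : ℂ) * x ∈
        closedBall (0 : ℂ) 1 := by
      intro t ht x hx
      have hx1 : ‖x‖ = 1 := by simpa [S] using hx
      rw [mem_closedBall_zero_iff, norm_mul, hx1, Complex.norm_real, mul_one, norm_eq_abs,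
        abs_of_pos (inv_pos.2 (by linarith [ht.1]))]
      exact inv_le_one_of_one_le₀ (by linarith [ht.1])
    have hmem2 : ∀ t ∈ Icc (0 : ℝ) 1, ∀ x ∈ S, ((-t * (1 + t)⁻¹ : ℝ) : ℂ) * x ∈
        closedBall (0 : ℂ) 1 := by
      intro t ht x hx
      have hx1 : ‖x‖ = 1 := by simpa [S] using hx
      rw [mem_closedBall_zero_iff, norm_mul, hx1, Complex.norm_real, mul_one, norm_eq_abs,
        abs_mul, abs_neg, abs_of_nonneg ht.1, abs_of_pos (inv_pos.2 (by linarith [ht.1])),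
        ← div_eq_mul_inv, div_le_one (by linarith [ht.1])]
      linarith
    have hinv : ContinuousOn (fun q : ℝ × ℂ => (1 + q.1)⁻¹) (Icc (0 : ℝ) 1 ×ˢ S) :=
      ContinuousOn.inv₀ (by fun_prop) (fun q hq => by
        have : (0:ℝ) ≤ q.1 := hq.1.1
        positivity)
    have hc : ContinuousOn (fun q : ℝ × ℂ => H q.1 q.2) (Icc 0 1 ×ˢ S) := by
      refine ContinuousOn.sub (hf.comp ?_ fun q hq => hmem1 _ hq.1 _ hq.2)
        (hf.comp ?_ fun q hq => hmem2 _ hq.1 _ hq.2)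
      · exact (Complex.continuous_ofReal.comp_continuousOn hinv).mul (by fun_prop)
      · exact (Complex.continuous_ofReal.comp_continuousOn
          (ContinuousOn.mul (by fun_prop) hinv)).mul (by fun_prop)
    have hne : ∀ t ∈ Icc (0 : ℝ) 1, ∀ x ∈ S, H t x ≠ 0 := by
      intro t ht x hx h
      have hx1 : x ≠ 0 := by
        rintro rfl; simp [S] at hx
      have := hi (hmem1 t ht x hx) (hmem2 t ht x hx) (sub_eq_zero.1 h)
      have h2 := mul_right_cancel₀ hx1 this
      have h3 : (1 + t)⁻¹ = -t * (1 + t)⁻¹ := by exact_mod_cast h2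
      have h4 : 0 < (1 + t)⁻¹ := inv_pos.2 (by linarith [ht.1])
      nlinarith [ht.1, mul_nonneg ht.1 h4.le]
    have h1 := HasContLog.of_homotopy hS hc hne (by
      have : H 0 = fun x => f x - f 0 := by funext x; simp [hH]
      rw [this]; exact hlog)
    refine not_hasContLog_of_odd (fun x hx => ?_) h1
    simp only [hH]
    rw [neg_sub]
    congr 2 <;> (push_cast; ring)
  have hfS : ContinuousOn (fun x => f x - f 0) S := (hf.mono hSB).sub continuousOn_const
  have hSne : S.Nonempty := ⟨1, by simp [S]⟩
  obtain ⟨x0, hx0, hmin⟩ := hS.exists_isMinOn hSne hfS.norm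
  have hm : 0 < ‖f x0 - f 0‖ := by
    rw [norm_pos_iff, sub_ne_zero]
    intro h
    have := hi (hSB hx0) h0B h
    simp [S, this] at hx0
  set m := ‖f x0 - f 0‖
  refine Filter.mem_of_superset (ball_mem_nhds (f 0) (half_pos hm)) fun y hy => ?_
  by_contra hyn
  have hne : ∀ x ∈ closedBall (0 : ℂ) 1, f x - y ≠ 0 := fun x hx h => hyn ⟨x, hx, sub_eq_zero.1 h⟩
  have hmemt : ∀ t ∈ Icc (0 : ℝ) 1, ∀ x ∈ S, (t : ℂ) * x ∈ closedBall (0 : ℂ) 1 := by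
    intro t ht x hx
    have hx1 : ‖x‖ = 1 := by simpa [S] using hx
    rw [mem_closedBall_zero_iff, norm_mul, hx1, Complex.norm_real, mul_one, norm_eq_abs,
      abs_of_nonneg ht.1]
    exact ht.2
  have hlog : HasContLog S (fun x => f x - y) := by
    have := HasContLog.of_homotopy (H := fun t x => f (t * x) - y) hS
      (ContinuousOn.sub (hf.comp (by fun_prop) fun q hq => hmemt _ hq.1 _ hq.2)
        continuousOn_const) (fun t ht x hx => hne _ (hmemt t ht x hx)) ?_
    · simpa using this
    · refine ⟨fun _ => Complex.log (f 0 - y), continuousOn_const, fun x _ => ?_⟩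
      rw [Complex.exp_log (hne 0 h0B)]; simp
  refine hnolog (hlog.of_near ((hf.mono hSB).sub continuousOn_const) hfS fun x hx => ?_)
  rw [mem_ball, dist_eq_norm] at hy
  have e1 : f x - f 0 - (f x - y) = y - f 0 := by ring
  have e2 : m ≤ ‖f x - f 0‖ := hmin hx
  have e3 : ‖f x - f 0‖ ≤ ‖f x - y‖ + ‖y - f 0‖ := by
    have : f x - f 0 = (f x - y) + (y - f 0) := by ring
    rw [this]; exact norm_add_le _ _
  rw [e1]; linarith

section TwoDim

variable {V W : Type*} [NormedAddCommGroup V] [NormedSpace ℝ V] [NormedAddCommGroup W]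
  [NormedSpace ℝ W]

/-- Invariance of domain for two-dimensional real normed spaces. -/
theorem invariance_of_domain (hV : Module.finrank ℝ V = 2) (hW : Module.finrank ℝ W = 2) {U : Set V}
    {h : V → W} (hc : ContinuousOn h U) (hi : InjOn h U) {x : V} (hx : U ∈ 𝓝 x)
    : h '' U ∈ 𝓝 (h x) := by
  have : FiniteDimensional ℝ V := Module.finite_of_finrank_pos (by omega)
  have : FiniteDimensional ℝ W := Module.finite_of_finrank_pos (by omega)
  let eV : ℂ ≃L[ℝ] V := ContinuousLinearEquiv.ofFinrankEq (by rw [hV]; simp)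
  let eW : W ≃L[ℝ] ℂ := ContinuousLinearEquiv.ofFinrankEq (by rw [hW]; simp)
  have hcont : Continuous fun z : ℂ => x + eV z := by fun_prop
  have : (fun z : ℂ => x + eV z) ⁻¹' U ∈ 𝓝 0 :=
    hcont.continuousAt.preimage_mem_nhds (by simpa using hx)
  obtain ⟨r, hr, hrU⟩ := Metric.nhds_basis_closedBall.mem_iff.1 this
  have hmaps : MapsTo (fun z : ℂ => x + eV ((r : ℂ) * z)) (closedBall 0 1) U := by
    intro z hz
    refine hrU ?_
    rw [mem_closedBall_zero_iff] at hz ⊢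
    rw [norm_mul, Complex.norm_real, norm_eq_abs, abs_of_pos hr]
    nlinarith
  have key := image_closedBall_mem_nhds (f := fun z : ℂ => eW (h (x + eV ((r : ℂ) * z))))
    (eW.continuous.comp_continuousOn (hc.comp (by fun_prop) hmaps))
    (by
      intro z hz z' hz' hzz
      have h1 := hi (hmaps hz) (hmaps hz') (eW.injective hzz)
      have h2 := eV.injective (add_left_cancel h1)
      exact mul_left_cancel₀ (by exact_mod_cast hr.ne') h2)
  simp only [mul_zero, map_zero, add_zero] at key
  have h2 := eW.continuous.continuousAt.preimage_mem_nhds (x := h x) key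
  refine Filter.mem_of_superset h2 ?_
  rintro w ⟨z, hz, hzw⟩
  exact ⟨_, hmaps hz, eW.injective hzw⟩

end TwoDim

/-! ### Convex sets and their boundaries -/

section ConvexGeneral

variable {E : Type*} [NormedAddCommGroup E] [NormedSpace ℝ E]

theorem subset_or_disjoint_of_frontier {X : Type*} [TopologicalSpace X] {O K : Set X}
    (hO : IsPreconnected O) (h : ∀ y ∈ O, y ∉ frontier K) : O ⊆ K ∨ ∀ y ∈ O, y ∉ K := by
  by_contra! hc
  obtain ⟨h1, y, hyO, hyK⟩ := hc
  obtain ⟨z, hzO, hzK⟩ := not_subset.1 h1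
  refine hzK (interior_subset (hO.subset_left_of_subset_union isOpen_interior
    isClosed_closure.isOpen_compl (disjoint_compl_right.mono_left interior_subset_closure)
    (fun w hw => ?_) ⟨y, hyO, ?_⟩ hzO))
  · by_contra hc
    rw [mem_union, not_or, mem_compl_iff, not_not] at hc
    exact h w hw ⟨hc.2, hc.1⟩
  · by_contra hc
    exact h y hyO ⟨subset_closure hyK, hc⟩

theorem exists_mem_frontier_segment {K : Set E} {a b : E} (ha : a ∈ K) (hb : b ∉ K) :
    ∃ t ∈ Icc (0 : ℝ) 1, a + t • (b - a) ∈ frontier K := by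
  have hconn : IsPreconnected ((fun t : ℝ => a + t • (b - a)) '' Icc 0 1) :=
    isPreconnected_Icc.image _ (by fun_prop)
  by_contra! hc
  rcases subset_or_disjoint_of_frontier (K := K) hconn (by
    rintro _ ⟨t, ht, rfl⟩; exact hc t ht) with h | h
  · exact hb (h ⟨1, by simp, by simp⟩)
  · exact h a ⟨0, by simp, by simp⟩ ha

theorem Convex.lineMap_mem_interior {K : Set E} (hK : Convex ℝ K) {a b : E} (ha : a ∈ interior K)
    (hb : b ∈ K) {t : ℝ} (ht : t ∈ Ico (0 : ℝ) 1) :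
    a + t • (b - a) ∈ interior K := by
  have h := hK.combo_interior_self_mem_interior ha hb (a := 1 - t) (b := t) (by linarith [ht.2])
    ht.1 (by ring)
  have e : a + t • (b - a) = (1 - t) • a + t • b := by module
  rwa [e]

theorem Convex.lineMap_mem_set {K : Set E} (hK : Convex ℝ K) {a b : E} (ha : a ∈ K) (hb : b ∈ K)
    {t : ℝ} (ht : t ∈ Icc (0 : ℝ) 1) :
    a + t • (b - a) ∈ K := hK.add_smul_sub_mem ha hb ht

theorem tendsto_lineMap_zero (x w : E) : Tendsto (fun t : ℝ => x + t • w) (𝓝[>] 0) (𝓝 x) := by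
  have : Continuous fun t : ℝ => x + t • w := by fun_prop
  have h := this.tendsto 0
  simp only [zero_smul, add_zero] at h
  exact h.mono_left nhdsWithin_le_nhds

theorem eventually_lineMap {x : E} (w : E) {s : Set E} (hs : s ∈ 𝓝 x) :
    ∀ᶠ t : ℝ in 𝓝[>] 0, x + t • w ∈ s ∧ 0 < t ∧ t < 1 := by
  filter_upwards [tendsto_lineMap_zero x w hs, self_mem_nhdsWithin,
    Ioo_mem_nhdsGT (show (0 : ℝ) < 1 by norm_num)] with t h1 h2 h3
  exact ⟨h1, h2, h3.2⟩

/-- If the boundary of a convex set lies near one of its points `x` on one side of a hyperplane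
through `x`, then the convex set lies on one side of the hyperplane. -/
theorem Convex.one_sided_of_frontier {K : Set E} (hK : Convex ℝ K) {x : E} (hx : x ∈ frontier K)
    (hxK : x ∈ K) (φ : E →L[ℝ] ℝ) {s : Set E} (hs : s ∈ 𝓝 x)
    (h : ∀ y ∈ frontier K, y ∈ s → φ y ≤ φ x) :
    (∀ y ∈ K, φ y ≤ φ x) ∨ ∀ y ∈ K, φ x ≤ φ y := by
  obtain ⟨ε, hε, hεs⟩ := Metric.mem_nhds_iff.1 hs
  set O := ball x ε ∩ {y | φ x < φ y}
  have hOo : IsOpen O := isOpen_ball.inter (isOpen_lt continuous_const φ.continuous)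
  have hO : Convex ℝ O := (convex_ball x ε).inter (convex_halfSpace_gt φ.isLinear _)
  rcases subset_or_disjoint_of_frontier (K := K) hO.isPreconnected (by
    rintro y ⟨hy1, hy2⟩ hyf
    exact absurd (h y hyf (hεs hy1)) (not_le.2 hy2)) with hsub | hdis
  · right
    intro k hk
    by_contra! hlt
    obtain ⟨t, ⟨ht1, ht0, ht2⟩⟩ := (eventually_lineMap (x - k) (ball_mem_nhds x hε)).exists
    have ho : x + t • (x - k) ∈ interior K := by
      refine interior_maximal hsub hOo ⟨ht1, ?_⟩
      simp only [mem_ofPred_eq, map_add, map_smul, map_sub, smul_eq_mul]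
      nlinarith
    have := hK.lineMap_mem_interior ho hk (t := t / (1 + t))
      ⟨by positivity, (div_lt_one (by positivity)).2 (by linarith)⟩
    have e : x + t • (x - k) + (t / (1 + t)) • (k - (x + t • (x - k))) = x := by
      have h1 : k - (x + t • (x - k)) = -((1 + t) • (x - k)) := by module
      rw [h1, smul_neg, smul_smul, div_mul_cancel₀ _ (by positivity)]
      abel
    rw [e] at this
    exact hx.2 this
  · left
    intro k hk
    by_contra! hlt
    obtain ⟨t, ⟨ht1, ht0, ht2⟩⟩ := (eventually_lineMap (k - x) (ball_mem_nhds x hε)).exists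
    refine hdis _ ⟨ht1, ?_⟩ (hK.lineMap_mem_set hxK hk ⟨ht0.le, ht2.le⟩)
    simp only [mem_ofPred_eq, map_add, map_smul, map_sub, smul_eq_mul]
    nlinarith

/-- If the boundary of a convex set with interior lies near one of its points `x` in a hyperplane,
then the hyperplane supports the set, which contains a neighborhood of `x` in the hyperplane. -/
theorem Convex.flat_of_frontier {K : Set E} (hK : Convex ℝ K) (hKc : IsClosed K)
    (hKi : (interior K).Nonempty) {x : E} (hx : x ∈ frontier K) (φ : E →L[ℝ] ℝ) (hφ : φ ≠ 0)
    {s : Set E} (hs : s ∈ 𝓝 x) (h : ∀ y ∈ frontier K, y ∈ s → φ y = φ x) :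
    ((∀ y ∈ K, φ y ≤ φ x) ∨ ∀ y ∈ K, φ x ≤ φ y) ∧
      ∃ δ > 0, ∀ y, φ y = φ x → dist y x < δ → y ∈ K := by
  have hxK := hKc.frontier_subset hx
  have h1 := hK.one_sided_of_frontier hx hxK φ hs fun y hy hys => (h y hy hys).le
  refine ⟨h1, ?_⟩
  obtain ⟨u, hu⟩ : ∃ u, 0 < φ u := by
    by_contra! hc
    refine hφ (ContinuousLinearMap.ext fun u => ?_)
    have := hc (-u)
    rw [map_neg] at this
    exact le_antisymm (hc u) (by simpa using this)
  wlog hle : ∀ y ∈ K, φ y ≤ φ x generalizing φ u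
  · obtain ⟨δ, hδ, hd⟩ := this (-φ) (by simpa using hφ) (by simpa using h)
      (by simpa [or_comm] using h1) (-u) (by simpa using hu)
      (by simpa using h1.resolve_left hle)
    exact ⟨δ, hδ, fun y hy => hd y (by simpa using hy)⟩
  obtain ⟨ε, hε, hεs⟩ := Metric.mem_nhds_iff.1 hs
  refine ⟨ε, hε, ?_⟩
  set O := ball x ε ∩ {y | φ y < φ x}
  have hO : Convex ℝ O := (convex_ball x ε).inter (convex_halfSpace_lt φ.isLinear _)
  obtain ⟨k, hk⟩ := hKi
  have hkx : φ k < φ x := by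
    refine lt_of_le_of_ne (hle k (interior_subset hk)) fun he => ?_
    obtain ⟨t, ⟨ht1, ht0, ht2⟩⟩ := (eventually_lineMap u (mem_interior_iff_mem_nhds.1 hk)).exists
    have := hle _ ht1
    rw [map_add, map_smul, smul_eq_mul, he] at this
    nlinarith
  have hOK : O ⊆ K := by
    refine (subset_or_disjoint_of_frontier (K := K) hO.isPreconnected ?_).resolve_right ?_
    · rintro y ⟨hy1, hy2⟩ hyf
      exact hy2.ne (h y hyf (hεs hy1))
    · intro hdis
      obtain ⟨t, ⟨ht1, ht0, ht2⟩⟩ := (eventually_lineMap (k - x) (ball_mem_nhds x hε)).exists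
      refine hdis _ ⟨ht1, ?_⟩ (hK.lineMap_mem_set hxK (interior_subset hk) ⟨ht0.le, ht2.le⟩)
      simp only [mem_ofPred_eq, map_add, map_smul, map_sub, smul_eq_mul]
      nlinarith
  intro y hy hyd
  refine hKc.closure_subset_iff.2 hOK ?_
  refine mem_closure_of_tendsto (tendsto_lineMap_zero y (-u)) ?_
  filter_upwards [eventually_lineMap (-u) (isOpen_ball.mem_nhds
    (show y ∈ ball x ε from hyd))] with t ht
  refine ⟨ht.1, ?_⟩
  simp only [mem_ofPred_eq, map_add, map_smul, map_neg, smul_eq_mul, hy]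
  nlinarith [ht.2.1]

section Chart

variable {V : Type*} [NormedAddCommGroup V] [NormedSpace ℝ V]

/-- Near a boundary point `x₀` of a convex set `K`, a linear projection whose kernel is spanned by a
vector `v` with `x₀ - v` in the interior of `K` is injective on the boundary. -/
theorem Convex.projection_injOn_frontier {K : Set E} (hK : Convex ℝ K) (hKc : IsClosed K) {x₀ v : E}
    (hv : x₀ - v ∈ interior K) {π : E →L[ℝ] V} (hker : ∀ w, π w = 0 → ∃ s : ℝ, w = s • v)
    :
    ∃ δ > 0, (∀ y ∈ ball x₀ δ, y - v ∈ interior K) ∧ InjOn π (frontier K ∩ ball x₀ δ) := by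
  have hcont : Continuous fun y : E => y - v := by fun_prop
  obtain ⟨δ, hδ, hδK⟩ := Metric.mem_nhds_iff.1
    (hcont.continuousAt.preimage_mem_nhds (isOpen_interior.mem_nhds hv))
  refine ⟨δ, hδ, hδK, ?_⟩
  have key : ∀ y ∈ frontier K ∩ ball x₀ δ, ∀ s : ℝ, 0 < s → y + s • v ∈ frontier K → False := by
    rintro y ⟨hy, hyb⟩ s hs hys
    have h1 := hK.lineMap_mem_interior (hδK hyb) (hKc.frontier_subset hys) (t := 1 / (1 + s))
      ⟨by positivity, (div_lt_one (by positivity)).2 (by linarith)⟩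
    have e : y - v + (1 / (1 + s)) • (y + s • v - (y - v)) = y := by
      have : y + s • v - (y - v) = (1 + s) • v := by module
      rw [this, smul_smul, div_mul_cancel₀ _ (by positivity), one_smul, sub_add_cancel]
    rw [e] at h1
    exact hy.2 h1
  intro y hy y' hy' hyy
  obtain ⟨s, hs⟩ := hker (y' - y) (by rw [map_sub, hyy, sub_self])
  rcases lt_trichotomy s 0 with h | h | h
  · exact (key y' hy' (-s) (by linarith) (by
      have : y' + (-s) • v = y := by rw [neg_smul, ← hs]; abel
      rw [this]; exact hy.1)).elim
  · rw [h, zero_smul, sub_eq_zero] at hs; exact hs.symm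
  · exact (key y hy s h (by rw [← hs, add_sub_cancel]; exact hy'.1)).elim

theorem Convex.exists_frontier_projection {K : Set E} (hK : Convex ℝ K) (hKc : IsClosed K)
    {x₀ v : E} (hv : x₀ - v ∈ interior K) (hx₀ : x₀ ∈ frontier K) {π : E →L[ℝ] V} {ι : V →L[ℝ] E}
    (hπι : ∀ w, π (ι w) = w) (hπv : π v = 0) {η : ℝ} (hη : 0 < η)
    :
    ∃ ρ > 0, ∀ w, ‖w‖ < ρ → ∃ x ∈ frontier K, dist x x₀ < η ∧ π (x - x₀) = w := by
  obtain ⟨τ, hτ0, hτ1, hτ⟩ : ∃ τ > 0, τ < (1 : ℝ) ∧ τ * ‖v‖ < η := by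
    refine ⟨min (1 / 2) (η / (2 * (‖v‖ + 1))), by positivity,
      lt_of_le_of_lt (min_le_left _ _) (by norm_num), ?_⟩
    calc _ ≤ η / (2 * (‖v‖ + 1)) * (‖v‖ + 1) := by
          gcongr
          · exact min_le_right _ _
          · linarith
      _ = η / 2 := by field_simp
      _ < η := by linarith
  have hin : x₀ - τ • v ∈ interior K := by
    have := hK.lineMap_mem_interior hv (hKc.frontier_subset hx₀) (t := 1 - τ)
      ⟨by linarith, by linarith⟩
    have e : x₀ - v + (1 - τ) • (x₀ - (x₀ - v)) = x₀ - τ • v := by module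
    rwa [e] at this
  have hout : x₀ + τ • v ∉ K := by
    intro h
    have := hK.lineMap_mem_interior hin h (t := 1 / 2) ⟨by norm_num, by norm_num⟩
    have e : x₀ - τ • v + (1 / 2 : ℝ) • (x₀ + τ • v - (x₀ - τ • v)) = x₀ := by module
    rw [e] at this
    exact hx₀.2 this
  have c1 : Continuous fun w : V => x₀ + ι w - τ • v := by fun_prop
  have c2 : Continuous fun w : V => x₀ + ι w + τ • v := by fun_prop
  have c3 : Continuous fun w : V => ‖ι w‖ + τ * ‖v‖ := by fun_prop
  have e1 := c1.continuousAt.preimage_mem_nhds (x := 0)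
    (isOpen_interior.mem_nhds (by simpa using hin))
  have e2 := c2.continuousAt.preimage_mem_nhds (x := 0)
    (hKc.isOpen_compl.mem_nhds (by simpa using hout))
  have e3 := c3.continuousAt.preimage_mem_nhds (x := 0) (isOpen_Iio.mem_nhds
    (show ‖ι (0 : V)‖ + τ * ‖v‖ ∈ Iio η by simpa using hτ))
  obtain ⟨ρ, hρ, hρs⟩ := Metric.mem_nhds_iff.1 (inter_mem (inter_mem e1 e2) e3)
  refine ⟨ρ, hρ, fun w hw => ?_⟩
  obtain ⟨⟨h1, h2⟩, h3⟩ := hρs (show w ∈ ball 0 ρ by simpa using hw)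
  obtain ⟨t, ht, htf⟩ := exists_mem_frontier_segment (interior_subset h1) h2
  have e : x₀ + ι w - τ • v + t • (x₀ + ι w + τ • v - (x₀ + ι w - τ • v)) - x₀ =
      ι w + ((2 * t - 1) * τ) • v := by module
  refine ⟨_, htf, ?_, ?_⟩
  · rw [dist_eq_norm, e]
    refine lt_of_le_of_lt (norm_add_le _ _) (lt_of_le_of_lt ?_ h3)
    rw [norm_smul, norm_mul, norm_eq_abs, norm_eq_abs, abs_of_pos hτ0]
    have : |2 * t - 1| ≤ 1 := abs_le.2 ⟨by linarith [ht.1], by linarith [ht.2]⟩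
    have h4 : |2 * t - 1| * τ ≤ 1 * τ := by gcongr
    have h5 : |2 * t - 1| * τ * ‖v‖ ≤ 1 * τ * ‖v‖ := by gcongr
    linarith
  · rw [e, map_add, hπι, map_smul, hπv, smul_zero, add_zero]

/-- The boundary of a convex set is near each of its points a graph over a hyperplane: it has a
continuous parametrization `P`, inverse to a linear projection. -/
theorem Convex.exists_frontier_chart {K : Set E} (hK : Convex ℝ K) (hKc : IsClosed K) {x₀ v : E}
    (hv : x₀ - v ∈ interior K) (hx₀ : x₀ ∈ frontier K) {π : E →L[ℝ] V} {ι : V →L[ℝ] E}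
    (hπι : ∀ w, π (ι w) = w) (hπv : π v = 0) (hker : ∀ w, π w = 0 → ∃ s : ℝ, w = s • v)
    :
    ∃ r > 0, ∃ P : V → E, ContinuousOn P (ball 0 r) ∧ P 0 = x₀ ∧
      (∀ w ∈ ball (0 : V) r, P w ∈ frontier K ∧ π (P w - x₀) = w) ∧
      ∃ ε > 0, ∀ x ∈ frontier K, dist x x₀ < ε → π (x - x₀) ∈ ball 0 r ∧ P (π (x - x₀)) = x := by
  obtain ⟨δ, hδ, hδK, hinj⟩ := hK.projection_injOn_frontier hKc hv hker
  obtain ⟨r, hr, hex⟩ := hK.exists_frontier_projection hKc hv hx₀ hπι hπv hδ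
  choose! P hP1 hP2 hP3 using hex
  have huniq : ∀ w, ‖w‖ < r → ∀ x ∈ frontier K, dist x x₀ < δ → π (x - x₀) = w → P w = x := by
    intro w hw x hx hxd hxw
    refine hinj ⟨hP1 w hw, hP2 w hw⟩ ⟨hx, hxd⟩ ?_
    have := (hP3 w hw).trans hxw.symm
    rwa [map_sub, map_sub, sub_left_inj] at this
  refine ⟨r, hr, P, ?_, ?_, ?_, ?_⟩
  · intro w₁ hw₁
    refine ContinuousAt.continuousWithinAt ?_
    rw [mem_ball_zero_iff] at hw₁
    have hb : P w₁ ∈ ball x₀ δ := hP2 w₁ hw₁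
    rw [Metric.continuousAt_iff]
    intro η hη
    obtain ⟨η', hη', hη'1, hη'2⟩ : ∃ η' > 0, η' ≤ η ∧ ball (P w₁) η' ⊆ ball x₀ δ := by
      obtain ⟨a, ha, hab⟩ := Metric.mem_nhds_iff.1 (isOpen_ball.mem_nhds hb)
      exact ⟨min a η, lt_min ha hη, min_le_right _ _,
        (Metric.ball_subset_ball (min_le_left _ _)).trans hab⟩
    obtain ⟨ρ, hρ, hex'⟩ := hK.exists_frontier_projection hKc (hδK _ hb) (hP1 w₁ hw₁) hπι hπv hη'
    obtain ⟨ρ', hρ', hρ'r⟩ := Metric.mem_nhds_iff.1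
      (isOpen_ball.mem_nhds (show w₁ ∈ ball (0 : V) r by simpa using hw₁))
    refine ⟨min ρ ρ', lt_min hρ hρ', fun {w} hw => ?_⟩
    have hwr : ‖w‖ < r := by
      simpa using hρ'r (hw.trans_le (min_le_right _ _) : w ∈ ball w₁ ρ')
    obtain ⟨x, hx, hxd, hxw⟩ := hex' (w - w₁)
      (by rw [← dist_eq_norm]; exact hw.trans_le (min_le_left _ _))
    have hPx : P w = x := by
      refine huniq w hwr x hx (hη'2 hxd) ?_
      have h3 := hP3 w₁ hw₁
      have : x - x₀ = (x - P w₁) + (P w₁ - x₀) := by abel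
      rw [this, map_add, hxw, h3, sub_add_cancel]
    rw [hPx]
    exact hxd.trans_le hη'1
  · exact huniq 0 (by simpa using hr) x₀ hx₀ (by simpa using hδ) (by simp)
  · intro w hw
    rw [mem_ball_zero_iff] at hw
    exact ⟨hP1 w hw, hP3 w hw⟩
  · have c : Continuous fun x : E => π (x - x₀) := by fun_prop
    obtain ⟨ε, hε, hεr⟩ := Metric.mem_nhds_iff.1 (c.continuousAt.preimage_mem_nhds (x := x₀)
      (isOpen_ball.mem_nhds (show π (x₀ - x₀) ∈ ball (0 : V) r by simpa using hr)))
    refine ⟨min ε δ, lt_min hε hδ, fun x hx hxd => ?_⟩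
    have h1 : π (x - x₀) ∈ ball (0 : V) r :=
      hεr (hxd.trans_le (min_le_left _ _) : x ∈ ball x₀ ε)
    exact ⟨h1, huniq _ (by simpa using h1) x hx (hxd.trans_le (min_le_right _ _)) rfl⟩

end Chart

end ConvexGeneral

/-! ### Boundaries of convex bodies in three-space -/

/-- The Euclidean plane. -/
abbrev E2 : Type := EuclideanSpace ℝ (Fin 2)

theorem norm_inv_norm_smul {x : R3} (hx : x ≠ 0) : ‖‖x‖⁻¹ • x‖ = 1 := by
  rw [norm_smul, norm_inv, norm_norm, inv_mul_cancel₀ (norm_ne_zero_iff.2 hx)]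

theorem inner_add_smul (n x y : R3) (t : ℝ) : ⟪n, x + t • y⟫ = ⟪n, x⟫ + t * ⟪n, y⟫ := by
  rw [inner_add_right, inner_smul_right]

theorem finrank_E2 : Module.finrank ℝ E2 = 2 := by simp

/-- An injective continuous map on a compact set has a continuous inverse, in `ε`-form. -/
theorem IsCompact.exists_dist_lt_imp_mem {X Y : Type*} [TopologicalSpace X] [MetricSpace Y]
    {S : Set X} (hS : IsCompact S) {F : X → Y} (hF : ContinuousOn F S) (hi : InjOn F S) {q : X}
    (hq : q ∈ S) {N : Set X} (hN : N ∈ 𝓝 q) :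
    ∃ ε > 0, ∀ x ∈ S, dist (F x) (F q) < ε → x ∈ N := by
  have hc : IsCompact (F '' (S \ interior N)) :=
    (hS.diff isOpen_interior).image_of_continuousOn (hF.mono sdiff_subset)
  have hn : F q ∉ F '' (S \ interior N) := by
    rintro ⟨x, ⟨hxS, hxN⟩, hx⟩
    rw [hi hxS hq hx] at hxN
    exact hxN (mem_interior_iff_mem_nhds.2 hN)
  obtain ⟨ε, hε, hb⟩ := Metric.mem_nhds_iff.1 (hc.isClosed.isOpen_compl.mem_nhds hn)
  refine ⟨ε, hε, fun x hx hd => interior_subset ?_⟩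
  by_contra hxN
  exact hb hd ⟨x, ⟨hx, hxN⟩, rfl⟩

/-- Orthogonal projection along `n`, in coordinates of the plane orthogonal to `n`. -/
theorem exists_orthogonal_coordinates {n : R3} (hn : n ≠ 0) :
    ∃ (π : R3 →L[ℝ] E2) (ι : E2 →L[ℝ] R3), (∀ w, π (ι w) = w) ∧ (∀ w, ⟪n, ι w⟫ = 0) ∧
      (∀ x, x = ι (π x) + (⟪n, x⟫ / ‖n‖ ^ 2) • n) ∧ (∀ w, ‖ι w‖ = ‖w‖) ∧ π n = 0 := by
  have : Fact (Module.finrank ℝ R3 = 2 + 1) := ⟨by simp⟩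
  let b := OrthonormalBasis.fromOrthogonalSpanSingleton (𝕜 := ℝ) 2 hn
  let W := (Submodule.span ℝ {n})ᗮ
  let π : R3 →L[ℝ] E2 := (b.repr.toContinuousLinearEquiv : W →L[ℝ] E2) ∘L W.orthogonalProjectionOnto
  let ι : E2 →L[ℝ] R3 := W.subtypeL ∘L (b.repr.symm.toContinuousLinearEquiv : E2 →L[ℝ] W)
  have hin : ∀ w : E2, ⟪n, ι w⟫ = 0 := fun w =>
    Submodule.mem_orthogonal_singleton_iff_inner_right.1 (b.repr.symm w).2
  have hπι : ∀ w, π (ι w) = w := fun w => by simp [π, ι]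
  have hdec : ∀ x, x = ι (π x) + (⟪n, x⟫ / ‖n‖ ^ 2) • n := by
    intro x
    have h1 : ι (π x) = W.orthogonalProjectionOnto x := by simp [π, ι]
    have h2 : ((W.orthogonalProjectionOnto x : W) : R3) =
        x - (Submodule.span ℝ {n}).starProjection x := by
      rw [← Submodule.starProjection_apply, Submodule.starProjection_orthogonal_val]
    rw [h1, h2, Submodule.starProjection_singleton]
    simp
  refine ⟨π, ι, hπι, hin, hdec, fun w => ?_, ?_⟩
  · exact b.repr.symm.norm_map w
  · have h := hdec n
    rw [real_inner_self_eq_norm_sq, div_self (by simpa using hn), one_smul] at h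
    have h' : ι (π n) = 0 := by simpa using h.symm
    rw [← hπι (π n), h', map_zero]

theorem IsConvexBody.isClosed {K : Set R3} (hK : IsConvexBody K) : IsClosed K :=
  hK.isCompact.isClosed

theorem IsConvexBody.frontier_subset {K : Set R3} (hK : IsConvexBody K) : frontier K ⊆ K :=
  hK.isClosed.frontier_subset

theorem IsConvexBody.subset_closure_interior {K : Set R3} (hK : IsConvexBody K) :
    K ⊆ closure (interior K) := by
  rw [hK.convex.closure_interior_eq_closure_of_nonempty_interior hK.interior_nonempty]
  exact subset_closure

theorem IsConvexBody.exists_interior_mem {K O : Set R3} (hK : IsConvexBody K) (hO : IsOpen O)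
    {y : R3} (hy : y ∈ K) (hyO : y ∈ O) : ∃ k ∈ interior K, k ∈ O := by
  obtain ⟨k, hk1, hk2⟩ := mem_closure_iff.1 (hK.subset_closure_interior hy) O hO hyO
  exact ⟨k, hk2, hk1⟩

theorem isOpen_inner_gt (n : R3) (c : ℝ) : IsOpen {x : R3 | c < ⟪n, x⟫} :=
  isOpen_lt continuous_const (by fun_prop)

theorem isOpen_inner_lt (n : R3) (c : ℝ) : IsOpen {x : R3 | ⟪n, x⟫ < c} :=
  isOpen_lt (by fun_prop) continuous_const

theorem isClosed_halfSpace (n : R3) (c : ℝ) : IsClosed (halfSpace n c) :=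
  isClosed_le continuous_const (by fun_prop)

theorem convex_halfSpace (n : R3) (c : ℝ) : Convex ℝ (halfSpace n c) :=
  convex_halfSpace_ge (f := fun x => ⟪n, x⟫) (innerSL ℝ n).isLinear c

/-- Coordinates near a boundary point `x₀` of a convex body: a linear projection which is injective
on the boundary near `x₀`. -/
theorem IsConvexBody.exists_injOn_projection {K : Set R3} (hK : IsConvexBody K) {x₀ : R3}
    (hx₀ : x₀ ∈ frontier K) :
    ∃ (π : R3 →L[ℝ] E2) (δ : ℝ), 0 < δ ∧ InjOn π (frontier K ∩ ball x₀ δ) := by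
  obtain ⟨o, ho⟩ := hK.interior_nonempty
  have hne : x₀ - o ≠ 0 := by
    rw [sub_ne_zero]; rintro rfl; exact hx₀.2 ho
  obtain ⟨π, ι, -, -, hdec, -, -⟩ := exists_orthogonal_coordinates hne
  obtain ⟨δ, hδ, -, hinj⟩ := hK.convex.projection_injOn_frontier hK.isClosed (x₀ := x₀)
    (v := x₀ - o) (by simpa using ho) (π := π) (fun w hw => ⟨_, by
      have := hdec w; rw [hw, map_zero, zero_add] at this; exact this⟩)
  exact ⟨π, δ, hδ, hinj⟩

/-- The boundary of a convex body is a surface: it has local parametrizations by plane disks. -/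
theorem IsConvexBody.exists_chart {K : Set R3} (hK : IsConvexBody K) {x₀ : R3}
    (hx₀ : x₀ ∈ frontier K) :
    ∃ (π : R3 →L[ℝ] E2), ∃ r > 0, ∃ P : E2 → R3, ContinuousOn P (ball 0 r) ∧ P 0 = x₀ ∧
      (∀ w ∈ ball (0 : E2) r, P w ∈ frontier K ∧ π (P w - x₀) = w) ∧
      ∃ ε > 0, ∀ x ∈ frontier K, dist x x₀ < ε → π (x - x₀) ∈ ball 0 r ∧ P (π (x - x₀)) = x := by
  obtain ⟨o, ho⟩ := hK.interior_nonempty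
  have hne : x₀ - o ≠ 0 := by
    rw [sub_ne_zero]; rintro rfl; exact hx₀.2 ho
  obtain ⟨π, ι, hπι, -, hdec, -, hπv⟩ := exists_orthogonal_coordinates hne
  exact ⟨π, hK.convex.exists_frontier_chart hK.isClosed (x₀ := x₀)
    (v := x₀ - o) (by simpa using ho) hx₀ hπι hπv (fun w hw => ⟨_, by
      have := hdec w; rw [hw, map_zero, zero_add] at this; exact this⟩)⟩

/-- Invariance of domain for maps of plane domains into the boundary of a convex body. -/
theorem IsConvexBody.image_mem_nhdsWithin {K : Set R3} (hK : IsConvexBody K) {U : Set E2}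
    {h : E2 → R3} (hc : ContinuousOn h U) (hi : InjOn h U) {x : E2} (hx : U ∈ 𝓝 x)
    (hU : ∀ y ∈ U, h y ∈ frontier K) : h '' U ∈ 𝓝[frontier K] (h x) := by
  obtain ⟨π, δ, hδ, hinj⟩ := hK.exists_injOn_projection (hU x (mem_of_mem_nhds hx))
  set U' := U ∩ h ⁻¹' ball (h x) δ
  have hU' : U' ∈ 𝓝 x := inter_mem hx ((hc.continuousAt hx).preimage_mem_nhds (ball_mem_nhds _ hδ))
  have key := invariance_of_domain finrank_E2 finrank_E2 (U := U') (h := fun y => π (h y))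
    (π.continuous.comp_continuousOn (hc.mono inter_subset_left))
    (fun y hy y' hy' e => hi hy.1 hy'.1 (hinj ⟨hU _ hy.1, hy.2⟩ ⟨hU _ hy'.1, hy'.2⟩ e)) hU'
  have h2 := π.continuous.continuousAt.preimage_mem_nhds key
  filter_upwards [mem_nhdsWithin_of_mem_nhds h2, self_mem_nhdsWithin,
    mem_nhdsWithin_of_mem_nhds (ball_mem_nhds (h x) hδ)] with z ⟨y, hy, hyz⟩ hzK hzb
  exact ⟨y, hy.1, hinj ⟨hU _ hy.1, hy.2⟩ ⟨hzK, hzb⟩ hyz⟩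

/-- If the boundary of a convex body lies, near a point, in the boundary of another one, then the
two boundaries agree near this point. -/
theorem IsConvexBody.frontier_mem_nhdsWithin {K₁ K₂ : Set R3} (h₁ : IsConvexBody K₁)
    (h₂ : IsConvexBody K₂) {x : R3} (hx : x ∈ frontier K₁) {s : Set R3} (hs : s ∈ 𝓝 x)
    (h : ∀ y ∈ frontier K₁, y ∈ s → y ∈ frontier K₂) : frontier K₁ ∈ 𝓝[frontier K₂] x := by
  obtain ⟨π, r, hr, P, hPc, hP0, hP, -⟩ := h₁.exists_chart hx
  have hb : ball (0 : E2) r ∈ 𝓝 0 := ball_mem_nhds _ hr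
  have hU : ball (0 : E2) r ∩ P ⁻¹' s ∈ 𝓝 0 := inter_mem hb
    ((hPc.continuousAt hb).preimage_mem_nhds (by rwa [hP0]))
  have := h₂.image_mem_nhdsWithin (hPc.mono inter_subset_left)
    (fun w hw w' hw' e => by rw [← (hP w hw.1).2, ← (hP w' hw'.1).2, e]) hU
    (fun w hw => h _ (hP w hw.1).1 hw.2)
  rw [hP0] at this
  refine Filter.mem_of_superset this ?_
  rintro _ ⟨w, hw, rfl⟩
  exact (hP w hw.1).1

theorem frontier_inter_eq_of_inter_eq {X : Type*} [TopologicalSpace X] {A B O : Set X}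
    (hO : IsOpen O) (h : A ∩ O = B ∩ O) : frontier A ∩ O = frontier B ∩ O := by
  rw [← frontier_inter_open_inter hO, h, frontier_inter_open_inter hO]

/-! ### Plane sections and bodies of caps -/

/-- `z` lies in the relative interior of the section of `K` by the plane `{⟨n, x⟩ = c}`. -/
def RelInt (K : Set R3) (n : R3) (c : ℝ) (z : R3) : Prop :=
  ⟪n, z⟫ = c ∧ ∃ ε > 0, ∀ y, ⟪n, y⟫ = c → dist y z < ε → y ∈ K

theorem RelInt.mem {K : Set R3} {n : R3} {c : ℝ} {z : R3} (h : RelInt K n c z) : z ∈ K := by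
  obtain ⟨h1, ε, hε, h2⟩ := h
  exact h2 z h1 (by simpa using hε)

theorem RelInt.neg {K : Set R3} {n : R3} {c : ℝ} {z : R3} (h : RelInt K n c z) :
    RelInt K (-n) (-c) z := by
  obtain ⟨h1, ε, hε, h2⟩ := h
  exact ⟨by simp [h1], ε, hε, fun y hy => h2 y (by simpa using hy)⟩

theorem RelInt.mono {K K' : Set R3} {n : R3} {c : ℝ} {z : R3} (h : RelInt K n c z)
    (hK : ∀ y ∈ K, ⟪n, y⟫ = c → y ∈ K') : RelInt K' n c z := by
  obtain ⟨h1, ε, hε, h2⟩ := h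
  exact ⟨h1, ε, hε, fun y hy hd => hK y (h2 y hy hd) hy⟩

theorem RelInt.eventually_mem_interior {K : Set R3} (hK : Convex ℝ K) {n : R3} {c : ℝ} {z k : R3}
    (h : RelInt K n c z) (hk : k ∈ interior K) (hkc : c < ⟪n, k⟫) :
    ∀ᶠ y in 𝓝 z, c < ⟪n, y⟫ → y ∈ interior K := by
  obtain ⟨h1, ε, hε, h2⟩ := h
  set t : R3 → ℝ := fun y => (⟪n, y⟫ - c) / (⟪n, k⟫ - c)
  have hd : 0 < ⟪n, k⟫ - c := by linarith
  have ht : Continuous t := by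
    simp only [t]; fun_prop
  have ht0 : t z = 0 := by simp [t, h1]
  have hz : ContinuousAt (fun y => (1 - t y)⁻¹ • (y - t y • k)) z := by
    exact ((continuousAt_const.sub ht.continuousAt).inv₀ (by simp [ht0])).smul
      (continuousAt_id.sub (ht.continuousAt.smul continuousAt_const))
  have hz0 : (1 - t z)⁻¹ • (z - t z • k) = z := by simp [ht0]
  have e1 : ∀ᶠ y in 𝓝 z, dist ((1 - t y)⁻¹ • (y - t y • k)) z < ε := by
    have h3 := Metric.tendsto_nhds.1 hz ε hε
    simp only [hz0] at h3
    exact h3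
  have e2 : ∀ᶠ y in 𝓝 z, t y < 1 :=
    ht.continuousAt.eventually (p := fun s => s < 1) (isOpen_Iio.mem_nhds (by simp [ht0]))
  filter_upwards [e1, e2] with y hy1 hy2 hyc
  have h0 : 0 < t y := div_pos (by linarith) hd
  set w := (1 - t y)⁻¹ • (y - t y • k)
  have hty : t y * (⟪n, k⟫ - c) = ⟪n, y⟫ - c := by
    simp only [t]; field_simp
  have hw : ⟪n, w⟫ = c := by
    have h3 : (1 : ℝ) - t y ≠ 0 := by linarith
    simp only [w, inner_smul_right, inner_sub_right]
    field_simp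
    linarith
  have hwK := h2 w hw hy1
  have := hK.lineMap_mem_interior hk hwK (t := 1 - t y) ⟨by linarith, by linarith⟩
  have e : k + (1 - t y) • (w - k) = y := by
    have h3 : (1 : ℝ) - t y ≠ 0 := by linarith
    simp only [w, smul_sub (1 - t y), smul_smul, mul_inv_cancel₀ h3, one_smul]
    module
  rwa [e] at this

theorem RelInt.lineMap {K : Set R3} (hK : Convex ℝ K) {n : R3} {c : ℝ} {z x : R3}
    (h : RelInt K n c z) (hx : x ∈ K) (hxc : ⟪n, x⟫ = c) {t : ℝ} (ht : t ∈ Ico (0 : ℝ) 1) :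
    RelInt K n c (z + t • (x - z)) := by
  obtain ⟨h1, ε, hε, h2⟩ := h
  have ht1 : 0 < 1 - t := by linarith [ht.2]
  refine ⟨by simp [inner_add_right, inner_smul_right, inner_sub_right, h1, hxc], ε * (1 - t),
    by positivity, fun y hy hd => ?_⟩
  set d := y - (z + t • (x - z))
  have hw : z + (1 - t)⁻¹ • d ∈ K := by
    refine h2 _ ?_ ?_
    · simp [d, inner_add_right, inner_smul_right, inner_sub_right, h1, hxc, hy]
    · rw [dist_eq_norm] at hd ⊢
      rw [add_sub_cancel_left, norm_smul, norm_inv, norm_eq_abs, abs_of_pos ht1,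
        inv_mul_lt_iff₀ ht1, mul_comm]
      exact hd
  have := hK.lineMap_mem_set hw hx (t := t) ⟨ht.1, ht.2.le⟩
  have e : z + (1 - t)⁻¹ • d + t • (x - (z + (1 - t)⁻¹ • d)) = y := by
    have h3 : z + (1 - t)⁻¹ • d + t • (x - (z + (1 - t)⁻¹ • d)) =
      z + t • (x - z) + ((1 - t) * (1 - t)⁻¹) • d := by module
    rw [h3, mul_inv_cancel₀ ht1.ne', one_smul]
    simp only [d]; abel
  rwa [e] at this

theorem RelInt.mem_interior {K : Set R3} (hK : IsConvexBody K) {n : R3} {c : ℝ} {z y y' : R3}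
    (h : RelInt K n c z) (hy : y ∈ K) (hyc : ⟪n, y⟫ < c) (hy' : y' ∈ K) (hyc' : c < ⟪n, y'⟫)
    : z ∈ interior K := by
  obtain ⟨k, hk, hkc⟩ := hK.exists_interior_mem (isOpen_inner_gt n c) hy' hyc'
  obtain ⟨k', hk', hkc'⟩ := hK.exists_interior_mem (isOpen_inner_gt (-n) (-c)) hy
    (by simpa using hyc)
  have e1 := h.eventually_mem_interior hK.convex hk hkc
  have e2 := h.neg.eventually_mem_interior hK.convex hk' hkc'
  obtain ⟨h1, ε, hε, h2⟩ := h
  rw [mem_interior_iff_mem_nhds]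
  filter_upwards [e1, e2, ball_mem_nhds z hε] with w hw1 hw2 hw3
  rcases lt_trichotomy ⟪n, w⟫ c with hlt | heq | hgt
  · exact interior_subset (hw2 (by simpa using hlt))
  · exact h2 w heq hw3
  · exact interior_subset (hw1 hgt)

/-- The body of a cap: a convex body which lies in the half-space `{⟨n, x⟩ ≥ c}` and whose
intersection with the plane `{⟨n, x⟩ = c}` has nonempty relative interior. The corresponding cap is
the closure of `openCap K n c`. -/
structure CapBody (K : Set R3) (n : R3) (c : ℝ) : Prop where
  body : IsConvexBody K
  normal_ne_zero : n ≠ 0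
  subset : K ⊆ halfSpace n c
  relInt : ∃ z, RelInt K n c z

/-- The part of the boundary of `K` in the open half-space `{⟨n, x⟩ > c}`. -/
def openCap (K : Set R3) (n : R3) (c : ℝ) : Set R3 := frontier K ∩ {x | c < ⟪n, x⟫}

theorem capBody_inter {K : Set R3} (hK : IsConvexBody K) {n : R3} {c : ℝ} {y y' : R3} (hy : y ∈ K)
    (hyc : ⟪n, y⟫ < c) (hy' : y' ∈ K) (hyc' : c < ⟪n, y'⟫) :
    CapBody (K ∩ halfSpace n c) n c := by
  obtain ⟨k, hk, hkc⟩ := hK.exists_interior_mem (isOpen_inner_gt n c) hy' hyc'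
  simp only [mem_ofPred_eq] at hkc
  refine ⟨⟨hK.isCompact.inter_right (isClosed_halfSpace n c),
    hK.convex.inter (convex_halfSpace n c), ⟨k, ?_⟩⟩, ?_, inter_subset_right, ?_⟩
  · rw [interior_inter]
    exact ⟨hk, interior_maximal (fun x (hx : c < ⟪n, x⟫) => (hx.le : c ≤ ⟪n, x⟫))
      (isOpen_inner_gt n c) hkc⟩
  · rintro rfl
    simp only [inner_zero_left] at hyc hyc'
    linarith
  · set t := (⟪n, k⟫ - c) / (⟪n, k⟫ - ⟪n, y⟫)
    have hd : 0 < ⟪n, k⟫ - ⟪n, y⟫ := by linarith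
    have hmem := hK.convex.lineMap_mem_interior hk hy (t := t)
      ⟨div_nonneg (by linarith) hd.le, (div_lt_one hd).2 (by linarith)⟩
    obtain ⟨ε, hε, hb⟩ := Metric.mem_nhds_iff.1 (mem_interior_iff_mem_nhds.1 hmem)
    refine ⟨_, ?_, ε, hε, fun x hx hxd => ⟨hb hxd, hx.ge⟩⟩
    have ht : t * (⟪n, k⟫ - ⟪n, y⟫) = ⟪n, k⟫ - c := by
      simp only [t]; field_simp
    simp only [inner_add_right, inner_smul_right, inner_sub_right]
    linarith

theorem openCap_inter_halfSpace (K : Set R3) (n : R3) (c : ℝ) :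
    openCap (K ∩ halfSpace n c) n c = openCap K n c := by
  refine frontier_inter_eq_of_inter_eq (isOpen_inner_gt n c) ?_
  ext x
  simp only [mem_inter_iff, mem_ofPred_eq, halfSpace]
  constructor
  · rintro ⟨⟨h1, -⟩, h2⟩; exact ⟨h1, h2⟩
  · rintro ⟨h1, h2⟩; exact ⟨⟨h1, h2.le⟩, h2⟩

namespace CapBody

variable {K : Set R3} {n : R3} {c : ℝ}

theorem exists_interior_gt (h : CapBody K n c) : ∃ k ∈ interior K, c < ⟪n, k⟫ := by
  obtain ⟨k, hk⟩ := h.body.interior_nonempty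
  refine ⟨k, hk, lt_of_le_of_ne (h.subset (interior_subset hk)) fun he => ?_⟩
  obtain ⟨t, ht1, ht0, -⟩ := (eventually_lineMap (-n) (mem_interior_iff_mem_nhds.1 hk)).exists
  have := h.subset ht1
  simp only [halfSpace, mem_ofPred_eq, inner_add_right, inner_smul_right, inner_neg_right, ← he,
    real_inner_self_eq_norm_sq] at this
  have hn : 0 < ‖n‖ ^ 2 := by have := norm_pos_iff.2 h.normal_ne_zero; positivity
  nlinarith

theorem mem_frontier_of_inner_eq (h : CapBody K n c) {x : R3} (hx : x ∈ K) (hxc : ⟪n, x⟫ = c)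
    : x ∈ frontier K := by
  refine ⟨subset_closure hx, fun hxi => ?_⟩
  obtain ⟨t, ht1, ht0, -⟩ := (eventually_lineMap (-n) (mem_interior_iff_mem_nhds.1 hxi)).exists
  have := h.subset ht1
  simp only [halfSpace, mem_ofPred_eq, inner_add_right, inner_smul_right, inner_neg_right, hxc,
    real_inner_self_eq_norm_sq] at this
  have hn : 0 < ‖n‖ ^ 2 := by have := norm_pos_iff.2 h.normal_ne_zero; positivity
  nlinarith

theorem closure_openCap_subset_frontier (K : Set R3) (n : R3) (c : ℝ) :
    closure (openCap K n c) ⊆ frontier K :=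
  closure_minimal inter_subset_left isClosed_frontier

theorem closure_openCap_subset_halfSpace (K : Set R3) (n : R3) (c : ℝ) :
    closure (openCap K n c) ⊆ halfSpace n c :=
  closure_minimal (fun x hx => (le_of_lt hx.2 : c ≤ ⟪n, x⟫)) (isClosed_halfSpace n c)

theorem mem_openCap_of_mem_closure {x : R3} (hx : x ∈ closure (openCap K n c)) (hxc : ⟪n, x⟫ ≠ c)
    : x ∈ openCap K n c :=
  ⟨closure_openCap_subset_frontier K n c hx,
    lt_of_le_of_ne (closure_openCap_subset_halfSpace K n c hx) hxc.symm⟩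

theorem not_relInt_of_mem_closure (h : CapBody K n c) {x : R3} (hx : x ∈ closure (openCap K n c))
    : ¬ RelInt K n c x := by
  intro hr
  obtain ⟨k, hk, hkc⟩ := h.exists_interior_gt
  obtain ⟨y, hy1, hy2⟩ := (mem_closure_iff_frequently.1 hx).and_eventually
    (hr.eventually_mem_interior h.body.convex hk hkc) |>.exists
  exact hy1.1.2 (hy2 hy1.2)

theorem mem_closure_openCap (h : CapBody K n c) {x : R3} (hx : x ∈ K) (hxc : ⟪n, x⟫ = c)
    (hr : ¬ RelInt K n c x) : x ∈ closure (openCap K n c) := by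
  by_contra hcl
  obtain ⟨ε, hε, hb⟩ := Metric.mem_nhds_iff.1 (isClosed_closure.isOpen_compl.mem_nhds hcl)
  set O := ball x ε ∩ {y | c < ⟪n, y⟫}
  have hO : Convex ℝ O := (convex_ball x ε).inter
    (convex_halfSpace_gt (f := fun y => ⟪n, y⟫) (innerSL ℝ n).isLinear c)
  obtain ⟨k, hk, hkc⟩ := h.exists_interior_gt
  have hOK : O ⊆ K := by
    refine (subset_or_disjoint_of_frontier (K := K) hO.isPreconnected ?_).resolve_right ?_
    · rintro y ⟨hy1, hy2⟩ hyf
      exact hb hy1 (subset_closure ⟨hyf, hy2⟩)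
    · intro hdis
      obtain ⟨t, ht1, ht0, ht2⟩ := (eventually_lineMap (k - x) (ball_mem_nhds x hε)).exists
      refine hdis _ ⟨ht1, ?_⟩ (h.body.convex.lineMap_mem_set hx (interior_subset hk)
        ⟨ht0.le, ht2.le⟩)
      simp only [mem_ofPred_eq, inner_add_right, inner_smul_right, inner_sub_right, hxc]
      nlinarith
  refine hr ⟨hxc, ε, hε, fun y hy hyd => ?_⟩
  refine h.body.isClosed.closure_subset_iff.2 hOK ?_
  refine mem_closure_of_tendsto (tendsto_lineMap_zero y n) ?_
  filter_upwards [eventually_lineMap n (isOpen_ball.mem_nhds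
    (show y ∈ ball x ε from hyd))] with t ht
  refine ⟨ht.1, ?_⟩
  simp only [mem_ofPred_eq, inner_add_right, inner_smul_right, hy, real_inner_self_eq_norm_sq]
  have hn : 0 < ‖n‖ ^ 2 := by have := norm_pos_iff.2 h.normal_ne_zero; positivity
  nlinarith [ht.2.1]

theorem isCompact_closure (h : CapBody K n c) : IsCompact (closure (openCap K n c)) :=
  h.body.isCompact.of_isClosed_subset isClosed_closure
    ((closure_openCap_subset_frontier K n c).trans h.body.frontier_subset)

end CapBody

/-! ### Caps in three-space -/

theorem one_lt_rank_E2 : 1 < Module.rank ℝ E2 := by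
  rw [← Module.finrank_eq_rank, finrank_E2]; norm_num

/-- Two orthonormal vectors of three-space are part of an orthonormal basis. -/
theorem exists_third_unit {n e : R3} (hn : ‖n‖ = 1) (he : ‖e‖ = 1) (hne : ⟪n, e⟫ = 0) :
    ∃ t : R3, ‖t‖ = 1 ∧ ⟪n, t⟫ = 0 ∧ ⟪e, t⟫ = 0 ∧
      ∀ x, x = ⟪n, x⟫ • n + ⟪e, x⟫ • e + ⟪t, x⟫ • t := by
  have horth : Orthonormal ℝ ((({0, 1} : Set (Fin 3)).domRestrict ![n, e, 0])) := by
    constructor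
    · rintro ⟨i, hi⟩
      rcases hi with rfl | rfl
      · exact hn
      · exact he
    · rintro ⟨i, hi⟩ ⟨j, hj⟩ hij
      rcases hi with rfl | rfl <;> rcases hj with rfl | rfl
      · exact absurd rfl hij
      · exact hne
      · exact (real_inner_comm _ _).trans hne
      · exact absurd rfl hij
  obtain ⟨b, hb⟩ := horth.exists_orthonormalBasis_extension_of_card_eq (by simp)
  have h0 : b 0 = n := by simpa using hb 0 (by simp)
  have h1 : b 1 = e := by simpa using hb 1 (by simp)
  have hbo := b.orthonormal
  refine ⟨b 2, hbo.1 2, ?_, ?_, fun x => ?_⟩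
  · rw [← h0]; exact hbo.2 (by decide)
  · rw [← h1]; exact hbo.2 (by decide)
  · have := b.sum_repr' x
    rw [Fin.sum_univ_three, h0, h1] at this
    exact this.symm

/-- A convex set either meets a plane in a set with nonempty relative interior, or it meets it in
a subset of a line. -/
theorem relInt_or_subset_line {K : Set R3} (hK : Convex ℝ K) {n : R3} (hn : n ≠ 0) {c : ℝ} {x₀ : R3}
    (hx₀ : x₀ ∈ K) (hc : ⟪n, x₀⟫ = c) :
    (∃ z, RelInt K n c z) ∨
      ∃ e : R3, ‖e‖ = 1 ∧ ⟪n, e⟫ = 0 ∧ ∀ y ∈ K, ⟪n, y⟫ = c → ⟪e, y - x₀⟫ = 0 := by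
  obtain ⟨π, ι, hπι, hin, hdec, hnorm, -⟩ := exists_orthogonal_coordinates hn
  have hflat : ∀ d, ⟪n, d⟫ = 0 → ι (π d) = d := by
    intro d hd
    have h := hdec d
    rw [hd, zero_div, zero_smul, add_zero] at h
    exact h.symm
  set A : Set E2 := {w | x₀ + ι w ∈ K}
  have hA : Convex ℝ A := by
    intro a ha b hb s t hs ht hst
    have := hK ha hb hs ht hst
    simp only [A, mem_ofPred_eq, map_add, map_smul]
    have e : x₀ + (s • ι a + t • ι b) = s • (x₀ + ι a) + t • (x₀ + ι b) := by
      have : x₀ = (s + t) • x₀ := by rw [hst, one_smul]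
      conv_lhs => rw [this]
      module
    rwa [e]
  have hyA : ∀ y ∈ K, ⟪n, y⟫ = c → π (y - x₀) ∈ A := by
    intro y hy hyc
    simp only [A, mem_ofPred_eq]
    rw [hflat _ (by rw [inner_sub_right, hyc, hc, sub_self])]
    simpa using hy
  have h0 : (0 : E2) ∈ A := by simpa [A] using hx₀
  rcases (interior A).eq_empty_or_nonempty with hi | ⟨w, hw⟩
  · right
    have hs : Submodule.span ℝ A ≠ ⊤ := by
      intro hs
      have : affineSpan ℝ A = ⊤ := by
        have h := affineSpan_insert_zero (k := ℝ) A
        rw [insert_eq_of_mem h0, hs] at h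
        exact SetLike.coe_injective (by simpa using h)
      have h2 := hA.interior_nonempty_iff_affineSpan_eq_top.2 this
      rw [hi] at h2
      exact not_nonempty_empty h2
    have ho : (Submodule.span ℝ A)ᗮ ≠ ⊥ := fun h => hs (Submodule.orthogonal_eq_bot_iff.1 h)
    obtain ⟨e, he, hene⟩ := Submodule.exists_mem_ne_zero_of_ne_bot ho
    have hιi : ∀ a b, ⟪ι a, ι b⟫ = ⟪a, b⟫ := (⟨ι.toLinearMap, hnorm⟩ : E2 →ₗᵢ[ℝ] R3).inner_map_map
    refine ⟨ι (‖e‖⁻¹ • e), ?_, hin _, fun y hy hyc => ?_⟩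
    · rw [hnorm, norm_smul, norm_inv, norm_norm, inv_mul_cancel₀ (norm_ne_zero_iff.2 hene)]
    · have h1 := hflat (y - x₀) (by rw [inner_sub_right, hyc, hc, sub_self])
      have h2 := (Submodule.mem_orthogonal' _ _).1 he _ (Submodule.subset_span (hyA y hy hyc))
      rw [← h1, hιi, inner_smul_left, h2, mul_zero]
  · left
    obtain ⟨ε, hε, hb⟩ := Metric.mem_nhds_iff.1 (mem_interior_iff_mem_nhds.1 hw)
    have hz : ⟪n, x₀ + ι w⟫ = c := by rw [inner_add_right, hin, hc, add_zero]
    refine ⟨x₀ + ι w, hz, ε, hε, fun y hy hyd => ?_⟩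
    have h1 := hflat (y - x₀) (by rw [inner_sub_right, hy, hc, sub_self])
    have h2 : π (y - x₀) ∈ A := hb (by
      rw [mem_ball, dist_eq_norm, ← hnorm, map_sub, h1]
      rwa [dist_eq_norm, ← sub_sub] at hyd)
    simp only [A, mem_ofPred_eq, h1] at h2
    simpa using h2

namespace CapBody

variable {K : Set R3} {n : R3} {c : ℝ}

theorem exists_exit (h : CapBody K n c) {x u : R3} (hx : x ∈ K) (hu : u ≠ 0) :
    ∃ t : ℝ, 0 ≤ t ∧ x + t • u ∈ K ∧ (∀ s : ℝ, x + s • u ∈ K → s ≤ t) ∧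
      ((c < ⟪n, x + t • u⟫ ∨ ⟪n, u⟫ = 0) → x + t • u ∈ closure (openCap K n c)) := by
  set A : Set ℝ := {t | 0 ≤ t ∧ x + t • u ∈ K}
  have hAc : IsClosed A := (isClosed_le continuous_const continuous_id).inter
    (h.body.isClosed.preimage (f := fun t : ℝ => x + t • u) (by fun_prop))
  have hAb : BddAbove A := by
    obtain ⟨R, hR⟩ := h.body.isCompact.isBounded.exists_norm_le
    refine ⟨(R + R) / ‖u‖, fun t ht => ?_⟩
    rw [le_div_iff₀ (norm_pos_iff.2 hu)]
    have h1 : ‖t • u‖ ≤ ‖x + t • u‖ + ‖x‖ := by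
      simpa using norm_sub_le (x + t • u) x
    rw [norm_smul, norm_eq_abs, abs_of_nonneg ht.1] at h1
    linarith [hR _ ht.2, hR _ hx]
  have hA0 : (0 : ℝ) ∈ A := ⟨le_rfl, by simpa using hx⟩
  have hmem := hAc.csSup_mem ⟨0, hA0⟩ hAb
  set t := sSup A
  have hmax : ∀ s : ℝ, x + s • u ∈ K → s ≤ t := by
    intro s hs
    rcases le_total 0 s with h0 | h0
    · exact le_csSup hAb ⟨h0, hs⟩
    · exact h0.trans hmem.1
  refine ⟨t, hmem.1, hmem.2, hmax, fun hor => ?_⟩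
  have hno : ∀ s ∈ 𝓝 (x + t • u), ∃ τ : ℝ,
      0 < τ ∧ x + t • u + τ • u ∈ s ∧ x + t • u + τ • u ∉ K := by
    intro s hs
    obtain ⟨τ, h1, h2, -⟩ := (eventually_lineMap u hs).exists
    refine ⟨τ, h2, h1, fun hK => ?_⟩
    have := hmax (t + τ) (by rwa [add_smul, ← add_assoc])
    linarith
  by_cases hgt : c < ⟪n, x + t • u⟫
  · refine subset_closure ⟨⟨subset_closure hmem.2, fun hi => ?_⟩, hgt⟩
    obtain ⟨τ, -, h1, h2⟩ := hno _ (mem_interior_iff_mem_nhds.1 hi)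
    exact h2 h1
  · have hu0 := hor.resolve_left hgt
    have heq : ⟪n, x + t • u⟫ = c := le_antisymm (not_lt.1 hgt) (h.subset hmem.2)
    refine h.mem_closure_openCap hmem.2 heq fun hr => ?_
    obtain ⟨-, ε, hε, h2⟩ := hr
    obtain ⟨τ, -, h3, h4⟩ := hno _ (ball_mem_nhds _ hε)
    refine h4 (h2 _ ?_ h3)
    rw [inner_add_right, heq, inner_smul_right, hu0, mul_zero, add_zero]

theorem eq_convexHull (h : CapBody K n c) : K = convexHull ℝ (closure (openCap K n c)) := by
  refine subset_antisymm (fun x hx => ?_) (convexHull_min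
    ((closure_openCap_subset_frontier K n c).trans h.body.frontier_subset) h.body.convex)
  obtain ⟨π, ι, -, hin, -, hnorm, -⟩ := exists_orthogonal_coordinates h.normal_ne_zero
  obtain ⟨w, hw⟩ := exists_ne (0 : E2)
  have hu : ι w ≠ 0 := by rw [← norm_ne_zero_iff, hnorm]; simpa using hw
  obtain ⟨t, ht, -, -, h1⟩ := h.exists_exit hx hu
  obtain ⟨s, hs, -, -, h2⟩ := h.exists_exit hx (neg_ne_zero.2 hu)
  have hA := subset_convexHull ℝ _ (h1 (Or.inr (hin w)))
  have hB := subset_convexHull ℝ _ (h2 (Or.inr (by simp [hin])))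
  rcases eq_or_lt_of_le (add_nonneg ht hs) with h0 | h0
  · have ht0 : t = 0 := by linarith
    rw [ht0] at hA
    simpa using hA
  · have := (convex_convexHull ℝ (closure (openCap K n c))).add_smul_sub_mem hA hB
      (t := t / (t + s)) ⟨by positivity, (div_le_one h0).2 (by linarith)⟩
    have e : x + t • ι w + (t / (t + s)) • (x + s • -ι w - (x + t • ι w)) = x := by
      have h3 : x + s • -ι w - (x + t • ι w) = -((t + s) • ι w) := by module
      rw [h3, smul_neg, smul_smul, div_mul_cancel₀ _ h0.ne']
      abel
    rwa [e] at this

theorem ray_unique (h : CapBody K n c) {z x x' : R3} (hz : RelInt K n c z)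
    (hx : x ∈ closure (openCap K n c)) (hx' : x' ∈ closure (openCap K n c)) {t : ℝ}
    (ht : t ∈ Ioo (0 : ℝ) 1) (he : x = z + t • (x' - z)) : False := by
  have hx'K := h.body.frontier_subset (closure_openCap_subset_frontier K n c hx')
  have hxf := closure_openCap_subset_frontier K n c hx
  by_cases hc : ⟪n, x'⟫ = c
  · refine h.not_relInt_of_mem_closure hx ?_
    rw [he]
    exact hz.lineMap h.body.convex hx'K hc ⟨ht.1.le, ht.2⟩
  · have hgt : c < ⟪n, x'⟫ := (h.subset hx'K).lt_of_ne' hc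
    obtain ⟨k, hk, hkc⟩ := h.exists_interior_gt
    obtain ⟨s, ⟨hs1, hs0, -⟩, hst⟩ := ((eventually_lineMap (x' - z)
      (hz.eventually_mem_interior h.body.convex hk hkc)).and (Ioo_mem_nhdsGT ht.1)).exists
    have hy : z + s • (x' - z) ∈ interior K := by
      refine hs1 ?_
      rw [inner_add_smul, inner_sub_right, hz.1]
      have := mul_pos hs0 (sub_pos.2 hgt)
      linarith
    have h1s : 0 < 1 - s := by linarith [hst.2, ht.2]
    have := h.body.convex.lineMap_mem_interior hy hx'K (t := (t - s) / (1 - s))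
      ⟨div_nonneg (by linarith [hst.2]) h1s.le, (div_lt_one h1s).2 (by linarith [ht.2])⟩
    have e : z + s • (x' - z) + ((t - s) / (1 - s)) • (x' - (z + s • (x' - z))) = x := by
      have h3 : x' - (z + s • (x' - z)) = (1 - s) • (x' - z) := by module
      rw [h3, smul_smul, div_mul_cancel₀ _ h1s.ne', he]
      module
    rw [e] at this
    exact hxf.2 this

/-- The cap of a cap body is a disk: central projection from a relative interior point of the base
onto a hemisphere, followed by orthogonal projection, is a homeomorphism onto the unit disk. -/
theorem exists_homeomorph (h : CapBody K n c) :
    ∃ e : closedBall (0 : E2) 1 ≃ₜ closure (openCap K n c),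
      ∀ w, ⟪n, (e w : R3)⟫ = c ↔ ‖(w : E2)‖ = 1 := by
  obtain ⟨z, hz⟩ := h.relInt
  obtain ⟨π, ι, hπι, hin, hdec, hnorm, hπn⟩ := exists_orthogonal_coordinates h.normal_ne_zero
  have hn : 0 < ‖n‖ := norm_pos_iff.2 h.normal_ne_zero
  set D := closure (openCap K n c)
  have hDK : D ⊆ K := (closure_openCap_subset_frontier K n c).trans h.body.frontier_subset
  have hpyth : ∀ x, ‖x‖ ^ 2 = ‖π x‖ ^ 2 + (⟪n, x⟫ / ‖n‖) ^ 2 := by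
    intro x
    conv_lhs => rw [hdec x]
    have e : ⟪ι (π x), (⟪n, x⟫ / ‖n‖ ^ 2) • n⟫ = 0 := by
      rw [inner_smul_right, real_inner_comm n, hin, mul_zero]
    rw [norm_add_sq_real, e, hnorm, norm_smul, mul_pow, norm_eq_abs, sq_abs]
    field_simp
    ring
  have hne : ∀ x ∈ D, 0 < ‖x - z‖ := by
    intro x hx
    rw [norm_pos_iff, sub_ne_zero]
    rintro rfl
    exact h.not_relInt_of_mem_closure hx hz
  have hge : ∀ x ∈ D, 0 ≤ ⟪n, x - z⟫ := by
    intro x hx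
    have : c ≤ ⟪n, x⟫ := h.subset (hDK hx)
    rw [inner_sub_right, hz.1]
    linarith
  have hΨ : ∀ x ∈ D, ‖‖x - z‖⁻¹ • π (x - z)‖ ^ 2 = 1 - (⟪n, x - z⟫ / ‖n‖ / ‖x - z‖) ^ 2 := by
    intro x hx
    have h1 := hpyth (x - z)
    have h2 := hne x hx
    rw [norm_smul, mul_pow, norm_inv, norm_norm, div_pow _ ‖x - z‖]
    field_simp
    field_simp at h1
    linarith
  let Ψ : D → closedBall (0 : E2) 1 := fun x => ⟨‖(x : R3) - z‖⁻¹ • π (x - z), by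
    rw [mem_closedBall_zero_iff]
    have := hΨ x x.2
    nlinarith [sq_nonneg (⟪n, (x : R3) - z⟫ / ‖n‖ / ‖(x : R3) - z‖), norm_nonneg
      (‖(x : R3) - z‖⁻¹ • π (x - z))]⟩
  have hΨc : Continuous Ψ := by
    have c1 : Continuous fun x : D => ‖(x : R3) - z‖ := by fun_prop
    have c2 : Continuous fun x : D => π ((x : R3) - z) := by fun_prop
    exact ((c1.inv₀ fun x => (hne x.1 x.2).ne').smul c2).subtype_mk _
  have hinj : Function.Injective Ψ := by
    intro x x' hxx
    have e1 : ‖(x : R3) - z‖⁻¹ • π (x - z) = ‖(x' : R3) - z‖⁻¹ • π (x' - z) :=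
      congrArg Subtype.val hxx
    have p1 := hne x x.2
    have p2 := hne x' x'.2
    have e2 : ⟪n, (x : R3) - z⟫ / ‖n‖ / ‖(x : R3) - z‖ =
        ⟪n, (x' : R3) - z⟫ / ‖n‖ / ‖(x' : R3) - z‖ := by
      have a1 := hΨ x x.2
      have a2 := hΨ x' x'.2
      rw [e1, a2] at a1
      have b1 : 0 ≤ ⟪n, (x : R3) - z⟫ / ‖n‖ / ‖(x : R3) - z‖ := by
        have := hge x x.2; positivity
      have b2 : 0 ≤ ⟪n, (x' : R3) - z⟫ / ‖n‖ / ‖(x' : R3) - z‖ := by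
        have := hge x' x'.2; positivity
      exact (pow_left_inj₀ b1 b2 two_ne_zero).1 (by linarith)
    have e3 : ‖(x : R3) - z‖⁻¹ • ((x : R3) - z) = ‖(x' : R3) - z‖⁻¹ • ((x' : R3) - z) := by
      have q1 := hdec (‖(x : R3) - z‖⁻¹ • ((x : R3) - z))
      have q2 := hdec (‖(x' : R3) - z‖⁻¹ • ((x' : R3) - z))
      have q3 : ⟪n, ‖(x : R3) - z‖⁻¹ • ((x : R3) - z)⟫ / ‖n‖ ^ 2 =
          ⟪n, ‖(x' : R3) - z‖⁻¹ • ((x' : R3) - z)⟫ / ‖n‖ ^ 2 := by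
        rw [inner_smul_right, inner_smul_right]
        field_simp at e2 ⊢
        linarith
      rw [map_smul, e1, q3] at q1
      rw [map_smul] at q2
      rw [q1, ← q2]
    have key : ∀ a b : D, ‖(a : R3) - z‖⁻¹ • ((a : R3) - z) = ‖(b : R3) - z‖⁻¹ • ((b : R3) - z) →
        ¬ ‖(a : R3) - z‖ < ‖(b : R3) - z‖ := by
      intro a b hab hlt
      have pa := hne a a.2
      have pb := hne b b.2
      refine h.ray_unique hz a.2 b.2 (t := ‖(a : R3) - z‖ / ‖(b : R3) - z‖)
        ⟨by positivity, (div_lt_one pb).2 hlt⟩ ?_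
      rw [div_eq_mul_inv, ← smul_smul, ← hab, smul_smul, mul_inv_cancel₀ pa.ne', one_smul]
      abel
    have e4 : ‖(x : R3) - z‖ = ‖(x' : R3) - z‖ :=
      le_antisymm (not_lt.1 (key x' x e3.symm)) (not_lt.1 (key x x' e3))
    rw [e4] at e3
    have e5 := smul_right_injective R3 (inv_ne_zero p2.ne') e3
    exact Subtype.ext (sub_left_injective e5)
  have hsurj : Function.Surjective Ψ := by
    rintro ⟨w, hw⟩
    rw [mem_closedBall_zero_iff] at hw
    have hs0 : 0 ≤ 1 - ‖w‖ ^ 2 := by nlinarith [norm_nonneg w]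
    set u := ι w + (√(1 - ‖w‖ ^ 2) / ‖n‖) • n
    have hπu : π u = w := by simp [u, hπι, hπn]
    have hnu : ⟪n, u⟫ = √(1 - ‖w‖ ^ 2) * ‖n‖ := by
      simp only [u, inner_add_right, hin, inner_smul_right, real_inner_self_eq_norm_sq, zero_add]
      field_simp
    have hu1 : ‖u‖ = 1 := by
      have := hpyth u
      rw [hπu, hnu, mul_div_assoc, div_self hn.ne', mul_one, Real.sq_sqrt hs0] at this
      have h2 : ‖u‖ ^ 2 = 1 := by linarith
      nlinarith [norm_nonneg u]
    have hu0 : u ≠ 0 := by rw [← norm_ne_zero_iff, hu1]; norm_num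
    have hnu0 : 0 ≤ ⟪n, u⟫ := by rw [hnu]; positivity
    obtain ⟨t, ht, hxK, hmax, hD⟩ := h.exists_exit hz.mem hu0
    have htpos : 0 < t := by
      rcases eq_or_lt_of_le hnu0 with h0 | h0
      · obtain ⟨hzc, ε, hε, h2⟩ := hz
        obtain ⟨τ, h3, h4, -⟩ := (eventually_lineMap u (ball_mem_nhds z hε)).exists
        refine h4.trans_le (hmax τ (h2 _ ?_ h3))
        rw [inner_add_smul, ← h0, mul_zero, add_zero, hzc]
      · obtain ⟨k, hk, hkc⟩ := h.exists_interior_gt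
        obtain ⟨τ, h3, h4, -⟩ := (eventually_lineMap u
          (hz.eventually_mem_interior h.body.convex hk hkc)).exists
        refine h4.trans_le (hmax τ (interior_subset (h3 ?_)))
        rw [inner_add_smul, hz.1]
        have := mul_pos h4 h0
        linarith
    have hxD := hD (by
      rcases eq_or_lt_of_le hnu0 with h0 | h0
      · exact Or.inr h0.symm
      · left
        rw [inner_add_smul, hz.1]
        have := mul_pos htpos h0
        linarith)
    refine ⟨⟨_, hxD⟩, Subtype.ext ?_⟩
    simp only [Ψ, add_sub_cancel_left, norm_smul, hu1, mul_one, norm_eq_abs, abs_of_pos htpos,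
      map_smul, hπu, smul_smul, inv_mul_cancel₀ htpos.ne', one_smul]
  have : CompactSpace D := isCompact_iff_compactSpace.1 h.isCompact_closure
  let E := (hΨc.homeoOfEquivCompactToT2 (f := Equiv.ofBijective Ψ ⟨hinj, hsurj⟩))
  refine ⟨E.symm, fun w => ?_⟩
  obtain ⟨x, rfl⟩ := E.surjective w
  rw [E.symm_apply_apply]
  have h1 : ((E x : closedBall (0 : E2) 1) : E2) = ‖(x : R3) - z‖⁻¹ • π (x - z) := rfl
  have h2 := hΨ x x.2
  have p1 := hne x x.2
  rw [h1]
  have h3 : ⟪n, (x : R3)⟫ = c ↔ ⟪n, (x : R3) - z⟫ = 0 := by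
    rw [inner_sub_right, hz.1, sub_eq_zero]
  rw [h3]
  constructor
  · intro h0
    rw [h0] at h2
    have : ‖‖(x : R3) - z‖⁻¹ • π (x - z)‖ ^ 2 = 1 := by rw [h2]; simp
    nlinarith [norm_nonneg (‖(x : R3) - z‖⁻¹ • π (x - z))]
  · intro h0
    rw [h0] at h2
    have : ⟪n, (x : R3) - z⟫ / ‖n‖ / ‖(x : R3) - z‖ = 0 := by
      have : (⟪n, (x : R3) - z⟫ / ‖n‖ / ‖(x : R3) - z‖) ^ 2 = 0 := by linarith
      exact pow_eq_zero_iff two_ne_zero |>.1 this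
    field_simp at this
    simpa using this

theorem isNondegenerateCap (h : CapBody K n c) :
    IsNondegenerateCap (closure (openCap K n c)) n c := by
  obtain ⟨e, he⟩ := h.exists_homeomorph
  refine ⟨⟨K, h.body, closure_openCap_subset_frontier K n c⟩,
    ⟨fun w => e w, by fun_prop, Subtype.val_injective.comp e.injective, ?_, he⟩,
    closure_openCap_subset_halfSpace K n c⟩
  ext x
  constructor
  · rintro ⟨w, rfl⟩; exact (e w).2
  · intro hx; exact ⟨e.symm ⟨x, hx⟩, by simp⟩

/-- The image of a convex part of the open disk is a connected part of the open cap. -/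
theorem exists_openCap_param (h : CapBody K n c) :
    ∃ e : closedBall (0 : E2) 1 ≃ₜ closure (openCap K n c),
      openCap K n c = (fun w => (e w : R3)) '' (Subtype.val ⁻¹' ball 0 1) ∧
      ∀ A ⊆ ball (0 : E2) 1, Convex ℝ A →
        IsPreconnected ((fun w => (e w : R3)) '' (Subtype.val ⁻¹' A)) := by
  obtain ⟨e, he⟩ := h.exists_homeomorph
  refine ⟨e, ?_, fun A hA hc => ?_⟩
  · ext x
    constructor
    · intro hx
      refine ⟨e.symm ⟨x, subset_closure hx⟩, ?_, by simp⟩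
      rw [mem_preimage, mem_ball_zero_iff]
      refine lt_of_le_of_ne (mem_closedBall_zero_iff.1 (e.symm ⟨x, subset_closure hx⟩).2)
        fun h1 => ?_
      rw [← he] at h1
      simp only [Homeomorph.apply_symm_apply] at h1
      exact hx.2.ne' h1
    · rintro ⟨w, hw, rfl⟩
      refine mem_openCap_of_mem_closure (e w).2 fun h1 => ?_
      rw [he] at h1
      rw [mem_preimage, mem_ball_zero_iff] at hw
      exact hw.ne h1
  · refine IsPreconnected.image ?_ _ (by fun_prop)
    rw [← Topology.IsInducing.subtypeVal.isPreconnected_image, Subtype.image_preimage_coe,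
      inter_eq_right.2 (hA.trans ball_subset_closedBall)]
    exact hc.isPreconnected

theorem isConnected_openCap (h : CapBody K n c) : IsConnected (openCap K n c) := by
  obtain ⟨e, he, hp⟩ := h.exists_openCap_param
  rw [he]
  exact ⟨⟨_, ⟨⟨0, by simp⟩, by simp, rfl⟩⟩, hp _ subset_rfl (convex_ball _ _)⟩

/-- The open cap is locally connected at the boundary of the cap. -/
theorem locally_connected (h : CapBody K n c) {x : R3} (hx : x ∈ closure (openCap K n c)) {ε : ℝ}
    (hε : 0 < ε) : ∃ V ⊆ openCap K n c ∩ ball x ε, IsPreconnected V ∧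
      ∃ δ > 0, openCap K n c ∩ ball x δ ⊆ V := by
  obtain ⟨e, he, hp⟩ := h.exists_openCap_param
  obtain ⟨w, hw⟩ := e.surjective ⟨x, hx⟩
  have hec : Continuous fun w => (e w : R3) := by fun_prop
  have hwx : (e w : R3) = x := by rw [hw]
  obtain ⟨ρ, hρ, hρs⟩ := Metric.continuous_iff.1 hec w ε hε
  obtain ⟨δ, hδ, hδs⟩ := Metric.continuous_iff.1 e.symm.continuous ⟨x, hx⟩ ρ hρ
  refine ⟨_, ?_, hp (ball 0 1 ∩ ball w ρ) inter_subset_left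
    ((convex_ball _ _).inter (convex_ball _ _)), δ, hδ, ?_⟩
  · rintro _ ⟨a, ⟨ha1, ha2⟩, rfl⟩
    refine ⟨he.ge ⟨a, ha1, rfl⟩, ?_⟩
    have := hρs a ha2
    rwa [hwx] at this
  · rintro y ⟨hy, hyd⟩
    have h1 := hδs ⟨y, subset_closure hy⟩ hyd
    rw [← hw, e.symm_apply_apply] at h1
    have hy' := hy
    rw [he] at hy'
    obtain ⟨a, ha, hay⟩ := hy'
    have : e.symm ⟨y, subset_closure hy⟩ = a := by
      rw [e.symm_apply_eq]; exact Subtype.ext hay.symm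
    rw [this] at h1
    exact ⟨a, ⟨ha, h1⟩, hay⟩

end CapBody

/-- The part of the boundary of a convex body in an open half-space which does not contain the body
is connected. -/
theorem isPreconnected_openCap {K : Set R3} (hK : IsConvexBody K) {n : R3} {c : ℝ} {y : R3}
    (hy : y ∈ K) (hyc : ⟪n, y⟫ ≤ c) : IsPreconnected (openCap K n c) := by
  obtain ⟨m, hmK, hmax⟩ := hK.isCompact.exists_isMaxOn ⟨y, hy⟩ (f := fun x => ⟪n, x⟫) (by fun_prop)
  refine isPreconnected_of_forall m fun x hx => ?_
  obtain ⟨c', h1, h2⟩ := exists_between (show c < ⟪n, x⟫ from hx.2)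
  have hcap := capBody_inter hK hy (hyc.trans_lt h1) (hK.frontier_subset hx.1) h2
  refine ⟨openCap K n c', fun w hw => ⟨hw.1, h1.trans hw.2⟩,
    ⟨⟨subset_closure hmK, fun hi => ?_⟩, ?_⟩,
    ⟨hx.1, h2⟩, ?_⟩
  · have hn : 0 < ‖n‖ ^ 2 := by have := norm_pos_iff.2 hcap.normal_ne_zero; positivity
    obtain ⟨t, ht1, ht0, -⟩ := (eventually_lineMap n (mem_interior_iff_mem_nhds.1 hi)).exists
    have := isMaxOn_iff.1 hmax _ ht1
    simp only [inner_add_right, inner_smul_right, real_inner_self_eq_norm_sq] at this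
    nlinarith
  · exact h2.trans_le (isMaxOn_iff.1 hmax x (hK.frontier_subset hx.1))
  · rw [← openCap_inter_halfSpace]
    exact hcap.isConnected_openCap.isPreconnected

/-- A nondegenerate cap is the cap of a cap body. -/
theorem IsNondegenerateCap.exists_capBody {S : Set R3} {n : R3} {c : ℝ} (hn : n ≠ 0)
    (h : IsNondegenerateCap S n c) : ∃ K, CapBody K n c ∧ S = closure (openCap K n c) := by
  obtain ⟨⟨K, hK, hSK⟩, ⟨g, hgc, hgi, hgS, hgn⟩, hSH⟩ := h
  obtain ⟨v, hv⟩ : ∃ v : E2, ‖v‖ = 1 := exists_norm_eq E2 zero_le_one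
  set x₀ := g ⟨v, by simp [hv]⟩
  have hx₀c : ⟪n, x₀⟫ = c := (hgn ⟨v, by simp [hv]⟩).2 hv
  have hx₀K : x₀ ∈ K := hK.frontier_subset (hSK (hgS ▸ mem_range_self _))
  have hgt : ∀ w : closedBall (0 : E2) 1, c < ⟪n, g w⟫ ↔ (w : E2) ∈ ball 0 1 := by
    intro w
    have h1 : c ≤ ⟪n, g w⟫ := hSH (hgS ▸ mem_range_self w)
    have h2 : ‖(w : E2)‖ ≤ 1 := mem_closedBall_zero_iff.1 w.2
    have h3 : ⟪n, g w⟫ = c ↔ _ := hgn w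
    rw [mem_ball_zero_iff, lt_iff_le_and_ne, lt_iff_le_and_ne, ne_comm, ne_eq, h3]
    simp [h1, h2]
  -- the part of the disk above the plane is open and closed in the connected open cap of `K`
  have hSopen : S ∩ {x | c < ⟪n, x⟫} = openCap K n c := by
    refine subset_antisymm (fun x hx => ⟨hSK hx.1, hx.2⟩) ?_
    have hpre := isPreconnected_openCap hK (n := n) hx₀K hx₀c.le
    have hScl : IsClosed S := by
      rw [← hgS]; exact (isCompact_range hgc).isClosed
    have hnb : ∀ x ∈ S ∩ {x | c < ⟪n, x⟫}, S ∈ 𝓝[frontier K] x := by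
      rintro x ⟨hx, hxc⟩
      rw [← hgS] at hx
      obtain ⟨w, rfl⟩ := hx
      have hw := (hgt w).1 hxc
      let G : E2 → R3 := Function.extend Subtype.val g 0
      have hG : ∀ w : closedBall (0 : E2) 1, G w = g w := fun w =>
        Subtype.val_injective.extend_apply g 0 w
      have hGc : ContinuousOn G (closedBall 0 1) := by
        rw [continuousOn_iff_continuous_domRestrict]
        have : (closedBall (0 : E2) 1).domRestrict G = g := funext hG
        rwa [this]
      have := hK.image_mem_nhdsWithin (U := ball (0 : E2) 1) (h := G)
        (hGc.mono ball_subset_closedBall) (fun a ha b hb hab => by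
          have ha' := ball_subset_closedBall ha
          have hb' := ball_subset_closedBall hb
          rw [hG ⟨a, ha'⟩, hG ⟨b, hb'⟩] at hab
          exact congrArg Subtype.val (hgi hab)) (isOpen_ball.mem_nhds hw)
        (fun a ha => by
          rw [hG ⟨a, ball_subset_closedBall ha⟩]
          exact hSK (hgS ▸ mem_range_self _))
      rw [hG] at this
      refine Filter.mem_of_superset this ?_
      rintro _ ⟨a, ha, rfl⟩
      rw [hG ⟨a, ball_subset_closedBall ha⟩, ← hgS]
      exact mem_range_self _
    choose! O hO using fun x hx => mem_nhdsWithin.1 (hnb x hx)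
    set U := ⋃ x ∈ S ∩ {x | c < ⟪n, x⟫}, O x
    have hUo : IsOpen U := isOpen_biUnion fun x hx => (hO x hx).1
    intro x hx
    refine ⟨?_, hx.2⟩
    by_contra hxS
    obtain ⟨y, hy1, hy2, hy3⟩ := hpre U Sᶜ hUo hScl.isOpen_compl (fun y hy => by
        by_cases hyS : y ∈ S
        · exact Or.inl (mem_biUnion (x := y) ⟨hyS, hy.2⟩ (hO y ⟨hyS, hy.2⟩).2.1)
        · exact Or.inr hyS)
      ⟨g ⟨0, by simp⟩, ⟨hSK (hgS ▸ mem_range_self _), (hgt _).2 (by simp)⟩,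
        mem_biUnion (x := g ⟨0, by simp⟩) ⟨hgS ▸ mem_range_self _, (hgt _).2 (by simp)⟩
        (hO _ ⟨hgS ▸ mem_range_self _, (hgt _).2 (by simp)⟩).2.1⟩ ⟨x, hx, hxS⟩
    obtain ⟨x', hx', hyx'⟩ := mem_iUnion₂.1 hy2
    exact hy3 ((hO x' hx').2.2 ⟨hyx', hy1.1⟩)
  have hSeq : S = closure (openCap K n c) := by
    refine subset_antisymm ?_ ?_
    · rw [← hSopen, ← hgS]
      rintro _ ⟨w, rfl⟩
      have hw : w ∈ closure (Subtype.val ⁻¹' ball (0 : E2) 1) := by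
        rw [Topology.IsInducing.subtypeVal.closure_eq_preimage_closure_image,
          Subtype.image_preimage_coe, inter_eq_right.2 ball_subset_closedBall,
          closure_ball _ one_ne_zero]
        exact w.2
      refine map_mem_closure hgc hw fun a ha => ⟨mem_range_self a, (hgt a).2 ha⟩
    · refine closure_minimal ?_ (by rw [← hgS]; exact (isCompact_range hgc).isClosed)
      rw [← hSopen]
      exact inter_subset_left
  have hgK : ∀ w, g w ∈ K := fun w => hK.frontier_subset (hSK (hgS ▸ mem_range_self _))
  by_cases hbelow : ∃ y ∈ K, ⟪n, y⟫ < c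
  · obtain ⟨y, hy, hyc⟩ := hbelow
    refine ⟨_, capBody_inter hK hy hyc (hgK ⟨0, by simp⟩) ((hgt _).2 (by simp)), ?_⟩
    rw [openCap_inter_halfSpace, hSeq]
  · push Not at hbelow
    rcases relInt_or_subset_line hK.convex hn hx₀K hx₀c with hr | ⟨e, he, hne, hline⟩
    · exact ⟨K, ⟨hK, hn, hbelow, hr⟩, hSeq⟩
    · -- the boundary circle would be embedded in a line
      exfalso
      obtain ⟨t, -, -, -, hdec⟩ := exists_third_unit (n := ‖n‖⁻¹ • n) (e := e)
        (norm_inv_norm_smul hn) he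
        (by rw [inner_smul_left, hne, mul_zero])
      have hs := (isConnected_sphere one_lt_rank_E2 (0 : E2) zero_le_one)
      let F : sphere (0 : E2) 1 → ℝ := fun w => ⟪t, g ⟨w, sphere_subset_closedBall w.2⟩⟫ -
        ⟪t, g ⟨-w, sphere_subset_closedBall (by simp)⟩⟫
      have hF : Continuous F := by
        have c1 : Continuous fun w : sphere (0 : E2) 1 =>
          (⟨w, sphere_subset_closedBall w.2⟩ : closedBall (0 : E2) 1) := by fun_prop
        have c2 : Continuous fun w : sphere (0 : E2) 1 =>
          (⟨-w, sphere_subset_closedBall (by simp)⟩ : closedBall (0 : E2) 1) := by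
            fun_prop
        exact (continuous_const.inner (hgc.comp c1)).sub (continuous_const.inner (hgc.comp c2))
      have : PreconnectedSpace (sphere (0 : E2) 1) := Subtype.preconnectedSpace hs.isPreconnected
      let w₀ : sphere (0 : E2) 1 := ⟨v, by simp [hv]⟩
      let w₁ : sphere (0 : E2) 1 := ⟨-v, by simp [hv]⟩
      have hodd : F w₁ = -F w₀ := by simp [F, w₀, w₁]
      obtain ⟨w, hw⟩ : ∃ w, F w = 0 := by
        rcases le_total (F w₀) 0 with h0 | h0
        · exact mem_range_of_exists_le_of_exists_ge hF ⟨w₀, h0⟩ ⟨w₁, by rw [hodd]; linarith⟩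
        · exact mem_range_of_exists_le_of_exists_ge hF ⟨w₁, by rw [hodd]; linarith⟩ ⟨w₀, h0⟩
      have hw1 : ‖(w : E2)‖ = 1 := by simp
      set a := g ⟨w, sphere_subset_closedBall w.2⟩
      set b := g ⟨-w, sphere_subset_closedBall (by simp)⟩
      have ha : ⟪n, a⟫ = c := (hgn _).2 hw1
      have hb : ⟪n, b⟫ = c := (hgn _).2 (by simp)
      have hab : a - b = 0 := by
        rw [hdec (a - b)]
        have h1 := hline a (hgK _) ha
        have h2 := hline b (hgK _) hb
        have h3 : ⟪t, a⟫ - ⟪t, b⟫ = 0 := hw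
        have h4 : ⟪e, a - b⟫ = 0 := by
          rw [inner_sub_right] at h1 h2 ⊢; linarith
        rw [h4, inner_sub_right t, h3, inner_smul_left, inner_sub_right, ha, hb]
        simp
      have := congrArg Subtype.val (hgi (sub_eq_zero.1 hab))
      simp only at this
      have h5 : (w : E2) = 0 := by
        have h6 : (2 : ℝ) • (w : E2) = 0 := by
          rw [two_smul]; nth_rewrite 2 [this]; simp
        simpa using h6
      rw [h5] at hw1
      simp at hw1

/-! ### Second order expansion of curves -/

/-- Second order Taylor expansion of a `C²` curve. -/
theorem tendsto_second_order {E : Type*} [NormedAddCommGroup E] [NormedSpace ℝ E] {γ : ℝ → E}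
    (hγ : ContDiff ℝ 2 γ) :
    Tendsto (fun s : ℝ => (s ^ 2)⁻¹ • (γ s - γ 0 - s • deriv γ 0)) (𝓝[≠] 0)
      (𝓝 ((1 / 2 : ℝ) • deriv (deriv γ) 0)) := by
  have h := taylor_tendsto (f := γ) (x₀ := 0) (n := 2) (s := univ) convex_univ (mem_univ _)
    (by exact_mod_cast hγ.contDiffOn)
  rw [nhdsWithin_univ] at h
  have h2 := (h.mono_left (nhdsWithin_le_nhds (s := {0}ᶜ))).add_const
    ((1 / 2 : ℝ) • deriv (deriv γ) 0)
  rw [zero_add] at h2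
  refine h2.congr' ?_
  filter_upwards [self_mem_nhdsWithin] with s hs
  have hs' : s ≠ 0 := hs
  have h3 : iteratedDeriv 2 γ 0 = deriv (deriv γ) 0 := by
    rw [iteratedDeriv_succ, iteratedDeriv_one]
  simp only [taylorWithinEval_succ, taylor_within_zero_eval, iteratedDerivWithin_univ, sub_zero,
    Nat.reduceAdd, iteratedDeriv_one, h3]
  simp only [Nat.factorial, Nat.cast_zero, zero_add, Nat.cast_one, mul_one, pow_one,
    inv_one, one_mul]
  have h4 : (1 / 2 : ℝ) • deriv (deriv γ) 0 = (s ^ 2)⁻¹ • ((s ^ 2 / 2) • deriv (deriv γ) 0) := by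
    rw [smul_smul]; congr 1; field_simp
  rw [h4, ← smul_add]
  congr 1
  module

theorem tendsto_second_order_inner {γ : ℝ → R3} (hγ : ContDiff ℝ 2 γ) (n : R3)
    (h : ⟪n, deriv γ 0⟫ = 0) :
    Tendsto (fun s : ℝ => ⟪n, γ s - γ 0⟫ / s ^ 2) (𝓝[≠] 0) (𝓝 (⟪n, deriv (deriv γ) 0⟫ / 2)) := by
  have h1 := (tendsto_const_nhds (x := n)).inner (𝕜 := ℝ) (tendsto_second_order hγ)
  rw [inner_smul_right] at h1
  convert h1 using 2 with s
  · rw [inner_smul_right, inner_sub_right _ (γ s - γ 0), inner_smul_right, h]; ring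
  · ring

theorem tendsto_first_order {γ : ℝ → R3} (hγ : ContDiff ℝ 2 γ) :
    Tendsto (fun s : ℝ => s⁻¹ • (γ s - γ 0)) (𝓝[≠] 0) (𝓝 (deriv γ 0)) := by
  have := (hγ.differentiable (by norm_num) 0).hasDerivAt.tendsto_slope
  convert this using 2 with s
  simp [slope]

/-- A curve which meets a plane repeatedly near a point of the curve on the plane is tangent to it
to second order. -/
theorem inner_deriv_eq_zero_of_frequently {γ : ℝ → R3} (hγ : ContDiff ℝ 2 γ) {n : R3}
    (h : ∃ᶠ s in 𝓝[≠] (0 : ℝ), ⟪n, γ s - γ 0⟫ = 0) :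
    ⟪n, deriv γ 0⟫ = 0 ∧ ⟪n, deriv (deriv γ) 0⟫ = 0 := by
  have h1 : ⟪n, deriv γ 0⟫ = 0 := by
    have := (tendsto_const_nhds (x := n)).inner (𝕜 := ℝ) (tendsto_first_order hγ)
    by_contra hne
    refine h ?_
    filter_upwards [this.eventually_ne hne] with s hs h0
    rw [inner_smul_right, h0, mul_zero] at hs
    exact hs rfl
  refine ⟨h1, ?_⟩
  by_contra hne
  refine h ?_
  filter_upwards [(tendsto_second_order_inner hγ n h1).eventually_ne
    (div_ne_zero hne two_ne_zero)] with s hs h0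
  rw [h0, zero_div] at hs
  exact hs rfl

/-- A curve with nonvanishing curvature meets a line through one of its points only in this point,
locally. -/
theorem eventually_not_mem_line {γ : ℝ → R3} (hγ : ContDiff ℝ 2 γ)
    (hli : LinearIndependent ℝ ![deriv γ 0, deriv (deriv γ) 0]) {n e : R3} (hn : ‖n‖ = 1)
    (he : ‖e‖ = 1) (hne : ⟪n, e⟫ = 0) :
    ∀ᶠ s in 𝓝[≠] (0 : ℝ), ¬ (⟪n, γ s - γ 0⟫ = 0 ∧ ⟪e, γ s - γ 0⟫ = 0) := by
  by_contra hc
  have hc' : ∃ᶠ s in 𝓝[≠] (0 : ℝ), ⟪n, γ s - γ 0⟫ = 0 ∧ ⟪e, γ s - γ 0⟫ = 0 := hc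
  obtain ⟨n1, n2⟩ := inner_deriv_eq_zero_of_frequently hγ (hc'.mono fun _ h => h.1)
  obtain ⟨e1, e2⟩ := inner_deriv_eq_zero_of_frequently hγ (hc'.mono fun _ h => h.2)
  obtain ⟨t, -, -, -, hdec⟩ := exists_third_unit hn he hne
  have d1 := hdec (deriv γ 0)
  have d2 := hdec (deriv (deriv γ) 0)
  rw [n1, e1, zero_smul, zero_smul, zero_add, zero_add] at d1
  rw [n2, e2, zero_smul, zero_smul, zero_add, zero_add] at d2
  rw [LinearIndependent.pair_iff] at hli
  obtain ⟨h1, h2⟩ := hli ⟪t, deriv (deriv γ) 0⟫ (-⟪t, deriv γ 0⟫) (by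
    rw [d1, d2]; simp only [inner_smul_right, smul_smul]; rw [← add_smul]
    convert zero_smul ℝ t using 2; ring)
  have := hli 1 0 (by rw [one_smul, zero_smul, add_zero, d1, neg_eq_zero.1 h2, zero_smul])
  exact one_ne_zero this.1

/-! ### Local models of locally convex immersions -/

/-- `U` is a compact neighborhood of `q` which `f` maps injectively into the boundary of the convex
body `K`. -/
structure LocalModel {M : Type*} [TopologicalSpace M] (f : M → R3) (q : M) (U : Set M)
    (K : Set R3) : Prop where
  isCompact : IsCompact U
  mem_nhds : U ∈ 𝓝 q
  injOn : InjOn f U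
  body : IsConvexBody K
  maps : ∀ x ∈ U, f x ∈ frontier K

/-- The inverse of an injective continuous map on a compact set is continuous. -/
theorem IsCompact.continuousOn_invFunOn {X Y : Type*} [TopologicalSpace X] [Nonempty X]
    [MetricSpace Y] {S : Set X} (hS : IsCompact S) {F : X → Y} (hF : ContinuousOn F S)
    (hi : InjOn F S) : ContinuousOn (Function.invFunOn F S) (F '' S) := by
  rintro _ ⟨q, hq, rfl⟩
  have hinv : ∀ x ∈ S, Function.invFunOn F S (F x) = x := fun x hx => hi.leftInvOn_invFunOn hx
  rw [ContinuousWithinAt, hinv q hq]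
  intro N hN
  obtain ⟨ε, hε, h⟩ := hS.exists_dist_lt_imp_mem hF hi hq hN
  refine mem_nhdsWithin.2 ⟨ball (F q) ε, isOpen_ball, mem_ball_self hε, ?_⟩
  rintro _ ⟨hd, x, hx, rfl⟩
  rw [mem_preimage, hinv x hx]
  exact h x hx hd

section Surface

variable {M : Type*} [TopologicalSpace M]

namespace LocalModel

variable {f : M → R3} {q : M} {U : Set M} {K : Set R3}

theorem mem (h : LocalModel f q U K) : q ∈ U := mem_of_mem_nhds h.mem_nhds

theorem mono (h : LocalModel f q U K) {q' : M} {U' : Set M} (hU : U' ⊆ U) (hc : IsCompact U')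
    (hq : U' ∈ 𝓝 q') : LocalModel f q' U' K :=
  ⟨hc, hq, h.injOn.mono hU, h.body, fun x hx => h.maps x (hU hx)⟩

theorem of_mem_interior (h : LocalModel f q U K) {q' : M} (hq : q' ∈ interior U) :
    LocalModel f q' U K :=
  h.mono subset_rfl h.isCompact (mem_interior_iff_mem_nhds.1 hq)

theorem sep (h : LocalModel f q U K) (hf : Continuous f) {N : Set M} (hN : N ∈ 𝓝 q) :
    ∃ ε > 0, ∀ x ∈ U, dist (f x) (f q) < ε → x ∈ N :=
  h.isCompact.exists_dist_lt_imp_mem hf.continuousOn h.injOn h.mem hN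

theorem isClosed_image (h : LocalModel f q U K) (hf : Continuous f) : IsClosed (f '' U) :=
  (h.isCompact.image hf).isClosed

end LocalModel

theorem IsLocallyConvexImmersion.exists_localModel [T2Space M] [CompactSpace M] {f : M → R3}
    (hf : IsLocallyConvexImmersion f) (q : M) {N : Set M} (hN : N ∈ 𝓝 q) :
    ∃ U ⊆ N, ∃ K, LocalModel f q U K := by
  obtain ⟨U₁, hU₁, hi⟩ := hf.locally_injective q
  obtain ⟨U₂, hU₂, K, hK, hUK⟩ := hf.locally_convex q
  obtain ⟨U, hU, hUs, hUc⟩ := local_compact_nhds (inter_mem (inter_mem hU₁ hU₂) hN)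
  exact ⟨U, fun x hx => (hUs hx).2, K, hUc, hU, hi.mono fun x hx => (hUs hx).1.1, hK,
    fun x hx => hUK ⟨x, (hUs hx).1.2, rfl⟩⟩

variable [ChartedSpace (EuclideanHalfSpace 2) M]

theorem extChartAt_nonneg (q q' : M) (hq' : q' ∈ (extChartAt (𝓡∂ 2) q).source) :
    0 ≤ (extChartAt (𝓡∂ 2) q q') 0 := by
  have h := extChartAt_target_subset_range (I := 𝓡∂ 2) q ((extChartAt (𝓡∂ 2) q).map_source hq')
  rw [range_modelWithCornersEuclideanHalfSpace] at h
  exact h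

theorem mem_bdry_iff (q : M) : q ∈ bdry M ↔ (extChartAt (𝓡∂ 2) q q) 0 = 0 := by
  show (𝓡∂ 2).IsBoundaryPoint q ↔ _
  rw [ModelWithCorners.isBoundaryPoint_iff, frontier_range_modelWithCornersEuclideanHalfSpace]
  exact eq_comm

theorem LocalModel.image_mem_nhdsWithin_of_pos {f : M → R3} (hf : Continuous f) {q q' : M}
    {U : Set M} {K : Set R3} (h : LocalModel f q' U K) (hq' : q' ∈ (extChartAt (𝓡∂ 2) q).source)
    (hpos : 0 < (extChartAt (𝓡∂ 2) q q') 0) :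
    f '' U ∈ 𝓝[frontier K] (f q') := by
  set e := extChartAt (𝓡∂ 2) q
  have ht : e.target ∈ 𝓝 (e q') := by
    have h1 := e.map_source hq'
    rw [show e.target = _ from extChartAt_target (𝓡∂ 2) q] at h1 ⊢
    refine inter_mem (((chartAt _ q).open_target.preimage (𝓡∂ 2).continuous_symm).mem_nhds h1.1) ?_
    rw [← mem_interior_iff_mem_nhds, interior_range_modelWithCornersEuclideanHalfSpace]
    exact hpos
  have hc : ContinuousOn e.symm e.target := continuousOn_extChartAt_symm q
  have hV : e.target ∩ e.symm ⁻¹' U ∈ 𝓝 (e q') := inter_mem ht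
    ((hc.continuousAt ht).preimage_mem_nhds (by rw [e.left_inv hq']; exact h.mem_nhds))
  have := h.body.image_mem_nhdsWithin (h := fun w => f (e.symm w))
    (hf.comp_continuousOn (hc.mono inter_subset_left))
    (fun w hw w' hw' he => e.symm.injOn hw.1 hw'.1 (h.injOn hw.2 hw'.2 he)) hV
    (fun w hw => h.maps _ hw.2)
  simp only [e.left_inv hq'] at this
  refine Filter.mem_of_superset this ?_
  rintro _ ⟨w, hw, rfl⟩
  exact ⟨_, hw.2, rfl⟩

/-- Near an interior point of the surface, the map is open into the boundary of the body. -/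
theorem LocalModel.image_mem_nhdsWithin {f : M → R3} (hf : Continuous f) {q : M} {U : Set M}
    {K : Set R3} (h : LocalModel f q U K) (hq : q ∉ bdry M) :
    f '' U ∈ 𝓝[frontier K] (f q) := by
  refine h.image_mem_nhdsWithin_of_pos hf (mem_extChartAt_source q) ?_
  exact lt_of_le_of_ne (extChartAt_nonneg q q (mem_extChartAt_source q))
    fun h0 => hq ((mem_bdry_iff q).2 h0.symm)

/-- Near a boundary point of the surface, the map is not open into the boundary of the body. -/
theorem LocalModel.image_notMem_nhdsWithin {f : M → R3} (hf : Continuous f) {q : M} {U : Set M}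
    {K : Set R3} (h : LocalModel f q U K) (hq : q ∈ bdry M) :
    f '' U ∉ 𝓝[frontier K] (f q) := by
  intro hn
  set e := extChartAt (𝓡∂ 2) q
  obtain ⟨π, r, hr, P, hPc, hP0, hP, -⟩ := h.body.exists_chart (h.maps q h.mem)
  have hb : ball (0 : E2) r ∈ 𝓝 0 := ball_mem_nhds _ hr
  have hPt : Tendsto P (𝓝 0) (𝓝[frontier K] (f q)) := by
    refine tendsto_nhdsWithin_iff.2 ⟨?_, ?_⟩
    · rw [← hP0]; exact hPc.continuousAt hb
    · filter_upwards [hb] with w hw using (hP w hw).1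
  have hne : Nonempty M := ⟨q⟩
  have hkc := h.isCompact.continuousOn_invFunOn hf.continuousOn h.injOn
  have hkl : ∀ x ∈ U, Function.invFunOn f U (f x) = x := fun x hx => h.injOn.leftInvOn_invFunOn hx
  set k := Function.invFunOn f U
  set V₁ := ball (0 : E2) r ∩ P ⁻¹' (f '' U)
  have hV₁ : V₁ ∈ 𝓝 0 := inter_mem hb (hPt hn)
  have hkP : ContinuousOn (fun w => k (P w)) V₁ :=
    hkc.comp (hPc.mono inter_subset_left) fun w hw => hw.2
  have hkP0 : k (P 0) = q := by rw [hP0, hkl q h.mem]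
  have hV : V₁ ∩ (fun w => k (P w)) ⁻¹' e.source ∈ 𝓝 0 := inter_mem hV₁
    ((hkP.continuousAt hV₁).preimage_mem_nhds (by
      simp only [hkP0]; exact extChartAt_source_mem_nhds (I := 𝓡∂ 2) q))
  have hPi : ∀ w ∈ V₁, ∀ w' ∈ V₁, P w = P w' → w = w' := fun w hw w' hw' he => by
    rw [← (hP w hw.1).2, ← (hP w' hw'.1).2, he]
  have := invariance_of_domain finrank_E2 finrank_E2 (h := fun w => e (k (P w)))
    ((continuousOn_extChartAt q).comp (hkP.mono inter_subset_left) fun w hw => hw.2)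
    (fun w hw w' hw' he => by
      have h1 := e.injOn hw.2 hw'.2 he
      obtain ⟨x, hx, hxP⟩ := hw.1.2
      obtain ⟨x', hx', hxP'⟩ := hw'.1.2
      simp only [← hxP, ← hxP', hkl x hx, hkl x' hx'] at h1
      exact hPi w hw.1 w' hw'.1 (by rw [← hxP, ← hxP', h1])) hV
  simp only [hkP0] at this
  have h2 : range (𝓡∂ 2) ∈ 𝓝 (e q) := by
    refine Filter.mem_of_superset this ?_
    rintro _ ⟨w, hw, rfl⟩
    exact extChartAt_target_subset_range (I := 𝓡∂ 2) q (e.map_source hw.2)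
  rw [← mem_interior_iff_mem_nhds, interior_range_modelWithCornersEuclideanHalfSpace] at h2
  have h3 := (mem_bdry_iff q).1 hq
  exact (ne_of_gt (show 0 < (e q) 0 from h2)) h3

section

variable [T2Space M] [CompactSpace M] {f : M → R3}

theorem IsLocallyConvexImmersion.notMem_bdry_of_pos (hf : IsLocallyConvexImmersion f) {q q' : M}
    (hq' : q' ∈ (extChartAt (𝓡∂ 2) q).source) (hpos : 0 < (extChartAt (𝓡∂ 2) q q') 0) :
    q' ∉ bdry M := by
  intro hb
  obtain ⟨U, -, K, h⟩ := hf.exists_localModel q' univ_mem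
  exact h.image_notMem_nhdsWithin hf.continuous hb
    (h.image_mem_nhdsWithin_of_pos hf.continuous hq' hpos)

theorem IsLocallyConvexImmersion.isClosed_bdry (hf : IsLocallyConvexImmersion f) :
    IsClosed (bdry M) := by
  rw [← isOpen_compl_iff, isOpen_iff_mem_nhds]
  intro q hq
  have hpos : 0 < (extChartAt (𝓡∂ 2) q q) 0 :=
    lt_of_le_of_ne (extChartAt_nonneg q q (mem_extChartAt_source q))
      fun h0 => hq ((mem_bdry_iff q).2 h0.symm)
  have hc : ContinuousAt (fun x => (extChartAt (𝓡∂ 2) q x) 0) q := by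
    have : Continuous fun w : E2 => w 0 := by fun_prop
    exact this.continuousAt.comp (continuousAt_extChartAt q)
  filter_upwards [hc.eventually (lt_mem_nhds hpos), extChartAt_source_mem_nhds (I := 𝓡∂ 2) q]
    with x hx1 hx2 using hf.notMem_bdry_of_pos hx2 hx1

theorem IsLocallyConvexImmersion.exists_notMem_bdry (hf : IsLocallyConvexImmersion f) (q : M)
    {N : Set M} (hN : N ∈ 𝓝 q) : ∃ x ∈ N, x ∉ bdry M := by
  set e := extChartAt (𝓡∂ 2) q
  have h1 : e.symm ⁻¹' N ∩ e.target ∈ 𝓝[range (𝓡∂ 2)] (e q) := by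
    refine inter_mem ?_ (extChartAt_target_mem_nhdsWithin q)
    have := (continuousAt_extChartAt_symm (I := 𝓡∂ 2) q)
    exact mem_nhdsWithin_of_mem_nhds (this.preimage_mem_nhds (by
      rwa [extChartAt_to_inv]))
  obtain ⟨s, hs, hsub⟩ := mem_nhdsWithin_iff_exists_mem_nhds_inter.1 h1
  set u : E2 := EuclideanSpace.single 0 1
  obtain ⟨t, ht1, ht0, -⟩ := (eventually_lineMap u hs).exists
  have hnn := extChartAt_nonneg q q (mem_extChartAt_source q)
  have hp : 0 < (e q + t • u) 0 := by
    simp only [u, PiLp.add_apply, PiLp.smul_apply, smul_eq_mul, PiLp.single_apply, if_true, mul_one]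
    exact add_pos_of_nonneg_of_pos hnn ht0
  have hmem := hsub ⟨ht1, by rw [range_modelWithCornersEuclideanHalfSpace]; exact hp.le⟩
  refine ⟨_, hmem.1, hf.notMem_bdry_of_pos (q := q) (e.map_target hmem.2) ?_⟩
  rw [e.right_inv hmem.2]
  exact hp

end

/-- A connected part of the boundary of the body, close to `f q` and disjoint from the image of
`∂M`, lies in the image of the surface or is disjoint from it. -/
theorem LocalModel.exists_subset_or_disjoint (hf : Continuous f) {q : M} {U : Set M} {K : Set R3}
    (h : LocalModel f q U K) : ∃ ε > 0, ∀ S ⊆ frontier K ∩ ball (f q) ε, IsPreconnected S →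
      (∀ b ∈ bdry M ∩ U, f b ∉ S) → S ⊆ f '' U ∨ Disjoint S (f '' U) := by
  obtain ⟨ε, hε, hs⟩ := h.sep hf (interior_mem_nhds.2 h.mem_nhds)
  refine ⟨ε, hε, fun S hS hc hb => ?_⟩
  have hloc : ∀ x ∈ S ∩ f '' U, ∃ O, IsOpen O ∧ x ∈ O ∧ O ∩ frontier K ⊆ f '' U := by
    rintro _ ⟨hx, y, hy, rfl⟩
    have hyi := hs y hy (hS hx).2
    exact mem_nhdsWithin.1 ((h.of_mem_interior hyi).image_mem_nhdsWithin hf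
      fun hyb => hb y ⟨hyb, hy⟩ hx)
  choose! O hO using hloc
  by_contra! hcon
  obtain ⟨h1, h2⟩ := hcon
  obtain ⟨z, hzS, hzU⟩ := not_subset.1 h1
  obtain ⟨y, hyS, hyU⟩ := not_disjoint_iff.1 h2
  obtain ⟨w, hwS, hw1, hw2⟩ := hc (⋃ x ∈ S ∩ f '' U, O x) (f '' U)ᶜ
    (isOpen_biUnion fun x hx => (hO x hx).1) (h.isClosed_image hf).isOpen_compl
    (fun x hx => by
      by_cases hxU : x ∈ f '' U
      · exact Or.inl (mem_biUnion ⟨hx, hxU⟩ (hO x ⟨hx, hxU⟩).2.1)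
      · exact Or.inr hxU)
    ⟨y, hyS, mem_biUnion ⟨hyS, hyU⟩ (hO y ⟨hyS, hyU⟩).2.1⟩ ⟨z, hzS, hzU⟩
  obtain ⟨x, hx, hxO⟩ := mem_iUnion₂.1 hw1
  exact hw2 ((hO x hx).2.2 ⟨hxO, (hS hwS).1⟩)

/-- Near a boundary point, the boundary of the surface is a regular curve. -/
theorem IsRegularParam.eventually_mem {f : M → R3} {k : ℕ} {φ : ℝ → bdry M}
    (hφ : IsRegularParam f k φ) {δ : ℝ} (hδ : 0 < δ) :
    ∀ᶠ x in 𝓝 (φ 0 : M), x ∈ bdry M → ∃ s, |s| < δ ∧ (φ s : M) = x := by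
  have h1 : φ '' ball 0 δ ∈ 𝓝 (φ 0) :=
    hφ.isOpenEmbedding.isOpenMap.image_mem_nhds (ball_mem_nhds _ hδ)
  rw [nhds_subtype_eq_comap, mem_comap] at h1
  obtain ⟨N, hN, hNs⟩ := h1
  filter_upwards [hN] with x hx hxb
  obtain ⟨s, hs, hsx⟩ := hNs (show (⟨x, hxb⟩ : bdry M) ∈ Subtype.val ⁻¹' N from hx)
  exact ⟨s, by simpa using hs, by rw [hsx]⟩

end Surface

/-! ### The cone of a convex body at a boundary point -/

/-- The cone of directions in which one can move from `x₀` inside `K`. -/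
def radialCone (K : Set R3) (x₀ : R3) : Set R3 := {w | ∃ t : ℝ, 0 < t ∧ x₀ + t • w ∈ K}

section RadialCone

variable {K : Set R3} {x₀ : R3}

theorem radialCone_smul {w : R3} (hw : w ∈ radialCone K x₀) {c : ℝ} (hc : 0 < c) :
    c • w ∈ radialCone K x₀ := by
  obtain ⟨t, ht, h⟩ := hw
  exact ⟨t / c, by positivity, by rwa [smul_smul, div_mul_cancel₀ _ hc.ne']⟩

theorem sub_mem_radialCone {y : R3} (hy : y ∈ K) : y - x₀ ∈ radialCone K x₀ :=
  ⟨1, one_pos, by simpa using hy⟩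

theorem IsConvexBody.add_smul_mem_of_le (hK : IsConvexBody K) (hx₀ : x₀ ∈ K) {w : R3} {t s : ℝ}
    (h : x₀ + t • w ∈ K) (hs : 0 ≤ s) (hst : s ≤ t) : x₀ + s • w ∈ K := by
  rcases eq_or_lt_of_le (hs.trans hst) with h0 | h0
  · obtain rfl : s = 0 := by linarith
    simpa using hx₀
  · have := hK.convex.lineMap_mem_set hx₀ h (t := s / t) ⟨by positivity, (div_le_one h0).2 hst⟩
    rwa [add_sub_cancel_left, smul_smul, div_mul_cancel₀ _ h0.ne'] at this

theorem IsConvexBody.radialCone_add (hK : IsConvexBody K) (hx₀ : x₀ ∈ K) {w₁ w₂ : R3}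
    (h₁ : w₁ ∈ radialCone K x₀) (h₂ : w₂ ∈ radialCone K x₀) : w₁ + w₂ ∈ radialCone K x₀ := by
  obtain ⟨t₁, ht₁, h₁⟩ := h₁
  obtain ⟨t₂, ht₂, h₂⟩ := h₂
  set t := min t₁ t₂
  have ht : 0 < t := lt_min ht₁ ht₂
  have a₁ := hK.add_smul_mem_of_le hx₀ h₁ ht.le (min_le_left _ _)
  have a₂ := hK.add_smul_mem_of_le hx₀ h₂ ht.le (min_le_right _ _)
  refine ⟨t / 2, by positivity, ?_⟩
  have := hK.convex.lineMap_mem_set a₁ a₂ (t := 1 / 2) ⟨by norm_num, by norm_num⟩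
  convert this using 1
  module

theorem IsConvexBody.convex_radialCone (hK : IsConvexBody K) (hx₀ : x₀ ∈ K) :
    Convex ℝ (radialCone K x₀) := by
  refine convex_iff_forall_pos.2 fun a ha b hb s t hs ht _ => ?_
  exact hK.radialCone_add hx₀ (radialCone_smul ha hs) (radialCone_smul hb ht)

theorem closure_radialCone_smul {w : R3} (hw : w ∈ closure (radialCone K x₀)) {c : ℝ} (hc : 0 < c)
    : c • w ∈ closure (radialCone K x₀) :=
  map_mem_closure (f := fun w : R3 => c • w) (by fun_prop) hw fun _ h => radialCone_smul h hc

theorem IsConvexBody.closure_radialCone_add (hK : IsConvexBody K) (hx₀ : x₀ ∈ K) {w₁ w₂ : R3}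
    (h₁ : w₁ ∈ closure (radialCone K x₀)) (h₂ : w₂ ∈ closure (radialCone K x₀)) :
    w₁ + w₂ ∈ closure (radialCone K x₀) :=
  map_mem_closure₂ continuous_add h₁ h₂ fun _ ha _ hb => hK.radialCone_add hx₀ ha hb

theorem sub_mem_interior_radialCone {o : R3} (ho : o ∈ interior K) :
    o - x₀ ∈ interior (radialCone K x₀) := by
  have hc : ContinuousAt (fun w : R3 => x₀ + w) (o - x₀) := by fun_prop
  rw [mem_interior_iff_mem_nhds]
  filter_upwards [hc.preimage_mem_nhds (by simpa using mem_interior_iff_mem_nhds.1 ho)] with w hw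
  exact ⟨1, one_pos, by simpa using hw⟩

/-- Directions in the interior of the closed cone lead into the interior of the body. -/
theorem IsConvexBody.exists_ray_mem_interior (hK : IsConvexBody K) (hx₀ : x₀ ∈ K) {w : R3}
    (hw : w ∈ interior (closure (radialCone K x₀))) :
    ∃ N ∈ 𝓝 w, ∃ t > 0, ∀ w' ∈ N, ∀ s ∈ Ioc (0 : ℝ) t, x₀ + s • w' ∈ interior K := by
  obtain ⟨o, ho⟩ := hK.interior_nonempty
  rw [(hK.convex_radialCone hx₀).interior_closure_eq_interior_of_nonempty_interior
    ⟨_, sub_mem_interior_radialCone ho⟩] at hw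
  obtain ⟨ε, hε, hε0, -⟩ := (eventually_lineMap (w - (o - x₀))
    (mem_interior_iff_mem_nhds.1 hw)).exists
  obtain ⟨t', ht', hw'⟩ := hε
  set t := min t' 1
  have ht : 0 < t := lt_min ht' one_pos
  have h1 := hK.add_smul_mem_of_le hx₀ hw' ht.le (min_le_left _ _)
  have h2 : x₀ + t • (o - x₀) ∈ interior K := by
    have := hK.convex.lineMap_mem_interior ho hx₀ (t := 1 - t)
      ⟨by linarith [min_le_right t' 1], by linarith⟩
    convert this using 1
    module
  have h3 : x₀ + t • w ∈ interior K := by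
    have := hK.convex.lineMap_mem_interior h2 h1 (t := 1 / (1 + ε))
      ⟨by positivity, (div_lt_one (by positivity)).2 (by linarith)⟩
    convert this using 1
    have e : x₀ + t • (w + ε • (w - (o - x₀))) - (x₀ + t • (o - x₀)) =
      (1 + ε) • t • (w - (o - x₀)) := by module
    rw [e, smul_smul, one_div_mul_cancel (by positivity)]
    module
  have hc : Continuous fun w : R3 => x₀ + t • w := by fun_prop
  refine ⟨_, hc.continuousAt.preimage_mem_nhds (isOpen_interior.mem_nhds h3), t, ht,
    fun w' hw' s hs => ?_⟩
  have := hK.convex.lineMap_mem_interior hw' hx₀ (t := 1 - s / t)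
    ⟨by rw [sub_nonneg, div_le_one ht]; exact hs.2, by linarith [div_pos hs.1 ht]⟩
  convert this using 1
  have e : x₀ - (x₀ + t • w') = -(t • w') := by module
  rw [e, smul_neg, smul_smul]
  have e2 : (1 - s / t) * t = t - s := by field_simp
  rw [e2]
  module

theorem IsConvexBody.zero_notMem_interior (hK : IsConvexBody K) (hx₀ : x₀ ∈ frontier K) :
    (0 : R3) ∉ interior (closure (radialCone K x₀)) := by
  intro h
  obtain ⟨N, hN, t, ht, h2⟩ := hK.exists_ray_mem_interior (hK.frontier_subset hx₀) h
  have := h2 0 (mem_of_mem_nhds hN) t ⟨ht, le_rfl⟩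
  rw [smul_zero, add_zero] at this
  exact hx₀.2 this

theorem IsConvexBody.add_smul_mem_interior (hK : IsConvexBody K) (hx₀ : x₀ ∈ K) {o w : R3}
    (ho : o ∈ interior K) (hw : w ∈ closure (radialCone K x₀)) {c : ℝ} (hc : 0 < c) :
    w + c • (o - x₀) ∈ interior (closure (radialCone K x₀)) := by
  have h1 := sub_mem_interior_radialCone (x₀ := x₀) ho
  rw [mem_interior_iff_mem_nhds] at h1 ⊢
  have hcont : ContinuousAt (fun y : R3 => c⁻¹ • (y - w)) (w + c • (o - x₀)) := by fun_prop
  filter_upwards [hcont.preimage_mem_nhds (by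
    rwa [add_sub_cancel_left, smul_smul, inv_mul_cancel₀ hc.ne', one_smul])] with y hy
  have h2 := hK.closure_radialCone_add hx₀ hw
    (subset_closure (radialCone_smul (mem_preimage.1 hy) hc))
  rwa [smul_smul, mul_inv_cancel₀ hc.ne', one_smul, add_sub_cancel] at h2

end RadialCone

/-- If no point of a closed set `Z` of directions is a limit direction of `Y` at `x₀`, then the
points of `Y` near `x₀` avoid these directions. -/
theorem exists_avoid_directions {x₀ : R3} {Y Z : Set R3} (hZ : IsClosed Z)
    (h : ∀ w ∈ Z, ‖w‖ = 1 → ∃ N ∈ 𝓝 w, ∃ t > 0, ∀ w' ∈ N, ∀ s ∈ Ioc (0 : ℝ) t, x₀ + s • w' ∉ Y) :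
    ∃ t > 0, ∀ y ∈ Y, y ≠ x₀ → dist y x₀ ≤ t → ‖y - x₀‖⁻¹ • (y - x₀) ∉ Z := by
  have hcomp : IsCompact (sphere (0 : R3) 1 ∩ Z) := (isCompact_sphere 0 1).inter_right hZ
  obtain ⟨t, ht, htY⟩ : ∃ t > 0, ∀ w ∈ sphere (0 : R3) 1 ∩ Z,
      ∀ s ∈ Ioc (0 : ℝ) t, x₀ + s • w ∉ Y := by
    refine hcomp.induction_on (p := fun A => ∃ t > 0, ∀ w ∈ A, ∀ s ∈ Ioc (0 : ℝ) t, x₀ + s • w ∉ Y)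
      ⟨1, one_pos, by simp⟩ ?_ ?_ ?_
    · rintro A B hAB ⟨t, ht, hB⟩
      exact ⟨t, ht, fun w hw => hB w (hAB hw)⟩
    · rintro A B ⟨t, ht, hA⟩ ⟨t', ht', hB⟩
      refine ⟨min t t', lt_min ht ht', ?_⟩
      rintro w (hw | hw) s hs
      · exact hA w hw s ⟨hs.1, hs.2.trans (min_le_left _ _)⟩
      · exact hB w hw s ⟨hs.1, hs.2.trans (min_le_right _ _)⟩
    · rintro w ⟨hw1, hw2⟩
      obtain ⟨N, hN, t, ht, hNt⟩ := h w hw2 (by simpa using hw1)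
      exact ⟨N, mem_nhdsWithin_of_mem_nhds hN, t, ht, hNt⟩
  refine ⟨t, ht, fun y hy hne hd hyZ => ?_⟩
  have hpos : 0 < ‖y - x₀‖ := norm_pos_iff.2 (sub_ne_zero.2 hne)
  refine htY _ ⟨?_, hyZ⟩ ‖y - x₀‖ ⟨hpos, by rwa [← dist_eq_norm]⟩ ?_
  · rw [mem_sphere_zero_iff_norm, norm_smul, norm_inv, norm_norm, inv_mul_cancel₀ hpos.ne']
  · rw [smul_smul, mul_inv_cancel₀ hpos.ne', one_smul]
    simpa using hy

/-! ### The sides of the boundary curve -/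

section Side

variable {M : Type*} [TopologicalSpace M] [ChartedSpace (EuclideanHalfSpace 2) M]

/-- Near a boundary point, the boundary curve divides the boundary of the body into two sides, one
of which is the image of the surface. Points `y` near `f p` are written as `γ(s) + h e + l v`, with
`v` the direction from an interior point of the body to `f p`, and `e` orthogonal to `v` and to the
curve; the surface is the side `h ≥ 0`. -/
theorem LocalModel.exists_side [T2Space M] [CompactSpace M] {f : M → R3}
    (hf : IsLocallyConvexImmersion f) {p : M} {U : Set M} {K : Set R3} (h : LocalModel f p U K)
    {φ : ℝ → bdry M} (hφ : IsRegularParam f 2 φ) (hφp : (φ 0 : M) = p) {o : R3}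
    (ho : o ∈ interior K) {t e : R3} (ht : 0 < ⟪t, deriv (boundaryCurve f φ) 0⟫) (he : ‖e‖ = 1)
    (hte : ⟪t, e⟫ = 0) (htv : ⟪t, f p - o⟫ = 0) (hev : ⟪e, f p - o⟫ = 0) :
    ∃ σ : ℝ, (σ = 1 ∨ σ = -1) ∧ ∀ ρ > 0, ∀ᶠ y in 𝓝[frontier K] (f p), ∃ s k l : ℝ, |s| < ρ ∧
      y = boundaryCurve f φ s + k • (σ • e) + l • (f p - o) ∧ (y ∈ f '' U ↔ 0 ≤ k) := by
  set γ := boundaryCurve f φ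
  set v := f p - o
  have hfc := hf.continuous
  have hγ2 : ContDiff ℝ 2 γ := hφ.contDiff
  have hγc : Continuous γ := hγ2.continuous
  have hγ0 : γ 0 = f p := by simp only [γ, boundaryCurve, hφp]
  have hx₀ : f p ∈ frontier K := h.maps p h.mem
  have hv0 : v ≠ 0 := by
    intro h0
    rw [sub_eq_zero] at h0
    exact hx₀.2 (h0 ▸ ho)
  have hpb : p ∈ bdry M := hφp ▸ (φ 0).2
  obtain ⟨π, ι, hπι, -, hdec, -, hπv⟩ := exists_orthogonal_coordinates hv0
  have hker : ∀ w, π w = 0 → ∃ s : ℝ, w = s • v := fun w hw => ⟨_, by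
    have := hdec w; rw [hw, map_zero, zero_add] at this; exact this⟩
  obtain ⟨r, hr, P, hPc, hP0, hP, ε₀, hε₀, hPinv⟩ := h.body.convex.exists_frontier_chart
    h.body.isClosed (x₀ := f p) (v := v) (by simpa [v] using ho) hx₀ hπι hπv hker
  obtain ⟨ε₁, hε₁, hconn⟩ := h.exists_subset_or_disjoint hfc
  -- the curve is monotone in the direction `t` near `0`
  obtain ⟨δ, hδ, hmono⟩ : ∃ δ > 0, InjOn (fun s => ⟪t, γ s⟫) (ball 0 δ) := by
    have hd : ∀ s, HasDerivAt (fun s => ⟪t, γ s⟫) ⟪t, deriv γ s⟫ s := fun s => by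
      simpa using (hasDerivAt_const s t).inner ℝ (hγ2.differentiable (by norm_num) s).hasDerivAt
    have hcd : Continuous fun s => ⟪t, deriv γ s⟫ :=
      continuous_const.inner (hγ2.continuous_deriv (by norm_num))
    obtain ⟨δ, hδ, hb⟩ := Metric.mem_nhds_iff.1 (hcd.continuousAt.preimage_mem_nhds
      (lt_mem_nhds ht))
    refine ⟨δ, hδ, (strictMonoOn_of_deriv_pos (convex_ball 0 δ)
      (fun s _ => (hd s).continuousAt.continuousWithinAt) fun s hs => ?_).injOn⟩
    rw [(hd s).deriv]
    exact hb (interior_subset hs)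
  obtain ⟨ε₂, hε₂, hsep⟩ := h.sep hfc (hφp ▸ hφ.eventually_mem hδ)
  have hbd : ∀ b ∈ bdry M ∩ U, dist (f b) (f p) < ε₂ → ∃ s, |s| < δ ∧ f b = γ s := by
    rintro b ⟨hb, hbU⟩ hd
    obtain ⟨s, hs, hsb⟩ := hsep b hbU hd hb
    exact ⟨s, hs, by simp only [γ, boundaryCurve, hsb]⟩
  let Q : ℝ × ℝ → E2 := fun z => π (γ z.1 - f p) + z.2 • π e
  have hQc : Continuous Q := by fun_prop
  have hQ0 : Q 0 = 0 := by simp [Q, hγ0]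
  have hπ0 : ∀ x, π x = 0 → ⟪t, x⟫ = 0 ∧ ⟪e, x⟫ = 0 := by
    intro x hx
    obtain ⟨l, rfl⟩ := hker x hx
    simp [inner_smul_right, htv, hev]
  have hQi : ∀ z z' : ℝ × ℝ, |z.1| < δ → |z'.1| < δ → Q z = Q z' → z = z' := by
    intro z z' hz hz' hzz
    have h0 : π (γ z.1 - γ z'.1 + (z.2 - z'.2) • e) = 0 := by
      have e1 : π (γ z.1 - γ z'.1 + (z.2 - z'.2) • e) = Q z - Q z' := by
        simp only [Q, map_sub, map_add, map_smul]
        module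
      rw [e1, hzz, sub_self]
    obtain ⟨h1, h2⟩ := hπ0 _ h0
    rw [inner_add_smul, hte, mul_zero, add_zero, inner_sub_right,
      sub_eq_zero] at h1
    have h3 : z.1 = z'.1 := hmono (by simpa using hz) (by simpa using hz') h1
    rw [h3, sub_self, zero_add, inner_smul_right, real_inner_self_eq_norm_sq, he] at h2
    exact Prod.ext h3 (by linarith)
  obtain ⟨ρ₀, hρ₀, hbox⟩ : ∃ ρ₀ > 0, ∀ z : ℝ × ℝ, ‖z‖ < ρ₀ → Q z ∈ ball 0 r ∧
      dist (P (Q z)) (f p) < min ε₁ ε₂ ∧ (φ z.1 : M) ∈ U ∧ dist (γ z.1) (f p) < ε₀ ∧ |z.1| < δ := by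
    have hb : ball (0 : E2) r ∈ 𝓝 0 := ball_mem_nhds _ hr
    have hQt : Tendsto Q (𝓝 0) (𝓝 0) := by
      have := hQc.tendsto 0; rwa [hQ0] at this
    have hPt : Tendsto P (𝓝 0) (𝓝 (f p)) := by
      have := (hPc.continuousAt hb).tendsto; rwa [hP0] at this
    have hφt : Tendsto (fun z : ℝ × ℝ => (φ z.1 : M)) (𝓝 0) (𝓝 p) := by
      have : Continuous fun z : ℝ × ℝ => (φ z.1 : M) :=
        continuous_subtype_val.comp (hφ.isOpenEmbedding.continuous.comp continuous_fst)
      have := this.tendsto 0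
      rwa [Prod.fst_zero, hφp] at this
    have hγt : Tendsto (fun z : ℝ × ℝ => γ z.1) (𝓝 0) (𝓝 (f p)) := by
      have := (hγc.comp continuous_fst).tendsto (0 : ℝ × ℝ)
      rwa [Function.comp_apply, Prod.fst_zero, hγ0] at this
    have h5 : ∀ᶠ z : ℝ × ℝ in 𝓝 0, |z.1| < δ := by
      have : Continuous fun z : ℝ × ℝ => |z.1| := by fun_prop
      exact this.continuousAt.eventually (gt_mem_nhds (by simpa using hδ))
    have hall := (hQt.eventually hb).and (((hPt.comp hQt).eventually
      (ball_mem_nhds (f p) (lt_min hε₁ hε₂))).and ((hφt.eventually h.mem_nhds).and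
      ((hγt.eventually (ball_mem_nhds (f p) hε₀)).and h5)))
    obtain ⟨ρ₀, hρ₀, hb⟩ := Metric.eventually_nhds_iff.1 hall
    exact ⟨ρ₀, hρ₀, fun z hz => hb (by simpa [dist_zero_right] using hz)⟩
  have hPγ : ∀ z : ℝ × ℝ, ‖z‖ < ρ₀ → z.2 = 0 → P (Q z) = γ z.1 := by
    intro z hz hz2
    have h1 : Q z = π (γ z.1 - f p) := by simp [Q, hz2]
    rw [h1]
    exact (hPinv _ (h.maps _ (hbox z hz).2.2.1) (hbox z hz).2.2.2.1).2
  let S : ℝ → Set R3 := fun σ => (fun z => P (Q z)) '' (ball (0 : ℝ × ℝ) ρ₀ ∩ {z | 0 < σ * z.2})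
  have hS : ∀ σ, S σ ⊆ f '' U ∨ Disjoint (S σ) (f '' U) := by
    intro σ
    have hconv : Convex ℝ (ball (0 : ℝ × ℝ) ρ₀ ∩ {z | 0 < σ * z.2}) :=
      (convex_ball _ _).inter (convex_halfSpace_gt (f := fun z : ℝ × ℝ => σ * z.2)
        (σ • LinearMap.snd ℝ ℝ ℝ).isLinear 0)
    refine hconn _ ?_ (hconv.isPreconnected.image _ (hPc.comp hQc.continuousOn ?_)) ?_
    · rintro _ ⟨z, ⟨hz, -⟩, rfl⟩
      have hz' := hbox z (by simpa using hz)
      exact ⟨(hP _ hz'.1).1, hz'.2.1.trans_le (min_le_left _ _)⟩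
    · rintro z ⟨hz, -⟩
      exact (hbox z (by simpa using hz)).1
    · rintro b hb ⟨z, ⟨hz, hzσ⟩, hzb⟩
      have hz' := hbox z (by simpa using hz)
      simp only at hzb
      obtain ⟨s, hs, hbs⟩ := hbd b hb (by rw [← hzb]; exact hz'.2.1.trans_le (min_le_right _ _))
      have h1 : Q z = Q (s, 0) := by
        rw [← (hP _ hz'.1).2, hzb, hbs]; simp [Q]
      have := hQi z (s, 0) hz'.2.2.2.2 hs h1
      rw [this] at hzσ
      simp at hzσ
  have hNB : ∀ ρ > 0, ∀ᶠ y in 𝓝[frontier K] (f p),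
      ∃ z : ℝ × ℝ, ‖z‖ < ρ ∧ ‖z‖ < ρ₀ ∧ y = P (Q z) := by
    intro ρ hρ
    have h1 := invariance_of_domain (V := ℝ × ℝ) (by simp) finrank_E2 (h := Q)
      (U := ball 0 (min ρ ρ₀)) (x := 0) hQc.continuousOn (fun z hz z' hz' => hQi z z'
        (hbox z ((mem_ball_zero_iff.1 hz).trans_le (min_le_right _ _))).2.2.2.2
        (hbox z' ((mem_ball_zero_iff.1 hz').trans_le (min_le_right _ _))).2.2.2.2)
      (ball_mem_nhds _ (lt_min hρ hρ₀))
    rw [hQ0] at h1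
    have hc : ContinuousAt (fun y => π (y - f p)) (f p) := by fun_prop
    filter_upwards [mem_nhdsWithin_of_mem_nhds (hc.preimage_mem_nhds (by simpa using h1)),
      mem_nhdsWithin_of_mem_nhds (ball_mem_nhds (f p) hε₀), self_mem_nhdsWithin]
      with y ⟨z, hz, hzy⟩ hy2 hy3
    rw [mem_ball_zero_iff] at hz
    refine ⟨z, hz.trans_le (min_le_left _ _), hz.trans_le (min_le_right _ _), ?_⟩
    rw [hzy]
    exact (hPinv y hy3 hy2).2.symm
  obtain ⟨σ, hσ, hσ1, hσ2⟩ : ∃ σ : ℝ, (σ = 1 ∨ σ = -1) ∧ S σ ⊆ f '' U ∧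
      Disjoint (S (-σ)) (f '' U) := by
    have hboth : ¬ (S 1 ⊆ f '' U ∧ S (-1) ⊆ f '' U) := by
      rintro ⟨h1, h2⟩
      refine h.image_notMem_nhdsWithin hfc hpb ?_
      filter_upwards [hNB 1 one_pos] with y ⟨z, _, hz, hzy⟩
      rw [hzy]
      rcases lt_trichotomy z.2 0 with hlt | heq | hgt
      · exact h2 ⟨z, ⟨by simpa using hz, by simpa using hlt⟩, rfl⟩
      · rw [hPγ z hz heq]
        exact ⟨φ z.1, (hbox z hz).2.2.1, rfl⟩
      · exact h1 ⟨z, ⟨by simpa using hz, by simpa using hgt⟩, rfl⟩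
    have hnone : ¬ (Disjoint (S 1) (f '' U) ∧ Disjoint (S (-1)) (f '' U)) := by
      rintro ⟨h1, h2⟩
      obtain ⟨N, hN, hNy⟩ := mem_nhdsWithin_iff_exists_mem_nhds_inter.1 (hNB 1 one_pos)
      obtain ⟨x, ⟨hxN, hxU⟩, hxb⟩ := hf.exists_notMem_bdry p
        (inter_mem (hfc.continuousAt.preimage_mem_nhds hN) h.mem_nhds)
      obtain ⟨z, -, hz, hzy⟩ := hNy ⟨hxN, h.maps x hxU⟩
      rcases lt_trichotomy z.2 0 with hlt | heq | hgt
      · exact disjoint_left.1 h2 ⟨z, ⟨by simpa using hz, by simpa using hlt⟩, rfl⟩ ⟨x, hxU, hzy⟩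
      · rw [hPγ z hz heq] at hzy
        have := h.injOn hxU (hbox z hz).2.2.1 hzy
        exact hxb (this ▸ (φ z.1).2)
      · exact disjoint_left.1 h1 ⟨z, ⟨by simpa using hz, by simpa using hgt⟩, rfl⟩ ⟨x, hxU, hzy⟩
    rcases hS 1 with h1 | h1
    · exact ⟨1, Or.inl rfl, h1, (hS (-1)).resolve_left fun h2 => hboth ⟨h1, h2⟩⟩
    · exact ⟨-1, Or.inr rfl, (hS (-1)).resolve_right fun h2 => hnone ⟨h1, h2⟩, by rwa [neg_neg]⟩
  refine ⟨σ, hσ, fun ρ hρ => ?_⟩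
  have hσσ : σ * σ = 1 := by rcases hσ with rfl | rfl <;> norm_num
  filter_upwards [hNB ρ hρ] with y ⟨z, hzρ, hz, hzy⟩
  have hz' := hbox z hz
  obtain ⟨l, hl⟩ := hker (y - f p - (γ z.1 - f p + z.2 • e)) (by
    rw [map_sub, hzy, (hP _ hz'.1).2, map_add, map_smul]
    exact sub_self _)
  refine ⟨z.1, σ * z.2, l, (norm_fst_le z).trans_lt hzρ, ?_, ?_⟩
  · have e1 : (σ * z.2) • σ • e = z.2 • e := by
      rw [smul_smul]; congr 1; linear_combination z.2 * hσσ
    rw [e1, ← hl]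
    abel
  · rw [hzy]
    rcases lt_trichotomy (σ * z.2) 0 with hlt | heq | hgt
    · refine iff_of_false (fun hU => ?_) (not_le.2 hlt)
      exact disjoint_left.1 hσ2 ⟨z, ⟨by simpa using hz, by
        simpa using hlt⟩, rfl⟩ hU
    · have hz2 : z.2 = 0 := by
        rcases mul_eq_zero.1 heq with h0 | h0
        · rw [h0] at hσσ; norm_num at hσσ
        · exact h0
      refine iff_of_true ?_ heq.ge
      rw [hPγ z hz hz2]
      exact ⟨φ z.1, hz'.2.2.1, rfl⟩
    · exact iff_of_true (hσ1 ⟨z, ⟨by simpa using hz, hgt⟩, rfl⟩) hgt.le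

end Side

/-! ### The frame of a boundary point -/

/-- Three orthonormal vectors form a basis of three-space. -/
theorem orthonormal_decomp {a b c : R3} (ha : ‖a‖ = 1) (hb : ‖b‖ = 1) (hc : ‖c‖ = 1)
    (hab : ⟪a, b⟫ = 0) (hac : ⟪a, c⟫ = 0) (hbc : ⟪b, c⟫ = 0) (x : R3) :
    x = ⟪a, x⟫ • a + ⟪b, x⟫ • b + ⟪c, x⟫ • c := by
  obtain ⟨t, ht, -, -, hdec⟩ := exists_third_unit ha hb hab
  have h1 := hdec c
  rw [hac, hbc, zero_smul, zero_smul, zero_add, zero_add] at h1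
  have h2 : ⟪t, c⟫ * ⟪t, c⟫ = 1 := by
    have h3 : ⟪c, c⟫ = (1 : ℝ) := by rw [real_inner_self_eq_norm_sq, hc, one_pow]
    nth_rewrite 1 [h1] at h3
    rwa [inner_smul_left] at h3
  have h3 : ⟪c, x⟫ • c = ⟪t, x⟫ • t := by
    rw [h1, inner_smul_left, smul_smul]
    congr 1
    simp only [conj_trivial]
    linear_combination ⟪t, x⟫ * h2
  rw [h3]
  exact hdec x

/-- The local data at a boundary point `p`: a local model `(U, K)`, a parametrization `φ` of the
boundary curve, its unit tangent vector `T`, the outward normal `n` and the conormal `ν`. -/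
structure BoundaryFrame {M : Type*} [TopologicalSpace M] [ChartedSpace (EuclideanHalfSpace 2) M]
    (f : M → R3) (p : M) (U : Set M) (K : Set R3) (φ : ℝ → bdry M) (T n ν : R3) : Prop where
  model : LocalModel f p U K
  param : IsRegularParam f 2 φ
  param_zero : (φ 0 : M) = p
  norm_T : ‖T‖ = 1
  norm_n : ‖n‖ = 1
  norm_ν : ‖ν‖ = 1
  inner_nT : ⟪n, T⟫ = 0
  inner_nν : ⟪n, ν⟫ = 0
  inner_Tν : ⟪T, ν⟫ = 0
  deriv_eq : ∃ τ : ℝ, 0 < τ ∧ deriv (boundaryCurve f φ) 0 = τ • T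
  le : ∀ y ∈ K, ⟪n, y - f p⟫ ≤ 0
  limit : ∀ η > 0, ∀ᶠ x in 𝓝 p, |⟪n, f x - f p⟫| ≤ η * ‖f x - f p‖ ∧
    -(η * ‖f x - f p‖) ≤ ⟪ν, f x - f p⟫
  side : ∀ η > 0, ∃ η' > 0, ∀ᶠ y in 𝓝[frontier K] (f p), |⟪n, y - f p⟫| ≤ η' * ‖y - f p‖ →
    η * ‖y - f p‖ ≤ ⟪ν, y - f p⟫ → y ∈ f '' U
  fine : ∃ e : R3, ⟪e, T⟫ = 0 ∧ 0 < ⟪e, ν⟫ ∧ ∀ ρ > 0, ∀ᶠ y in 𝓝[frontier K] (f p),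
    ∃ s k : ℝ, |s| < ρ ∧ ⟪e, y - f p⟫ = ⟪e, boundaryCurve f φ s - f p⟫ + k ∧ (y ∈ f '' U ↔ 0 ≤ k)
  attained : ∀ η > 0, ∀ N ∈ 𝓝 p, ∃ x ∈ N, f x ≠ f p ∧
    ‖f x - f p - ‖f x - f p‖ • ν‖ ≤ η * ‖f x - f p‖

section Frame

variable {M : Type*} [TopologicalSpace M] [ChartedSpace (EuclideanHalfSpace 2) M]

set_option maxHeartbeats 800000 in
/-- At each boundary point the tangent cone is a half-plane, one of the two faces of the tangent
wedge of the body. -/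
theorem LocalModel.exists_boundaryFrame [T2Space M] [CompactSpace M] {f : M → R3}
    (hf : IsLocallyConvexImmersion f) {p : M} {U : Set M} {K : Set R3} (h : LocalModel f p U K)
    {φ : ℝ → bdry M} (hφ : IsRegularParam f 2 φ) (hφp : (φ 0 : M) = p) :
    ∃ T n ν, BoundaryFrame f p U K φ T n ν := by
  set γ := boundaryCurve f φ
  have hfc := hf.continuous
  have hγ2 : ContDiff ℝ 2 γ := hφ.contDiff
  have hγ0 : γ 0 = f p := by simp only [γ, boundaryCurve, hφp]
  have hx₀ : f p ∈ frontier K := h.maps p h.mem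
  have hx₀K : f p ∈ K := h.body.frontier_subset hx₀
  obtain ⟨o, ho⟩ := h.body.interior_nonempty
  set v := f p - o with hv
  set Tc := closure (radialCone K (f p))
  set T₀ := deriv γ 0
  have hT₀ : 0 < ‖T₀‖ := norm_pos_iff.2 (hφ.deriv_ne_zero 0)
  set T := ‖T₀‖⁻¹ • T₀
  have hT1 : ‖T‖ = 1 := norm_inv_norm_smul (norm_pos_iff.1 hT₀)
  have hT₀T : T₀ = ‖T₀‖ • T := by rw [smul_smul, mul_inv_cancel₀ hT₀.ne', one_smul]
  have hfo := tendsto_first_order hγ2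
  have hγK : ∀ᶠ s in 𝓝 (0 : ℝ), γ s ∈ K := by
    have hc : ContinuousAt (fun s => (φ s : M)) 0 :=
      (continuous_subtype_val.comp hφ.isOpenEmbedding.continuous).continuousAt
    filter_upwards [hc.preimage_mem_nhds (by rw [hφp]; exact h.mem_nhds)] with s hs
    exact h.body.frontier_subset (h.maps _ hs)
  -- the cone contains the tangent line, but not the direction from the interior point
  have hTmem : ∀ c : ℝ, c • T ∈ Tc := by
    have h1 : T₀ ∈ Tc := by
      have h2 : Tendsto (fun s : ℝ => s⁻¹ • (γ s - γ 0)) (𝓝[>] 0) (𝓝 T₀) :=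
        hfo.mono_left (nhdsWithin_mono _ fun s hs => ne_of_gt hs)
      refine mem_closure_of_tendsto h2 ?_
      filter_upwards [self_mem_nhdsWithin, nhdsWithin_le_nhds hγK] with s hs hsK
      rw [hγ0]
      exact radialCone_smul (sub_mem_radialCone hsK) (inv_pos.2 hs)
    have h2 : -T₀ ∈ Tc := by
      have h2 : Tendsto (fun s : ℝ => -(s⁻¹ • (γ s - γ 0))) (𝓝[<] 0) (𝓝 (-T₀)) :=
        (hfo.mono_left (nhdsWithin_mono _ fun s hs => ne_of_lt hs)).neg
      refine mem_closure_of_tendsto h2 ?_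
      filter_upwards [self_mem_nhdsWithin, nhdsWithin_le_nhds hγK] with s hs hsK
      rw [hγ0, ← neg_smul]
      exact radialCone_smul (sub_mem_radialCone hsK) (neg_pos.2 (inv_lt_zero.2 hs))
    intro c
    rcases lt_trichotomy c 0 with hc | rfl | hc
    · have := closure_radialCone_smul h2 (c := -c * ‖T₀‖⁻¹) (by
        have := neg_pos.2 hc; positivity)
      convert this using 1
      simp only [T]; module
    · have := h.body.closure_radialCone_add hx₀K h1 h2
      rwa [add_neg_cancel, ← zero_smul ℝ T] at this
    · have := closure_radialCone_smul h1 (c := c * ‖T₀‖⁻¹) (by positivity)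
      convert this using 1
      simp only [T]; module
  clear_value T
  have hvint : -v ∈ interior Tc := by
    have := interior_mono subset_closure (sub_mem_interior_radialCone (x₀ := f p) ho)
    rwa [hv, neg_sub]
  have hvT : v ∉ Tc := by
    intro hmem
    have := h.body.add_smul_mem_interior hx₀K ho hmem one_pos
    rw [one_smul, hv, sub_add_sub_cancel, sub_self] at this
    exact h.body.zero_notMem_interior hx₀ this
  have hvpos : ∀ {c : ℝ}, 0 < c → c • v ∉ Tc := by
    intro c hc hmem
    have := closure_radialCone_smul hmem (inv_pos.2 hc)
    rw [smul_smul, inv_mul_cancel₀ hc.ne', one_smul] at this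
    exact hvT this
  have hTv : ∀ a : ℝ, T ≠ a • v := by
    intro a ha
    rcases lt_trichotomy a 0 with h0 | rfl | h0
    · refine hvpos (neg_pos.2 h0) ?_
      rw [neg_smul, ← ha, ← neg_one_smul ℝ]
      exact hTmem _
    · rw [zero_smul] at ha
      rw [ha, norm_zero] at hT1
      exact zero_ne_one hT1
    · exact hvpos h0 (ha ▸ by simpa using hTmem 1)
  have hv0 : 0 < ‖v‖ := by
    rw [norm_pos_iff]
    intro h0
    exact hvT (h0 ▸ by simpa using hTmem 0)
  set w₁ := ‖v‖⁻¹ • v with hw₁v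
  have hw₁ : ‖w₁‖ = 1 := norm_inv_norm_smul (norm_pos_iff.1 hv0)
  have hvw : v = ‖v‖ • w₁ := by rw [smul_smul, mul_inv_cancel₀ hv0.ne', one_smul]
  set T₁ := T - ⟪w₁, T⟫ • w₁
  have hT₁ : 0 < ‖T₁‖ := by
    rw [norm_pos_iff]
    intro h0
    refine hTv (⟪w₁, T⟫ * ‖v‖⁻¹) ?_
    rw [← smul_smul]
    exact sub_eq_zero.1 h0
  set t := ‖T₁‖⁻¹ • T₁
  have ht1 : ‖t‖ = 1 := norm_inv_norm_smul (norm_pos_iff.1 hT₁)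
  have hw₁T₁ : ⟪w₁, T₁⟫ = 0 := by
    simp only [T₁, inner_sub_right, inner_smul_right, real_inner_self_eq_norm_sq, hw₁]; ring
  have htw : ⟪t, w₁⟫ = 0 := by
    rw [real_inner_comm, inner_smul_right, hw₁T₁, mul_zero]
  have hTt : T = ‖T₁‖ • t + ⟪w₁, T⟫ • w₁ := by
    rw [smul_smul, mul_inv_cancel₀ hT₁.ne', one_smul]; simp only [T₁]; abel
  clear_value t T₁ w₁
  have htT : ⟪t, T⟫ = ‖T₁‖ := by
    rw [hTt, inner_add_smul, inner_smul_right, htw,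
      real_inner_self_eq_norm_sq, ht1]; ring
  have htv : ⟪t, v⟫ = 0 := by rw [hvw, inner_smul_right, htw, mul_zero]
  obtain ⟨e₀, he₀, hte₀, hwe₀, hdec₀⟩ := exists_third_unit ht1 hw₁ htw
  have hev₀ : ⟪e₀, v⟫ = 0 := by
    rw [hvw, inner_smul_right, real_inner_comm, hwe₀, mul_zero]
  have heT₀ : ⟪e₀, T⟫ = 0 := by
    rw [hTt, inner_add_smul, inner_smul_right, real_inner_comm t,
      real_inner_comm w₁, hte₀, hwe₀]; ring
  obtain ⟨σ, hσ, hside⟩ := h.exists_side hf hφ hφp ho (t := t) (e := e₀) (by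
    show 0 < ⟪t, T₀⟫
    rw [hT₀T, inner_smul_right, htT]; positivity) he₀ hte₀ htv hev₀
  have hσσ : σ * σ = 1 := by rcases hσ with rfl | rfl <;> norm_num
  set e := σ • e₀
  have he1 : ‖e‖ = 1 := by
    rw [norm_smul, he₀, mul_one]; rcases hσ with rfl | rfl <;> simp
  have hev : ⟪e, v⟫ = 0 := by rw [inner_smul_left, hev₀, mul_zero]
  have heT : ⟪e, T⟫ = 0 := by rw [inner_smul_left, heT₀, mul_zero]
  have hte : ⟪t, e⟫ = 0 := by rw [inner_smul_right, hte₀, mul_zero]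
  have hee : ⟪e, e⟫ = (1 : ℝ) := by rw [real_inner_self_eq_norm_sq, he1, one_pow]
  have hdec : ∀ x, ∃ a m : ℝ, x = a • T + ⟪e, x⟫ • e + m • v := by
    intro x
    refine ⟨⟪t, x⟫ / ‖T₁‖, (⟪w₁, x⟫ - ⟪t, x⟫ / ‖T₁‖ * ⟪w₁, T⟫) * ‖v‖⁻¹, ?_⟩
    have e1 : ⟪e, x⟫ • e = ⟪e₀, x⟫ • e₀ := by
      simp only [e, inner_smul_left, smul_smul, conj_trivial]
      congr 1; linear_combination ⟪e₀, x⟫ * hσσ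
    have e2 : (⟪t, x⟫ / ‖T₁‖) • T = ⟪t, x⟫ • t + (⟪t, x⟫ / ‖T₁‖ * ⟪w₁, T⟫) • w₁ := by
      conv_lhs => rw [hTt]
      rw [smul_add, smul_smul, smul_smul, div_mul_cancel₀ _ hT₁.ne']
    have e3 : ∀ k : ℝ, (k * ‖v‖⁻¹) • v = k • w₁ := fun k => by rw [hw₁v, smul_smul]
    rw [e1, e2, e3]
    conv_lhs => rw [hdec₀ x]
    module
  clear_value e
  -- the steepest direction of the closed cone over `e`
  obtain ⟨m, hm, hmax⟩ : ∃ m : ℝ, e + m • v ∈ Tc ∧ ∀ m' : ℝ, e + m' • v ∈ Tc → m' ≤ m := by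
    have hcl : IsClosed {m : ℝ | e + m • v ∈ Tc} :=
      isClosed_closure.preimage (f := fun m : ℝ => e + m • v) (by fun_prop)
    have hne : {m : ℝ | e + m • v ∈ Tc}.Nonempty := by
      obtain ⟨s, hs, hs0, -⟩ := (eventually_lineMap e (mem_interior_iff_mem_nhds.1 hvint)).exists
      refine ⟨-s⁻¹, ?_⟩
      have := closure_radialCone_smul hs (inv_pos.2 hs0)
      rw [smul_add, smul_smul, inv_mul_cancel₀ hs0.ne', one_smul] at this
      show e + -s⁻¹ • v ∈ Tc
      convert this using 1
      module
    have hbd : BddAbove {m : ℝ | e + m • v ∈ Tc} := by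
      obtain ⟨δ, hδ, hb⟩ := Metric.mem_nhds_iff.1 (isClosed_closure.isOpen_compl.mem_nhds hvT)
      refine ⟨1 / δ, fun m hm => ?_⟩
      by_contra! hlt
      have hm0 : 0 < m := (by positivity : 0 < 1 / δ).trans hlt
      have := closure_radialCone_smul hm (inv_pos.2 hm0)
      refine hb ?_ this
      rw [mem_ball, dist_eq_norm, smul_add, smul_smul, inv_mul_cancel₀ hm0.ne', one_smul,
        add_sub_cancel_right, norm_smul, he1, mul_one, norm_inv, norm_eq_abs, abs_of_pos hm0]
      rw [div_lt_iff₀ hδ] at hlt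
      rw [inv_lt_iff_one_lt_mul₀ hm0]
      linarith
    exact ⟨_, hcl.csSup_mem hne hbd, fun m' hm' => le_csSup hbd hm'⟩
  set u := e + m • v with hu
  set u' := u - ⟪T, u⟫ • T with hu'
  have hu'T : u' ∈ Tc := by
    have := h.body.closure_radialCone_add hx₀K hm (hTmem (-⟪T, u⟫))
    rwa [neg_smul, ← sub_eq_add_neg] at this
  have heu' : ⟪e, u'⟫ = 1 := by
    rw [hu', hu, inner_sub_right, inner_add_smul, inner_smul_right, hev, heT, hee]
    ring
  have hu'0 : 0 < ‖u'‖ := by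
    rw [norm_pos_iff]
    intro h0
    rw [h0, inner_zero_right] at heu'
    exact zero_ne_one heu'
  set ν := ‖u'‖⁻¹ • u' with hν
  have hν1 : ‖ν‖ = 1 := norm_inv_norm_smul (norm_pos_iff.1 hu'0)
  have hνT : ν ∈ Tc := closure_radialCone_smul hu'T (inv_pos.2 hu'0)
  have hTTν : ⟪T, ν⟫ = 0 := by
    rw [hν, inner_smul_right, hu', inner_sub_right, inner_smul_right, real_inner_self_eq_norm_sq,
      hT1]
    ring
  have heν : 0 < ⟪e, ν⟫ := by
    rw [hν, inner_smul_right, heu', mul_one]; exact inv_pos.2 hu'0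
  have huν : u = ‖u'‖ • ν + ⟪T, u⟫ • T := by
    rw [hν, smul_smul, mul_inv_cancel₀ hu'0.ne', one_smul, hu']; abel
  clear_value ν u'
  obtain ⟨n, hn1, hTn, hνn, hnv⟩ : ∃ n : R3, ‖n‖ = 1 ∧ ⟪T, n⟫ = 0 ∧ ⟪ν, n⟫ = 0 ∧ 0 < ⟪n, v⟫ := by
    obtain ⟨n₀, h1, h2, h3, h4⟩ := exists_third_unit hT1 hν1 hTTν
    have hne : ⟪n₀, v⟫ ≠ 0 := by
      intro h0
      have h5 := h4 v
      rw [h0, zero_smul, add_zero] at h5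
      have h6 := hev
      rw [h5, inner_add_smul, inner_smul_right, heT, mul_zero, zero_add] at h6
      have h7 : ⟪ν, v⟫ = 0 := (mul_eq_zero.1 h6).resolve_right heν.ne'
      rw [h7, zero_smul, add_zero] at h5
      have h8 : ⟪T, v⟫ ≠ 0 := by
        intro h8
        rw [h8, zero_smul] at h5
        rw [h5, norm_zero] at hv0
        exact lt_irrefl _ hv0
      refine hTv ⟪T, v⟫⁻¹ ?_
      conv_rhs => rw [h5]
      rw [h5] at h8
      rw [inner_smul_right, real_inner_self_eq_norm_sq, hT1]
      rw [inner_smul_right, real_inner_self_eq_norm_sq, hT1] at h8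
      rw [smul_smul, one_pow, mul_one]
      rw [one_pow, mul_one] at h8
      rw [inv_mul_cancel₀ h8, one_smul]
    rcases lt_or_gt_of_ne hne with h0 | h0
    · exact ⟨-n₀, by simpa using h1, by simpa using h2, by simpa using h3, by simpa using h0⟩
    · exact ⟨n₀, h1, h2, h3, h0⟩
  have hnT : ⟪n, T⟫ = 0 := by rw [real_inner_comm, hTn]
  have hnν : ⟪n, ν⟫ = 0 := by rw [real_inner_comm, hνn]
  clear_value u
  have hnu : ⟪n, u⟫ = 0 := by
    rw [huν, inner_add_smul, inner_smul_right, hnT, hnν]; ring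
  have hne : ⟪n, e⟫ = -(m * ⟪n, v⟫) := by
    rw [hu, inner_add_smul] at hnu; linarith
  have hdecν : ∀ x, x = ⟪n, x⟫ • n + ⟪T, x⟫ • T + ⟪ν, x⟫ • ν :=
    orthonormal_decomp hn1 hT1 hν1 hnT hnν hTTν
  have hle : ∀ w ∈ Tc, ⟪n, w⟫ ≤ 0 := by
    intro w hw
    by_contra! hpos
    obtain ⟨a, k, hak⟩ := hdec w
    set b := ⟪e, w⟫
    have hw' : b • e + k • v ∈ Tc := by
      have := h.body.closure_radialCone_add hx₀K hw (hTmem (-a))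
      rw [hak] at this
      convert this using 1
      module
    have hnw : ⟪n, w⟫ = (k - m * b) * ⟪n, v⟫ := by
      rw [hak, inner_add_right, inner_add_smul, inner_smul_right,
        inner_smul_right, hnT, hne]; ring
    rw [hnw] at hpos
    have hk : 0 < k - m * b := pos_of_mul_pos_left hpos hnv.le
    rcases lt_or_ge 0 b with hb | hb
    · have := closure_radialCone_smul hw' (inv_pos.2 hb)
      rw [smul_add, smul_smul, smul_smul, inv_mul_cancel₀ hb.ne', one_smul] at this
      have := hmax _ this
      rw [inv_mul_le_iff₀ hb] at this
      linarith
    · refine hvpos hk ?_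
      rcases eq_or_lt_of_le hb with hb0 | hb0
      · rw [hb0, zero_smul, zero_add] at hw'
        rwa [hb0, mul_zero, sub_zero]
      · have := h.body.closure_radialCone_add hx₀K hw' (closure_radialCone_smul hm (neg_pos.2 hb0))
        convert this using 1
        rw [hu]; module
  have hleK : ∀ y ∈ K, ⟪n, y - f p⟫ ≤ 0 := fun y hy =>
    hle _ (subset_closure (sub_mem_radialCone hy))
  have hcurve : ∀ η > 0, ∃ ρ > 0, ∀ s : ℝ, |s| < ρ →
      |⟪e, γ s - f p⟫| ≤ η * |⟪t, γ s - f p⟫| := by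
    intro η hη
    have h1 : Tendsto (fun s : ℝ => |⟪e, s⁻¹ • (γ s - γ 0)⟫|) (𝓝[≠] 0) (𝓝 0) := by
      have := ((tendsto_const_nhds (x := e)).inner (𝕜 := ℝ) hfo).abs
      have e0 : ⟪e, T₀⟫ = 0 := by rw [hT₀T, inner_smul_right, heT, mul_zero]
      rwa [show ⟪e, deriv γ 0⟫ = 0 from e0, abs_zero] at this
    have h2 : Tendsto (fun s : ℝ => η * |⟪t, s⁻¹ • (γ s - γ 0)⟫|) (𝓝[≠] 0) (𝓝 (η * |⟪t, T₀⟫|)) :=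
      (((tendsto_const_nhds (x := t)).inner (𝕜 := ℝ) hfo).abs).const_mul η
    have h3 : 0 < η * |⟪t, T₀⟫| := by
      rw [hT₀T, inner_smul_right, htT]
      positivity
    obtain ⟨ρ, hρ, hb⟩ := Metric.mem_nhdsWithin_iff.1 (h1.eventually_lt h2 h3)
    refine ⟨ρ, hρ, fun s hs => ?_⟩
    by_cases hs0 : s = 0
    · simp [hs0, hγ0]
    · have h4 : |⟪e, s⁻¹ • (γ s - γ 0)⟫| < η * |⟪t, s⁻¹ • (γ s - γ 0)⟫| :=
        hb ⟨by simpa using hs, hs0⟩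
      rw [hγ0, inner_smul_right, inner_smul_right, abs_mul, abs_mul] at h4
      have h5 : 0 < |s⁻¹| := by positivity
      have h6 : |s⁻¹| * |⟪e, γ s - f p⟫| < |s⁻¹| * (η * |⟪t, γ s - f p⟫|) := by
        linarith
      exact (lt_of_mul_lt_mul_left h6 h5.le).le
  have hside' : ∀ ρ > 0, ∀ᶠ y in 𝓝[frontier K] (f p), ∃ s k : ℝ, |s| < ρ ∧
      ⟪t, y - f p⟫ = ⟪t, γ s - f p⟫ ∧
      ⟪e, y - f p⟫ = ⟪e, γ s - f p⟫ + k ∧ (y ∈ f '' U ↔ 0 ≤ k) := by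
    intro ρ hρ
    filter_upwards [hside ρ hρ] with y ⟨s, k, l, hs, hy, hk⟩
    have hy' : y - f p = (γ s - f p) + k • e + l • v := by rw [hy]; abel
    refine ⟨s, k, hs, ?_, ?_, hk⟩
    · rw [hy', inner_add_right, inner_add_smul, inner_smul_right, hte, htv]; ring
    · rw [hy', inner_add_right, inner_add_smul, inner_smul_right, hee, hev]; ring
  have hin : ∀ (a x : R3), ‖a‖ = 1 → |⟪a, x⟫| ≤ ‖x‖ := fun a x ha => by
    simpa [ha] using abs_real_inner_le_norm a x
  have hsides : ∀ η > 0, ∃ η' > 0, ∀ᶠ y in 𝓝[frontier K] (f p),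
      |⟪n, y - f p⟫| ≤ η' * ‖y - f p‖ → η * ‖y - f p‖ ≤ ⟪ν, y - f p⟫ →
      y ∈ f '' U := by
    intro η hη
    set η' := ⟪e, ν⟫ * η / 2 with hη'
    have hη'0 : 0 < η' := by positivity
    obtain ⟨ρ, hρ, hρs⟩ := hcurve η' hη'0
    refine ⟨η', hη'0, ?_⟩
    filter_upwards [hside' ρ hρ] with y ⟨s, k, hs, h1, h2, h3⟩ hy1 hy2
    rw [h3]
    set d := y - f p
    have h4 : ⟪e, d⟫ = ⟪n, d⟫ * ⟪e, n⟫ + ⟪ν, d⟫ * ⟪e, ν⟫ := by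
      conv_lhs => rw [hdecν d]
      rw [inner_add_right, inner_add_smul, inner_smul_right, inner_smul_right, heT]
      ring
    have h5 : |⟪n, d⟫ * ⟪e, n⟫| ≤ η' * ‖d‖ := by
      rw [abs_mul]
      calc _ ≤ |⟪n, d⟫| * 1 := by
            gcongr; simpa [hn1] using hin e n he1
        _ ≤ _ := by rw [mul_one]; exact hy1
    have h6 := hρs s hs
    rw [← h1] at h6
    have h7 := hin t d ht1
    have h8 : η' * |⟪t, d⟫| ≤ η' * ‖d‖ := by gcongr
    have h9 : ⟪e, ν⟫ * (η * ‖d‖) ≤ ⟪e, ν⟫ * ⟪ν, d⟫ := by gcongr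
    have h10 : ⟪e, ν⟫ * (η * ‖d‖) = 2 * (η' * ‖d‖) := by rw [hη']; ring
    linarith [(abs_le.1 h5).1, (abs_le.1 h6).2]
  refine ⟨T, n, ν, h, hφ, hφp, hT1, hn1, hν1, hnT, hnν, hTTν, ⟨‖T₀‖, hT₀, hT₀T⟩, hleK, ?_, hsides,
    ⟨e, heT, heν, fun ρ hρ => (hside' ρ hρ).mono fun _ ⟨s, k, h1, _, h3, h4⟩ => ⟨s, k, h1, h3, h4⟩⟩,
      ?_⟩
  · intro η hη
    have hneg : ∀ w, ⟪e, w⟫ < 0 → ‖w‖ = 1 → ∃ N ∈ 𝓝 w, ∃ t > 0, ∀ w' ∈ N,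
        ∀ s ∈ Ioc (0 : ℝ) t, f p + s • w' ∉ f '' U := by
      intro w hw hw1
      set β := -⟪e, w⟫ with hβ
      have hβ0 : 0 < β := by linarith
      obtain ⟨ρ, hρ, hρs⟩ := hcurve (β / 8) (by positivity)
      obtain ⟨δ, hδ, hb⟩ := Metric.mem_nhdsWithin_iff.1 (hside' ρ hρ)
      have hN : {w' : R3 | ⟪e, w'⟫ < -β / 2} ∩ {w' | ‖w'‖ < 2} ∈ 𝓝 w :=
        ((isOpen_inner_lt e _).inter (isOpen_lt continuous_norm continuous_const)).mem_nhds
          ⟨show ⟪e, w⟫ < -β / 2 by linarith, show ‖w‖ < 2 by linarith⟩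
      refine ⟨_, hN, δ / 4, by positivity, ?_⟩
      rintro w' ⟨hw'1, hw'2⟩ s ⟨hs0, hs⟩ hU
      simp only [mem_ofPred_eq] at hw'1 hw'2
      have hyf : f p + s • w' ∈ frontier K := by
        obtain ⟨x, hx, hxy⟩ := hU; rw [← hxy]; exact h.maps x hx
      obtain ⟨s', k, hs', h1, h2, h3⟩ := hb ⟨by
        rw [mem_ball, dist_eq_norm, add_sub_cancel_left, norm_smul, norm_eq_abs, abs_of_pos hs0]
        have := mul_le_mul hs hw'2.le (norm_nonneg _) (show 0 ≤ δ / 4 by positivity)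
        linarith, hyf⟩
      have hk := h3.1 hU
      rw [add_sub_cancel_left] at h1 h2
      have h6 := hρs s' hs'
      rw [← h1, inner_smul_right, abs_mul, abs_of_pos hs0] at h6
      rw [inner_smul_right] at h2
      have h7 := hin t w' ht1
      have h8 := (abs_le.1 h6).1
      have h9 : s * |⟪t, w'⟫| ≤ s * 2 := by gcongr; linarith
      have h10 : s * ⟪e, w'⟫ < s * (-β / 2) := by gcongr
      have h11 : β / 8 * (s * |⟪t, w'⟫|) ≤ β / 8 * (s * 2) := by gcongr
      have h12 := mul_pos hs0 hβ0
      linarith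
    set Z : Set R3 := {w | η ≤ |⟪n, w⟫|} ∪ {w | ⟪ν, w⟫ ≤ -η}
    have hZ : IsClosed Z := by
      refine IsClosed.union (isClosed_le continuous_const ?_) (isClosed_le ?_ continuous_const) <;>
        fun_prop
    obtain ⟨δ, hδ, hav⟩ := exists_avoid_directions (x₀ := f p) (Y := f '' U) hZ (by
      intro w hwZ hw1
      rcases lt_trichotomy ⟪n, w⟫ 0 with h0 | h0 | h0
      · by_cases hb : ⟪e, w⟫ < 0
        · exact hneg w hb hw1
        · push Not at hb
          obtain ⟨a, k, hak⟩ := hdec w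
          set b := ⟪e, w⟫
          have hnw : ⟪n, w⟫ = (k - m * b) * ⟪n, v⟫ := by
            rw [hak, inner_add_right, inner_add_smul, inner_smul_right,
              inner_smul_right, hnT, hne]; ring
          have hk : 0 < m * b - k := by
            by_contra! hc
            rw [hnw] at h0
            have := mul_nonneg (show 0 ≤ k - m * b by linarith) hnv.le
            linarith
          have h1 : a • T + b • u ∈ Tc := by
            rcases eq_or_lt_of_le hb with hb0 | hb0
            · rw [← hb0, zero_smul, add_zero]; exact hTmem a
            · exact h.body.closure_radialCone_add hx₀K (hTmem a) (closure_radialCone_smul hm hb0)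
          have h2 := h.body.add_smul_mem_interior hx₀K ho h1 hk
          have h3 : a • T + b • u + (m * b - k) • (o - f p) = w := by
            rw [hak, hu]
            have : o - f p = -v := by rw [hv]; abel
            rw [this]
            module
          rw [h3] at h2
          obtain ⟨N, hN, s₀, hs₀, hNs⟩ := h.body.exists_ray_mem_interior hx₀K h2
          refine ⟨N, hN, s₀, hs₀, fun w' hw' s hs hU => ?_⟩
          obtain ⟨x, hx, hxy⟩ := hU
          have := h.maps x hx
          rw [hxy] at this
          exact this.2 (hNs w' hw' s hs)
      · refine hneg w ?_ hw1
        have h1 : ⟪ν, w⟫ ≤ -η := by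
          rcases hwZ with hwZ | hwZ
          · have : η ≤ |⟪n, w⟫| := hwZ
            rw [h0, abs_zero] at this
            linarith
          · exact hwZ
        have h4 : ⟪e, w⟫ = ⟪n, w⟫ * ⟪e, n⟫ + ⟪ν, w⟫ * ⟪e, ν⟫ := by
          conv_lhs => rw [hdecν w]
          rw [inner_add_right, inner_add_smul, inner_smul_right,
            inner_smul_right, heT]
          ring
        rw [h4, h0]
        have := mul_pos (show 0 < -⟪ν, w⟫ by linarith) heν
        linarith
      · refine ⟨_, (isOpen_inner_gt n 0).mem_nhds h0, 1, one_pos, fun w' hw' s hs hU => ?_⟩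
        obtain ⟨x, hx, hxy⟩ := hU
        have h1 := hleK _ (h.body.frontier_subset (h.maps x hx))
        rw [hxy, add_sub_cancel_left, inner_smul_right] at h1
        have h2 : 0 < ⟪n, w'⟫ := hw'
        have := mul_pos hs.1 h2
        linarith)
    filter_upwards [h.mem_nhds, hfc.continuousAt.preimage_mem_nhds (ball_mem_nhds (f p) hδ)]
      with x hx hxd
    by_cases hxe : f x = f p
    · simp [hxe]
    have hd : 0 < ‖f x - f p‖ := norm_pos_iff.2 (sub_ne_zero.2 hxe)
    have h1 := hav (f x) ⟨x, hx, rfl⟩ hxe (le_of_lt hxd)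
    simp only [Z, mem_union, mem_ofPred_eq, not_or, not_le, inner_smul_right, abs_mul, abs_inv,
      abs_norm] at h1
    rw [inv_mul_lt_iff₀ hd, lt_inv_mul_iff₀ hd] at h1
    constructor <;> linarith
  · intro η hη N hN
    obtain ⟨η', hη', hs⟩ := hsides (1 / 3) (by norm_num)
    obtain ⟨ε, hε, hsep⟩ := h.sep hfc hN
    obtain ⟨δ, hδ, hb⟩ := Metric.mem_nhdsWithin_iff.1 hs
    set κ := min (1 / 2) (min (η / 4) (η' / 2))
    have hκ0 : 0 < κ := lt_min (by norm_num) (lt_min (by positivity) (by positivity))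
    have hκ1 : κ ≤ 1 / 2 := min_le_left _ _
    have hκ2 : κ ≤ η / 4 := (min_le_right _ _).trans (min_le_left _ _)
    have hκ3 : κ ≤ η' / 2 := (min_le_right _ _).trans (min_le_right _ _)
    set c := κ / ‖v‖ with hc
    have hc0 : 0 < c := by positivity
    have hcv : c * ‖v‖ = κ := div_mul_cancel₀ _ hv0.ne'
    have h1 := h.body.add_smul_mem_interior hx₀K ho hνT hc0
    obtain ⟨N', hN', s₀, hs₀, hray⟩ := h.body.exists_ray_mem_interior hx₀K h1
    obtain ⟨s, hs0, hs1⟩ : ∃ s, 0 < s ∧ s < min s₀ (min (δ / 2) (ε / 2)) :=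
      exists_between (lt_min hs₀ (lt_min (by positivity) (by positivity)))
    have hs2 : s < s₀ := hs1.trans_le (min_le_left _ _)
    have hs3 : s < δ / 2 := hs1.trans_le ((min_le_right _ _).trans (min_le_left _ _))
    have hs4 : s < ε / 2 := hs1.trans_le ((min_le_right _ _).trans (min_le_right _ _))
    have ha := interior_subset (hray _ (mem_of_mem_nhds hN') s ⟨hs0, hs2.le⟩)
    have hbK : f p + s • (ν + c • v) ∉ K := by
      intro hmem
      have := hleK _ hmem
      rw [add_sub_cancel_left, inner_smul_right, inner_add_smul, hnν] at this
      have h3 := mul_pos hs0 (mul_pos hc0 hnv)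
      linarith
    obtain ⟨τ, hτ, hyf⟩ := exists_mem_frontier_segment ha hbK
    set y := f p + s • (ν + c • (o - f p)) + τ • (f p + s • (ν + c • v) -
      (f p + s • (ν + c • (o - f p))))
      with hy
    have hyd : y - f p = s • ν + (s * c * (2 * τ - 1)) • v := by
      have : o - f p = -v := by rw [hv]; abel
      rw [hy, this]; module
    have hdν : ‖y - f p - s • ν‖ ≤ s * κ := by
      rw [hyd, add_sub_cancel_left, norm_smul, norm_eq_abs, abs_mul, abs_of_pos (by positivity)]
      have h2 : |2 * τ - 1| ≤ 1 := abs_le.2 ⟨by linarith [hτ.1], by linarith [hτ.2]⟩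
      calc s * c * |2 * τ - 1| * ‖v‖ ≤ s * c * 1 * ‖v‖ := by gcongr
        _ = s * κ := by rw [← hcv]; ring
    have hsν : ‖s • ν‖ = s := by rw [norm_smul, hν1, mul_one, norm_eq_abs, abs_of_pos hs0]
    set d := y - f p with hd
    clear_value d
    have hd1 : ‖d‖ ≤ s + s * κ := by
      have := norm_add_le (s • ν) (d - s • ν)
      rw [add_sub_cancel, hsν] at this
      linarith
    have hd2 : s - s * κ ≤ ‖d‖ := by
      have := norm_sub_norm_le (s • ν) (s • ν - d)
      rw [sub_sub_cancel, hsν, norm_sub_rev] at this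
      linarith
    have hsκ : s * κ ≤ s * (1 / 2) := by gcongr
    have hd0 : 0 < ‖d‖ := by linarith
    have hdlt : ‖d‖ < 2 * s := by linarith
    have hyU : y ∈ f '' U := by
      refine hb ⟨?_, hyf⟩ ?_ ?_
      · rw [mem_ball, dist_eq_norm]
        rw [← hd]
        linarith
      · rw [← hd]
        have h2 : ⟪n, d⟫ = ⟪n, d - s • ν⟫ := by
          rw [inner_sub_right, inner_smul_right, hnν]; ring
        rw [h2]
        refine (hin n _ hn1).trans (hdν.trans ?_)
        have h3 : s * κ ≤ s * (η' / 2) := by gcongr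
        have h4 := mul_le_mul_of_nonneg_left (show s / 2 ≤ ‖d‖ by linarith) hη'.le
        linarith
      · rw [← hd]
        have h2 : ⟪ν, d⟫ = s + ⟪ν, d - s • ν⟫ := by
          rw [inner_sub_right, inner_smul_right, real_inner_self_eq_norm_sq, hν1]; ring
        have h3 := (abs_le.1 ((hin ν (d - s • ν) hν1).trans hdν)).1
        linarith
    obtain ⟨x, hxU, hxy⟩ := hyU
    have hxd : f x - f p = d := by rw [hxy, hd]
    refine ⟨x, hsep x hxU ?_, ?_, ?_⟩
    · rw [dist_eq_norm, hxd]; linarith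
    · rw [← sub_ne_zero, hxd]; exact norm_pos_iff.1 hd0
    · rw [hxd]
      have h2 : d - ‖d‖ • ν = (d - s • ν) + (s - ‖d‖) • ν := by module
      rw [h2]
      refine (norm_add_le _ _).trans ?_
      rw [norm_smul, hν1, mul_one, norm_eq_abs]
      have h3 : |s - ‖d‖| ≤ s * κ := abs_le.2 ⟨by linarith, by linarith⟩
      have h4 : s * κ ≤ s * (η / 4) := by gcongr
      have h5 := mul_le_mul_of_nonneg_left (show s / 2 ≤ ‖d‖ by linarith) hη.le
      linarith

end Frame

namespace BoundaryFrame

variable {M : Type*} [TopologicalSpace M] [ChartedSpace (EuclideanHalfSpace 2) M]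
  {f : M → R3} {p : M} {U : Set M} {K : Set R3} {φ : ℝ → bdry M} {T n ν : R3}

variable (h : BoundaryFrame f p U K φ T n ν)

include h

theorem decomp (x : R3) : x = ⟪n, x⟫ • n + ⟪T, x⟫ • T + ⟪ν, x⟫ • ν :=
  orthonormal_decomp h.norm_n h.norm_T h.norm_ν h.inner_nT h.inner_nν h.inner_Tν x

theorem mem_bdry : p ∈ bdry M := h.param_zero ▸ (φ 0).2

theorem n_ne_zero : n ≠ 0 := norm_ne_zero_iff.1 (by rw [h.norm_n]; exact one_ne_zero)

theorem inner_le {y : R3} (hy : y ∈ K) : ⟪n, y⟫ ≤ ⟪n, f p⟫ := by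
  have := h.le y hy
  rwa [inner_sub_right, sub_nonpos] at this

theorem eventually_le : ∀ᶠ x in 𝓝 p, ⟪n, f x⟫ ≤ ⟪n, f p⟫ := by
  filter_upwards [h.model.mem_nhds] with x hx
  exact h.inner_le (h.model.body.frontier_subset (h.model.maps x hx))

/-- Limit directions of the image of the surface at `f p` lie in the half-plane spanned by the
tangent line and the conormal. -/
theorem limit_direction {w : R3}
    (hw : ∀ η > 0, ∀ N ∈ 𝓝 p, ∃ x ∈ N, ∃ t : ℝ, 0 < t ∧ ‖f x - f p - t • w‖ ≤ η * t) :
    ⟪n, w⟫ = 0 ∧ 0 ≤ ⟪ν, w⟫ := by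
  have hin : ∀ (a x : R3), ‖a‖ = 1 → |⟪a, x⟫| ≤ ‖x‖ := fun a x ha => by
    simpa [ha] using abs_real_inner_le_norm a x
  have key : ∀ η > 0, η ≤ 1 → |⟪n, w⟫| ≤ η * (‖w‖ + 2) ∧ -(η * (‖w‖ + 2)) ≤ ⟪ν, w⟫ := by
    intro η hη hη1
    obtain ⟨x, hxN, t, ht, hxt⟩ := hw η hη _ (h.limit η hη)
    obtain ⟨h1, h2⟩ := hxN
    set d := f x - f p
    have h3 : ‖d‖ ≤ t * (‖w‖ + η) := by
      have := norm_add_le (d - t • w) (t • w)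
      rw [sub_add_cancel, norm_smul, norm_eq_abs, abs_of_pos ht] at this
      linarith
    have h4 : η * ‖d‖ ≤ η * (t * (‖w‖ + 1)) := by
      refine mul_le_mul_of_nonneg_left (h3.trans ?_) hη.le
      gcongr
    have h5 : ⟪n, d - t • w⟫ = ⟪n, d⟫ - t * ⟪n, w⟫ := by
      rw [inner_sub_right, inner_smul_right]
    have h6 : ⟪ν, d - t • w⟫ = ⟪ν, d⟫ - t * ⟪ν, w⟫ := by
      rw [inner_sub_right, inner_smul_right]
    have h7 := abs_le.1 ((hin n _ h.norm_n).trans hxt)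
    have h8 := abs_le.1 ((hin ν _ h.norm_ν).trans hxt)
    have h9 := abs_le.1 h1
    rw [h5] at h7
    rw [h6] at h8
    refine ⟨abs_le.2 ⟨?_, ?_⟩, ?_⟩ <;> refine le_of_mul_le_mul_left ?_ ht <;> linarith
  have hlim : Tendsto (fun η : ℝ => η * (‖w‖ + 2)) (𝓝[>] 0) (𝓝 0) := by
    have : Continuous fun η : ℝ => η * (‖w‖ + 2) := by fun_prop
    have := this.tendsto 0
    rw [zero_mul] at this
    exact this.mono_left nhdsWithin_le_nhds
  have hev : ∀ᶠ η : ℝ in 𝓝[>] 0, 0 < η ∧ η ≤ 1 := by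
    filter_upwards [Ioo_mem_nhdsGT (show (0 : ℝ) < 1 by norm_num)] with η hη
    exact ⟨hη.1, hη.2.le⟩
  constructor
  · refine abs_eq_zero.1 (le_antisymm ?_ (abs_nonneg _))
    exact ge_of_tendsto hlim (hev.mono fun η hη => (key η hη.1 hη.2).1)
  · have := le_of_tendsto hlim.neg (hev.mono fun η hη => (key η hη.1 hη.2).2)
    simpa using this

theorem of_mem_tangentCone (hf : Continuous f) {w : R3} (hw : w ∈ tangentCone f p)
    : ⟪n, w⟫ = 0 ∧ 0 ≤ ⟪ν, w⟫ := by
  by_cases hw0 : w = 0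
  · simp [hw0]
  refine h.limit_direction fun η hη N hN => ?_
  obtain ⟨ε, hε, hsep⟩ := h.model.sep hf hN
  have h1 := mem_iInter₂.1 hw U h.model.mem_nhds
  obtain ⟨c, d, hd, hdU, hcd⟩ := mem_tangentConeAt_iff_exists_seq.1 h1
  have hd' := (tendsto_iff_norm_sub_tendsto_zero.1 hd).eventually (gt_mem_nhds hε)
  have hcd' := (tendsto_iff_norm_sub_tendsto_zero.1 hcd).eventually (gt_mem_nhds hη)
  obtain ⟨k, ⟨⟨hk1, hk2⟩, hk3⟩, hk4⟩ := (((hdU.and hd').and hcd').and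
    (hcd.eventually_ne hw0)).exists
  obtain ⟨x, hxU, hx⟩ := hk1
  have hc : 0 < (c k : ℝ) := by
    refine lt_of_le_of_ne (c k).2 fun h0 => hk4 ?_
    have : c k = 0 := by exact_mod_cast h0.symm
    rw [this, zero_smul]
  rw [sub_zero] at hk2
  have hxd : f x - f p = d k := by rw [hx]; abel
  refine ⟨x, hsep x hxU (by rwa [dist_eq_norm, hxd]), (c k : ℝ)⁻¹, inv_pos.2 hc, ?_⟩
  rw [hxd]
  have e : d k - (c k : ℝ)⁻¹ • w = (c k : ℝ)⁻¹ • ((c k : ℝ) • d k - w) := by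
    rw [smul_sub, smul_smul, inv_mul_cancel₀ hc.ne', one_smul]
  rw [e, norm_smul, norm_inv, norm_eq_abs, abs_of_pos hc, mul_comm]
  gcongr
  exact hk3.le

theorem ν_mem_tangentCone (hf : Continuous f) : ν ∈ tangentCone f p := by
  refine mem_iInter₂.2 fun V hV => mem_tangentConeAt_iff_exists_seq.2 ?_
  have hex : ∀ k : ℕ, ∃ x ∈ V, f x ≠ f p ∧ ‖f x - f p‖ < 1 / ((k : ℝ) + 1) ∧
      ‖f x - f p - ‖f x - f p‖ • ν‖ ≤ 1 / ((k : ℝ) + 1) * ‖f x - f p‖ := by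
    intro k
    have hk : 0 < 1 / ((k : ℝ) + 1) := by positivity
    obtain ⟨x, ⟨hx1, hx2⟩, hx3, hx4⟩ := h.attained _ hk _ (inter_mem hV
      (hf.continuousAt.preimage_mem_nhds (ball_mem_nhds (f p) hk)))
    exact ⟨x, hx1, hx3, by rw [← dist_eq_norm]; exact hx2, hx4⟩
  choose x hxV hxne hx1 hx2 using hex
  have hlim : Tendsto (fun k : ℕ => 1 / ((k : ℝ) + 1)) atTop (𝓝 0) :=
    tendsto_one_div_add_atTop_nhds_zero_nat
  have hpos : ∀ k, 0 < ‖f (x k) - f p‖ := fun k => norm_pos_iff.2 (sub_ne_zero.2 (hxne k))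
  refine ⟨fun k => ⟨‖f (x k) - f p‖⁻¹, by positivity⟩, fun k => f (x k) - f p, ?_, ?_, ?_⟩
  · exact squeeze_zero_norm (fun k => (hx1 k).le) hlim
  · exact Eventually.of_forall fun k => ⟨x k, hxV k, (add_sub_cancel _ _).symm⟩
  · rw [tendsto_iff_norm_sub_tendsto_zero]
    refine squeeze_zero (fun _ => norm_nonneg _) (fun k => ?_) hlim
    have e : ‖f (x k) - f p‖⁻¹ • (f (x k) - f p) - ν =
        ‖f (x k) - f p‖⁻¹ • (f (x k) - f p - ‖f (x k) - f p‖ • ν) := by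
      rw [smul_sub ‖f (x k) - f p‖⁻¹ (f (x k) - f p), smul_smul, inv_mul_cancel₀ (hpos k).ne',
        one_smul]
    show ‖‖f (x k) - f p‖⁻¹ • (f (x k) - f p) - ν‖ ≤ _
    rw [e, norm_smul, norm_inv, norm_norm, inv_mul_le_iff₀ (hpos k), mul_comm]
    exact hx2 k

/-- The velocity of every regular parametrization of the boundary is a multiple of `T`. -/
theorem inner_deriv {ψ : ℝ → bdry M} (hψ : IsRegularParam f 1 ψ) (hψp : (ψ 0 : M) = p) :
    ⟪ν, deriv (boundaryCurve f ψ) 0⟫ = 0 := by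
  have hd := (hψ.contDiff.differentiable (by norm_num) 0).hasDerivAt.tendsto_slope
  have hψc : Tendsto (fun s => (ψ s : M)) (𝓝[≠] 0) (𝓝 p) := by
    have : Continuous fun s => (ψ s : M) :=
      continuous_subtype_val.comp hψ.isOpenEmbedding.continuous
    have := this.tendsto 0
    rw [hψp] at this
    exact this.mono_left nhdsWithin_le_nhds
  have hγ : ∀ s, boundaryCurve f ψ s = f (ψ s) := fun s => rfl
  set D := deriv (boundaryCurve f ψ) 0
  have hboth : ∀ σ : ℝ, σ = 1 ∨ σ = -1 → 0 ≤ ⟪ν, σ • D⟫ := by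
    intro σ hσ
    refine (h.limit_direction fun η hη N hN => ?_).2
    have h1 := (tendsto_iff_norm_sub_tendsto_zero.1 hd).eventually (gt_mem_nhds hη)
    have h2 : ∃ᶠ s : ℝ in 𝓝[≠] 0, 0 < σ * s := by
      rcases hσ with rfl | rfl
      · refine Frequently.filter_mono (f := 𝓝[>] (0 : ℝ)) (Eventually.frequently ?_)
          (nhdsWithin_mono _ fun s hs => ne_of_gt hs)
        filter_upwards [self_mem_nhdsWithin] with s hs
        simpa using hs
      · refine Frequently.filter_mono (f := 𝓝[<] (0 : ℝ)) (Eventually.frequently ?_)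
          (nhdsWithin_mono _ fun s hs => ne_of_lt hs)
        filter_upwards [self_mem_nhdsWithin] with s hs
        simpa using hs
    obtain ⟨s, hs1, hs2, hs3⟩ := (h2.and_eventually (h1.and (hψc.eventually hN))).exists
    have hσσ : σ * σ = 1 := by rcases hσ with rfl | rfl <;> norm_num
    refine ⟨ψ s, hs3, σ * s, hs1, ?_⟩
    have e : f (ψ s) - f p - (σ * s) • σ • D = s • (slope (boundaryCurve f ψ) 0 s - D) := by
      have hs0 : s ≠ 0 := by rintro rfl; simp at hs1
      rw [slope, vsub_eq_sub, hγ, hγ, hψp, sub_zero, smul_sub, smul_smul s, mul_inv_cancel₀ hs0,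
        one_smul, smul_smul]
      congr 2
      linear_combination s * hσσ
    have e2 : |s| = σ * s := by
      rw [← abs_of_pos hs1, abs_mul]
      rcases hσ with rfl | rfl <;> simp
    rw [e, norm_smul, norm_eq_abs, e2, mul_comm]
    gcongr
  have h1 := hboth 1 (Or.inl rfl)
  have h2 := hboth (-1) (Or.inr rfl)
  rw [one_smul] at h1
  rw [inner_smul_right] at h2
  linarith

theorem isOutwardNormal (hf : Continuous f) : IsOutwardNormal f p n := by
  refine ⟨h.norm_n, fun w hw => (h.of_mem_tangentCone hf hw).1, ?_⟩
  filter_upwards [h.model.mem_nhds] with x hx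
  exact h.le _ (h.model.body.frontier_subset (h.model.maps x hx))

omit h in
theorem isConormal {p : bdry M} (h : BoundaryFrame f (p : M) U K φ T n ν) (hf : Continuous f) :
    IsConormal f p ν :=
  ⟨h.norm_ν, h.ν_mem_tangentCone hf, fun _ hψ hψp => h.inner_deriv hψ (by rw [hψp])⟩

end BoundaryFrame

/-! ### Locally convex maps of compact connected spaces -/

section Tietze

variable {G : Type*} {f : G → R3}

/-- The relation of lying in a common member of a cover. -/
def CoverRel {ι : Type*} (A : ι → Set G) (x y : G) : Prop := ∃ i, x ∈ A i ∧ y ∈ A i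

theorem exists_coverRel_chain [TopologicalSpace G] [ConnectedSpace G] {ι : Type*} {A : ι → Set G}
    (hA : ∀ q, ∃ i, A i ∈ 𝓝 q) (x y : G) :
    ∃ (m : ℕ) (z : ℕ → G), z 0 = x ∧ z m = y ∧ ∀ j < m, CoverRel A (z j) (z (j + 1)) := by
  set S := {y | ∃ (m : ℕ) (z : ℕ → G), z 0 = x ∧ z m = y ∧ ∀ j < m, CoverRel A (z j) (z (j + 1))}
  have hext : ∀ a b, a ∈ S → CoverRel A a b → b ∈ S := by
    rintro a b ⟨m, z, h0, hm, hz⟩ hab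
    refine ⟨m + 1, fun j => if j ≤ m then z j else b, by simpa using h0, by simp, fun j hj => ?_⟩
    rcases Nat.lt_succ_iff_lt_or_eq.1 hj with h | rfl
    · simpa [h.le, Nat.succ_le_of_lt h] using hz j h
    · simpa [hm] using hab
  have hcl : IsClopen S := by
    constructor
    · rw [← isOpen_compl_iff, isOpen_iff_mem_nhds]
      intro q hq
      obtain ⟨i, hi⟩ := hA q
      filter_upwards [hi] with a ha haS
      exact hq (hext a q haS ⟨i, ha, mem_of_mem_nhds hi⟩)
    · rw [isOpen_iff_mem_nhds]
      intro q hq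
      obtain ⟨i, hi⟩ := hA q
      filter_upwards [hi] with a ha
      exact hext q a hq ⟨i, mem_of_mem_nhds hi, ha⟩
  have hx : x ∈ S := ⟨0, fun _ => x, rfl, rfl, by simp⟩
  have := hcl.eq_univ ⟨x, hx⟩
  show y ∈ S
  rw [this]
  trivial

/-- Lifts of midpoints. -/
theorem CoverRel.exists_midpoint {ι : Type*} {A : ι → Set G} (hconv : ∀ i, Convex ℝ (f '' A i))
    {x y : G} (h : CoverRel A x y) :
    ∃ w, CoverRel A x w ∧ CoverRel A w y ∧ f w = (1 / 2 : ℝ) • (f x + f y) := by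
  obtain ⟨i, hx, hy⟩ := h
  obtain ⟨w, hw, hfw⟩ := hconv i ⟨x, hx, rfl⟩ ⟨y, hy, rfl⟩
    (show (0 : ℝ) ≤ 1 / 2 by norm_num) (show (0 : ℝ) ≤ 1 / 2 by norm_num) (by norm_num)
  exact ⟨w, ⟨i, hx, hw⟩, ⟨i, hw, hy⟩, by rw [hfw, smul_add]⟩

theorem exists_coverRel_chain_energy [TopologicalSpace G] [ConnectedSpace G] {ι : Type*}
    {A : ι → Set G} (hA : ∀ q, ∃ i, A i ∈ 𝓝 q) (hconv : ∀ i, Convex ℝ (f '' A i)) (x y : G) {ε : ℝ}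
    (hε : 0 < ε) :
    ∃ (m : ℕ) (z : ℕ → G), z 0 = x ∧ z m = y ∧ (∀ j < m, CoverRel A (z j) (z (j + 1))) ∧
      ∑ j ∈ Finset.range m, ‖f (z j) - f (z (j + 1))‖ ^ 2 < ε := by
  obtain ⟨m, z, h0, hm, hz⟩ := exists_coverRel_chain hA x y
  set e₀ := ∑ j ∈ Finset.range m, ‖f (z j) - f (z (j + 1))‖ ^ 2
  -- halving all steps of a chain halves its energy
  have key : ∀ k : ℕ, ∃ (m : ℕ) (z : ℕ → G), z 0 = x ∧ z m = y ∧
      (∀ j < m, CoverRel A (z j) (z (j + 1))) ∧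
      ∑ j ∈ Finset.range m, ‖f (z j) - f (z (j + 1))‖ ^ 2 = e₀ * (1 / 2) ^ k := by
    intro k
    induction k with
    | zero => exact ⟨m, z, h0, hm, hz, by simp [e₀]⟩
    | succ k ih =>
      obtain ⟨m, z, h0, hm, hz, he⟩ := ih
      choose! w hw1 hw2 hw3 using fun j (hj : j < m) => (hz j hj).exists_midpoint hconv
      set z' : ℕ → G := fun l => if l % 2 = 0 then z (l / 2) else w (l / 2)
      have he' : ∀ j, z' (2 * j) = z j := fun j => by simp [z']
      have ho' : ∀ j, z' (2 * j + 1) = w j := fun j => by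
        have h1 : (2 * j + 1) % 2 = 1 := by omega
        have h2 : (2 * j + 1) / 2 = j := by omega
        simp [z', h1, h2]
      refine ⟨2 * m, z', by simpa [h0] using he' 0, by rw [he', hm], fun l hl => ?_, ?_⟩
      · rcases Nat.even_or_odd' l with ⟨j, rfl | rfl⟩
        · rw [he', ho']; exact hw1 j (by omega)
        · rw [ho', show 2 * j + 1 + 1 = 2 * (j + 1) by ring, he']; exact hw2 j (by omega)
      · have hsum : ∀ i ≤ m, ∑ l ∈ Finset.range (2 * i), ‖f (z' l) - f (z' (l + 1))‖ ^ 2 =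
            1 / 2 * ∑ j ∈ Finset.range i, ‖f (z j) - f (z (j + 1))‖ ^ 2 := by
          intro i hi
          induction i with
          | zero => simp
          | succ i ihi =>
            rw [show 2 * (i + 1) = 2 * i + 1 + 1 by ring, Finset.sum_range_succ,
              Finset.sum_range_succ, ihi (by omega), Finset.sum_range_succ, he', ho',
              show 2 * i + 1 + 1 = 2 * (i + 1) by ring, he', hw3 i (by omega)]
            have e1 : f (z i) - (1 / 2 : ℝ) • (f (z i) + f (z (i + 1))) =
              (1 / 2 : ℝ) • (f (z i) - f (z (i + 1))) := by module
            have e2 : (1 / 2 : ℝ) • (f (z i) + f (z (i + 1))) - f (z (i + 1)) =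
              (1 / 2 : ℝ) • (f (z i) - f (z (i + 1))) := by module
            rw [e1, e2, norm_smul, mul_pow]
            norm_num
            ring
        rw [hsum m le_rfl, he, pow_succ]
        ring
  obtain ⟨k, hk⟩ := exists_pow_lt_of_lt_one (show 0 < ε / (e₀ + 1) by positivity)
    (show (1 / 2 : ℝ) < 1 by norm_num)
  obtain ⟨m, z, h0, hm, hz, he⟩ := key k
  refine ⟨m, z, h0, hm, hz, ?_⟩
  have he₀ : 0 ≤ e₀ := Finset.sum_nonneg fun _ _ => by positivity
  rw [he]
  calc e₀ * (1 / 2) ^ k ≤ (e₀ + 1) * (1 / 2) ^ k := by gcongr; linarith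
    _ < (e₀ + 1) * (ε / (e₀ + 1)) := by gcongr
    _ = ε := by field_simp

/-- Any two points are joined by a chain whose image divides a segment into equal parts: a chain
of least energy. -/
theorem exists_straight_chain [TopologicalSpace G] [T2Space G] [CompactSpace G] [ConnectedSpace G]
    (hf : Continuous f) {ι : Type*} [Finite ι] {A : ι → Set G} (hcl : ∀ i, IsClosed (A i))
    (hA : ∀ q, ∃ i, A i ∈ 𝓝 q) (hi : ∀ i, InjOn f (A i)) (hconv : ∀ i, Convex ℝ (f '' A i))
    (x y : G) :
    ∃ (m : ℕ) (z : ℕ → G) (d : R3), z 0 = x ∧ z m = y ∧ (∀ j < m, CoverRel A (z j) (z (j + 1))) ∧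
      ∀ j < m, f (z (j + 1)) = f (z j) + d := by
  have hEcl : IsClosed {v : G × G | CoverRel A v.1 v.2} := by
    have : {v : G × G | CoverRel A v.1 v.2} = ⋃ i, A i ×ˢ A i := by
      ext v; simp [CoverRel]
    rw [this]
    exact isClosed_iUnion_of_finite fun i => (hcl i).prod (hcl i)
  -- consecutive short steps lie in a common member of the cover
  obtain ⟨ε, hε, htriple⟩ : ∃ ε > 0, ∀ a b c, CoverRel A a b → CoverRel A b c →
      ‖f a - f b‖ ^ 2 + ‖f b - f c‖ ^ 2 < ε → CoverRel A a c := by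
    set B : Set (G × G × G) := {v | CoverRel A v.1 v.2.1} ∩ {v | CoverRel A v.2.1 v.2.2} ∩
      (⋃ i, interior (A i) ×ˢ interior (A i) ×ˢ interior (A i))ᶜ
    have hBc : IsCompact B := by
      refine IsClosed.isCompact (((hEcl.preimage (f := fun v : G × G × G => (v.1, v.2.1))
        (by fun_prop)).inter (hEcl.preimage (f := fun v : G × G × G => (v.2.1, v.2.2))
        (by fun_prop))).inter ?_)
      exact (isOpen_iUnion fun i => isOpen_interior.prod
        (isOpen_interior.prod isOpen_interior)).isClosed_compl
    set F : G × G × G → ℝ := fun v => ‖f v.1 - f v.2.1‖ ^ 2 + ‖f v.2.1 - f v.2.2‖ ^ 2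
    have hFc : Continuous F := by fun_prop
    have hFpos : ∀ v ∈ B, 0 < F v := by
      rintro ⟨a, b, c⟩ ⟨⟨⟨i, hai, hbi⟩, ⟨j, hbj, hcj⟩⟩, h3⟩
      by_contra! hle
      have h1 : ‖f a - f b‖ ^ 2 + ‖f b - f c‖ ^ 2 ≤ 0 := hle
      have h4 : ‖f a - f b‖ = 0 := by
        have := sq_nonneg ‖f b - f c‖
        exact pow_eq_zero_iff two_ne_zero |>.1 (le_antisymm (by linarith) (sq_nonneg _))
      have h5 : ‖f b - f c‖ = 0 := by
        have := sq_nonneg ‖f a - f b‖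
        exact pow_eq_zero_iff two_ne_zero |>.1 (le_antisymm (by linarith) (sq_nonneg _))
      have hab : a = b := hi i hai hbi (sub_eq_zero.1 (norm_eq_zero.1 h4))
      have hbc : b = c := hi j hbj hcj (sub_eq_zero.1 (norm_eq_zero.1 h5))
      subst hab hbc
      obtain ⟨k, hk⟩ := hA a
      have hk' := mem_interior_iff_mem_nhds.2 hk
      exact h3 (mem_iUnion.2 ⟨k, hk', hk', hk'⟩)
    obtain ⟨ε, hε, hb⟩ : ∃ ε > 0, ∀ v ∈ B, ε ≤ F v := by
      rcases B.eq_empty_or_nonempty with h0 | hne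
      · exact ⟨1, one_pos, by simp [h0]⟩
      · obtain ⟨v, hv, hmin⟩ := hBc.exists_isMinOn hne hFc.continuousOn
        exact ⟨F v, hFpos v hv, fun w hw => isMinOn_iff.1 hmin w hw⟩
    refine ⟨ε, hε, fun a b c hab hbc hlt => ?_⟩
    by_contra hno
    refine absurd (hb (a, b, c) ⟨⟨hab, hbc⟩, ?_⟩) (not_le.2 hlt)
    intro hmem
    obtain ⟨i, h1, -, h3⟩ := mem_iUnion.1 hmem
    exact hno ⟨i, interior_subset h1, interior_subset h3⟩
  obtain ⟨m, z₀, h0, hm, hz₀, he₀⟩ := exists_coverRel_chain_energy hA hconv x y hε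
  set C : Set (ℕ → G) := {z | z 0 = x ∧ z m = y ∧ ∀ j < m, CoverRel A (z j) (z (j + 1))}
  have hCcl : IsClosed C := by
    have e : C = {z | z 0 = x} ∩ ({z | z m = y} ∩
        ⋂ j, ⋂ (_ : j < m), {z | CoverRel A (z j) (z (j + 1))}) := by
      ext z; simp [C]
    rw [e]
    refine (isClosed_eq (continuous_apply 0) continuous_const).inter
      ((isClosed_eq (continuous_apply m) continuous_const).inter ?_)
    exact isClosed_iInter fun j => isClosed_iInter fun _ =>
      hEcl.preimage (f := fun z : ℕ → G => (z j, z (j + 1)))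
        ((continuous_apply j).prodMk (continuous_apply (j + 1)))
  have hEc : Continuous fun z : ℕ → G => ∑ j ∈ Finset.range m, ‖f (z j) - f (z (j + 1))‖ ^ 2 := by
    refine continuous_finsetSum _ fun j _ => ?_
    exact ((hf.comp (continuous_apply j)).sub (hf.comp (continuous_apply (j + 1)))).norm.pow 2
  obtain ⟨z, ⟨hz0, hzm, hz⟩, hmin⟩ := hCcl.isCompact.exists_isMinOn
    (s := C) ⟨z₀, h0, hm, hz₀⟩ hEc.continuousOn
  rw [isMinOn_iff] at hmin
  have hez : ∑ j ∈ Finset.range m, ‖f (z j) - f (z (j + 1))‖ ^ 2 < ε :=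
    (hmin z₀ ⟨h0, hm, hz₀⟩).trans_lt he₀
  have hstep : ∀ j, j + 1 < m → f (z (j + 2)) - f (z (j + 1)) = f (z (j + 1)) - f (z j) := by
    intro j hj
    have hsub : ({j, j + 1} : Finset ℕ) ⊆ Finset.range m := by
      intro i hi
      simp only [Finset.mem_insert, Finset.mem_singleton] at hi
      rw [Finset.mem_range]; omega
    have hpair : ∀ z : ℕ → G, ∑ i ∈ ({j, j + 1} : Finset ℕ), ‖f (z i) - f (z (i + 1))‖ ^ 2 =
        ‖f (z j) - f (z (j + 1))‖ ^ 2 + ‖f (z (j + 1)) - f (z (j + 2))‖ ^ 2 := fun z =>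
      Finset.sum_pair (by omega)
    have hsmall := (Finset.sum_le_sum_of_subset_of_nonneg hsub
      (f := fun i => ‖f (z i) - f (z (i + 1))‖ ^ 2) fun _ _ _ => by positivity).trans_lt hez
    rw [hpair] at hsmall
    obtain ⟨w, hw1, hw2, hw3⟩ := (htriple _ _ _ (hz j (by omega)) (hz (j + 1) hj)
      hsmall).exists_midpoint hconv
    set z' := Function.update z (j + 1) w
    have hz'1 : z' (j + 1) = w := Function.update_self _ _ _
    have hz'2 : ∀ i, i ≠ j + 1 → z' i = z i := fun i hi => Function.update_of_ne hi _ _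
    have hz'C : z' ∈ C := by
      refine ⟨by rw [hz'2 _ (by omega), hz0], by rw [hz'2 _ (by omega), hzm], fun i hi => ?_⟩
      by_cases h1 : i = j
      · rw [h1, hz'1, hz'2 _ (by omega)]; exact hw1
      · by_cases h2 : i = j + 1
        · rw [h2, hz'1, hz'2 _ (by omega)]; exact hw2
        · rw [hz'2 _ h2, hz'2 _ (by omega)]; exact hz i hi
    have h1 := hmin z' hz'C
    rw [← Finset.sum_sdiff hsub, ← Finset.sum_sdiff hsub, hpair, hpair] at h1
    have h2 : ∑ i ∈ Finset.range m \ {j, j + 1}, ‖f (z' i) - f (z' (i + 1))‖ ^ 2 =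
        ∑ i ∈ Finset.range m \ {j, j + 1}, ‖f (z i) - f (z (i + 1))‖ ^ 2 := by
      refine Finset.sum_congr rfl fun i hi => ?_
      simp only [Finset.mem_sdiff, Finset.mem_insert, Finset.mem_singleton, not_or] at hi
      rw [hz'2 _ hi.2.2, hz'2 _ (by omega)]
    rw [h2, hz'1, hz'2 j (by omega), hz'2 (j + 2) (by omega), hw3] at h1
    -- the parallelogram law
    set a := f (z j)
    set b := f (z (j + 1))
    set c := f (z (j + 2))
    have e1 : a - (1 / 2 : ℝ) • (a + c) = (1 / 2 : ℝ) • (a - c) := by module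
    have e2 : (1 / 2 : ℝ) • (a + c) - c = (1 / 2 : ℝ) • (a - c) := by module
    have e3 := parallelogram_law_with_norm ℝ (a - b) (b - c)
    rw [sub_add_sub_cancel] at e3
    rw [e1, e2, norm_smul, mul_pow] at h1
    have e4 : ‖(1 / 2 : ℝ)‖ ^ 2 = 1 / 4 := by norm_num
    rw [e4] at h1
    have e5 : ‖a - b - (b - c)‖ = 0 := by
      have := norm_nonneg (a - b - (b - c))
      nlinarith
    have e6 := sub_eq_zero.1 (norm_eq_zero.1 e5)
    rw [← neg_sub b c, ← e6, neg_sub]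
  refine ⟨m, z, f (z 1) - f (z 0), hz0, hzm, hz, fun j => ?_⟩
  induction j with
  | zero => intro _; abel
  | succ j ih =>
    intro hj
    have h1 := ih (by omega)
    have h2 := hstep j hj
    rw [sub_eq_iff_eq_add] at h2
    rw [show j + 1 + 1 = j + 2 by ring, h2]
    nth_rewrite 1 [h1]
    abel

/-- A continuous map of a compact connected space, which is locally one-to-one and maps small
neighborhoods onto convex sets, is one-to-one, and its image is convex. -/
theorem injective_and_convex_range [TopologicalSpace G] [T2Space G] [CompactSpace G]
    [ConnectedSpace G] (hf : Continuous f)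
    (h : ∀ q, ∃ N ∈ 𝓝 q, IsClosed N ∧ InjOn f N ∧ Convex ℝ (f '' N)) :
    Function.Injective f ∧ Convex ℝ (range f) := by
  choose N hN hNc hNi hNconv using h
  obtain ⟨t, ht⟩ := isCompact_univ.elim_nhds_subcover (fun q => interior (N q)) fun q _ =>
    interior_mem_nhds.2 (hN q)
  let A : t → Set G := fun i => N i
  have hA : ∀ q, ∃ i, A i ∈ 𝓝 q := by
    intro q
    obtain ⟨i, hi, hq⟩ := mem_iUnion₂.1 (ht.2 (mem_univ q))
    exact ⟨⟨i, hi⟩, mem_interior_iff_mem_nhds.1 hq⟩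
  have hch := exists_straight_chain hf (A := A) (fun i => hNc i) hA (fun i => hNi i)
    (fun i => hNconv i)
  have hval : ∀ (m : ℕ) (z : ℕ → G) (d : R3), (∀ j < m, f (z (j + 1)) = f (z j) + d) →
      ∀ j ≤ m, f (z j) = f (z 0) + (j : ℝ) • d := by
    intro m z d hz j
    induction j with
    | zero => simp
    | succ j ih =>
      intro hj
      rw [hz j (by omega), ih (by omega)]
      push_cast
      module
  constructor
  · intro x y hxy
    obtain ⟨m, z, d, h0, hm, hz, hd⟩ := hch x y
    have hv := hval m z d hd
    have hconst : ∀ j ≤ m, z j = x := by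
      intro j
      induction j with
      | zero => intro _; exact h0
      | succ j ih =>
        intro hj
        have h1 := hv m le_rfl
        rw [hm, h0, hxy, left_eq_add, smul_eq_zero] at h1
        have hd0 : d = 0 := h1.resolve_left (by
          have : m ≠ 0 := by omega
          exact_mod_cast this)
        obtain ⟨i, hi1, hi2⟩ := hz j (by omega)
        have := hNi i hi2 hi1 (by rw [hd j (by omega), hd0, add_zero])
        rw [this, ih (by omega)]
    rw [← hm, hconst m le_rfl]
  · rintro _ ⟨x, rfl⟩ _ ⟨y, rfl⟩ a b ha hb hab
    obtain ⟨m, z, d, h0, hm, hz, hd⟩ := hch x y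
    have hv := hval m z d hd
    rcases Nat.eq_zero_or_pos m with rfl | hmpos
    · rw [← hm, ← h0]
      exact ⟨z 0, by rw [← add_smul, hab, one_smul]⟩
    -- the point lies in the image of the link number `⌊b m⌋` of the chain
    have hpt : a • f x + b • f y = f x + (b * m) • d := by
      have h1 := hv m le_rfl
      rw [hm, h0] at h1
      rw [h1, show a = 1 - b by linarith]
      module
    rw [hpt]
    rcases eq_or_lt_of_le (show b ≤ 1 by linarith) with rfl | hb1
    · refine ⟨y, ?_⟩
      have h1 := hv m le_rfl
      rw [hm, h0] at h1
      rw [h1, one_mul]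
    set j := ⌊b * m⌋₊
    have hm' : (0 : ℝ) < m := by exact_mod_cast hmpos
    have hbm : 0 ≤ b * m := by positivity
    have hj1 : (j : ℝ) ≤ b * m := Nat.floor_le hbm
    have hj2 : b * m < j + 1 := Nat.lt_floor_add_one _
    have hjm : j < m := by
      have : (j : ℝ) < m := hj1.trans_lt (by nlinarith)
      exact_mod_cast this
    obtain ⟨i, hi1, hi2⟩ := hz j hjm
    obtain ⟨w, -, hw⟩ := hNconv i ⟨_, hi1, rfl⟩ ⟨_, hi2, rfl⟩
      (show 0 ≤ 1 - (b * m - j) by linarith) (show 0 ≤ b * m - j by linarith) (by ring)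
    refine ⟨w, ?_⟩
    rw [hw, hd j hjm, hv j hjm.le, h0]
    module

end Tietze

/-! ### Points where the surface touches a plane from one side -/

section Support

variable {K : Set R3} {n : R3} {c : ℝ}

theorem inner_lt_of_mem_interior (hn : n ≠ 0) (hle : ∀ y ∈ K, ⟪n, y⟫ ≤ c) {k : R3}
    (hk : k ∈ interior K) : ⟪n, k⟫ < c := by
  obtain ⟨t, ht1, ht0, -⟩ := (eventually_lineMap n (mem_interior_iff_mem_nhds.1 hk)).exists
  have := hle _ ht1
  rw [inner_add_smul, real_inner_self_eq_norm_sq] at this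
  have hn' : 0 < ‖n‖ ^ 2 := pow_pos (norm_pos_iff.2 hn) 2
  have := mul_pos ht0 hn'
  linarith

theorem mem_frontier_of_inner_eq (hn : n ≠ 0) (hle : ∀ y ∈ K, ⟪n, y⟫ ≤ c) {y : R3} (hy : y ∈ K)
    (hyc : ⟪n, y⟫ = c) : y ∈ frontier K :=
  ⟨subset_closure hy, fun hi => (inner_lt_of_mem_interior hn hle hi).ne hyc⟩

/-- Near a relative interior point of a face, the boundary of the body is contained in the plane of
the face. -/
theorem RelInt.eventually_frontier (hK : IsConvexBody K) (hn : n ≠ 0) (hle : ∀ y ∈ K, ⟪n, y⟫ ≤ c)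
    {z : R3} (hz : RelInt K n c z) :
    ∀ᶠ y in 𝓝 z, y ∈ frontier K → ⟪n, y⟫ = c := by
  obtain ⟨k, hk⟩ := hK.interior_nonempty
  have hkc := inner_lt_of_mem_interior hn hle hk
  filter_upwards [hz.neg.eventually_mem_interior hK.convex hk (by simpa using hkc)] with y hy hyf
  by_contra hne
  refine hyf.2 (hy ?_)
  have := lt_of_le_of_ne (hle y (hK.frontier_subset hyf)) hne
  simpa using this

theorem convex_relInt (hK : Convex ℝ K) : Convex ℝ {y | RelInt K n c y} := by
  refine convex_iff_forall_pos.2 fun x hx y hy a b ha hb hab => ?_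
  have hx' : RelInt K n c x := hx
  have hy' : RelInt K n c y := hy
  have := hx'.lineMap hK hy'.mem hy'.1 (t := b) ⟨hb.le, by linarith⟩
  have e : a • x + b • y = x + b • (y - x) := by
    rw [show a = 1 - b by linarith]; module
  rw [e]
  exact this

theorem mem_closure_relInt_inter_ball (hK : Convex ℝ K) {z y : R3} (hz : RelInt K n c z)
    (hy : y ∈ K) (hyc : ⟪n, y⟫ = c) {O : Set R3} (hO : O ∈ 𝓝 y) :
    y ∈ closure ({w | RelInt K n c w} ∩ O) := by
  refine mem_closure_of_tendsto (tendsto_lineMap_zero y (z - y)) ?_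
  filter_upwards [eventually_lineMap (z - y) hO] with t ht
  refine ⟨?_, ht.1⟩
  have := hz.lineMap hK hy hyc (t := 1 - t) ⟨by linarith [ht.2.2], by linarith [ht.2.1]⟩
  have e : y + t • (z - y) = z + (1 - t) • (y - z) := by module
  rw [e]
  exact this

end Support

/-- A star-shaped subset of a line is convex. -/
theorem convex_of_star_of_line {S : Set R3} {z t : R3}
    (hstar : ∀ y ∈ S, ∀ τ ∈ Icc (0 : ℝ) 1, z + τ • (y - z) ∈ S)
    (hline : ∀ y ∈ S, ∃ a : ℝ, y = z + a • t) : Convex ℝ S := by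
  have key : ∀ a b : ℝ, z + b • t ∈ S → ((0 ≤ a ∧ a ≤ b) ∨ (a ≤ 0 ∧ b ≤ a)) → z + a • t ∈ S := by
    intro a b hb hab
    rcases eq_or_ne b 0 with h0 | h0
    · have : a = b := by rcases hab with h | h <;> linarith [h.1, h.2]
      rwa [this]
    · have hτ : a / b ∈ Icc (0 : ℝ) 1 := by
        rcases hab with ⟨h1, h2⟩ | ⟨h1, h2⟩
        · have hb0 : 0 < b := lt_of_le_of_ne (h1.trans h2) h0.symm
          exact ⟨by positivity, (div_le_one hb0).2 h2⟩
        · have hb0 : b < 0 := lt_of_le_of_ne (h2.trans h1) h0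
          exact ⟨div_nonneg_of_nonpos h1 hb0.le, (div_le_one_of_neg hb0).2 h2⟩
      have := hstar _ hb _ hτ
      rwa [add_sub_cancel_left, smul_smul, div_mul_cancel₀ _ h0] at this
  intro y₁ h₁ y₂ h₂ α β hα hβ hαβ
  obtain ⟨a₁, rfl⟩ := hline y₁ h₁
  obtain ⟨a₂, rfl⟩ := hline y₂ h₂
  have e : α • (z + a₁ • t) + β • (z + a₂ • t) = z + (α * a₁ + β * a₂) • t := by
    rw [show α = 1 - β by linarith]; module
  rw [e]
  rcases le_total a₁ a₂ with h | h <;> rcases le_total 0 (α * a₁ + β * a₂) with h0 | h0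
  · exact key _ a₂ h₂ (Or.inl ⟨h0, by nlinarith⟩)
  · exact key _ a₁ h₁ (Or.inr ⟨h0, by nlinarith⟩)
  · exact key _ a₁ h₁ (Or.inl ⟨h0, by nlinarith⟩)
  · exact key _ a₂ h₂ (Or.inr ⟨h0, by nlinarith⟩)

section Nice

variable {M : Type*} [TopologicalSpace M]

/-- Near `q`, the surface lies on one side of the plane `{⟨n, x⟩ = c}`, and it meets the plane in a
convex set. -/
def NiceAt (f : M → R3) (n : R3) (c : ℝ) (q : M) : Prop := ∃ U K, LocalModel f q U K ∧
    ((∀ x ∈ U, ⟪n, f x⟫ ≤ c) ∨ ∀ x ∈ U, c ≤ ⟪n, f x⟫) ∧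
    Convex ℝ (f '' (U ∩ f ⁻¹' plane n c))

variable {f : M → R3} {n : R3} {c : ℝ} {q : M} {U : Set M} {K : Set R3}

theorem plane_neg (n : R3) (c : ℝ) : plane (-n) (-c) = plane n c := by
  ext x; simp [plane]

theorem NiceAt.neg (h : NiceAt f n c q) : NiceAt f (-n) (-c) q := by
  obtain ⟨U, K, h1, h2, h3⟩ := h
  refine ⟨U, K, h1, ?_, by rwa [plane_neg]⟩
  simpa [or_comm] using h2

theorem niceAt_neg_iff : NiceAt f (-n) (-c) q ↔ NiceAt f n c q :=
  ⟨fun h => by simpa using h.neg, NiceAt.neg⟩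

/-- The part of a local model over a small closed ball. -/
theorem LocalModel.exists_inter_closedBall (h : LocalModel f q U K) (hf : Continuous f) {N : Set M}
    (hN : N ∈ 𝓝 q) : ∃ ε > 0, ∀ ε', 0 < ε' → ε' ≤ ε →
      LocalModel f q (U ∩ f ⁻¹' closedBall (f q) ε') K ∧
      U ∩ f ⁻¹' closedBall (f q) ε' ⊆ interior U ∩ N := by
  obtain ⟨ε, hε, hs⟩ := h.sep hf (inter_mem (interior_mem_nhds.2 h.mem_nhds) hN)
  refine ⟨ε / 2, by positivity, fun ε' hε' hle => ⟨?_, ?_⟩⟩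
  · exact h.mono inter_subset_left (h.isCompact.inter_right (isClosed_closedBall.preimage hf))
      (inter_mem h.mem_nhds (hf.continuousAt.preimage_mem_nhds (closedBall_mem_nhds _ hε')))
  · rintro x ⟨hxU, hx⟩
    have : dist (f x) (f q) ≤ ε' := hx
    exact hs x hxU (by linarith)

theorem NiceAt.exists_small (h : NiceAt f n c q) (hf : Continuous f) {N : Set M} (hN : N ∈ 𝓝 q) :
    ∃ U ⊆ N, ∃ K, LocalModel f q U K ∧ ((∀ x ∈ U, ⟪n, f x⟫ ≤ c) ∨ ∀ x ∈ U, c ≤ ⟪n, f x⟫) ∧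
      Convex ℝ (f '' (U ∩ f ⁻¹' plane n c)) ∧ ∀ x ∈ U, ⟪n, f x⟫ = c → NiceAt f n c x := by
  obtain ⟨U, K, h1, h2, h3⟩ := h
  obtain ⟨ε, hε, hs⟩ := h1.exists_inter_closedBall hf hN
  obtain ⟨h4, h5⟩ := hs ε hε le_rfl
  refine ⟨_, h5.trans inter_subset_right, K, h4, ?_, ?_, fun x hx _ =>
    ⟨U, K, h1.of_mem_interior (h5 hx).1, h2, h3⟩⟩
  · exact h2.imp (fun h x hx => h x hx.1) fun h x hx => h x hx.1
  · have e : f '' (U ∩ f ⁻¹' closedBall (f q) ε ∩ f ⁻¹' plane n c) =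
        f '' (U ∩ f ⁻¹' plane n c) ∩ closedBall (f q) ε := by
      rw [← image_inter_preimage]; congr 1; ext x; simp only [mem_inter_iff]; tauto
    rw [e]
    exact h3.inter (convex_closedBall _ _)

theorem LocalModel.niceAt_of_face (h : LocalModel f q U K) (hf : Continuous f)
    (hle : ∀ y ∈ K, ⟪n, y⟫ ≤ c) {ε : ℝ} (hε : 0 < ε)
    (hface : ∀ y ∈ K, ⟪n, y⟫ = c → dist y (f q) < ε → y ∈ f '' U) : NiceAt f n c q := by
  obtain ⟨ε', hε', hs⟩ := h.exists_inter_closedBall hf univ_mem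
  set ε₀ := min ε' (ε / 2)
  have hε₀ : 0 < ε₀ := lt_min hε' (by positivity)
  obtain ⟨h4, h5⟩ := hs ε₀ hε₀ (min_le_left _ _)
  refine ⟨_, K, h4, Or.inl fun x hx => hle _ (h.body.frontier_subset (h.maps x hx.1)), ?_⟩
  have e : f '' (U ∩ f ⁻¹' closedBall (f q) ε₀ ∩ f ⁻¹' plane n c) =
      K ∩ plane n c ∩ closedBall (f q) ε₀ := by
    ext y
    constructor
    · rintro ⟨x, ⟨⟨h1, h2⟩, h3⟩, rfl⟩
      exact ⟨⟨h.body.frontier_subset (h.maps x h1), h3⟩, h2⟩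
    · rintro ⟨⟨h1, h2⟩, h3⟩
      have h3' : dist y (f q) ≤ ε₀ := h3
      obtain ⟨x, hx, rfl⟩ := hface y h1 h2 (by linarith [min_le_right ε' (ε / 2)])
      exact ⟨x, ⟨⟨hx, h3⟩, h2⟩, rfl⟩
  rw [e]
  exact (h.body.convex.inter (convex_hyperplane (f := fun x => ⟪n, x⟫)
    (innerSL ℝ n).isLinear c)).inter (convex_closedBall _ _)

variable [ChartedSpace (EuclideanHalfSpace 2) M]

/-- An interior point of the surface, where the plane supports the body, is nice. -/
theorem LocalModel.niceAt_of_notMem_bdry (h : LocalModel f q U K) (hf : Continuous f)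
    (hq : q ∉ bdry M) (hn : n ≠ 0) (hle : ∀ y ∈ K, ⟪n, y⟫ ≤ c) : NiceAt f n c q := by
  obtain ⟨ε, hε, hb⟩ := Metric.mem_nhdsWithin_iff.1 (h.image_mem_nhdsWithin hf hq)
  exact h.niceAt_of_face hf hle hε fun y hy hyc hyd =>
    hb ⟨hyd, mem_frontier_of_inner_eq hn hle hy hyc⟩

theorem LocalModel.not_relInt_of_mem_bdry (h : LocalModel f q U K) (hf : Continuous f)
    (hflat : LocallyNonflatAlongBoundary f) (hn : n ≠ 0) (hle : ∀ y ∈ K, ⟪n, y⟫ ≤ c) {b : M}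
    (hb : b ∈ bdry M) (hbU : b ∈ interior U) : ¬ RelInt K n c (f b) := by
  intro hr
  refine hflat b hb _ (inter_mem (mem_interior_iff_mem_nhds.1 hbU)
    (hf.continuousAt.preimage_mem_nhds (hr.eventually_frontier h.body hn hle))) ⟨n, c, hn, ?_⟩
  rintro _ ⟨x, ⟨hxU, hx⟩, rfl⟩
  exact hx (h.maps x hxU)

/-- At a boundary point where the plane supports the body, either the surface meets the plane in a
convex set, or the face of the body has nonempty relative interior and lies on the other side of
the boundary curve. -/
theorem LocalModel.niceAt_or (h : LocalModel f q U K) (hf : Continuous f)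
    (hflat : LocallyNonflatAlongBoundary f) (hn : ‖n‖ = 1) (hle : ∀ y ∈ K, ⟪n, y⟫ ≤ c)
    (hqc : ⟪n, f q⟫ = c) {φ : ℝ → bdry M} (hφ : IsRegularParam f 2 φ) (hφq : (φ 0 : M) = q)
    (hli : LinearIndependent ℝ
      ![deriv (boundaryCurve f φ) 0, deriv (deriv (boundaryCurve f φ)) 0]) :
    NiceAt f n c q ∨ ((∃ z, RelInt K n c z) ∧
      (∃ ε > 0, ∀ y, RelInt K n c y → dist y (f q) < ε → y ∉ f '' U) ∧
      ∀ᶠ x in 𝓝 q, ⟪n, f x⟫ = c → x ∈ bdry M) := by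
  have hn0 : n ≠ 0 := by rw [← norm_ne_zero_iff, hn]; exact one_ne_zero
  have hqK : f q ∈ K := h.body.frontier_subset (h.maps q h.mem)
  obtain ⟨ε₁, hε₁, hconn⟩ := h.exists_subset_or_disjoint hf
  rcases relInt_or_subset_line h.body.convex hn0 hqK hqc with ⟨z, hz⟩ | ⟨e, he, hne, hline⟩
  · obtain ⟨ε₂, hε₂, hsep⟩ := h.sep hf (interior_mem_nhds.2 h.mem_nhds)
    set ε := min ε₁ ε₂
    have hε : 0 < ε := lt_min hε₁ hε₂
    have hR := hconn ({y | RelInt K n c y} ∩ ball (f q) ε) (by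
        rintro y ⟨hy1, hy2⟩
        exact ⟨mem_frontier_of_inner_eq hn0 hle (RelInt.mem hy1) hy1.1,
          Metric.ball_subset_ball (min_le_left _ _) hy2⟩)
      (((convex_relInt h.body.convex).inter (convex_ball _ _)).isPreconnected) (by
        rintro b ⟨hb, hbU⟩ ⟨h1, h2⟩
        exact h.not_relInt_of_mem_bdry hf hflat hn0 hle hb
          (hsep b hbU (Metric.ball_subset_ball (min_le_right _ _) h2)) h1)
    have hcl : ∀ y ∈ K, ⟪n, y⟫ = c → dist y (f q) < ε →
        y ∈ closure ({y | RelInt K n c y} ∩ ball (f q) ε) := fun y hy hyc hyd =>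
      mem_closure_relInt_inter_ball h.body.convex hz hy hyc (isOpen_ball.mem_nhds hyd)
    rcases hR with hsub | hdis
    · left
      refine h.niceAt_of_face hf hle hε fun y hy hyc hyd => ?_
      exact closure_minimal hsub (h.isClosed_image hf) (hcl y hy hyc hyd)
    · right
      refine ⟨⟨z, hz⟩, ⟨ε, hε, fun y hy hyd hyU => disjoint_left.1 hdis ⟨hy, hyd⟩ hyU⟩, ?_⟩
      filter_upwards [interior_mem_nhds.2 h.mem_nhds,
        hf.continuousAt.preimage_mem_nhds (ball_mem_nhds (f q) hε)] with x hx hxd hxc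
      by_contra hxb
      have hxU := interior_subset hx
      obtain ⟨O, hO, hxO, hOU⟩ := mem_nhdsWithin.1
        ((h.of_mem_interior hx).image_mem_nhdsWithin hf hxb)
      obtain ⟨y, hyO, hy⟩ := mem_closure_iff.1
        (hcl _ (h.body.frontier_subset (h.maps x hxU)) hxc hxd) O hO hxO
      exact disjoint_left.1 hdis hy
        (hOU ⟨hyO, mem_frontier_of_inner_eq hn0 hle (RelInt.mem hy.1) hy.1.1⟩)
  · left
    obtain ⟨δ, hδ, hb⟩ := Metric.mem_nhdsWithin_iff.1
      (eventually_not_mem_line hφ.contDiff hli hn he hne)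
    have hγ0 : boundaryCurve f φ 0 = f q := by simp only [boundaryCurve, hφq]
    have hbd : ∀ᶠ x in 𝓝 q, x ∈ bdry M → f x ∈ K → ⟪n, f x⟫ = c → x = q := by
      filter_upwards [hφq ▸ hφ.eventually_mem hδ] with x hx hxb hxK hxc
      obtain ⟨s, hs, hsx⟩ := hx hxb
      by_contra hne'
      have hs0 : s ≠ 0 := by rintro rfl; exact hne' (hsx.symm.trans hφq)
      have hγs : boundaryCurve f φ s = f x := by simp only [boundaryCurve, hsx]
      refine hb ⟨by simpa using hs, hs0⟩ ?_
      rw [hγ0, hγs]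
      exact ⟨by rw [inner_sub_right, hxc, hqc, sub_self], hline _ hxK hxc⟩
    obtain ⟨ε', hε', hs⟩ := h.exists_inter_closedBall hf hbd
    set ε := min ε' (ε₁ / 2)
    have hε : 0 < ε := lt_min hε' (by positivity)
    obtain ⟨h4, h5⟩ := hs ε hε (min_le_left _ _)
    refine ⟨_, K, h4, Or.inl fun x hx => hle _ (h.body.frontier_subset (h.maps x hx.1)), ?_⟩
    obtain ⟨t, -, -, -, hdec⟩ := exists_third_unit hn he hne
    refine convex_of_star_of_line (z := f q) (t := t) ?_ ?_
    · rintro _ ⟨x, ⟨⟨hxU, hxd⟩, hxc⟩, rfl⟩ τ hτ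
      have hxK := h.body.frontier_subset (h.maps x hxU)
      have hxc' : ⟪n, f x⟫ = c := hxc
      have hplane : ∀ τ : ℝ, ⟪n, f q + τ • (f x - f q)⟫ = c := fun τ => by
        rw [inner_add_smul, inner_sub_right, hqc, hxc']; ring
      have hball : ∀ τ ∈ Icc (0 : ℝ) 1, f q + τ • (f x - f q) ∈ closedBall (f q) ε :=
        fun τ hτ => (convex_closedBall _ _).lineMap_mem_set (mem_closedBall_self hε.le) hxd hτ
      by_cases hxq : f x = f q
      · exact ⟨x, ⟨⟨hxU, hxd⟩, hxc⟩, by simp [hxq]⟩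
      have hτ0 : τ = 0 ∨ 0 < τ := (eq_or_lt_of_le hτ.1).imp Eq.symm id
      rcases hτ0 with rfl | hτ0
      · exact ⟨q, ⟨⟨h.mem, mem_closedBall_self hε.le⟩, hqc⟩, by simp⟩
      have hsub := (hconn ((fun τ : ℝ => f q + τ • (f x - f q)) '' Ioc 0 1) (by
          rintro _ ⟨σ, hσ, rfl⟩
          have hσ' : σ ∈ Icc (0 : ℝ) 1 := ⟨hσ.1.le, hσ.2⟩
          have h6 : dist (f q + σ • (f x - f q)) (f q) ≤ ε := hball σ hσ'
          refine ⟨mem_frontier_of_inner_eq hn0 hle (h.body.convex.lineMap_mem_set hqK hxK hσ')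
            (hplane σ), ?_⟩
          rw [mem_ball]
          linarith [min_le_right ε' (ε₁ / 2)])
        (isPreconnected_Ioc.image _ (by fun_prop)) (by
          rintro b ⟨hb, hbU⟩ ⟨σ, hσ, hσb⟩
          have hσ' : σ ∈ Icc (0 : ℝ) 1 := ⟨hσ.1.le, hσ.2⟩
          simp only at hσb
          have h6 := (h5 ⟨hbU, show f b ∈ _ by rw [← hσb]; exact hball σ hσ'⟩).2 hb
            (h.body.frontier_subset (h.maps b hbU)) (by rw [← hσb]; exact hplane σ)
          rw [h6, add_eq_left, smul_eq_zero, sub_eq_zero] at hσb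
          exact hσb.elim hσ.1.ne' hxq)).resolve_right fun hd =>
        disjoint_left.1 hd ⟨1, ⟨one_pos, le_rfl⟩, by simp⟩ ⟨x, hxU, rfl⟩
      obtain ⟨x', hx'U, hx'⟩ := hsub ⟨τ, ⟨hτ0, hτ.2⟩, rfl⟩
      simp only at hx'
      refine ⟨x', ⟨⟨hx'U, ?_⟩, ?_⟩, hx'⟩
      · rw [mem_preimage, hx']; exact hball τ hτ
      · show ⟪n, f x'⟫ = c
        rw [hx']; exact hplane τ
    · rintro _ ⟨x, ⟨⟨hxU, hxd⟩, hxc⟩, rfl⟩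
      have hxc' : ⟪n, f x⟫ = c := hxc
      refine ⟨⟪t, f x - f q⟫, ?_⟩
      have h6 := hdec (f x - f q)
      rw [hline _ (h.body.frontier_subset (h.maps x hxU)) hxc', inner_sub_right, hxc', hqc,
        sub_self,
        zero_smul, zero_smul, zero_add, zero_add] at h6
      rw [← h6]; abel

end Nice

/-! ### Planar pieces of the surface -/

theorem IsCompact.isPreconnected_of_image {X Y : Type*} [TopologicalSpace X] [MetricSpace Y]
    {S A : Set X} (hS : IsCompact S) {F : X → Y} (hF : ContinuousOn F S) (hi : InjOn F S)
    (hA : A ⊆ S) (h : IsPreconnected (F '' A)) : IsPreconnected A := by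
  rcases A.eq_empty_or_nonempty with rfl | ⟨a, ha⟩
  · exact isPreconnected_empty
  have : Nonempty X := ⟨a⟩
  have h1 := h.image _ ((hS.continuousOn_invFunOn hF hi).mono (image_mono hA))
  have h2 : ∀ x ∈ A, Function.invFunOn F S (F x) = id x := fun x hx => hi.leftInvOn_invFunOn (hA hx)
  rwa [image_image, image_congr h2, image_id] at h1

/-- An isometric parametrization `P` of the plane `{⟨n, x⟩ = c}`, with inverse `π`. -/
theorem exists_plane_param {n : R3} (hn : n ≠ 0) (c : ℝ) :
    ∃ (P : E2 → R3) (π : R3 →L[ℝ] E2) (ι : E2 →L[ℝ] R3), (∀ w, ⟪n, P w⟫ = c) ∧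
      (∀ w, π (P w) = w) ∧ (∀ x, ⟪n, x⟫ = c → P (π x) = x) ∧
      (∀ w w', dist (P w) (P w') = dist w w') ∧ (∀ w w', P w' = P w + ι (w' - w)) ∧
      Continuous P ∧ ∀ B w, RelInt B n c (P w) ↔ w ∈ interior (P ⁻¹' B) := by
  obtain ⟨π, ι, hπι, hnι, hdec, hnorm, hπn⟩ := exists_orthogonal_coordinates hn
  set P : E2 → R3 := fun w => ι w + (c / ‖n‖ ^ 2) • n with hP
  have hnn : ‖n‖ ^ 2 ≠ 0 := pow_ne_zero _ (norm_ne_zero_iff.2 hn)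
  have hPpl : ∀ w, ⟪n, P w⟫ = c := fun w => by
    rw [hP]; simp only
    rw [inner_add_right, hnι, inner_smul_right, real_inner_self_eq_norm_sq, zero_add,
      div_mul_cancel₀ _ hnn]
  have hπP : ∀ w, π (P w) = w := fun w => by simp [hP, hπι, hπn]
  have hPπ : ∀ x, ⟪n, x⟫ = c → P (π x) = x := fun x hx => by
    conv_rhs => rw [hdec x, hx]
  have hdist : ∀ w w', dist (P w) (P w') = dist w w' := fun w w' => by
    rw [dist_eq_norm, dist_eq_norm, hP]
    simp only [add_sub_add_right_eq_sub]
    rw [← map_sub, hnorm]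
  refine ⟨P, π, ι, hPpl, hπP, hPπ, hdist, fun w w' => ?_, by fun_prop, fun B w => ?_⟩
  · simp only [hP, map_sub]; abel
  rw [mem_interior_iff_mem_nhds, Metric.mem_nhds_iff]
  constructor
  · rintro ⟨-, ε, hε, h⟩
    exact ⟨ε, hε, fun w' hw' => h _ (hPpl w') (by rw [hdist]; exact hw')⟩
  · rintro ⟨ε, hε, h⟩
    refine ⟨hPpl w, ε, hε, fun y hy hyd => ?_⟩
    rw [← hPπ y hy, hdist] at hyd
    have := h hyd
    rwa [mem_preimage, hPπ y hy] at this

theorem convex_preimage_plane_param {B : Set R3} (hB : Convex ℝ B) {P : E2 → R3} {ι : E2 →L[ℝ] R3}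
    (hP : ∀ w w', P w' = P w + ι (w' - w)) : Convex ℝ (P ⁻¹' B) := by
  intro w hw w' hw' a b ha hb hab
  have e : P (a • w + b • w') = a • P w + b • P w' := by
    rw [hP w w', hP w (a • w + b • w'), ← sub_eq_zero]
    have : a • w + b • w' - w = b • (w' - w) := by rw [show a = 1 - b by linarith]; module
    rw [this, map_smul, show a = 1 - b by linarith]; module
  rw [mem_preimage, e]
  exact hB hw hw' ha hb hab

/-- The relative boundary of a planar compact convex set is connected. -/
theorem isPreconnected_not_relInt {B : Set R3} (hB : IsCompact B) (hconv : Convex ℝ B) {n : R3}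
    (hn : n ≠ 0) {c : ℝ} (hsub : B ⊆ plane n c) : IsPreconnected {x ∈ B | ¬ RelInt B n c x} := by
  by_cases hex : ∃ z, RelInt B n c z
  swap
  · have : {x ∈ B | ¬ RelInt B n c x} = B := by
      ext x; exact ⟨fun h => h.1, fun h => ⟨h, fun h' => hex ⟨x, h'⟩⟩⟩
    rw [this]
    exact hconv.isPreconnected
  obtain ⟨z, hz⟩ := hex
  obtain ⟨P, π, ι, -, hπP, hPπ, -, hPι, hPc, hint⟩ := exists_plane_param hn c
  have hB' : P ⁻¹' B = π '' B := by
    ext w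
    constructor
    · intro hw; exact ⟨_, hw, hπP w⟩
    · rintro ⟨x, hx, rfl⟩; rw [mem_preimage, hPπ x (hsub hx)]; exact hx
  have hcomp : IsCompact (P ⁻¹' B) := by rw [hB']; exact hB.image π.continuous
  have hconv' : Convex ℝ (P ⁻¹' B) := convex_preimage_plane_param hconv hPι
  obtain ⟨h, -, -, hfr⟩ := exists_homeomorph_image_interior_closure_frontier_eq_unitBall hconv'
    ⟨π z, (hint B _).1 (by rw [hPπ z hz.1]; exact hz)⟩ hcomp.isBounded
  have hcon : IsPreconnected (frontier (P ⁻¹' B)) := by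
    have := (isPreconnected_sphere one_lt_rank_E2 (0 : E2) 1).image h.symm
      h.symm.continuous.continuousOn
    rw [← hfr, ← image_comp] at this
    simpa using this
  have e : {x ∈ B | ¬ RelInt B n c x} = P '' frontier (P ⁻¹' B) := by
    rw [hcomp.isClosed.frontier_eq]
    ext x
    constructor
    · rintro ⟨hx, hr⟩
      refine ⟨π x, ⟨?_, ?_⟩, hPπ x (hsub hx)⟩
      · rw [mem_preimage, hPπ x (hsub hx)]; exact hx
      · rw [← hint, hPπ x (hsub hx)]; exact hr
    · rintro ⟨w, ⟨hw1, hw2⟩, rfl⟩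
      exact ⟨hw1, fun hr => hw2 ((hint B w).1 hr)⟩
  rw [e]
  exact hcon.image _ hPc.continuousOn

/-- A small disk in a plane, which is contained in the boundary of a convex body, is a neighborhood
of its center in this boundary. -/
theorem IsConvexBody.disk_mem_nhdsWithin {K : Set R3} (hK : IsConvexBody K) {n : R3} (hn : n ≠ 0)
    {c : ℝ} {x : R3} (hxc : ⟪n, x⟫ = c) {ε : ℝ} (hε : 0 < ε)
    (h : ∀ y, ⟪n, y⟫ = c → dist y x < ε → y ∈ frontier K) :
    plane n c ∩ ball x ε ∈ 𝓝[frontier K] x := by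
  obtain ⟨π, ι, hπι, hnι, hdec, hnorm, hπn⟩ := exists_orthogonal_coordinates hn
  have hin : ∀ w, ⟪n, x + ι w⟫ = c := fun w => by rw [inner_add_right, hnι, hxc, add_zero]
  have hd : ∀ w, dist (x + ι w) x = ‖w‖ := fun w => by rw [dist_eq_norm, add_sub_cancel_left, hnorm]
  have hmem : ∀ w ∈ ball (0 : E2) ε, dist (x + ι w) x < ε := fun w hw => by
    rw [hd]; simpa using hw
  have h1 := hK.image_mem_nhdsWithin (U := ball (0 : E2) ε) (h := fun w => x + ι w)
    (x := 0) (by fun_prop)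
    (fun w _ w' _ hww => by
      have := congrArg π (add_left_cancel hww); rwa [hπι, hπι] at this)
    (ball_mem_nhds _ hε) fun w hw => h _ (hin w) (hmem w hw)
  simp only [map_zero, add_zero] at h1
  refine mem_of_superset h1 ?_
  rintro _ ⟨w, hw, rfl⟩
  exact ⟨hin w, hmem w hw⟩

/-- The set of points near a nice point which are mapped into the plane is connected. -/
theorem NiceAt.exists_subset_component {M : Type*} [TopologicalSpace M] {f : M → R3} {n : R3}
    {c : ℝ} {q : M} (h : NiceAt f n c q) (hf : Continuous f) (hqc : ⟪n, f q⟫ = c) {N : Set M}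
    (hN : N ∈ 𝓝 q) :
    ∃ U ⊆ N, ∃ K, LocalModel f q U K ∧ ((∀ x ∈ U, ⟪n, f x⟫ ≤ c) ∨ ∀ x ∈ U, c ≤ ⟪n, f x⟫) ∧
      Convex ℝ (f '' (U ∩ f ⁻¹' plane n c)) ∧
      U ∩ f ⁻¹' plane n c ⊆ connectedComponentIn {x | ⟪n, f x⟫ = c ∧ NiceAt f n c x} q := by
  obtain ⟨U, hUN, K, h1, h2, h3, h4⟩ := h.exists_small hf hN
  refine ⟨U, hUN, K, h1, h2, h3, ?_⟩
  exact (h1.isCompact.isPreconnected_of_image hf.continuousOn h1.injOn inter_subset_left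
    h3.isPreconnected).subset_connectedComponentIn ⟨h1.mem, hqc⟩ fun x hx => ⟨hx.2, h4 x hx.1 hx.2⟩

section Face

variable {M : Type*} [TopologicalSpace M] [ChartedSpace (EuclideanHalfSpace 2) M]

/-- A locally convex immersion with the regularity properties along the boundary. -/
structure IsRegularImmersion (f : M → R3) : Prop extends IsLocallyConvexImmersion f where
  bdry_regular : BoundaryRegular f 2
  no_inflections : NoBoundaryInflections f
  nonflat : LocallyNonflatAlongBoundary f

variable [T2Space M] [CompactSpace M] {f : M → R3} {n : R3} {c : ℝ}

/-- Near each point of the surface, the boundary meets a line through the image of the point only in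
this point. -/
theorem IsRegularImmersion.eventually_bdry_line (hf : IsRegularImmersion f) (q : M) {e : R3}
    (hn : ‖n‖ = 1) (he : ‖e‖ = 1) (hne : ⟪n, e⟫ = 0)
    :
    ∀ᶠ x in 𝓝 q, x ∈ bdry M → ⟪n, f x - f q⟫ = 0 → ⟪e, f x - f q⟫ = 0 → x = q := by
  by_cases hq : q ∈ bdry M
  swap
  · filter_upwards [hf.isClosed_bdry.isOpen_compl.mem_nhds hq] with x hx hx'
    exact absurd hx' hx
  obtain ⟨φ, hφ, hφq⟩ := hf.bdry_regular ⟨q, hq⟩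
  have hφq' : (φ 0 : M) = q := by rw [hφq]
  have h1 := eventually_not_mem_line hφ.contDiff (hf.no_inflections φ hφ 0) hn he hne
  rw [eventually_nhdsWithin_iff, Metric.eventually_nhds_iff] at h1
  obtain ⟨δ, hδ, h1⟩ := h1
  have h2 := hφ.eventually_mem hδ
  rw [hφq'] at h2
  filter_upwards [h2] with x hx hxb hx1 hx2
  obtain ⟨s, hs, hsx⟩ := hx hxb
  have e0 : boundaryCurve f φ 0 = f q := by simp [boundaryCurve, hφq']
  have es : boundaryCurve f φ s = f x := by simp [boundaryCurve, hsx]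
  by_contra hne'
  refine h1 (y := s) (by simpa using hs) ?_ ⟨by rw [e0, es]; exact hx1, by rw [e0, es]; exact hx2⟩
  rintro rfl
  exact hne' (hsx.symm.trans hφq')

/-- A connected set with more than one point, whose points have neighborhoods in which the set
is mapped onto a convex planar set, has points off the boundary near each of its points. -/
theorem IsRegularImmersion.exists_notMem_bdry_of_nice (hf : IsRegularImmersion f) (hn : ‖n‖ = 1)
    {G : Set M} (hG : IsPreconnected G) (hnt : G.Nontrivial) {q : M} (hq : q ∈ G)
    (hqc : ⟪n, f q⟫ = c) {U : Set M} {K : Set R3} (h : LocalModel f q U K)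
    (hconv : Convex ℝ (f '' (U ∩ f ⁻¹' plane n c))) (hUG : U ∩ f ⁻¹' plane n c ⊆ G)
    (hGc : ∀ x ∈ G, ⟪n, f x⟫ = c) :
    ∃ x ∈ U, x ∈ G ∧ x ∉ bdry M := by
  -- `q` is not isolated in `G`
  have hx₁ : ∃ x₁ ∈ G ∩ interior U, x₁ ≠ q := by
    by_contra! hcon
    obtain ⟨y, hy, hyq⟩ := hnt.exists_ne q
    obtain ⟨z, hz, hz1, hz2⟩ := hG (interior U) {q}ᶜ isOpen_interior isClosed_singleton.isOpen_compl
      (fun x hx => by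
        by_cases hxq : x = q
        · left; rw [hxq]; exact mem_interior_iff_mem_nhds.2 h.mem_nhds
        · right; exact hxq)
      ⟨q, hq, mem_interior_iff_mem_nhds.2 h.mem_nhds⟩ ⟨y, hy, hyq⟩
    exact hz2 (hcon z ⟨hz, hz1⟩)
  obtain ⟨x₁, ⟨hx₁G, hx₁U⟩, hx₁q⟩ := hx₁
  have hx₁U := interior_subset hx₁U
  set d := f x₁ - f q with hd
  have hd0 : d ≠ 0 := fun h0 => hx₁q (h.injOn hx₁U h.mem (sub_eq_zero.1 h0))
  have hnd : ⟪n, d⟫ = 0 := by rw [hd, inner_sub_right, hGc _ hx₁G, hqc, sub_self]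
  have hd1 : ‖(‖d‖⁻¹ • d)‖ = 1 := by
    exact norm_inv_norm_smul hd0
  obtain ⟨e, he, hne, hde, -⟩ := exists_third_unit hn hd1 (by rw [inner_smul_right, hnd, mul_zero])
  have hed : ⟪e, d⟫ = 0 := by
    rw [inner_smul_left] at hde
    rw [real_inner_comm]
    refine (mul_eq_zero.1 hde).resolve_left ?_
    simpa using hd0
  by_contra! hcon
  have h2 := hf.eventually_bdry_line q hn he hne
  obtain ⟨ε, hε, hsep⟩ := h.sep hf.continuous h2
  obtain ⟨t, ht1, ht0, ht2⟩ := (eventually_lineMap d (ball_mem_nhds (f q) hε)).exists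
  obtain ⟨x, hx, hxt⟩ := hconv.add_smul_sub_mem (mem_image_of_mem f ⟨h.mem, hqc⟩)
    (mem_image_of_mem f ⟨hx₁U, hGc _ hx₁G⟩) (t := t) ⟨ht0.le, ht2.le⟩
  have hxd : f x - f q = t • d := by rw [hxt, hd]; abel
  have := hsep x hx.1 (by rw [hxt]; exact ht1) (hcon x hx.1 (hUG hx))
    (by rw [hxd, inner_smul_right, hnd, mul_zero]) (by rw [hxd, inner_smul_right, hed, mul_zero])
  rw [this, sub_self] at hxd
  exact (smul_ne_zero ht0.ne' hd0) hxd.symm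

/-- The set of nice points is closed along its components. -/
theorem IsRegularImmersion.niceAt_of_mem_closure (hf : IsRegularImmersion f) (hn : ‖n‖ = 1) {q : M}
    (hqc : ⟪n, f q⟫ = c) (h : ∀ N ∈ 𝓝 q, ∃ x ∈ N, ⟪n, f x⟫ = c ∧ NiceAt f n c x ∧ x ∉ bdry M)
    :
    NiceAt f n c q := by
  obtain ⟨U, -, K, hU⟩ := hf.exists_localModel q univ_mem
  obtain ⟨x, hxU, hxc, hxn, hxb⟩ := h _ (interior_mem_nhds.2 hU.mem_nhds)
  have hxU' := hU.of_mem_interior hxU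
  obtain ⟨U₁, hU₁s, K₁, hU₁, hside, -, -⟩ := hxn.exists_small hf.continuous hxU'.mem_nhds
  -- the plane supports the body `K`
  have hxmem := hxU'.mono (U' := U₁) hU₁s hU₁.isCompact hU₁.mem_nhds
  have hev := mem_nhdsWithin_iff_exists_mem_nhds_inter.1
    (hxmem.image_mem_nhdsWithin hf.continuous hxb)
  obtain ⟨s, hs, hsU⟩ := hev
  have hxK : f x ∈ frontier K := hU.maps x (interior_subset hxU)
  have key : ∀ {n : R3} {c : ℝ}, ‖n‖ = 1 → ⟪n, f q⟫ = c →
      (∀ N ∈ 𝓝 q, ∃ x ∈ N, ⟪n, f x⟫ = c ∧ NiceAt f n c x ∧ x ∉ bdry M) →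
      (∀ y ∈ K, ⟪n, y⟫ ≤ c) → NiceAt f n c q := by
    intro n c hn hqc h hle
    by_cases hq : q ∈ bdry M
    swap
    · exact hU.niceAt_of_notMem_bdry hf.continuous hq (by rintro rfl; simp at hn) hle
    obtain ⟨φ, hφ, hφq⟩ := hf.bdry_regular ⟨q, hq⟩
    rcases hU.niceAt_or hf.continuous hf.nonflat hn hle hqc hφ (by rw [hφq])
        (hf.no_inflections φ hφ 0) with
      h1 | ⟨-, -, h1⟩
    · exact h1
    · obtain ⟨x, hx, hxc, -, hxb⟩ := h _ h1
      exact absurd (hx hxc) hxb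
  have key' : (∀ y ∈ K, ⟪n, y⟫ ≤ c) ∨ ∀ y ∈ K, c ≤ ⟪n, y⟫ := by
    rcases hside with hside | hside
    · have := hU.body.convex.one_sided_of_frontier hxK (hU.body.frontier_subset hxK) (innerSL ℝ n)
        hs
        (fun y hy hys => by
          obtain ⟨z, hz, rfl⟩ := hsU ⟨hys, hy⟩
          simpa [hxc] using hside z hz)
      simpa [hxc] using this
    · have := hU.body.convex.one_sided_of_frontier hxK (hU.body.frontier_subset hxK)
        (innerSL ℝ (-n)) hs
        (fun y hy hys => by
          obtain ⟨z, hz, rfl⟩ := hsU ⟨hys, hy⟩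
          simpa [hxc] using hside z hz)
      simpa [hxc, or_comm] using this
  rcases key' with hle | hle
  · exact key hn hqc h hle
  · rw [← niceAt_neg_iff]
    refine key (by simpa using hn) (by simpa using hqc) ?_ (by simpa using hle)
    intro N hN
    obtain ⟨x, hx, hxc, hxn, hxb⟩ := h N hN
    exact ⟨x, hx, by simpa using hxc, hxn.neg, hxb⟩

end Face

section FlatFace

variable {M : Type*} [TopologicalSpace M] [ChartedSpace (EuclideanHalfSpace 2) M]
  {f : M → R3} {n : R3} {c : ℝ}

/-- A point near which the surface lies in a plane is mapped to a relative interior point. -/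
theorem LocalModel.relInt_of_flat {q : M} {U : Set M} {K : Set R3} (hU : LocalModel f q U K)
    (hf : Continuous f) (hq : q ∉ bdry M) (hn : n ≠ 0) (h : ∀ x ∈ U, ⟪n, f x⟫ = c) :
    RelInt (f '' U) n c (f q) := by
  obtain ⟨s, hs, hsU⟩ := mem_nhdsWithin_iff_exists_mem_nhds_inter.1 (hU.image_mem_nhdsWithin hf hq)
  have hqc := h q hU.mem
  obtain ⟨hside, δ, hδ, hdisk⟩ := hU.body.convex.flat_of_frontier hU.body.isClosed
    hU.body.interior_nonempty (hU.maps q hU.mem) (innerSL ℝ n)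
    (fun h0 => hn (by simpa using congrArg (fun φ => φ n) h0)) hs (fun y hy hys => by
      obtain ⟨z, hz, rfl⟩ := hsU ⟨hys, hy⟩
      simp [hqc, h z hz])
  obtain ⟨ε, hε, hεs⟩ := Metric.mem_nhds_iff.1 hs
  refine ⟨hqc, min ε δ, lt_min hε hδ, fun y hy hyd => hsU ⟨hεs ?_, ?_⟩⟩
  · exact hyd.trans_le (min_le_left _ _)
  · have hyK := hdisk y (by simp [hqc, hy]) (hyd.trans_le (min_le_right _ _))
    rcases hside with h1 | h1
    · exact mem_frontier_of_inner_eq hn (c := c) (by simpa [hqc] using h1) hyK hy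
    · exact mem_frontier_of_inner_eq (neg_ne_zero.2 hn) (c := -c) (by simpa [hqc] using h1) hyK
        (by simp [hy])

/-- The surface is flat near a point which is mapped to a relative interior point of an embedded
planar piece. -/
theorem LocalModel.flat_of_relInt {q : M} {U : Set M} {K : Set R3} (hU : LocalModel f q U K)
    (hf : Continuous f) (hn : n ≠ 0) (h : RelInt (f '' U) n c (f q)) :
    q ∉ bdry M ∧ ∀ᶠ x in 𝓝 q, ⟪n, f x⟫ = c := by
  obtain ⟨hqc, ε, hε, hdisk⟩ := h
  have h1 := hU.body.disk_mem_nhdsWithin hn hqc hε fun y hy hyd => by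
    obtain ⟨x, hx, rfl⟩ := hdisk y hy hyd
    exact hU.maps x hx
  constructor
  · intro hq
    exact hU.image_notMem_nhdsWithin hf hq (mem_of_superset h1 fun y hy => hdisk y hy.1 hy.2)
  · obtain ⟨s, hs, hsU⟩ := mem_nhdsWithin_iff_exists_mem_nhds_inter.1 h1
    filter_upwards [hU.mem_nhds, hf.continuousAt.preimage_mem_nhds hs] with x hxU hxs
    exact (hsU ⟨hxs, hU.maps x hxU⟩).1

variable [T2Space M] [CompactSpace M]

/-- The component through `p` of the set of points mapped into a supporting plane, at which the
surface meets this plane in a convex set, is mapped injectively onto a convex set. The surface lies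
locally on one side of the plane along this component, and it meets the plane only there. -/
theorem IsRegularImmersion.exists_flat_face (hf : IsRegularImmersion f) (hn : ‖n‖ = 1) {p : M}
    (hp : p ∈ bdry M) (hpc : ⟪n, f p⟫ = c) (hnice : NiceAt f n c p)
    (hle : ∀ᶠ x in 𝓝 p, ⟪n, f x⟫ ≤ c) :
    ∃ W : Set M, p ∈ W ∧ IsCompact W ∧ IsConnected W ∧ InjOn f W ∧ Convex ℝ (f '' W) ∧
      (∀ x ∈ W, ⟪n, f x⟫ = c) ∧
      ∃ N, IsOpen N ∧ W ⊆ N ∧ ∀ x ∈ N, ⟪n, f x⟫ ≤ c ∧ (⟪n, f x⟫ = c → x ∈ W) := by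
  have hn0 : n ≠ 0 := by rintro rfl; simp at hn
  set S : Set M := {x | ⟪n, f x⟫ = c ∧ NiceAt f n c x}
  set W := connectedComponentIn S p with hW
  have hpW : p ∈ W := mem_connectedComponentIn ⟨hpc, hnice⟩
  have hWS : W ⊆ S := connectedComponentIn_subset _ _
  have hWpre : IsPreconnected W := isPreconnected_connectedComponentIn
  have hloc : ∀ q ∈ W, ∀ N ∈ 𝓝 q, ∃ U ⊆ N, ∃ K, LocalModel f q U K ∧
      ((∀ x ∈ U, ⟪n, f x⟫ ≤ c) ∨ ∀ x ∈ U, c ≤ ⟪n, f x⟫) ∧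
      Convex ℝ (f '' (U ∩ f ⁻¹' plane n c)) ∧ U ∩ f ⁻¹' plane n c ⊆ W := by
    intro q hq N hN
    obtain ⟨U, hUN, K, h1, h2, h3, h4⟩ := (hWS hq).2.exists_subset_component hf.continuous
      (hWS hq).1 hN
    exact ⟨U, hUN, K, h1, h2, h3, by rwa [hW, connectedComponentIn_eq hq]⟩
  have hWcl : IsClosed W := by
    by_cases hnt : W.Nontrivial
    swap
    · exact (not_nontrivial_iff.1 hnt).finite.isClosed
    refine isClosed_of_closure_subset ?_
    refine hWpre.closure.subset_connectedComponentIn (subset_closure hpW) fun q hq => ?_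
    have hqc : ⟪n, f q⟫ = c := by
      have : IsClosed {x | ⟪n, f x⟫ = c} :=
        isClosed_eq (continuous_const.inner hf.continuous) continuous_const
      exact closure_minimal (fun x hx => (hWS hx).1) this hq
    refine ⟨hqc, hf.niceAt_of_mem_closure hn hqc fun N hN => ?_⟩
    obtain ⟨x, hxN, hxW⟩ := mem_closure_iff_nhds.1 hq _ (interior_mem_nhds.2 hN)
    obtain ⟨U, hUN, K, h1, -, h3, h4⟩ := hloc x hxW N (mem_interior_iff_mem_nhds.1 hxN)
    obtain ⟨y, hyU, hyW, hyb⟩ := hf.exists_notMem_bdry_of_nice hn hWpre hnt hxW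
      (hWS hxW).1 h1 h3 h4 fun x hx => (hWS hx).1
    exact ⟨y, hUN hyU, (hWS hyW).1, (hWS hyW).2, hyb⟩
  have hWcp : IsCompact W := hWcl.isCompact
  have hcon : IsConnected W := ⟨⟨p, hpW⟩, hWpre⟩
  -- local convexity implies convexity
  have hWconv : InjOn f W ∧ Convex ℝ (f '' W) := by
    have : CompactSpace W := isCompact_iff_compactSpace.1 hWcp
    have : ConnectedSpace W := isConnected_iff_connectedSpace.1 hcon
    obtain ⟨h1, h2⟩ := injective_and_convex_range (G := W) (f := fun x => f x)
      (hf.continuous.comp continuous_subtype_val) (by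
        rintro ⟨q, hq⟩
        obtain ⟨U, -, K, h1, -, h3, h4⟩ := hloc q hq univ univ_mem
        refine ⟨Subtype.val ⁻¹' U, continuous_subtype_val.continuousAt.preimage_mem_nhds
          h1.mem_nhds,
          h1.isCompact.isClosed.preimage continuous_subtype_val, ?_, ?_⟩
        · intro x hx y hy hxy
          exact Subtype.ext (h1.injOn hx hy hxy)
        · convert h3 using 1
          ext y
          constructor
          · rintro ⟨x, hx, rfl⟩; exact ⟨x, ⟨hx, (hWS x.2).1⟩, rfl⟩
          · rintro ⟨x, hx, rfl⟩; exact ⟨⟨x, h4 hx⟩, hx.1, rfl⟩)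
    refine ⟨fun x hx y hy hxy => congrArg Subtype.val (@h1 ⟨x, hx⟩ ⟨y, hy⟩ hxy), ?_⟩
    rwa [image_eq_range]
  have hWpl : f '' W ⊆ plane n c := by rintro _ ⟨x, hx, rfl⟩; exact (hWS hx).1
  -- the points of `W` near which the surface is flat are mapped to the relative interior of `f(W)`
  have hflat1 : ∀ q ∈ W, (∀ᶠ x in 𝓝 q, ⟪n, f x⟫ = c) → RelInt (f '' W) n c (f q) := by
    intro q hq hev
    obtain ⟨U, hUN, K, h1, -, -, h4⟩ := hloc q hq _ hev
    have hqb : q ∉ bdry M := fun hb => hf.nonflat q hb U h1.mem_nhds ⟨n, c, hn0, by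
      rintro _ ⟨x, hx, rfl⟩; exact hUN hx⟩
    refine (h1.relInt_of_flat hf.continuous hqb hn0 fun x hx => hUN hx).mono fun y hy hyc => ?_
    obtain ⟨x, hx, rfl⟩ := hy
    exact ⟨x, h4 ⟨hx, hyc⟩, rfl⟩
  have hflat2 : ∀ q ∈ W, RelInt (f '' W) n c (f q) → q ∉ bdry M ∧ ∀ᶠ x in 𝓝 q, ⟪n, f x⟫ = c := by
    intro q hq hr
    obtain ⟨U, -, K, h1, -, -, h4⟩ := hloc q hq univ univ_mem
    refine h1.flat_of_relInt hf.continuous hn0 ?_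
    obtain ⟨ε, hε, hsep⟩ := hWcp.exists_dist_lt_imp_mem hf.continuous.continuousOn hWconv.1 hq
      h1.mem_nhds
    obtain ⟨hqc, δ, hδ, hdisk⟩ := hr
    refine ⟨hqc, min δ ε, lt_min hδ hε, fun y hy hyd => ?_⟩
    obtain ⟨x, hx, rfl⟩ := hdisk y hy (hyd.trans_le (min_le_left _ _))
    exact ⟨x, hsep x hx (hyd.trans_le (min_le_right _ _)), rfl⟩
  set R : Set M := {x ∈ W | ¬ RelInt (f '' W) n c (f x)}
  have hRpre : IsPreconnected R := by
    refine hWcp.isPreconnected_of_image hf.continuous.continuousOn hWconv.1 (fun x hx => hx.1) ?_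
    have : f '' R = {x ∈ f '' W | ¬ RelInt (f '' W) n c x} := by
      ext y
      constructor
      · rintro ⟨x, hx, rfl⟩; exact ⟨⟨x, hx.1, rfl⟩, hx.2⟩
      · rintro ⟨⟨x, hx, rfl⟩, hr⟩; exact ⟨x, ⟨hx, hr⟩, rfl⟩
    rw [this]
    exact isPreconnected_not_relInt (hWcp.image hf.continuous) hWconv.2 hn0 hWpl
  have hpR : p ∈ R := ⟨hpW, fun hr => (hflat2 p hpW hr).1 hp⟩
  -- the side on which the surface lies is constant along the relative boundary of `f(W)`
  have hside : ∀ q ∈ W, ∀ᶠ x in 𝓝 q, ⟪n, f x⟫ ≤ c := by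
    intro q hq
    by_cases hr : RelInt (f '' W) n c (f q)
    · exact (hflat2 q hq hr).2.mono fun x hx => hx.le
    set A : Set M := {q | ∀ᶠ x in 𝓝 q, ⟪n, f x⟫ ≤ c}
    set B : Set M := {q | ∀ᶠ x in 𝓝 q, c ≤ ⟪n, f x⟫}
    have hAB : R ⊆ A ∪ B := by
      rintro x ⟨hx, -⟩
      obtain ⟨U, -, K, h1, h2, -⟩ := hloc x hx univ univ_mem
      exact h2.imp (fun h => mem_of_superset h1.mem_nhds h) fun h => mem_of_superset h1.mem_nhds h
    rcases isPreconnected_iff_subset_of_disjoint.1 hRpre A B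
      (isOpen_iff_mem_nhds.2 fun x hx => eventually_eventually_nhds.2 hx)
      (isOpen_iff_mem_nhds.2 fun x hx => eventually_eventually_nhds.2 hx) hAB (by
        refine eq_empty_of_forall_notMem fun x ⟨hx, hxA, hxB⟩ => hx.2 (hflat1 x hx.1 ?_)
        filter_upwards [hxA, hxB] with y h1 h2 using le_antisymm h1 h2) with h | h
    · exact h ⟨hq, hr⟩
    · refine absurd (hflat1 p hpW ?_) hpR.2
      filter_upwards [hle, h hpR] with y h1 h2 using le_antisymm h1 h2
  refine ⟨W, hpW, hWcp, hcon, hWconv.1, hWconv.2, fun x hx => (hWS hx).1,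
    interior {x | ⟪n, f x⟫ ≤ c ∧ (⟪n, f x⟫ = c → x ∈ W)}, isOpen_interior,
    fun q hq => ?_, fun x hx =>
      (interior_subset hx : x ∈ {x | ⟪n, f x⟫ ≤ c ∧ (⟪n, f x⟫ = c → x ∈ W)})⟩
  rw [mem_interior_iff_mem_nhds]
  obtain ⟨U, -, K, h1, -, -, h4⟩ := hloc q hq univ univ_mem
  filter_upwards [hside q hq, h1.mem_nhds] with x hx hxU
  exact ⟨hx, fun hxc => h4 ⟨hxU, hxc⟩⟩

end FlatFace

/-! ### Caps through a boundary point -/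

theorem connectedComponentIn_eq_of_isolated {X : Type*} [TopologicalSpace X] {F S N : Set X} {p : X}
    (hp : p ∈ S) (hSF : S ⊆ F) (hS : IsClosed S) (hSc : IsPreconnected S) (hN : IsOpen N)
    (hSN : S ⊆ N) (hNF : ∀ x ∈ N, x ∈ F → x ∈ S) : connectedComponentIn F p = S := by
  refine Subset.antisymm (fun x hx => ?_) (hSc.subset_connectedComponentIn hp hSF)
  by_contra hxS
  obtain ⟨y, hy, hyN, hyS⟩ := isPreconnected_connectedComponentIn (x := p) (F := F) N Sᶜ hN
    hS.isOpen_compl (fun z _ => by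
      by_cases hz : z ∈ S
      · exact Or.inl (hSN hz)
      · exact Or.inr hz)
    ⟨p, mem_connectedComponentIn (hSF hp), hSN hp⟩ ⟨x, hx, hxS⟩
  exact hyS (hNF y hyN (connectedComponentIn_subset _ _ hy))

theorem CapBody.isCapWith {M : Type*} [TopologicalSpace M] [T2Space M] {f : M → R3} {K : Set R3}
    {n : R3} {c : ℝ} (h : CapBody K n c) (hf : Continuous f) {C : Set M} (hC : IsCompact C)
    (hi : InjOn f C) (hfC : f '' C = closure (openCap K n c)) : IsCapWith f C n c := by
  have hcon : IsConnected (f '' C) := by rw [hfC]; exact h.isConnected_openCap.closure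
  refine ⟨hC.isClosed, ⟨image_nonempty.1 hcon.nonempty,
    hC.isPreconnected_of_image hf.continuousOn hi subset_rfl hcon.isPreconnected⟩,
    h.normal_ne_zero, hi, Or.inl ?_⟩
  rw [hfC]
  exact h.isNondegenerateCap

theorem inner_rotatedNormal (ν n : R3) (θ : ℝ) (x : R3) :
    ⟪rotatedNormal ν n θ, x⟫ = cos θ * ⟪n, x⟫ + sin θ * ⟪ν, x⟫ := by
  rw [rotatedNormal, inner_add_left, real_inner_smul_left, real_inner_smul_left]

theorem rotatedNormal_zero (ν n : R3) : rotatedNormal ν n 0 = n := by simp [rotatedNormal]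

theorem rotatedNormal_pi (ν n : R3) : rotatedNormal ν n Real.pi = -n := by simp [rotatedNormal]

/-- A point not above the supporting plane, which is above a rotated plane, remains above it if the
plane is rotated further. -/
theorem cos_mul_add_sin_mul_nonneg {a b θ θ' : ℝ} (ha : a ≤ 0) (hθ : 0 < θ) (hθθ : θ ≤ θ')
    (hθ' : θ' ≤ Real.pi) (h : 0 ≤ cos θ * a + sin θ * b) :
    0 ≤ cos θ' * a + sin θ' * b := by
  rcases eq_or_lt_of_le (hθθ.trans hθ') with hπ | hπ
  · have : θ' = θ := by linarith
    rwa [this]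
  have hs : 0 < sin θ := sin_pos_of_pos_of_lt_pi hθ hπ
  have hs' : 0 ≤ sin θ' := Real.sin_nonneg_of_nonneg_of_le_pi (hθ.le.trans hθθ) hθ'
  have hd : 0 ≤ sin (θ' - θ) := Real.sin_nonneg_of_nonneg_of_le_pi (by linarith) (by linarith)
  rw [Real.sin_sub] at hd
  have e : sin θ * (cos θ' * a + sin θ' * b) = sin θ' * (cos θ * a + sin θ * b) +
      (sin θ' * cos θ - cos θ' * sin θ) * (-a) := by ring
  have h2 := add_nonneg (mul_nonneg hs' h) (mul_nonneg hd (neg_nonneg.2 ha))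
  rw [← e] at h2
  exact nonneg_of_mul_nonneg_right h2 hs

namespace BoundaryFrame

variable {M : Type*} [TopologicalSpace M] [ChartedSpace (EuclideanHalfSpace 2) M]
  {f : M → R3} {p : M} {U : Set M} {K : Set R3} {φ : ℝ → bdry M} {T n ν : R3}

variable (h : BoundaryFrame f p U K φ T n ν)

include h

theorem inner_νn : ⟪ν, n⟫ = 0 := by
  rw [real_inner_comm]; exact h.inner_nν

theorem inner_νT : ⟪ν, T⟫ = 0 := by
  rw [real_inner_comm]; exact h.inner_Tν

theorem norm_rotatedNormal (θ : ℝ) : ‖rotatedNormal ν n θ‖ = 1 := by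
  rw [← sq_eq_sq₀ (norm_nonneg _) zero_le_one, ← real_inner_self_eq_norm_sq, inner_rotatedNormal,
    real_inner_comm (rotatedNormal ν n θ) n, real_inner_comm (rotatedNormal ν n θ) ν,
      inner_rotatedNormal, inner_rotatedNormal, real_inner_self_eq_norm_sq,
    real_inner_self_eq_norm_sq, h.norm_n, h.norm_ν, h.inner_nν, h.inner_νn]
  nlinarith [Real.sin_sq_add_cos_sq θ]

theorem rotatedNormal_ne_zero (θ : ℝ) : rotatedNormal ν n θ ≠ 0 := by
  intro h0
  have := h.norm_rotatedNormal θ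
  rw [h0] at this; simp at this

/-- Near `p` there are points of the surface above each rotated plane. -/
theorem exists_above {θ : ℝ} (hθ : θ ∈ Ioo 0 Real.pi) {N : Set M} (hN : N ∈ 𝓝 p) :
    ∃ x ∈ N, ⟪rotatedNormal ν n θ, f p⟫ < ⟪rotatedNormal ν n θ, f x⟫ := by
  have hs := Real.sin_pos_of_mem_Ioo hθ
  obtain ⟨x, hx, hne, hd⟩ := h.attained (sin θ / 2) (by positivity) N hN
  refine ⟨x, hx, ?_⟩
  have hd0 : 0 < ‖f x - f p‖ := norm_pos_iff.2 (sub_ne_zero.2 hne)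
  have h1 := neg_le_of_abs_le ((abs_real_inner_le_norm (rotatedNormal ν n θ)
    (f x - f p - ‖f x - f p‖ • ν)).trans (le_of_eq_of_le (by rw [h.norm_rotatedNormal, one_mul])
      hd))
  have h2 : ⟪rotatedNormal ν n θ, ν⟫ = sin θ := by
    rw [inner_rotatedNormal, h.inner_nν, real_inner_self_eq_norm_sq, h.norm_ν]; ring
  rw [inner_sub_right, inner_smul_right, h2] at h1
  have h3 : 0 < ⟪rotatedNormal ν n θ, f x - f p⟫ := by nlinarith
  rw [inner_sub_right] at h3
  linarith

variable [T2Space M] [CompactSpace M]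

theorem zero_mem_capAngles (hf : IsRegularImmersion f) (hnice : NiceAt f n ⟪n, f p⟫ p) :
    0 ∈ capAngles f p ν n := by
  refine ⟨⟨le_rfl, Real.pi_pos.le⟩, ?_⟩
  obtain ⟨W, hpW, hW, hWc, hi, hconv, hpl, N, hN, hWN, hNW⟩ := hf.exists_flat_face
    h.norm_n h.mem_bdry rfl hnice h.eventually_le
  have hcap : capAt f p ν n 0 = W := by
    rw [capAt, rotatedNormal_zero]
    exact connectedComponentIn_eq_of_isolated hpW (fun x hx => (hpl x hx).ge) hW.isClosed
      hWc.isPreconnected hN hWN fun x hx hxF => (hNW x hx).2 (le_antisymm (hNW x hx).1 hxF)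
  rw [hcap, rotatedNormal_zero]
  refine ⟨hW.isClosed, hWc, norm_ne_zero_iff.1 (by rw [h.norm_n]; exact one_ne_zero), hi,
    Or.inr ⟨⟨⟨f p, p, hpW, rfl⟩, hW.image hf.continuous, hconv, ?_⟩, N, hN.mem_nhdsSet.2 hWN, ?_⟩⟩
  · rintro _ ⟨x, hx, rfl⟩; exact hpl x hx
  · rw [disjoint_left]
    rintro _ ⟨x, ⟨hxN, hxW⟩, rfl⟩ hxH
    exact hxW ((hNW x hxN).2 (le_antisymm (hNW x hxN).1 hxH))

/-- The geometry of the supporting plane at `p`, if the surface does not meet it in a convex set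
near `p`: it contains no segment of the surface emanating from `f p`; the face of the body `K` lies
on the side of the tangent line opposite to the conormal; and the boundary curve has a contact with
this plane of order greater than two and is curved away from the conormal. -/
theorem of_not_niceAt (hf : IsRegularImmersion f) (hnice : ¬ NiceAt f n ⟪n, f p⟫ p) :
    (∀ d ≠ 0, ⟪n, d⟫ = 0 → ¬ ∃ᶠ t in 𝓝[>] (0 : ℝ), f p + t • d ∈ f '' U) ∧
    (∀ y ∈ K, ⟪n, y⟫ = ⟪n, f p⟫ → 0 ≤ ⟪ν, y - f p⟫ → y = f p) ∧
    ∀ᶠ s in 𝓝 (0 : ℝ), ⟪ν, boundaryCurve f φ s - f p⟫ ≤ 0 := by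
  have hγ0 : boundaryCurve f φ 0 = f p := by simp [boundaryCurve, h.param_zero]
  have hli := hf.no_inflections φ h.param 0
  obtain ⟨-, -, hX⟩ := (h.model.niceAt_or hf.continuous hf.nonflat h.norm_n (fun _ => h.inner_le)
    rfl
    h.param h.param_zero hli).resolve_left hnice
  -- there are no segments on the surface in the supporting plane
  have noseg : ∀ d ≠ 0, ⟪n, d⟫ = 0 → ¬ ∃ᶠ t in 𝓝[>] (0 : ℝ), f p + t • d ∈ f '' U := by
    intro d hd hnd hfr
    have hd1 : ‖(‖d‖⁻¹ • d)‖ = 1 := by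
      exact norm_inv_norm_smul hd
    obtain ⟨e, he, hne, hde, -⟩ := exists_third_unit h.norm_n hd1
      (by rw [inner_smul_right, hnd, mul_zero])
    have hed : ⟪e, d⟫ = 0 := by
      rw [inner_smul_left] at hde
      rw [real_inner_comm]
      exact (mul_eq_zero.1 hde).resolve_left (by simpa using hd)
    obtain ⟨ε, hε, hsep⟩ := h.model.sep hf.continuous
      (hX.and (hf.eventually_bdry_line p h.norm_n he hne))
    obtain ⟨t, ⟨x, hxU, hxt⟩, ht, ht0, -⟩ :=
      (hfr.and_eventually (eventually_lineMap d (ball_mem_nhds (f p) hε))).exists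
    obtain ⟨h1, h2⟩ := hsep x hxU (by rw [hxt]; exact ht)
    have hxd : f x - f p = t • d := by rw [hxt]; abel
    have h3 : ⟪n, f x - f p⟫ = 0 := by rw [hxd, inner_smul_right, hnd, mul_zero]
    have h4 := h2 (h1 (by rwa [inner_sub_right, sub_eq_zero] at h3)) h3
      (by rw [hxd, inner_smul_right, hed, mul_zero])
    rw [h4, sub_self] at hxd
    exact smul_ne_zero ht0.ne' hd hxd.symm
  have hK := h.model.body
  have hpK : f p ∈ K := hK.frontier_subset (h.model.maps p h.model.mem)
  -- points of the face near `f p` in a given direction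
  have hray : ∀ y ∈ K, ⟪n, y⟫ = ⟪n, f p⟫ → ∀ s ∈ 𝓝[frontier K] (f p),
      ∀ᶠ t in 𝓝[>] (0 : ℝ), f p + t • (y - f p) ∈ s ∧ 0 < t := by
    intro y hy hyc s hs
    obtain ⟨s', hs', hss⟩ := mem_nhdsWithin_iff_exists_mem_nhds_inter.1 hs
    filter_upwards [eventually_lineMap (y - f p) hs'] with t ht
    refine ⟨hss ⟨ht.1, mem_frontier_of_inner_eq h.n_ne_zero (fun _ => h.inner_le)
      (hK.convex.add_smul_sub_mem hpK hy ⟨ht.2.1.le, ht.2.2.le⟩) ?_⟩, ht.2.1⟩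
    rw [inner_add_smul, inner_sub_right, hyc, sub_self, mul_zero, add_zero]
  have hnsub : ∀ y : R3, ⟪n, y⟫ = ⟪n, f p⟫ → ⟪n, y - f p⟫ = 0 := fun y hy => by
    rw [inner_sub_right, hy, sub_self]
  have hface : ∀ y ∈ K, ⟪n, y⟫ = ⟪n, f p⟫ → ⟪ν, y - f p⟫ ≤ 0 := by
    intro y hy hyc
    by_contra! hpos
    have hd : y - f p ≠ 0 := by rintro h0; rw [h0, inner_zero_right] at hpos; exact lt_irrefl _ hpos
    have hdn := norm_pos_iff.2 hd
    obtain ⟨η', hη', hside⟩ := h.side (⟪ν, y - f p⟫ / ‖y - f p‖) (by positivity)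
    refine noseg _ hd (hnsub y hyc) (Eventually.frequently ?_)
    filter_upwards [hray y hy hyc _ hside] with t ht
    refine ht.1 ?_ ?_
    · rw [add_sub_cancel_left, inner_smul_right, hnsub y hyc, mul_zero, abs_zero]
      positivity
    · rw [add_sub_cancel_left, norm_smul, norm_eq_abs, abs_of_pos ht.2, inner_smul_right,
        mul_left_comm, div_mul_cancel₀ _ hdn.ne']
  -- the boundary curve has a contact of higher order with the plane
  have hfreq : ∃ᶠ s in 𝓝[≠] (0 : ℝ), ⟪n, boundaryCurve f φ s - boundaryCurve f φ 0⟫ = 0 := by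
    intro hev
    refine hnice ?_
    rw [eventually_nhdsWithin_iff, Metric.eventually_nhds_iff] at hev
    obtain ⟨δ, hδ, hev⟩ := hev
    have h2 := h.param.eventually_mem hδ
    rw [h.param_zero] at h2
    obtain ⟨V, hV, K', hmod⟩ := hf.exists_localModel p (inter_mem h.model.mem_nhds (hX.and h2))
    refine ⟨V, K', hmod, Or.inl fun x hx =>
      h.inner_le (hK.frontier_subset (h.model.maps x (hV hx).1)), ?_⟩
    have : V ∩ f ⁻¹' plane n ⟪n, f p⟫ = {p} := by
      refine eq_singleton_iff_unique_mem.2 ⟨⟨hmod.mem, rfl⟩, ?_⟩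
      rintro x ⟨hxV, hxc⟩
      obtain ⟨s, hs, hsx⟩ := (hV hxV).2.2 ((hV hxV).2.1 hxc)
      by_contra hne
      refine hev (y := s) (by simpa using hs) ?_ ?_
      · rintro rfl
        exact hne (hsx.symm.trans h.param_zero)
      · show ⟪n, boundaryCurve f φ s - boundaryCurve f φ 0⟫ = 0
        rw [hγ0, show boundaryCurve f φ s = f x by simp [boundaryCurve, hsx]]
        exact hnsub _ hxc
    rw [this, image_singleton]
    exact convex_singleton _
  obtain ⟨-, hn2⟩ := inner_deriv_eq_zero_of_frequently h.param.contDiff hfreq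
  obtain ⟨τ, hτ, hderiv⟩ := h.deriv_eq
  have hν1 : ⟪ν, deriv (boundaryCurve f φ) 0⟫ = 0 := by
    rw [hderiv, inner_smul_right, h.inner_νT, mul_zero]
  set γ'' := deriv (deriv (boundaryCurve f φ)) 0
  have hdec := h.decomp γ''
  rw [hn2, zero_smul, zero_add] at hdec
  have hκ0 : ⟪ν, γ''⟫ ≠ 0 := by
    intro h0
    rw [h0, zero_smul, add_zero] at hdec
    rw [LinearIndependent.pair_iff] at hli
    obtain ⟨-, h1⟩ := hli ⟪T, γ''⟫ (-τ) (by
      rw [hderiv]; conv_lhs => rw [hdec]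
      rw [smul_smul, smul_smul, ← add_smul]
      convert zero_smul ℝ T using 2
      rw [inner_smul_right, real_inner_self_eq_norm_sq, h.norm_T]; ring)
    exact hτ.ne' (neg_eq_zero.1 h1)
  have hκ : ⟪ν, γ''⟫ < 0 := by
    refine lt_of_le_of_ne ?_ hκ0
    by_contra! hpos
    have h1 := (tendsto_second_order_inner h.param.contDiff ν hν1).eventually
      (lt_mem_nhds (half_pos hpos))
    have hcont : Tendsto (fun s => (φ s : M)) (𝓝[≠] 0) (𝓝 p) := by
      have : Continuous fun s => (φ s : M) :=
        continuous_subtype_val.comp h.param.isOpenEmbedding.continuous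
      have := this.tendsto 0
      rw [h.param_zero] at this
      exact this.mono_left nhdsWithin_le_nhds
    obtain ⟨s, hs, hs1, hsU⟩ := (hfreq.and_eventually
      (h1.and (hcont.eventually h.model.mem_nhds))).exists
    have h2 := hface _ (hK.frontier_subset (h.model.maps _ hsU)) (by
      rw [hγ0, inner_sub_right, sub_eq_zero] at hs; exact hs)
    rw [hγ0] at hs1
    exact absurd hs1 (not_lt.2 (div_nonpos_of_nonpos_of_nonneg h2 (sq_nonneg s)))
  -- the second order expansion, in directions with a positive product with the conormal
  have hneg : ∀ e : R3, ⟪e, T⟫ = 0 → ⟪e, γ''⟫ < 0 →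
      ∀ᶠ s in 𝓝 (0 : ℝ), ⟪e, boundaryCurve f φ s - f p⟫ ≤ 0 := by
    intro e heT heγ
    have h1 := (tendsto_second_order_inner h.param.contDiff e (by
      rw [hderiv, inner_smul_right, heT, mul_zero])).eventually
      (gt_mem_nhds (show ⟪e, γ''⟫ / 2 < 0 by linarith))
    rw [eventually_nhdsWithin_iff] at h1
    filter_upwards [h1] with s hs
    rcases eq_or_ne s 0 with rfl | hs0
    · rw [hγ0, sub_self, inner_zero_right]
    · have := hs hs0
      rw [hγ0] at this
      by_contra! hcon
      exact absurd this (not_lt.2 (by positivity))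
  refine ⟨noseg, fun y hy hyc hyν => ?_, hneg ν h.inner_νT hκ⟩
  obtain ⟨e, heT, heν, hfine⟩ := h.fine
  have hd := h.decomp (y - f p)
  rw [hnsub y hyc, le_antisymm (hface y hy hyc) hyν, zero_smul, zero_smul, zero_add, add_zero] at hd
  have hed : ⟪e, y - f p⟫ = 0 := by rw [hd, inner_smul_right, heT, mul_zero]
  have h1 := hneg e heT (by
    rw [hdec, inner_add_smul, inner_smul_right, heT, mul_zero, zero_add]
    exact mul_neg_of_neg_of_pos hκ heν)
  obtain ⟨ρ, hρ, h1⟩ := Metric.eventually_nhds_iff.1 h1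
  by_contra hne
  refine noseg _ (sub_ne_zero.2 hne) (hnsub y hyc) (Eventually.frequently ?_)
  filter_upwards [hray y hy hyc _ (hfine ρ hρ)] with t ht
  obtain ⟨⟨s, k, hs, hek, hiff⟩, -⟩ := ht
  refine hiff.2 ?_
  rw [add_sub_cancel_left, inner_smul_right, hed, mul_zero] at hek
  have := h1 (y := s) (by simpa using hs)
  linarith

end BoundaryFrame

/-- If the points `(a, b)` of a compact set satisfy `a ≤ 0`, and `b < 0` if `a = 0`, then the set
lies below the lines of small positive slope angle. -/
theorem IsCompact.eventually_cos_mul_add_sin_mul_neg {X : Type*} [TopologicalSpace X] {S : Set X}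
    (hS : IsCompact S) {a b : X → ℝ} (ha : Continuous a) (hb : Continuous b) (h : ∀ y ∈ S, a y ≤ 0)
    (h' : ∀ y ∈ S, a y = 0 → b y < 0) :
    ∀ᶠ θ : ℝ in 𝓝[>] 0, ∀ y ∈ S, cos θ * a y + sin θ * b y < 0 := by
  have hS' : IsCompact (S ∩ {y | 0 ≤ b y}) := hS.inter_right (isClosed_le continuous_const hb)
  obtain ⟨δ, hδ, hδa⟩ : ∃ δ > 0, ∀ y ∈ S ∩ {y | 0 ≤ b y}, a y ≤ -δ := by
    rcases (S ∩ {y | 0 ≤ b y}).eq_empty_or_nonempty with he | hne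
    · exact ⟨1, one_pos, fun y hy => by rw [he] at hy; exact hy.elim⟩
    · obtain ⟨y₀, hy₀, hmax⟩ := hS'.exists_isMaxOn hne ha.continuousOn
      refine ⟨-a y₀, ?_, fun y hy => by rw [neg_neg]; exact hmax hy⟩
      have : a y₀ ≠ 0 := fun h0 => absurd hy₀.2 (not_le.2 (h' y₀ hy₀.1 h0))
      have := lt_of_le_of_ne (h y₀ hy₀.1) this
      linarith
  obtain ⟨B, hB⟩ := (hS.image hb).bddAbove
  have hlim : Tendsto (fun θ : ℝ => cos θ * (-δ) + sin θ * B) (𝓝[>] 0) (𝓝 (-δ)) := by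
    have : Continuous fun θ : ℝ => cos θ * (-δ) + sin θ * B := by fun_prop
    have := this.tendsto 0
    simp only [Real.cos_zero, Real.sin_zero, one_mul, zero_mul, add_zero] at this
    exact this.mono_left nhdsWithin_le_nhds
  filter_upwards [hlim.eventually (gt_mem_nhds (show -δ < 0 by linarith)),
    Ioo_mem_nhdsGT (show (0 : ℝ) < Real.pi / 2 by positivity)] with θ hθ hθ' y hy
  have hs := sin_pos_of_pos_of_lt_pi hθ'.1 (by linarith [hθ'.2, Real.pi_pos])
  have hc := Real.cos_pos_of_mem_Ioo ⟨by linarith [hθ'.1, Real.pi_pos], hθ'.2⟩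
  rcases lt_or_ge (b y) 0 with hby | hby
  · have h1 := mul_neg_of_pos_of_neg hs hby
    have h2 := mul_nonpos_of_nonneg_of_nonpos hc.le (h y hy)
    linarith
  · have h1 := mul_le_mul_of_nonneg_left (hδa y ⟨hy, hby⟩) hc.le
    have h2 := mul_le_mul_of_nonneg_left (hB (mem_image_of_mem b hy)) hs.le
    linarith

namespace BoundaryFrame

variable {M : Type*} [TopologicalSpace M] [ChartedSpace (EuclideanHalfSpace 2) M]
  {f : M → R3} {p : M} {U : Set M} {K : Set R3} {φ : ℝ → bdry M} {T n ν : R3}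
  [T2Space M] [CompactSpace M]

theorem eventually_mem_capAngles (h : BoundaryFrame f p U K φ T n ν) (hf : IsRegularImmersion f)
    (hnice : ¬ NiceAt f n ⟪n, f p⟫ p) :
    ∀ᶠ θ : ℝ in 𝓝[>] 0, θ ∈ capAngles f p ν n := by
  obtain ⟨-, hface, hcurve⟩ := h.of_not_niceAt hf hnice
  have hK := h.model.body
  obtain ⟨ε₁, hε₁, hconn⟩ := h.model.exists_subset_or_disjoint hf.continuous
  obtain ⟨ρ, hρ, hcurve⟩ := Metric.eventually_nhds_iff.1 hcurve
  have hpar := h.param.eventually_mem hρ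
  rw [h.param_zero] at hpar
  obtain ⟨ε₂, hε₂, hsep⟩ := h.model.sep hf.continuous
    (inter_mem (interior_mem_nhds.2 h.model.mem_nhds) hpar)
  set ε := min ε₁ ε₂
  have hε0 : 0 < ε := lt_min hε₁ hε₂
  -- the part of the body above the rotated plane is small
  have hsmall := (hK.isCompact.diff (isOpen_ball (x := f p) (ε := ε / 2))
    ).eventually_cos_mul_add_sin_mul_neg
    (a := fun y => ⟪n, y - f p⟫) (b := fun y => ⟪ν, y - f p⟫)
    (by fun_prop) (by fun_prop) (fun y hy => h.le y hy.1) (fun y hy h0 => by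
      by_contra! hcon
      rw [inner_sub_right, sub_eq_zero] at h0
      have := hface y hy.1 h0 hcon
      refine hy.2 ?_
      rw [this]
      exact mem_ball_self (by positivity))
  obtain ⟨o, ho⟩ := hK.interior_nonempty
  have hon := inner_lt_of_mem_interior h.n_ne_zero (fun _ => h.inner_le) ho
  have hbelow := (isCompact_singleton (x := o)).eventually_cos_mul_add_sin_mul_neg
    (a := fun y => ⟪n, y - f p⟫) (b := fun y => ⟪ν, y - f p⟫)
    (by fun_prop) (by fun_prop) (fun y hy => by
      rw [mem_singleton_iff.1 hy]; exact h.le o (interior_subset ho)) (fun y hy h0 => by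
      rw [mem_singleton_iff.1 hy, inner_sub_right] at h0
      linarith)
  filter_upwards [hsmall, hbelow, Ioo_mem_nhdsGT (show (0 : ℝ) < Real.pi / 2 by positivity)]
    with θ hsmall hbelow hθ
  have hθπ : θ ∈ Ioo 0 Real.pi := ⟨hθ.1, by linarith [hθ.2, Real.pi_pos]⟩
  have hs := Real.sin_pos_of_mem_Ioo hθπ
  have hc := Real.cos_pos_of_mem_Ioo ⟨by linarith [hθ.1, Real.pi_pos], hθ.2⟩
  refine ⟨⟨hθπ.1.le, hθπ.2.le⟩, ?_⟩
  set m := rotatedNormal ν n θ with hm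
  set c := ⟪m, f p⟫ with hcdef
  have hmsub : ∀ y : R3, ⟪m, y⟫ - c = cos θ * ⟪n, y - f p⟫ + sin θ * ⟪ν, y - f p⟫ := fun y => by
    rw [hcdef, ← inner_sub_right, hm, inner_rotatedNormal]
  have hball : ∀ y ∈ K, c ≤ ⟪m, y⟫ → dist y (f p) < ε / 2 := fun y hy hyc => by
    by_contra hd
    have := hsmall y ⟨hy, hd⟩
    rw [← hmsub] at this
    linarith
  obtain ⟨x₁, hx₁U, hx₁⟩ := h.exists_above hθπ h.model.mem_nhds
  have hoc : ⟪m, o⟫ < c := by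
    have := hbelow o rfl
    rw [← hmsub] at this
    linarith
  have hcap : CapBody (K ∩ halfSpace m c) m c := capBody_inter hK (interior_subset ho) hoc
    (hK.frontier_subset (h.model.maps x₁ hx₁U)) hx₁
  have hopen : openCap (K ∩ halfSpace m c) m c = openCap K m c := openCap_inter_halfSpace K m c
  have hbdry : ∀ b ∈ bdry M ∩ U, f b ∉ openCap K m c := by
    rintro b ⟨hb, hbU⟩ ⟨hbK, hbc⟩
    have hbc' : c < ⟪m, f b⟫ := hbc
    have hd := hball _ (hK.frontier_subset hbK) hbc'.le
    obtain ⟨s, hs', hsb⟩ := (hsep b hbU (by linarith [min_le_right ε₁ ε₂])).2 hb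
    have h1 := hcurve (y := s) (by simpa using hs')
    rw [show boundaryCurve f φ s = f b by simp [boundaryCurve, hsb]] at h1
    have h2 := mul_nonpos_of_nonneg_of_nonpos hc.le (h.le _ (hK.frontier_subset hbK))
    have h3 := mul_nonpos_of_nonneg_of_nonpos hs.le h1
    have := hmsub (f b)
    linarith
  have hsub : openCap K m c ⊆ f '' U := by
    refine (hconn _ (fun y hy => ⟨hy.1, ?_⟩) ?_ hbdry).resolve_right fun hd =>
      disjoint_left.1 hd ⟨h.model.maps x₁ hx₁U, hx₁⟩ ⟨x₁, hx₁U, rfl⟩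
    · have hyc : c < ⟪m, y⟫ := hy.2
      have := hball y (hK.frontier_subset hy.1) hyc.le
      rw [mem_ball]
      linarith [min_le_left ε₁ ε₂]
    · rw [← hopen]; exact hcap.isConnected_openCap.isPreconnected
  have hclsub : closure (openCap K m c) ⊆ f '' U :=
    closure_minimal hsub (h.model.isClosed_image hf.continuous)
  set C : Set M := U ∩ f ⁻¹' closure (openCap K m c) with hC
  have hCc : IsCompact C := h.model.isCompact.inter_right (isClosed_closure.preimage hf.continuous)
  have hfC : f '' C = closure (openCap K m c) := by
    rw [hC, image_inter_preimage, inter_eq_right.2 hclsub]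
  have hpC : p ∈ C := by
    refine ⟨h.model.mem, mem_closure_iff_nhds.2 fun N hN => ?_⟩
    obtain ⟨x, hx, hxc⟩ := h.exists_above hθπ
      (inter_mem (hf.continuous.continuousAt.preimage_mem_nhds hN) h.model.mem_nhds)
    exact ⟨f x, hx.1, h.model.maps x hx.2, hxc⟩
  have hcapW := hcap.isCapWith hf.continuous hCc (h.model.injOn.mono inter_subset_left)
    (by rw [hopen]; exact hfC)
  have hcapAt : capAt f p ν n θ = C := by
    refine connectedComponentIn_eq_of_isolated hpC ?_ hCc.isClosed hcapW.isConnected.isPreconnected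
      (isOpen_interior (s := U)) ?_ ?_
    · exact fun x hx => CapBody.closure_openCap_subset_halfSpace K m c hx.2
    · intro x hx
      have h1 := hball _ (hK.frontier_subset (h.model.maps x hx.1))
        (CapBody.closure_openCap_subset_halfSpace K m c hx.2)
      exact (hsep x hx.1 (by linarith [min_le_right ε₁ ε₂])).1
    · intro x hx hxc
      have hxU := interior_subset hx
      have hxK := h.model.maps x hxU
      refine ⟨hxU, ?_⟩
      rcases eq_or_lt_of_le (show c ≤ ⟪m, f x⟫ from hxc) with he | hlt
      · have := hcap.mem_closure_openCap ⟨hK.frontier_subset hxK, hxc⟩ he.symm fun hr =>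
          hxK.2 ((hr.mono fun y hy _ => hy.1).mem_interior hK (interior_subset ho) hoc
            (hK.frontier_subset (h.model.maps x₁ hx₁U)) hx₁)
        rwa [hopen] at this
      · exact subset_closure ⟨hxK, hlt⟩
  rw [hcapAt]
  exact hcapW

theorem capAngles_nonempty (h : BoundaryFrame f p U K φ T n ν) (hf : IsRegularImmersion f)
    : (capAngles f p ν n).Nonempty := by
  by_cases hnice : NiceAt f n ⟪n, f p⟫ p
  · exact ⟨0, h.zero_mem_capAngles hf hnice⟩
  · exact (h.eventually_mem_capAngles hf hnice).exists

end BoundaryFrame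

/-! ### Nondegenerate caps on the surface -/

theorem IsPreconnected.subset_of_relatively_clopen {X : Type*} [TopologicalSpace X] {S T : Set X}
    (hS : IsPreconnected S) (hop : ∀ x ∈ S, x ∈ T → ∀ᶠ y in 𝓝 x, y ∈ S → y ∈ T)
    (hcl : ∀ x ∈ S, x ∈ closure T → x ∈ T) (hne : (S ∩ T).Nonempty) : S ⊆ T := by
  intro z hz
  by_contra hzT
  have hint : ∀ x ∈ S, x ∈ T → x ∈ interior (T ∪ Sᶜ) := fun x hx hxT => by
    rw [mem_interior_iff_mem_nhds]
    filter_upwards [hop x hx hxT] with y hy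
    by_cases hyS : y ∈ S
    · exact Or.inl (hy hyS)
    · exact Or.inr hyS
  obtain ⟨y, hy, hyT⟩ := hne
  obtain ⟨w, hw, hw1, hw2⟩ := hS (interior (T ∪ Sᶜ)) (closure T)ᶜ isOpen_interior
    isClosed_closure.isOpen_compl (fun w hw => by
      by_cases hwT : w ∈ T
      · exact Or.inl (hint w hw hwT)
      · exact Or.inr fun hwc => hwT (hcl w hw hwc))
    ⟨y, hy, hint y hy hyT⟩ ⟨z, hz, fun hzc => hzT (hcl z hz hzc)⟩
  rcases interior_subset hw1 with h1 | h1
  · exact hw2 (subset_closure h1)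
  · exact h1 hw

theorem plane_smul {a : ℝ} (ha : 0 < a) (n : R3) (c : ℝ) : plane (a • n) (a * c) = plane n c := by
  ext x
  show ⟪a • n, x⟫ = a * c ↔ ⟪n, x⟫ = c
  rw [real_inner_smul_left]
  exact mul_right_inj' ha.ne'

theorem halfSpace_smul {a : ℝ} (ha : 0 < a) (n : R3) (c : ℝ) :
    halfSpace (a • n) (a * c) = halfSpace n c := by
  ext x
  show a * c ≤ ⟪a • n, x⟫ ↔ c ≤ ⟪n, x⟫
  rw [real_inner_smul_left]
  exact mul_le_mul_iff_of_pos_left ha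

theorem IsCapWith.smul {M : Type*} [TopologicalSpace M] {f : M → R3} {C : Set M} {n : R3} {c : ℝ}
    (h : IsCapWith f C n c) {a : ℝ} (ha : 0 < a) : IsCapWith f C (a • n) (a * c) := by
  refine ⟨h.isClosed, h.isConnected, smul_ne_zero ha.ne' h.normal_ne_zero, h.injOn, ?_⟩
  have := h.image_isCap
  rwa [IsNondegenerateCap, IsDegenerateCap, plane_smul ha, halfSpace_smul ha]

/-- A limit direction of the open cap at a rim point: it points from a point of the base across the
rim point, with a component into the interior of the body. -/
theorem CapBody.exists_limit_direction {K : Set R3} {n : R3} {c : ℝ} (h : CapBody K n c)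
    {x r i : R3} (hx : x ∈ K) (hxc : ⟪n, x⟫ = c) (hxr : ¬ RelInt K n c x) (hr : RelInt K n c r)
    (hi : i ∈ K) (hic : c < ⟪n, i⟫) :
    ∃ α ∈ Icc (0 : ℝ) 1, ∀ η > 0, ∀ O ∈ 𝓝 x, ∃ y ∈ openCap K n c, y ∈ O ∧ ∃ t : ℝ, 0 < t ∧
      ‖y - x - t • ((1 - α) • (i - x) - α • (r - x))‖ ≤ η * t := by
  have hK := h.body
  set u := r - x with hu
  set v := i - x with hv
  have hu0 : -u ≠ 0 := by
    intro h0
    rw [neg_eq_zero, hu, sub_eq_zero] at h0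
    exact hxr (h0 ▸ hr)
  have hnu : ⟪n, u⟫ = 0 := by rw [hu, inner_sub_right, hr.1, hxc, sub_self]
  have hnv : 0 < ⟪n, v⟫ := by rw [hv, inner_sub_right, hxc]; linarith
  have hmem : ∀ τ ∈ Icc (0 : ℝ) 1, x + τ • v ∈ K := fun τ hτ => hK.convex.add_smul_sub_mem hx hi hτ
  -- the exit point of the line in direction `-u` through `x + τ • v`
  have hex : ∀ τ : ℝ, ∃ s : ℝ, τ ∈ Ioc (0 : ℝ) 1 →
      0 ≤ s ∧ x + τ • v + s • (-u) ∈ openCap K n c := by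
    intro τ
    by_cases hτ : τ ∈ Ioc (0 : ℝ) 1
    swap
    · exact ⟨0, fun h => absurd h hτ⟩
    obtain ⟨s, hs0, -, -, hs⟩ := h.exists_exit (hmem τ ⟨hτ.1.le, hτ.2⟩) hu0
    have hs := hs (Or.inr (by rw [inner_neg_right, hnu, neg_zero]))
    refine ⟨s, fun _ => ⟨hs0, CapBody.mem_openCap_of_mem_closure hs ?_⟩⟩
    rw [inner_add_right, inner_add_smul, inner_smul_right, inner_neg_right, hnu,
      hxc, neg_zero, mul_zero, add_zero]
    have := mul_pos hτ.1 hnv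
    linarith
  choose s hs using hex
  have hIoc : ∀ᶠ τ : ℝ in 𝓝[>] 0, τ ∈ Ioc (0 : ℝ) 1 := Ioc_mem_nhdsGT one_pos
  have hpos : ∀ᶠ τ : ℝ in 𝓝[>] 0, 0 < τ := self_mem_nhdsWithin
  have hslim : ∀ σ > 0, ∀ᶠ τ in 𝓝[>] (0 : ℝ), s τ < σ := by
    intro σ hσ
    by_contra hcon
    have hfr : ∃ᶠ τ in 𝓝[>] (0 : ℝ), x + τ • v + σ • (-u) ∈ K := by
      have hfr : ∃ᶠ τ in 𝓝[>] (0 : ℝ), ¬ s τ < σ := Filter.not_eventually.1 hcon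
      refine (hfr.and_eventually hIoc).mono fun τ hτ => ?_
      obtain ⟨h1, h2⟩ := hs τ hτ.2
      have hσs := not_lt.1 hτ.1
      have hs0 : 0 < s τ := lt_of_lt_of_le hσ hσs
      have := hK.convex.add_smul_sub_mem (hmem τ ⟨hτ.2.1.le, hτ.2.2⟩) (hK.frontier_subset h2.1)
        (t := σ / s τ) ⟨by positivity, (div_le_one hs0).2 hσs⟩
      rwa [add_sub_cancel_left, smul_smul, div_mul_cancel₀ _ hs0.ne'] at this
    have hlim : Tendsto (fun τ : ℝ => x + τ • v + σ • (-u)) (𝓝[>] 0) (𝓝 (x + σ • (-u))) := by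
      exact (tendsto_lineMap_zero x v).add_const _
    have hmemK := hK.isClosed.mem_of_frequently_of_tendsto hfr hlim
    refine hxr ?_
    have h1 := hr.lineMap hK.convex hmemK (by
      rw [inner_add_smul, inner_neg_right, hnu, neg_zero, mul_zero, add_zero, hxc])
      (t := 1 / (1 + σ)) ⟨by positivity, by rw [div_lt_one (by positivity)]; linarith⟩
    have e : r + (1 / (1 + σ)) • (x + σ • (-u) - r) = x := by
      have e1 : x + σ • (-u) - r = -((1 + σ) • u) := by rw [hu]; module
      rw [e1, smul_neg, smul_smul, one_div_mul_cancel (by positivity), one_smul, hu]; abel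
    rwa [e] at h1
  obtain ⟨α, hα, hcl⟩ := (isCompact_Icc (a := (0 : ℝ)) (b := 1)).exists_mapClusterPt_of_frequently
    (l := 𝓝[>] (0 : ℝ)) (f := fun τ => s τ / (τ + s τ)) (Eventually.frequently (by
      filter_upwards [hIoc] with τ hτ
      have := (hs τ hτ).1
      have := hτ.1
      exact ⟨by positivity, (div_le_one (by positivity)).2 (by linarith)⟩))
  refine ⟨α, hα, fun η hη O hO => ?_⟩
  have hη' : 0 < η / (‖u + v‖ + 1) := by positivity
  have h1 := mapClusterPt_iff_frequently.1 hcl _ (closedBall_mem_nhds α hη')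
  obtain ⟨ε, hε, hεO⟩ := Metric.mem_nhds_iff.1 hO
  have hlimv : ∀ᶠ τ : ℝ in 𝓝[>] 0, ‖τ • v‖ < ε / 2 := by
    have : Tendsto (fun τ : ℝ => ‖τ • v‖) (𝓝[>] 0) (𝓝 0) := by
      have : Continuous fun τ : ℝ => ‖τ • v‖ := by fun_prop
      have := this.tendsto 0
      rw [zero_smul, norm_zero] at this
      exact this.mono_left nhdsWithin_le_nhds
    exact this.eventually (gt_mem_nhds (by positivity))
  obtain ⟨τ, hτ, hτI, hτv, hτs⟩ := (h1.and_eventually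
    (hIoc.and (hlimv.and (hslim (ε / 2 / (‖u‖ + 1)) (by positivity))))).exists
  obtain ⟨hs0, hso⟩ := hs τ hτI
  have hτ0 := hτI.1
  refine ⟨_, hso, hεO ?_, τ + s τ, by positivity, ?_⟩
  · have h2 : s τ * (‖u‖ + 1) < ε / 2 := (lt_div_iff₀ (by positivity)).1 hτs
    rw [mem_ball, dist_eq_norm,
      show x + τ • v + s τ • (-u) - x = τ • v + s τ • (-u) by abel]
    have h3 := norm_add_le (τ • v) (s τ • (-u))
    rw [norm_smul (s τ), norm_neg, norm_eq_abs, abs_of_nonneg hs0] at h3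
    linarith
  · have hts : τ + s τ ≠ 0 := by positivity
    have e : x + τ • v + s τ • (-u) - x - (τ + s τ) • ((1 - α) • v - α • u) =
        ((τ + s τ) * (α - s τ / (τ + s τ))) • (u + v) := by
      have : (τ + s τ) * (α - s τ / (τ + s τ)) = (τ + s τ) * α - s τ := by
        rw [mul_sub, mul_div_cancel₀ _ hts]
      rw [this]; module
    have hd : dist (s τ / (τ + s τ)) α ≤ η / (‖u + v‖ + 1) := hτ
    rw [Real.dist_eq, abs_sub_comm, le_div_iff₀ (by positivity)] at hd
    rw [e, norm_smul, norm_eq_abs, abs_mul, abs_of_pos (by positivity : 0 < τ + s τ), mul_assoc,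
      mul_comm η]
    refine mul_le_mul_of_nonneg_left ?_ (by positivity)
    nlinarith [abs_nonneg (α - s τ / (τ + s τ))]

/-- `f` maps the compact set `C` injectively onto the nondegenerate cap which is cut off from the
boundary of the cap body `K`. -/
structure CapModel {M : Type*} [TopologicalSpace M] (f : M → R3) (C : Set M) (K : Set R3) (n : R3)
    (c : ℝ) : Prop where
  capBody : CapBody K n c
  norm_eq_one : ‖n‖ = 1
  isCompact : IsCompact C
  injOn : InjOn f C
  image_eq : f '' C = closure (openCap K n c)

namespace CapModel

variable {M : Type*} [TopologicalSpace M] {f : M → R3} {C : Set M} {K : Set R3} {n : R3} {c : ℝ}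
  {q : M} {U : Set M} {L : Set R3}
  (h : CapModel f C K n c)

include h

theorem mem_closure (hq : q ∈ C) : f q ∈ closure (openCap K n c) := by
  rw [← h.image_eq]; exact mem_image_of_mem f hq

theorem mem_frontier (hq : q ∈ C) : f q ∈ frontier K :=
  CapBody.closure_openCap_subset_frontier K n c (h.mem_closure hq)

theorem mem_body (hq : q ∈ C) : f q ∈ K := h.capBody.body.frontier_subset (h.mem_frontier hq)

theorem le_inner (hq : q ∈ C) : c ≤ ⟪n, f q⟫ :=
  CapBody.closure_openCap_subset_halfSpace K n c (h.mem_closure hq)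

theorem exists_of_mem_openCap {y : R3} (hy : y ∈ openCap K n c) : ∃ x ∈ C, f x = y := by
  have : y ∈ f '' C := by rw [h.image_eq]; exact subset_closure hy
  exact this

theorem exists_of_mem_plane {y : R3} (hy : y ∈ K) (hyc : ⟪n, y⟫ = c) (hr : ¬ RelInt K n c y)
    : ∃ x ∈ C, f x = y := by
  have : y ∈ f '' C := by rw [h.image_eq]; exact h.capBody.mem_closure_openCap hy hyc hr
  exact this

/-- Near a point of the cap, the open cap is contained in the image of each neighborhood. -/
theorem eventually_openCap (hf : Continuous f) (hq : q ∈ C) {N : Set M} (hN : N ∈ 𝓝 q)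
    : ∀ᶠ y in 𝓝 (f q), y ∈ closure (openCap K n c) → ∃ x ∈ C, x ∈ N ∧ f x = y := by
  obtain ⟨ε, hε, hs⟩ := h.isCompact.exists_dist_lt_imp_mem hf.continuousOn h.injOn hq hN
  filter_upwards [ball_mem_nhds (f q) hε] with y hy hyc
  rw [← h.image_eq] at hyc
  obtain ⟨x, hx, rfl⟩ := hyc
  exact ⟨x, hx, hs x hx hy, rfl⟩

/-- In the open half-space, the boundary of the body of a cap is a neighborhood in the boundary of
the body of each local model. -/
theorem frontier_mem_nhdsWithin (hf : Continuous f) (hq : q ∈ C) (hU : LocalModel f q U L) :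
    ∀ᶠ y in 𝓝 (f q), y ∈ openCap K n c → y ∈ frontier L ∧ frontier K ∈ 𝓝[frontier L] y := by
  have h1 := eventually_eventually_nhds.2 (h.eventually_openCap hf hq hU.mem_nhds)
  filter_upwards [h1] with y hy hyo
  have hy' : ∀ᶠ z in 𝓝 y, z ∈ frontier K → z ∈ frontier L := by
    filter_upwards [hy, (isOpen_inner_gt n c).mem_nhds hyo.2] with z hz hzc hzK
    obtain ⟨x, -, hxU, rfl⟩ := hz (subset_closure ⟨hzK, hzc⟩)
    exact hU.maps x hxU
  exact ⟨hy'.self_of_nhds hyo.1, h.capBody.body.frontier_mem_nhdsWithin hU.body hyo.1 hy'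
    fun z hz hzs => hzs hz⟩

theorem eventually_frontier_iff (hf : Continuous f) (hq : q ∈ C) (hqc : c < ⟪n, f q⟫)
    (hU : LocalModel f q U L) :
    ∀ᶠ y in 𝓝 (f q), y ∈ frontier L ↔ y ∈ frontier K := by
  obtain ⟨s, hs, hsK⟩ := mem_nhdsWithin_iff_exists_mem_nhds_inter.1
    ((h.frontier_mem_nhdsWithin hf hq hU).self_of_nhds ⟨h.mem_frontier hq, hqc⟩).2
  filter_upwards [h.eventually_openCap hf hq hU.mem_nhds, hs,
    (isOpen_inner_gt n c).mem_nhds hqc] with y hy hys hyc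
  refine ⟨fun hyL => hsK ⟨hys, hyL⟩, fun hyK => ?_⟩
  obtain ⟨x, -, hxU, rfl⟩ := hy (subset_closure ⟨hyK, hyc⟩)
  exact hU.maps x hxU

theorem isCapWith [T2Space M] (hf : Continuous f) : IsCapWith f C n c :=
  h.capBody.isCapWith hf h.isCompact h.injOn h.image_eq

/-- At a rim point, if the body of a local model cuts off a cap body from the half-space of a cap,
then the boundaries of the bodies agree in the open half-space, and the
surface is contained there in the cap. -/
theorem agree_of_capBody (hf : Continuous f) (hq : q ∈ C) (hU : LocalModel f q U L)
    (hL : CapBody (L ∩ halfSpace n c) n c) :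
    (∀ᶠ y in 𝓝 (f q), c < ⟪n, y⟫ → (y ∈ frontier L ↔ y ∈ frontier K)) ∧
    ∀ᶠ x in 𝓝 q, c < ⟪n, f x⟫ → x ∈ C := by
  obtain ⟨ε, hε, hev⟩ := Metric.eventually_nhds_iff_ball.1
    ((h.frontier_mem_nhdsWithin hf hq hU).and (h.eventually_openCap hf hq hU.mem_nhds))
  have hopen : openCap (L ∩ halfSpace n c) n c = openCap L n c := openCap_inter_halfSpace L n c
  have hmeet : ∀ δ > 0, ∃ y, y ∈ openCap K n c ∧ y ∈ openCap L n c ∧ dist y (f q) < δ := by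
    intro δ hδ
    obtain ⟨y, hy, hyo⟩ := mem_closure_iff_nhds.1 (h.mem_closure hq) _
      (ball_mem_nhds (f q) (lt_min hε hδ))
    have hy' : dist y (f q) < min ε δ := hy
    exact ⟨y, hyo, ⟨((hev y (hy'.trans_le (min_le_left _ _))).1 hyo).1, hyo.2⟩,
      hy'.trans_le (min_le_right _ _)⟩
  have hqL : f q ∈ closure (openCap (L ∩ halfSpace n c) n c) := by
    rw [hopen, Metric.mem_closure_iff]
    intro δ hδ
    obtain ⟨y, -, hy, hyd⟩ := hmeet δ hδ
    exact ⟨y, hy, by rwa [dist_comm]⟩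
  obtain ⟨V, hV, hVc, δ, hδ, hVδ⟩ := hL.locally_connected hqL hε
  rw [hopen] at hV hVδ
  -- the open cap is relatively open and closed in the connected set `V`
  have hVK : V ⊆ frontier K := by
    obtain ⟨y, hyK, hyL, hyd⟩ := hmeet δ hδ
    have key : ∀ z ∈ V, z ∈ frontier K → frontier K ∈ 𝓝[V] z := fun z hz hzK =>
      nhdsWithin_mono z (fun w hw => (hV hw).1.1) ((hev z (hV hz).2).1 ⟨hzK, (hV hz).1.2⟩).2
    exact hVc.subset_of_relatively_clopen
      (fun z hz hzK => mem_nhdsWithin_iff_eventually.1 (key z hz hzK))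
      (fun z _ hz => by rwa [isClosed_frontier.closure_eq] at hz) ⟨y, hVδ ⟨hyL, hyd⟩, hyK.1⟩
  have hLK : ∀ y, dist y (f q) < min δ ε → c < ⟪n, y⟫ → (y ∈ frontier L ↔ y ∈ frontier K) :=
    fun y hyd hyc => ⟨fun hyL => hVK (hVδ ⟨⟨hyL, hyc⟩, hyd.trans_le (min_le_left _ _)⟩),
      fun hyK => ((hev y (hyd.trans_le (min_le_right _ _))).1 ⟨hyK, hyc⟩).1⟩
  have hδε := lt_min hδ hε
  constructor
  · filter_upwards [ball_mem_nhds (f q) hδε] with y hy using hLK y hy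
  · filter_upwards [hf.continuousAt.preimage_mem_nhds (ball_mem_nhds (f q) hδε),
      hU.mem_nhds] with x hx hxU hxc
    have hx' : dist (f x) (f q) < min δ ε := hx
    obtain ⟨x', hx'C, hx'U, he⟩ := (hev _ (hx'.trans_le (min_le_right _ _))).2
      (subset_closure ⟨(hLK _ hx' hxc).1 (hU.maps x hxU), hxc⟩)
    rwa [hU.injOn hxU hx'U he.symm]

/-- If the body of a local model at a rim point does not cut off a cap body from the half-space of
the cap, then it is contained in this half-space and meets the plane in a subset of a line. -/
theorem thin_of_not_capBody (hf : Continuous f) (hq : q ∈ C) (hqc : ⟪n, f q⟫ = c)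
    (hU : LocalModel f q U L) (hL : ¬ CapBody (L ∩ halfSpace n c) n c)
    :
    (∀ y ∈ L, c ≤ ⟪n, y⟫) ∧ ∃ e : R3, ‖e‖ = 1 ∧ ⟪n, e⟫ = 0 ∧
      ∀ y ∈ L, ⟪n, y⟫ = c → ⟪e, y - f q⟫ = 0 := by
  obtain ⟨y, hy, hyo⟩ := mem_closure_iff_nhds.1 (h.mem_closure hq) _
    (h.frontier_mem_nhdsWithin hf hq hU)
  have hyL := hU.body.frontier_subset (hy hyo).1
  have hyc : c < ⟪n, y⟫ := hyo.2
  have hle : ∀ y ∈ L, c ≤ ⟪n, y⟫ := by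
    intro y' hy'
    by_contra! hlt
    exact hL (capBody_inter hU.body hy' hlt hyL hyc)
  have hLeq : L ∩ halfSpace n c = L := inter_eq_left.2 hle
  refine ⟨hle, (relInt_or_subset_line hU.body.convex h.capBody.normal_ne_zero
    (hU.body.frontier_subset (hU.maps q hU.mem)) hqc).resolve_left fun hr => hL ?_⟩
  rw [hLeq]
  exact ⟨hU.body, h.capBody.normal_ne_zero, hle, hr⟩

/-- At a rim point, either the body of a local model agrees with the body of the cap in the open
half-space, or the cap lies in a plane near the point. -/
theorem agree_or_flat (hf : Continuous f) (hq : q ∈ C) (hU : LocalModel f q U L)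
    (hL : CapBody (L ∩ halfSpace n c) n c) :
    (∀ᶠ y in 𝓝 (f q), c < ⟪n, y⟫ → (y ∈ K ↔ y ∈ L)) ∨
    ∃ m : R3, m ≠ 0 ∧ ∀ᶠ y in 𝓝 (f q), y ∈ openCap K n c → ⟪m, y - f q⟫ = 0 := by
  have hK := h.capBody.body
  obtain ⟨ε, hε, hagr⟩ := Metric.eventually_nhds_iff_ball.1 (h.agree_of_capBody hf hq hU hL).1
  set O : Set R3 := {y | c < ⟪n, y⟫} ∩ ball (f q) ε
  have hOo : IsOpen O := (isOpen_inner_gt n c).inter isOpen_ball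
  have hOc : Convex ℝ O := (convex_halfSpace_gt (f := fun x => ⟪n, x⟫)
    (innerSL ℝ n).isLinear c).inter (convex_ball _ _)
  have hcl : ∀ {A : Set R3}, IsConvexBody A → ∀ y ∈ frontier A, y ∈ O →
      y ∈ closure (interior A ∩ O) := by
    intro A hA y hy hyO
    refine mem_closure_iff_nhds.2 fun N hN => ?_
    obtain ⟨k, hk, hkN⟩ := hA.exists_interior_mem (isOpen_interior.inter hOo)
      (hA.frontier_subset hy) ⟨mem_interior_iff_mem_nhds.2 hN, hyO⟩
    exact ⟨k, interior_subset hkN.1, hk, hkN.2⟩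
  by_cases hmeet : (interior K ∩ O ∩ (interior L ∩ O)).Nonempty
  · left
    obtain ⟨z, ⟨hzK, hzO⟩, hzL, -⟩ := hmeet
    have key : ∀ {A B : Set R3}, IsConvexBody A → IsConvexBody B →
        (∀ y ∈ O, (y ∈ frontier A ↔ y ∈ frontier B)) → z ∈ interior A → z ∈ B →
        ∀ y ∈ O, y ∈ A → y ∈ B := by
      intro A B hA hB hAB hzA hzB y hyO hyA
      by_cases hyi : y ∈ interior A
      · have := (subset_or_disjoint_of_frontier (K := B)
          (hA.convex.interior.inter hOc).isPreconnected fun w hw hwB =>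
            ((hAB w hw.2).2 hwB).2 hw.1).resolve_right fun hd => hd z ⟨hzA, hzO⟩ hzB
        exact this ⟨hyi, hyO⟩
      · exact hB.frontier_subset ((hAB y hyO).1 ⟨subset_closure hyA, hyi⟩)
    filter_upwards [ball_mem_nhds (f q) hε] with y hy hyc
    exact ⟨key hK hU.body (fun y hy => (hagr y hy.2 hy.1).symm) hzK (interior_subset hzL) y
      ⟨hyc, hy⟩,
      key hU.body hK (fun y hy => hagr y hy.2 hy.1) hzL (interior_subset hzK) y ⟨hyc, hy⟩⟩
  · right
    obtain ⟨y₀, hy₀, hy₀o⟩ := mem_closure_iff_nhds.1 (h.mem_closure hq) _ (ball_mem_nhds (f q) hε)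
    have hy₀K : y₀ ∈ frontier K := hy₀o.1
    have hy₀c : c < ⟪n, y₀⟫ := hy₀o.2
    have hy₀O : y₀ ∈ O := ⟨hy₀c, hy₀⟩
    have hy₀L : y₀ ∈ frontier L := (hagr y₀ hy₀ hy₀c).2 hy₀K
    obtain ⟨φ, d, h1, h2⟩ := geometric_hahn_banach_open (hK.convex.interior.inter hOc)
      (isOpen_interior.inter hOo) (hU.body.convex.interior.inter hOc)
      (disjoint_iff_inter_eq_empty.2 (not_nonempty_iff_eq_empty.1 hmeet))
    have hd : ∀ y ∈ openCap K n c, y ∈ ball (f q) ε → φ y = d := by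
      intro y hy hyb
      have hyO : y ∈ O := ⟨hy.2, hyb⟩
      refine le_antisymm ?_ ?_
      · exact closure_minimal (fun w hw => (h1 w hw).le) (isClosed_le φ.continuous continuous_const)
          (hcl hK y hy.1 hyO)
      · exact closure_minimal (fun w hw => h2 w hw) (isClosed_le continuous_const φ.continuous)
          (hcl hU.body y ((hagr y hyb hy.2).2 hy.1) hyO)
    have hφ0 : φ ≠ 0 := by
      rintro rfl
      obtain ⟨w, -, hw⟩ := mem_closure_iff_nhds.1 (hcl hK y₀ hy₀K hy₀O) univ univ_mem
      have := h1 w hw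
      rw [← hd y₀ hy₀o hy₀] at this
      simp at this
    refine ⟨(InnerProductSpace.toDual ℝ R3).symm φ, fun h0 => hφ0 (by simpa using h0), ?_⟩
    have hqd : φ (f q) = d := by
      have h3 : f q ∈ closure (openCap K n c ∩ ball (f q) ε) := by
        refine mem_closure_iff_nhds.2 fun N hN => ?_
        obtain ⟨y, hy, hyo⟩ := mem_closure_iff_nhds.1 (h.mem_closure hq) _
          (inter_mem hN (ball_mem_nhds (f q) hε))
        exact ⟨y, hy.1, hyo, hy.2⟩
      exact closure_minimal (fun y hy => hd y hy.1 hy.2) (isClosed_eq φ.continuous continuous_const)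
        h3
    filter_upwards [ball_mem_nhds (f q) hε] with y hy hyo
    rw [InnerProductSpace.toDual_symm_apply, map_sub, hd y hyo hy, hqd, sub_self]

/-- If a cap lies in a plane near a rim point, then this plane supports the body of the cap. -/
theorem one_sided_of_flat (hq : q ∈ C) {m : R3} (hm : m ≠ 0)
    (hflat : ∀ᶠ y in 𝓝 (f q), y ∈ openCap K n c → ⟪m, y - f q⟫ = 0) {N : Set R3} (hN : N ∈ 𝓝 (f q))
    :
    ((∀ y ∈ K, ⟪m, y - f q⟫ ≤ 0) ∨ ∀ y ∈ K, 0 ≤ ⟪m, y - f q⟫) ∧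
    ∃ y ∈ openCap K n c, y ∈ N ∧ ⟪m, y - f q⟫ = 0 ∧
      ∃ δ > 0, ∀ z, ⟪m, z - f q⟫ = 0 → dist z y < δ → z ∈ K := by
  have hK := h.capBody.body
  obtain ⟨y, hy, hyo⟩ := mem_closure_iff_nhds.1 (h.mem_closure hq) _
    (inter_mem (interior_mem_nhds.2 hN) (eventually_eventually_nhds.2 hflat))
  have hyc : c < ⟪n, y⟫ := hyo.2
  have hym := hy.2.self_of_nhds hyo
  rw [inner_sub_right, sub_eq_zero] at hym
  obtain ⟨h1, δ, hδ, h2⟩ := hK.convex.flat_of_frontier hK.isClosed hK.interior_nonempty hyo.1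
    (innerSL ℝ m) (fun h0 => hm (by simpa using congrArg (fun φ => φ m) h0))
    (inter_mem hy.2 ((isOpen_inner_gt n c).mem_nhds hyc)) (fun z hz hzs => by
      have := hzs.1 ⟨hz, hzs.2⟩
      rw [inner_sub_right, sub_eq_zero] at this
      rw [innerSL_apply_apply, innerSL_apply_apply, this, hym])
  simp only [innerSL_apply_apply, hym] at h1 h2
  refine ⟨?_, y, hyo, interior_subset hy.1, by rw [inner_sub_right, hym, sub_self], δ, hδ,
    fun z hz => h2 z (by rwa [inner_sub_right, sub_eq_zero] at hz)⟩
  simpa [inner_sub_right] using h1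

/-- If the rim of a cap lies in a line near the image of a rim point, then this image is the
midpoint of a segment in the base of the cap body. -/
theorem exists_segment_of_thin (hq : q ∈ C) (hqc : ⟪n, f q⟫ = c) {e : R3} (he : ‖e‖ = 1)
    (hne : ⟪n, e⟫ = 0)
    (hL : ∀ᶠ y in 𝓝 (f q), y ∈ closure (openCap K n c) → ⟪n, y⟫ = c → ⟪e, y - f q⟫ = 0) :
    ∃ w : R3, w ≠ 0 ∧ ⟪n, w⟫ = 0 ∧ ⟪e, w⟫ = 0 ∧ f q + w ∈ K ∧ f q - w ∈ K := by
  obtain ⟨P, π, ι, hPn, hπP, hPπ, hdist, hPι, hPc, hint⟩ :=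
    exists_plane_param h.capBody.normal_ne_zero c
  have hK := h.capBody.body
  have hsub : ∀ x y : R3, ⟪n, x⟫ = c → ⟪n, y⟫ = c → ι (π y - π x) = y - x := by
    intro x y hx hy
    have := hPι (π x) (π y)
    rw [hPπ x hx, hPπ y hy] at this
    exact (sub_eq_of_eq_add' this).symm
  have hx : f q ∈ K := h.mem_body hq
  obtain ⟨z, hz⟩ := h.capBody.relInt
  have hfr : π (f q) ∈ frontier (P ⁻¹' K) := by
    rw [(hK.isClosed.preimage hPc).frontier_eq]
    refine ⟨by rw [mem_preimage, hPπ _ hqc]; exact hx, fun hi => ?_⟩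
    rw [← hint, hPπ _ hqc] at hi
    exact h.capBody.not_relInt_of_mem_closure (h.mem_closure hq) hi
  have hev : ∀ᶠ y in 𝓝 (f q), y ∈ K → ⟪n, y⟫ = c → ¬ RelInt K n c y → ⟪e, y - f q⟫ = 0 := by
    filter_upwards [hL] with y hy hyK hyc hyr
    exact hy (h.capBody.mem_closure_openCap hyK hyc hyr) hyc
  have hs : {w | P w ∈ K → ⟪n, P w⟫ = c → ¬ RelInt K n c (P w) →
      ⟪e, P w - f q⟫ = 0} ∈ 𝓝 (π (f q)) := by
    have := hPc.continuousAt (x := π (f q))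
    rw [ContinuousAt, hPπ _ hqc] at this
    exact this.eventually hev
  obtain ⟨-, δ, hδ, hdisk⟩ := (convex_preimage_plane_param hK.convex hPι).flat_of_frontier
    (hK.isClosed.preimage hPc) ⟨π z, (hint K _).1 (by rw [hPπ z hz.1]; exact hz)⟩ hfr
    ((innerSL ℝ e).comp ι) (by
      intro h0
      have h1 := congrArg (fun φ => φ (π (f q + e) - π (f q))) h0
      simp only [ContinuousLinearMap.comp_apply, zero_apply] at h1
      rw [hsub _ _ hqc (by rw [inner_add_right, hqc, hne, add_zero]), add_sub_cancel_left,
        innerSL_apply_apply, real_inner_self_eq_norm_sq, he] at h1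
      norm_num at h1) hs (fun w hw hws => by
      rw [(hK.isClosed.preimage hPc).frontier_eq] at hw
      have h1 := hws hw.1 (hPn w) fun hr => hw.2 ((hint K w).1 hr)
      rw [hPι (π (f q)) w, hPπ _ hqc, add_sub_cancel_left, map_sub, inner_sub_right,
        sub_eq_zero] at h1
      exact h1)
  obtain ⟨t, ht, hnt, het, -⟩ := exists_third_unit h.norm_eq_one he hne
  have key : ∀ s : ℝ, |s| < δ → f q + s • t ∈ K := by
    intro s hs
    have hc : ⟪n, f q + s • t⟫ = c := by
      rw [inner_add_smul, hnt, mul_zero, add_zero, hqc]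
    have := hdisk (π (f q + s • t)) (by
      rw [← sub_eq_zero, ← map_sub, ContinuousLinearMap.comp_apply, hsub _ _ hqc hc,
        add_sub_cancel_left, innerSL_apply_apply, inner_smul_right, het, mul_zero]) (by
      rw [← hdist, hPπ _ hc, hPπ _ hqc, dist_eq_norm, add_sub_cancel_left, norm_smul, ht, mul_one]
      exact hs)
    rwa [mem_preimage, hPπ _ hc] at this
  have ht0 : t ≠ 0 := by rintro rfl; simp at ht
  refine ⟨(δ / 2) • t, smul_ne_zero (by positivity) ht0, by rw [inner_smul_right, hnt, mul_zero],
    by rw [inner_smul_right, het, mul_zero], key _ (by rw [abs_of_pos (by positivity)]; linarith),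
      ?_⟩
  rw [sub_eq_add_neg, ← neg_smul]
  exact key _ (by rw [abs_neg, abs_of_pos (by positivity)]; linarith)

variable [ChartedSpace (EuclideanHalfSpace 2) M] [T2Space M] [CompactSpace M]

/-- The points of a nondegenerate cap which are mapped off the plane of the cap are interior points
of the cap, and they do not belong to the boundary of the surface. -/
theorem mem_nhds_and_notMem_bdry (hf : IsRegularImmersion f) (hq : q ∈ C) (hqc : c < ⟪n, f q⟫)
    : C ∈ 𝓝 q ∧ q ∉ bdry M := by
  obtain ⟨U, -, L, hU⟩ := hf.exists_localModel q univ_mem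
  have h1 : ∀ᶠ y in 𝓝 (f q), y ∈ frontier L → ∃ x ∈ C, x ∈ U ∧ f x = y := by
    filter_upwards [h.eventually_frontier_iff hf.continuous hq hqc hU,
      h.eventually_openCap hf.continuous hq hU.mem_nhds,
      (isOpen_inner_gt n c).mem_nhds hqc] with y hy1 hy2 hyc hyL
    exact hy2 (subset_closure ⟨hy1.1 hyL, hyc⟩)
  constructor
  · filter_upwards [hf.continuous.continuousAt.eventually h1, hU.mem_nhds] with x hx hxU
    obtain ⟨x', hx'C, hx'U, he⟩ := hx (hU.maps x hxU)
    rwa [hU.injOn hxU hx'U he.symm]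
  · intro hb
    refine hU.image_notMem_nhdsWithin hf.continuous hb (mem_nhdsWithin_iff_exists_mem_nhds_inter.2
      ⟨_, h1, ?_⟩)
    rintro y ⟨hy, hyL⟩
    obtain ⟨x, -, hxU, rfl⟩ := hy hyL
    exact ⟨x, hxU, rfl⟩

/-- In the same situation, the surface continues beyond the cap at the nearby rim points. -/
theorem eventually_mem_closure_of_thin (hf : IsRegularImmersion f) (hqc : ⟪n, f q⟫ = c)
    (hU : LocalModel f q U L) (hle : ∀ y ∈ L, c ≤ ⟪n, y⟫) {e : R3} (he : ‖e‖ = 1) (hne : ⟪n, e⟫ = 0)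
    (hL : ∀ y ∈ L, ⟪n, y⟫ = c → ⟪e, y - f q⟫ = 0) :
    ∀ᶠ q' in 𝓝 q, q' ∈ C → ⟪n, f q'⟫ = c → q' ≠ q → q' ∈ closure {x | c < ⟪n, f x⟫ ∧ x ∉ C} := by
  have hn0 := h.capBody.normal_ne_zero
  filter_upwards [interior_mem_nhds.2 hU.mem_nhds,
    hf.eventually_bdry_line q h.norm_eq_one he hne] with q' hq'U hline hq'C hq'c hq'q
  have hq'L := hU.body.frontier_subset (hU.maps q' (interior_subset hq'U))
  have hq'b : q' ∉ bdry M := fun hb => hq'q (hline hb (by rw [inner_sub_right, hqc, hq'c, sub_self])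
    (hL _ hq'L hq'c))
  by_contra hcl
  have hU' := hU.of_mem_interior hq'U
  have hN : {x | c < ⟪n, f x⟫ → x ∈ C} ∈ 𝓝 q' := by
    filter_upwards [isClosed_closure.isOpen_compl.mem_nhds hcl] with x hx hxc
    by_contra hxC
    exact hx (subset_closure ⟨hxc, hxC⟩)
  obtain ⟨V, hVN, _, hV⟩ := hf.exists_localModel q' (inter_mem hU'.mem_nhds hN)
  have hV' := hU'.mono (fun x hx => (hVN hx).1) hV.isCompact hV.mem_nhds
  have h1 : ∀ᶠ y in 𝓝 (f q'), y ∈ frontier L → c < ⟪n, y⟫ → y ∈ frontier K := by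
    obtain ⟨s, hs, hsV⟩ := mem_nhdsWithin_iff_exists_mem_nhds_inter.1
      (hV'.image_mem_nhdsWithin hf.continuous hq'b)
    filter_upwards [hs] with y hys hyL hyc
    obtain ⟨x, hx, rfl⟩ := hsV ⟨hys, hyL⟩
    exact h.mem_frontier ((hVN hx).2 hyc)
  -- the part of the boundary of `L` off the plane is dense
  have h2 : ∀ᶠ y in 𝓝 (f q'), y ∈ frontier L → y ∈ frontier K := by
    filter_upwards [eventually_eventually_nhds.2 h1] with y hy hyL
    by_contra hyK
    have hyLL := hU.body.frontier_subset hyL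
    have hyc : ⟪n, y⟫ = c := by
      refine le_antisymm (not_lt.1 fun hlt => hyK (hy.self_of_nhds hyL hlt)) (hle y hyLL)
    obtain ⟨-, δ, hδ, hdisk⟩ := hU.body.convex.flat_of_frontier hU.body.isClosed
      hU.body.interior_nonempty hyL (innerSL ℝ n)
      (fun h0 => hn0 (by simpa using congrArg (fun φ => φ n) h0))
      (inter_mem hy (isClosed_frontier.isOpen_compl.mem_nhds hyK)) (fun z hzL hz => by
        rw [innerSL_apply_apply, innerSL_apply_apply, hyc]
        exact le_antisymm (not_lt.1 fun hlt => hz.2 (hz.1 hzL hlt))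
          (hle z (hU.body.frontier_subset hzL)))
    have hc : ⟪n, y + (δ / 2) • e⟫ = c := by
      rw [inner_add_smul, hne, mul_zero, add_zero, hyc]
    have h3 := hL _ (hdisk (y + (δ / 2) • e) (by
      rw [innerSL_apply_apply, innerSL_apply_apply, hc, hyc]) (by
      rw [dist_eq_norm, add_sub_cancel_left, norm_smul, he, mul_one, norm_eq_abs,
        abs_of_pos (by positivity)]
      linarith)) hc
    have h4 := hL _ hyLL hyc
    rw [add_sub_right_comm, inner_add_right, h4, inner_smul_right, real_inner_self_eq_norm_sq,
      he] at h3
    linarith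
  -- hence the base of the cap body would be contained in a line near `f q'`
  have h3 := hU.body.frontier_mem_nhdsWithin h.capBody.body (hU'.maps q' hU'.mem) h2
    fun y hy hyN => hyN hy
  obtain ⟨s, hs, hsL⟩ := mem_nhdsWithin_iff_exists_mem_nhds_inter.1 h3
  obtain ⟨z, hz⟩ := h.capBody.relInt
  obtain ⟨y, hys, hyr, hyi⟩ := mem_closure_iff_nhds.1 (mem_closure_relInt_inter_ball
    h.capBody.body.convex hz (h.mem_body hq'C) hq'c (interior_mem_nhds.2 hs)) _
    (interior_mem_nhds.2 hs)
  obtain ⟨hyc, ε, hε, hdisk⟩ := hyr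
  obtain ⟨t, ⟨ht1, ht2⟩, ht0, -⟩ := (eventually_lineMap e (inter_mem
    (mem_interior_iff_mem_nhds.1 hyi) (ball_mem_nhds y hε))).exists
  have hc : ⟪n, y + t • e⟫ = c := by
    rw [inner_add_smul, hne, mul_zero, add_zero, hyc]
  have hin : ∀ x ∈ s, x ∈ K → ⟪n, x⟫ = c → ⟪e, x - f q⟫ = 0 := fun x hxs hxK hxc =>
    hL x (hU.body.frontier_subset (hsL ⟨hxs, h.capBody.mem_frontier_of_inner_eq hxK hxc⟩)) hxc
  have h4 := hin _ ht1 (hdisk _ hc ht2) hc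
  have h5 := hin _ (interior_subset hyi) (hdisk y hyc (by simpa using hε)) hyc
  rw [add_sub_right_comm, inner_add_right, h5, inner_smul_right, real_inner_self_eq_norm_sq,
    he] at h4
  linarith

/-- The body of each local model at a rim point cuts off a cap body from the half-space of the cap.
Otherwise the base of the cap body would contain a segment through the image of each rim point,
and it would have no extreme points. -/
theorem capBody_of_rim (hf : IsRegularImmersion f) (hq : q ∈ C) (hqc : ⟪n, f q⟫ = c)
    (hU : LocalModel f q U L) : CapBody (L ∩ halfSpace n c) n c := by
  by_contra hcap
  have hK := h.capBody.body
  set Z : Set M := {x | c < ⟪n, f x⟫ ∧ x ∉ C}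
  set R : Set M := {x ∈ C | ⟪n, f x⟫ = c}
  have hB : IsCompact (K ∩ plane n c) := hK.isCompact.inter_right
    (isClosed_eq (continuous_const.inner continuous_id) continuous_const)
  have hBr : ∀ x, RelInt (K ∩ plane n c) n c x ↔ RelInt K n c x := fun x =>
    ⟨fun hx => hx.mono fun y hy _ => hy.1, fun hx => hx.mono fun y hy hyc => ⟨hy, hyc⟩⟩
  have hRpre : IsPreconnected R := by
    refine h.isCompact.isPreconnected_of_image hf.continuous.continuousOn h.injOn
      (fun x hx => hx.1) ?_
    have e : f '' R = {x ∈ K ∩ plane n c | ¬ RelInt (K ∩ plane n c) n c x} := by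
      ext y
      constructor
      · rintro ⟨x, ⟨hx, hxc⟩, rfl⟩
        exact ⟨⟨h.mem_body hx, hxc⟩, fun hr =>
          h.capBody.not_relInt_of_mem_closure (h.mem_closure hx) ((hBr _).1 hr)⟩
      · rintro ⟨⟨hy, hyc⟩, hyr⟩
        obtain ⟨x, hx, rfl⟩ := h.exists_of_mem_plane hy hyc fun hr => hyr ((hBr _).2 hr)
        exact ⟨x, ⟨hx, hyc⟩, rfl⟩
    rw [e]
    exact isPreconnected_not_relInt hB (hK.convex.inter (convex_hyperplane
      (f := fun x => ⟪n, x⟫) (innerSL ℝ n).isLinear c)) h.capBody.normal_ne_zero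
      inter_subset_right
  have hthin : ∀ x ∈ R, x ∈ closure Z → ∀ U L, LocalModel f x U L →
      ¬ CapBody (L ∩ halfSpace n c) n c := by
    intro x hx hxZ U L hU hcap
    obtain ⟨y, hy, hyc, hyC⟩ := mem_closure_iff_nhds.1 hxZ _
      (h.agree_of_capBody hf.continuous hx.1 hU hcap).2
    exact hyC (hy hyc)
  have hnext : ∀ x ∈ R, ∀ U L, LocalModel f x U L → ¬ CapBody (L ∩ halfSpace n c) n c →
      ∀ᶠ y in 𝓝 x, y ∈ R → y ≠ x → y ∈ closure Z := by
    intro x hx U L hU hcap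
    obtain ⟨hle, e, he, hne, hL⟩ := h.thin_of_not_capBody hf.continuous hx.1 hx.2 hU hcap
    filter_upwards [h.eventually_mem_closure_of_thin hf hx.2 hU hle he hne hL]
      with y hy hyR using hy hyR.1 hyR.2
  obtain ⟨a, ha⟩ := hB.extremePoints_nonempty (by
    obtain ⟨z, hz⟩ := h.capBody.relInt
    exact ⟨z, hz.mem, hz.1⟩)
  have haB := extremePoints_subset ha
  have hnoseg : ∀ w : R3, w ≠ 0 → ⟪n, w⟫ = 0 → a + w ∈ K → a - w ∈ K → False := by
    intro w hw hnw h1 h2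
    have hac : ⟪n, a⟫ = c := haB.2
    have h3 := (mem_extremePoints.1 ha).2 (a + w)
      ⟨h1, show ⟪n, a + w⟫ = c by rw [inner_add_right, hnw, add_zero, hac]⟩ (a - w)
      ⟨h2, show ⟪n, a - w⟫ = c by rw [inner_sub_right, hnw, sub_zero, hac]⟩
      ⟨1 / 2, 1 / 2, by norm_num, by norm_num, by norm_num, by module⟩
    exact hw (by simpa using h3.1)
  have har : ¬ RelInt K n c a := by
    rintro ⟨hac, ε, hε, hdisk⟩
    obtain ⟨e₀, he₀⟩ : ∃ w : R3, w ≠ 0 ∧ ⟪n, w⟫ = 0 := by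
      obtain ⟨π, ι, hπι, hnι, -, -, -⟩ := exists_orthogonal_coordinates h.capBody.normal_ne_zero
      obtain ⟨v, hv⟩ := exists_ne (0 : E2)
      exact ⟨ι v, fun h0 => hv (by rw [← hπι v, h0, map_zero]), hnι v⟩
    obtain ⟨t, ht, ht0, -⟩ := (eventually_lineMap e₀ (ball_mem_nhds a hε)).exists
    have hd : dist (a + t • e₀) a = ‖t • e₀‖ := by rw [dist_eq_norm, add_sub_cancel_left]
    rw [mem_ball, hd] at ht
    have hn1 : ⟪n, t • e₀⟫ = 0 := by rw [inner_smul_right, he₀.2, mul_zero]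
    refine hnoseg (t • e₀) (smul_ne_zero ht0.ne' he₀.1) hn1 (hdisk _ ?_ (by rwa [hd]))
      (hdisk _ ?_ ?_)
    · rw [inner_add_right, hn1, add_zero, hac]
    · rw [inner_sub_right, hn1, sub_zero, hac]
    · rwa [dist_eq_norm, sub_sub_cancel_left, norm_neg]
  obtain ⟨qa, hqaC, hqa⟩ := h.exists_of_mem_plane haB.1 haB.2 har
  have hqaR : qa ∈ R := ⟨hqaC, by rw [hqa]; exact haB.2⟩
  have hnothin : ∀ U L, LocalModel f qa U L → CapBody (L ∩ halfSpace n c) n c := by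
    intro U L hU
    by_contra hcap
    obtain ⟨hle, e, he, hne, hL⟩ := h.thin_of_not_capBody hf.continuous hqaC hqaR.2 hU hcap
    obtain ⟨w, hw, hnw, -, h1, h2⟩ := h.exists_segment_of_thin hqaC hqaR.2 he hne (by
      filter_upwards [h.eventually_openCap hf.continuous hqaC hU.mem_nhds] with y hy hyC hyc
      obtain ⟨x, -, hxU, rfl⟩ := hy hyC
      exact hL _ (hU.body.frontier_subset (hU.maps x hxU)) hyc)
    rw [hqa] at h1 h2
    exact hnoseg w hw hnw h1 h2
  have hRT : R ⊆ closure Z ∪ {q} := by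
    refine hRpre.subset_of_relatively_clopen ?_ (fun x _ hx => by
      rwa [(isClosed_closure.union isClosed_singleton).closure_eq] at hx) ⟨q, ⟨hq, hqc⟩, Or.inr rfl⟩
    rintro x hx (hxZ | hxq)
    · obtain ⟨V, _, L', hV⟩ := hf.exists_localModel x univ_mem
      filter_upwards [hnext x hx V L' hV (hthin x hx hxZ V L' hV)] with y hy hyR
      by_cases hyx : y = x
      · rw [hyx]; exact Or.inl hxZ
      · exact Or.inl (hy hyR hyx)
    · rw [mem_singleton_iff] at hxq
      subst hxq
      filter_upwards [hnext x hx U L hU hcap] with y hy hyR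
      by_cases hyx : y = x
      · exact Or.inr hyx
      · exact Or.inl (hy hyR hyx)
  rcases hRT hqaR with hZa | hqq
  · obtain ⟨V, _, L', hV⟩ := hf.exists_localModel qa univ_mem
    exact hthin qa hqaR hZa V L' hV (hnothin V L' hV)
  · rw [mem_singleton_iff] at hqq
    subst hqq
    exact hcap (hnothin U L hU)

end CapModel

/-! ### Nondegenerate caps through a boundary point -/

theorem RelInt.eventually_add_smul {K : Set R3} {n : R3} {c : ℝ} {z : R3} (h : RelInt K n c z)
    {g : R3} (hg : ⟪n, g⟫ = 0) : ∀ᶠ s in 𝓝 (0 : ℝ), RelInt K n c (z + s • g) := by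
  obtain ⟨hz, ε, hε, hdisk⟩ := h
  have h1 : Tendsto (fun s : ℝ => z + s • g) (𝓝 0) (𝓝 z) := by
    have : Continuous fun s : ℝ => z + s • g := by fun_prop
    simpa using this.tendsto 0
  filter_upwards [h1.eventually (ball_mem_nhds z (half_pos hε))] with s hs
  refine ⟨by rw [inner_add_smul, hg, mul_zero, add_zero, hz], ε / 2, half_pos hε,
    fun y hy hyd => hdisk y hy ?_⟩
  have hs' : dist (z + s • g) z < ε / 2 := hs
  linarith [dist_triangle y (z + s • g) z]

theorem eq_smul_of_orthogonal_imp {m n : R3} (hm : m ≠ 0) (h : ∀ g : R3, ⟪m, g⟫ = 0 → ⟪n, g⟫ = 0)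
    : ∃ a : ℝ, n = a • m := by
  refine ⟨⟪m, n⟫ / ‖m‖ ^ 2, ?_⟩
  have hm' : ‖m‖ ^ 2 ≠ 0 := pow_ne_zero _ (norm_ne_zero_iff.2 hm)
  have h1 : ⟪m, n - (⟪m, n⟫ / ‖m‖ ^ 2) • m⟫ = 0 := by
    rw [inner_sub_right, inner_smul_right, real_inner_self_eq_norm_sq, div_mul_cancel₀ _ hm',
      sub_self]
  have h2 := h _ h1
  rw [← sub_eq_zero, ← inner_self_eq_zero (𝕜 := ℝ)]
  nth_rewrite 1 [inner_sub_left]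
  rw [real_inner_smul_left, h1, h2, mul_zero, sub_zero]

theorem sin_mul_inner_rotatedNormal (ν n : R3) (θ θ' : ℝ) (x : R3) :
    sin θ' * ⟪rotatedNormal ν n θ, x⟫ =
      sin (θ' - θ) * ⟪n, x⟫ + sin θ * ⟪rotatedNormal ν n θ', x⟫ := by
  rw [inner_rotatedNormal, inner_rotatedNormal, Real.sin_sub]; ring

theorem inner_eq_zero_of_rotatedNormal {ν n d : R3} {θ θ' : ℝ} (hθ : θ ∈ Ioo 0 θ')
    (hθ' : θ' ≤ Real.pi) (h : ⟪rotatedNormal ν n θ, d⟫ = 0) (h' : ⟪rotatedNormal ν n θ', d⟫ = 0)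
    : ⟪n, d⟫ = 0 ∧ ⟪ν, d⟫ = 0 := by
  have hs : 0 < sin θ := sin_pos_of_pos_of_lt_pi hθ.1 (hθ.2.trans_le hθ')
  have hd : 0 < sin (θ' - θ) := sin_pos_of_pos_of_lt_pi (by linarith [hθ.2]) (by linarith [hθ.1])
  have h1 := sin_mul_inner_rotatedNormal ν n θ θ' d
  rw [h, h', mul_zero, mul_zero, add_zero] at h1
  have h2 := (mul_eq_zero.1 h1.symm).resolve_left hd.ne'
  refine ⟨h2, ?_⟩
  rw [inner_rotatedNormal, h2, mul_zero, zero_add] at h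
  exact (mul_eq_zero.1 h).resolve_left hs.ne'

theorem CapModel.eventually_mem_of_rim {M : Type*} [TopologicalSpace M]
    [ChartedSpace (EuclideanHalfSpace 2) M] [T2Space M] [CompactSpace M] {f : M → R3} {C : Set M}
    {K : Set R3} {m : R3} {c : ℝ} (g : CapModel f C K m c) (hf : IsRegularImmersion f) {q : M}
    (hq : q ∈ C) (hqc : ⟪m, f q⟫ = c)
    : ∀ᶠ x in 𝓝 q, c < ⟪m, f x⟫ → x ∈ C := by
  obtain ⟨V, _, A, hV⟩ := hf.exists_localModel q univ_mem
  exact (g.agree_of_capBody hf.continuous hq hV (g.capBody_of_rim hf hq hqc hV)).2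

namespace BoundaryFrame

variable {M : Type*} [TopologicalSpace M] [ChartedSpace (EuclideanHalfSpace 2) M]
  {f : M → R3} {p : M} {U : Set M} {L : Set R3} {φ : ℝ → bdry M} {T n ν : R3}
  {C : Set M} {K : Set R3} {c : ℝ}

theorem tendsto_param (h : BoundaryFrame f p U L φ T n ν) :
    Tendsto (fun s => (φ s : M)) (𝓝 0) (𝓝 p) := by
  have := (continuous_subtype_val.comp h.param.isOpenEmbedding.continuous).tendsto 0
  rwa [Function.comp_apply, h.param_zero] at this

variable [T2Space M] [CompactSpace M] (h : BoundaryFrame f p U L φ T n ν)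
  (hf : IsRegularImmersion f)

include h hf

section General

variable {m : R3} (g : CapModel f C K m c) (hp : p ∈ C)

include g hp

theorem inner_eq_of_mem_cap : ⟪m, f p⟫ = c := by
  by_contra hne
  exact (g.mem_nhds_and_notMem_bdry hf hp ((g.le_inner hp).lt_of_ne' hne)).2 h.mem_bdry

/-- A limit direction of the open cap of a cap through `p` is tangent to the surface. -/
theorem limit_of_openCap {w : R3}
    (hw : ∀ η > 0, ∀ O ∈ 𝓝 (f p), ∃ y ∈ openCap K m c, y ∈ O ∧ ∃ t : ℝ, 0 < t ∧
      ‖y - f p - t • w‖ ≤ η * t) :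
    ⟪n, w⟫ = 0 ∧ 0 ≤ ⟪ν, w⟫ ∧ 0 ≤ ⟪m, w⟫ := by
  obtain ⟨h1, h2⟩ := h.limit_direction (w := w) fun η hη N hN => by
    obtain ⟨y, hyo, hy, t, ht, hyt⟩ := hw η hη _ (g.eventually_openCap hf.continuous hp hN)
    obtain ⟨x, -, hxN, rfl⟩ := hy (subset_closure hyo)
    exact ⟨x, hxN, t, ht, hyt⟩
  refine ⟨h1, h2, ?_⟩
  by_contra! hneg
  obtain ⟨y, hyo, -, t, ht, hyt⟩ := hw (-⟪m, w⟫ / 2) (by linarith) univ univ_mem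
  have hyc : c < ⟪m, y⟫ := hyo.2
  have h3 := (abs_le.1 ((abs_real_inner_le_norm m (y - f p - t • w)).trans
    (le_of_eq_of_le (by rw [g.norm_eq_one, one_mul]) hyt))).2
  rw [inner_sub_right, inner_sub_right, inner_smul_right, h.inner_eq_of_mem_cap hf g hp] at h3
  have h4 := mul_neg_of_pos_of_neg ht hneg
  linarith

/-- The plane of a nondegenerate cap through `p` contains the tangent line of the boundary curve. -/
theorem inner_T_eq_zero : ⟪m, T⟫ = 0 := by
  have hpc := h.inner_eq_of_mem_cap hf g hp
  have hmax : IsLocalMax (fun s => ⟪m, boundaryCurve f φ s⟫) 0 := by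
    filter_upwards [h.tendsto_param.eventually (g.eventually_mem_of_rim hf hp hpc)] with s hs
    have e0 : boundaryCurve f φ 0 = f p := by simp [boundaryCurve, h.param_zero]
    rw [e0, hpc]
    by_contra! hlt
    exact (g.mem_nhds_and_notMem_bdry hf (hs hlt) hlt).2 (φ s).2
  have hd : HasDerivAt (boundaryCurve f φ) (deriv (boundaryCurve f φ) 0) 0 :=
    (h.param.contDiff.differentiable (by norm_num)).differentiableAt.hasDerivAt
  have hd' := (innerSL ℝ m).hasFDerivAt.comp_hasDerivAt 0 hd
  have h0 := hmax.hasDerivAt_eq_zero hd'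
  obtain ⟨τ, hτ, hderiv⟩ := h.deriv_eq
  rw [innerSL_apply_apply, hderiv, inner_smul_right] at h0
  exact (mul_eq_zero.1 h0).resolve_left hτ.ne'

/-- Each nondegenerate cap through `p` has a limit direction at `f p` whose product with the
conormal is positive. Hence its plane arises from the supporting plane by a rotation. -/
theorem exists_direction : (∃ w, ⟪n, w⟫ = 0 ∧ 0 < ⟪ν, w⟫ ∧ ∀ η > 0, ∀ O ∈ 𝓝 (f p),
      ∃ y ∈ openCap K m c, y ∈ O ∧ ∃ t : ℝ, 0 < t ∧ ‖y - f p - t • w‖ ≤ η * t) ∧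
    ∃ θ ∈ Ioc 0 Real.pi, m = rotatedNormal ν n θ := by
  have hpc := h.inner_eq_of_mem_cap hf g hp
  have hpK := g.mem_body hp
  have hpr := g.capBody.not_relInt_of_mem_closure (g.mem_closure hp)
  have hmT := h.inner_T_eq_zero hf g hp
  set a := ⟪n, m⟫ with ha
  set b := ⟪ν, m⟫ with hb
  have hm : m = a • n + b • ν := by
    have := h.decomp m
    rwa [real_inner_comm m T, hmT, zero_smul, add_zero] at this
  have hma : ∀ x, ⟪m, x⟫ = a * ⟪n, x⟫ + b * ⟪ν, x⟫ := fun x => by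
    rw [hm, inner_add_left, real_inner_smul_left, real_inner_smul_left]
  have hab : a ^ 2 + b ^ 2 = 1 := by
    have := hma m
    rw [real_inner_self_eq_norm_sq, g.norm_eq_one, ← ha, ← hb] at this
    linarith
  obtain ⟨i, hi, hic⟩ := g.capBody.exists_interior_gt
  -- a relative interior point of the base off the tangent line
  obtain ⟨r, hr, hrT⟩ : ∃ r, RelInt K m c r ∧ ¬ (⟪n, r - f p⟫ = 0 ∧ ⟪ν, r - f p⟫ = 0) := by
    obtain ⟨r₀, hr₀⟩ := g.capBody.relInt
    by_cases h0 : ⟪n, r₀ - f p⟫ = 0 ∧ ⟪ν, r₀ - f p⟫ = 0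
    swap
    · exact ⟨r₀, hr₀, h0⟩
    have hg : ⟪m, b • n - a • ν⟫ = 0 := by
      rw [inner_sub_right, inner_smul_right, inner_smul_right, real_inner_comm, real_inner_comm ν m,
        ← ha, ← hb]
      ring
    obtain ⟨s, hs, hs0⟩ := (((hr₀.eventually_add_smul hg).filter_mono
      (nhdsWithin_le_nhds (s := Ioi 0))).and self_mem_nhdsWithin).exists
    have hs0' : 0 < s := hs0
    refine ⟨_, hs, ?_⟩
    rintro ⟨h1, h2⟩
    have e1 : ⟪n, b • n - a • ν⟫ = b := by
      rw [inner_sub_right, inner_smul_right, inner_smul_right, h.inner_nν,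
        real_inner_self_eq_norm_sq, h.norm_n]
      ring
    have e2 : ⟪ν, b • n - a • ν⟫ = -a := by
      rw [inner_sub_right, inner_smul_right, inner_smul_right, h.inner_νn,
        real_inner_self_eq_norm_sq, h.norm_ν]
      ring
    rw [add_sub_right_comm, inner_add_smul, h0.1, e1] at h1
    rw [add_sub_right_comm, inner_add_smul, h0.2, e2] at h2
    have hb0 : b = 0 := by
      have : s * b = 0 := by linarith
      exact (mul_eq_zero.1 this).resolve_left hs0'.ne'
    have ha0 : a = 0 := by
      have : s * a = 0 := by linarith
      exact (mul_eq_zero.1 this).resolve_left hs0'.ne'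
    rw [ha0, hb0] at hab
    norm_num at hab
  obtain ⟨α, hα, hlim⟩ := g.capBody.exists_limit_direction hpK hpc hpr hr (interior_subset hi) hic
  set w := (1 - α) • (i - f p) - α • (r - f p) with hw
  obtain ⟨h1, h2, h3⟩ := h.limit_of_openCap hf g hp hlim
  have hmw : ⟪m, w⟫ = (1 - α) * ⟪m, i - f p⟫ := by
    rw [hw, inner_sub_right, inner_smul_right, inner_smul_right, inner_sub_right m r, hr.1, hpc,
      sub_self, mul_zero, sub_zero]
  have hνw : 0 < ⟪ν, w⟫ := by
    refine lt_of_le_of_ne h2 fun h0 => hrT ?_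
    have h4 := hma w
    rw [h1, ← h0, hmw, mul_zero, mul_zero, add_zero] at h4
    have hα1 : α = 1 := by
      have h5 : ⟪m, i - f p⟫ ≠ 0 := by
        rw [inner_sub_right, hpc]; linarith
      linarith [(mul_eq_zero.1 h4).resolve_right h5]
    rw [hw, hα1, sub_self, zero_smul, one_smul, zero_sub] at h1 h0
    rw [inner_neg_right] at h1 h0
    exact ⟨neg_eq_zero.1 h1, neg_eq_zero.1 h0.symm⟩
  have hb0 : 0 ≤ b := by
    have h4 := hma w
    rw [h1, mul_zero, zero_add] at h4
    rw [h4] at h3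
    exact nonneg_of_mul_nonneg_left h3 hνw
  have ha1 : a < 1 := by
    refine lt_of_le_of_ne (by nlinarith) fun h4 => ?_
    have hb1 : b = 0 := by rw [h4] at hab; nlinarith
    have hmn : m = n := by rw [hm, h4, hb1, one_smul, zero_smul, add_zero]
    obtain ⟨y, hy, hyo⟩ := mem_closure_iff_nhds.1 (g.mem_closure hp) _
      (g.eventually_openCap hf.continuous hp h.model.mem_nhds)
    obtain ⟨x, -, hxU, rfl⟩ := hy (subset_closure hyo)
    have h5 := h.inner_le (h.model.body.frontier_subset (h.model.maps x hxU))
    have h6 : c < ⟪m, f x⟫ := hyo.2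
    rw [← hmn] at h5
    linarith
  refine ⟨⟨w, h1, hνw, hlim⟩, Real.arccos a, ⟨Real.arccos_pos.2 ha1, Real.arccos_le_pi a⟩, ?_⟩
  rw [rotatedNormal, Real.cos_arccos (by nlinarith) ha1.le, Real.sin_arccos,
    show 1 - a ^ 2 = b ^ 2 by linarith, Real.sqrt_sq hb0]
  exact hm

/-- The body of a cap through `p` has points above each rotated plane. -/
theorem exists_cap_above {θ : ℝ} (hθ : θ ∈ Ioo 0 Real.pi) {O : Set R3} (hO : O ∈ 𝓝 (f p)) :
    ∃ y ∈ openCap K m c, y ∈ O ∧ ⟪rotatedNormal ν n θ, f p⟫ < ⟪rotatedNormal ν n θ, y⟫ := by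
  obtain ⟨⟨w, h1, h2, h3⟩, -⟩ := h.exists_direction hf g hp
  have hs := Real.sin_pos_of_mem_Ioo hθ
  have hw : ⟪rotatedNormal ν n θ, w⟫ = sin θ * ⟪ν, w⟫ := by
    rw [inner_rotatedNormal, h1, mul_zero, zero_add]
  have hpos := mul_pos hs h2
  obtain ⟨y, hyo, hyO, t, ht, hyt⟩ := h3 (sin θ * ⟪ν, w⟫ / 2) (by positivity) O hO
  refine ⟨y, hyo, hyO, ?_⟩
  have h4 := (abs_le.1 ((abs_real_inner_le_norm (rotatedNormal ν n θ) (y - f p - t • w)).trans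
    (le_of_eq_of_le (by rw [h.norm_rotatedNormal, one_mul]) hyt))).1
  rw [inner_sub_right, inner_sub_right, inner_smul_right, hw] at h4
  have h5 := mul_pos ht hpos
  linarith

/-- If the supporting plane at `p` also supports the body of a cap through `p`, and contains a point
of the open cap, then the surface lies below this plane near each point of the cap in the plane. -/
theorem eventually_le_of_face (hside : (∀ y ∈ K, ⟪n, y⟫ ≤ ⟪n, f p⟫) ∨ ∀ y ∈ K, ⟪n, f p⟫ ≤ ⟪n, y⟫)
    {y₀ : R3} (hy₀ : y₀ ∈ K) (hy₀n : ⟪n, y₀⟫ = ⟪n, f p⟫) (hy₀m : c < ⟪m, y₀⟫) {q : M} (hq : q ∈ C)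
    (hqn : ⟪n, f q⟫ = ⟪n, f p⟫) :
    ∀ᶠ x in 𝓝 q, ⟪n, f x⟫ ≤ ⟪n, f p⟫ := by
  have hK := g.capBody.body
  have hfr : ∀ y ∈ K, ⟪n, y⟫ = ⟪n, f p⟫ → y ∈ frontier K := by
    intro y hy hyn
    rcases hside with hs | hs
    · exact mem_frontier_of_inner_eq h.n_ne_zero hs hy hyn
    · exact mem_frontier_of_inner_eq (neg_ne_zero.2 h.n_ne_zero) (c := -⟪n, f p⟫)
        (by simpa using hs) hy
        (by simp [hyn])
  -- the segments from points of the cap to `y₀`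
  have hseg : ∀ z ∈ C, ⟪n, f z⟫ = ⟪n, f p⟫ → ∀ t ∈ Ioc (0 : ℝ) 1,
      f z + t • (y₀ - f z) ∈ openCap K m c ∧ ⟪n, f z + t • (y₀ - f z)⟫ = ⟪n, f p⟫ := by
    intro z hz hzn t ht
    have e : ⟪n, f z + t • (y₀ - f z)⟫ = ⟪n, f p⟫ := by
      rw [inner_add_smul, inner_sub_right, hzn, hy₀n, sub_self, mul_zero, add_zero]
    refine ⟨⟨hfr _ (hK.convex.add_smul_sub_mem (g.mem_body hz) hy₀ ⟨ht.1.le, ht.2⟩) e, ?_⟩, e⟩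
    show c < ⟪m, _⟫
    rw [inner_add_smul, inner_sub_right]
    have h1 := g.le_inner hz
    have h2 := mul_pos ht.1 (sub_pos.2 hy₀m)
    have h3 := mul_le_mul_of_nonneg_left h1 (sub_nonneg.2 ht.2)
    linarith
  have hnice : NiceAt f n ⟪n, f p⟫ p := by
    by_contra hnice
    obtain ⟨-, -, hX⟩ := (h.model.niceAt_or hf.continuous hf.nonflat h.norm_n (fun _ => h.inner_le)
      rfl
      h.param h.param_zero (hf.no_inflections φ h.param 0)).resolve_left hnice
    obtain ⟨t, ht, ht0, ht1⟩ := (eventually_lineMap (y₀ - f p)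
      (g.eventually_openCap hf.continuous hp hX)).exists
    obtain ⟨ho, he⟩ := hseg p hp rfl t ⟨ht0, ht1.le⟩
    obtain ⟨x, hxC, hx, hxt⟩ := ht (subset_closure ho)
    rw [← hxt] at ho he
    exact (g.mem_nhds_and_notMem_bdry hf hxC ho.2).2 (hx he)
  obtain ⟨W, hpW, hW, -, -, -, -, N, hN, hWN, hNW⟩ := hf.exists_flat_face
    h.norm_n h.mem_bdry rfl hnice h.eventually_le
  have hsegment : ∀ z ∈ C, ⟪n, f z⟫ = ⟪n, f p⟫ → ∀ y ∈ segment ℝ (f z) y₀,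
      y ∈ f '' C ∧ ⟪n, y⟫ = ⟪n, f p⟫ := by
    intro z hz hzn y hy
    rw [segment_eq_image'] at hy
    obtain ⟨t, ht, rfl⟩ := hy
    rcases eq_or_lt_of_le ht.1 with h0 | h0
    · simp only [← h0, zero_smul, add_zero]
      exact ⟨⟨z, hz, rfl⟩, hzn⟩
    · obtain ⟨h1, h2⟩ := hseg z hz hzn t ⟨h0, ht.2⟩
      exact ⟨by rw [g.image_eq]; exact subset_closure h1, h2⟩
  set A : Set M := C ∩ f ⁻¹' (segment ℝ (f p) y₀ ∪ segment ℝ (f q) y₀) with hA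
  have hApre : IsPreconnected A := by
    refine g.isCompact.isPreconnected_of_image hf.continuous.continuousOn g.injOn inter_subset_left
      ?_
    rw [hA, image_inter_preimage, inter_eq_right.2 (by
      rintro y (hy | hy)
      · exact (hsegment p hp rfl y hy).1
      · exact (hsegment q hq hqn y hy).1)]
    exact (convex_segment _ _).isPreconnected.union y₀ (right_mem_segment ℝ _ _)
      (right_mem_segment ℝ _ _) (convex_segment _ _).isPreconnected
  have hAn : ∀ x ∈ A, ⟪n, f x⟫ = ⟪n, f p⟫ := by
    rintro x ⟨-, hx | hx⟩
    · exact (hsegment p hp rfl _ hx).2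
    · exact (hsegment q hq hqn _ hx).2
  have hAW : A ⊆ W := hApre.subset_of_relatively_clopen (fun x _ hxW => by
      filter_upwards [hN.mem_nhds (hWN hxW)] with y hy hyA using (hNW y hy).2 (hAn y hyA))
    (fun x _ hx => by rwa [hW.isClosed.closure_eq] at hx)
    ⟨p, ⟨hp, Or.inl (left_mem_segment ℝ _ _)⟩, hpW⟩
  filter_upwards [hN.mem_nhds (hWN (hAW ⟨hq, Or.inr (left_mem_segment ℝ _ _)⟩))] with x hx
    using (hNW x hx).1

/-- The supporting plane at `p` supports the body of each nondegenerate cap through `p`. -/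
theorem cap_le : ∀ y ∈ K, ⟪n, y⟫ ≤ ⟪n, f p⟫ := by
  have hK := g.capBody.body
  have hpc := h.inner_eq_of_mem_cap hf g hp
  have hpK := g.mem_body hp
  have hrim := g.capBody_of_rim hf hp hpc h.model
  rcases g.agree_or_flat hf.continuous hp h.model hrim with hagr | ⟨m', hm', hfl⟩
  · by_contra! hcon
    obtain ⟨y, hy, hyn⟩ := hcon
    obtain ⟨k, hk, hkn⟩ := hK.exists_interior_mem (isOpen_inner_gt n _) hy hyn
    have hkn' : ⟪n, f p⟫ < ⟪n, k⟫ := hkn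
    have hkc : c < ⟪m, k⟫ := by
      have := inner_lt_of_mem_interior (neg_ne_zero.2 g.capBody.normal_ne_zero) (c := -c)
        (fun y hy => by rw [inner_neg_left]; exact neg_le_neg (g.capBody.subset hy)) hk
      simpa using this
    obtain ⟨t, ht, ht0, ht1⟩ := (eventually_lineMap (k - f p) hagr).exists
    have h1 := (ht (by
      rw [inner_add_smul, inner_sub_right, hpc]
      have := mul_pos ht0 (sub_pos.2 hkc)
      linarith)).1 (hK.convex.add_smul_sub_mem hpK (interior_subset hk) ⟨ht0.le, ht1.le⟩)
    have h2 := h.inner_le h1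
    rw [inner_add_smul, inner_sub_right] at h2
    have := mul_pos ht0 (sub_pos.2 hkn')
    linarith
  · obtain ⟨hside, y, hyo, -, hym, δ, hδ, hdisk⟩ := g.one_sided_of_flat hp hm' hfl univ_mem
    have hyc : c < ⟪m, y⟫ := hyo.2
    -- the directions to the points of the flat piece are tangent to the surface
    have hdir : ∀ z ∈ K, ⟪m', z - f p⟫ = 0 → c < ⟪m, z⟫ → ⟪n, z - f p⟫ = 0 := by
      intro z hz hzm hzc
      refine (h.limit_of_openCap hf g hp (w := z - f p) fun η hη O hO => ?_).1
      obtain ⟨t, ht, ht0, ht1⟩ := (eventually_lineMap (z - f p) hO).exists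
      refine ⟨_, ⟨?_, ?_⟩, ht, t, ht0, ?_⟩
      · have hzK := hK.convex.add_smul_sub_mem hpK hz ⟨ht0.le, ht1.le⟩
        have e : ⟪m', f p + t • (z - f p)⟫ = ⟪m', f p⟫ := by
          rw [inner_add_smul, hzm, mul_zero, add_zero]
        rcases hside with hs | hs
        · exact mem_frontier_of_inner_eq hm' (fun y hy => by
            have := hs y hy; rw [inner_sub_right] at this; linarith) hzK e
        · exact mem_frontier_of_inner_eq (neg_ne_zero.2 hm') (c := -⟪m', f p⟫) (fun y hy => by
            have := hs y hy; rw [inner_sub_right] at this; rw [inner_neg_left]; linarith) hzK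
            (by rw [inner_neg_left, e])
      · show c < ⟪m, _⟫
        rw [inner_add_smul, inner_sub_right, hpc]
        have := mul_pos ht0 (sub_pos.2 hzc)
        linarith
      · rw [add_sub_cancel_left, sub_self, norm_zero]; positivity
    have hyn := hdir y (hK.frontier_subset hyo.1) hym hyc
    obtain ⟨a, ha⟩ := eq_smul_of_orthogonal_imp (n := n) hm' (by
      intro u hu
      obtain ⟨t, ⟨ht1, ht2⟩, ht0, -⟩ := (eventually_lineMap u (inter_mem (ball_mem_nhds y hδ)
        ((isOpen_inner_gt m c).mem_nhds hyc))).exists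
      have e : ⟪m', y + t • u - f p⟫ = 0 := by
        rw [add_sub_right_comm, inner_add_right, hym, inner_smul_right, hu, mul_zero, add_zero]
      have h1 := hdir _ (hdisk _ e ht1) e ht2
      rw [add_sub_right_comm, inner_add_right, hyn, inner_smul_right, zero_add] at h1
      exact (mul_eq_zero.1 h1).resolve_left ht0.ne')
    have hside' : (∀ y ∈ K, ⟪n, y⟫ ≤ ⟪n, f p⟫) ∨ ∀ y ∈ K, ⟪n, f p⟫ ≤ ⟪n, y⟫ := by
      have e : ∀ z : R3, ⟪n, z⟫ - ⟪n, f p⟫ = a * ⟪m', z - f p⟫ := fun z => by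
        rw [← inner_sub_right, ha, real_inner_smul_left]
      rcases hside with hs | hs <;> rcases le_total 0 a with ha0 | ha0
      · left; intro z hz
        linarith [e z, mul_nonpos_of_nonneg_of_nonpos ha0 (hs z hz)]
      · right; intro z hz
        linarith [e z, mul_nonneg_of_nonpos_of_nonpos ha0 (hs z hz)]
      · right; intro z hz
        linarith [e z, mul_nonneg ha0 (hs z hz)]
      · left; intro z hz
        linarith [e z, mul_nonpos_of_nonpos_of_nonneg ha0 (hs z hz)]
    rcases hside' with hs | hs
    · exact hs
    -- otherwise, the cap would be contained in the supporting plane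
    exfalso
    rw [inner_sub_right, sub_eq_zero] at hyn
    have hsub : openCap K m c ⊆ {z | ⟪n, z⟫ = ⟪n, f p⟫} := by
      refine g.capBody.isConnected_openCap.isPreconnected.subset_of_relatively_clopen ?_
        (fun z _ hz => by
          have hcl : IsClosed {z : R3 | ⟪n, z⟫ = ⟪n, f p⟫} :=
            isClosed_eq (by fun_prop) continuous_const
          rwa [hcl.closure_eq] at hz)
        ⟨y, hyo, hyn⟩
      intro z hzo hzn
      obtain ⟨q, hq, rfl⟩ := g.exists_of_mem_openCap hzo
      have h1 := h.eventually_le_of_face hf g hp (Or.inr hs)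
        (hK.frontier_subset hyo.1) hyn hyc hq hzn
      filter_upwards [g.eventually_openCap hf.continuous hq h1] with w hw hwo
      obtain ⟨x, hxC, hx, rfl⟩ := hw (subset_closure hwo)
      exact le_antisymm hx (hs _ (g.mem_body hxC))
    have hKsub : K ⊆ plane n ⟪n, f p⟫ := by
      rw [g.capBody.eq_convexHull]
      exact convexHull_min (closure_minimal hsub
        (isClosed_eq (continuous_const.inner continuous_id) continuous_const))
        (convex_hyperplane (f := fun x => ⟪n, x⟫) (innerSL ℝ n).isLinear _)
    obtain ⟨k, hk⟩ := hK.interior_nonempty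
    exact (inner_lt_of_mem_interior h.n_ne_zero (fun y hy => (hKsub hy).le) hk).ne
      (hKsub (interior_subset hk))

end General

section Rotated

variable {θ θ' : ℝ} (g : CapModel f C K (rotatedNormal ν n θ') c) (hp : p ∈ C)
  (hθ' : θ' ≤ Real.pi) (hθ : θ ∈ Ioo 0 θ')

include g hp hθ' hθ

/-- The base of a nondegenerate cap through `p` lies below the rotated planes of smaller angles. -/
theorem base_le {y : R3} (hy : y ∈ K) (hyc : ⟪rotatedNormal ν n θ', y⟫ = c) :
    ⟪rotatedNormal ν n θ, y - f p⟫ ≤ 0 := by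
  have hpc := h.inner_eq_of_mem_cap hf g hp
  have hle := h.cap_le hf g hp
  have hs : 0 < sin θ := sin_pos_of_pos_of_lt_pi hθ.1 (hθ.2.trans_le hθ')
  rcases eq_or_lt_of_le hθ' with rfl | hlt
  · obtain ⟨r₀, hr₀⟩ := g.capBody.relInt
    obtain ⟨i, hi, hic⟩ := g.capBody.exists_interior_gt
    have hin : ⟪n, i - f p⟫ < 0 := by
      rw [inner_sub_right]; linarith [inner_lt_of_mem_interior h.n_ne_zero hle hi]
    have hnr : ∀ r : R3, ⟪rotatedNormal ν n Real.pi, r⟫ = c → ⟪n, r - f p⟫ = 0 := by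
      intro r hr
      rw [← hpc, rotatedNormal_pi, inner_neg_left, inner_neg_left, neg_inj] at hr
      rw [inner_sub_right, hr, sub_self]
    have key : ∀ r, RelInt K (rotatedNormal ν n Real.pi) c r → ⟪ν, r - f p⟫ ≤ 0 := by
      intro r hr
      obtain ⟨α, hα, hlim⟩ := g.capBody.exists_limit_direction (g.mem_body hp) hpc
        (g.capBody.not_relInt_of_mem_closure (g.mem_closure hp)) hr (interior_subset hi) hic
      obtain ⟨h1, h2, -⟩ := h.limit_of_openCap hf g hp hlim
      rw [inner_sub_right, inner_smul_right, inner_smul_right, hnr r hr.1, mul_zero, sub_zero] at h1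
      have hα1 : 1 - α = 0 := (mul_eq_zero.1 h1).resolve_right hin.ne
      rw [hα1, zero_smul, zero_sub, inner_neg_right, inner_smul_right,
        show α = 1 by linarith, one_mul] at h2
      linarith
    have hcl := mem_closure_relInt_inter_ball g.capBody.body.convex hr₀ hy hyc univ_mem
    have hyν : ⟪ν, y - f p⟫ ≤ 0 := by
      have hclosed : IsClosed {z : R3 | ⟪ν, z - f p⟫ ≤ 0} :=
        isClosed_le (by fun_prop) continuous_const
      exact closure_minimal (fun z hz => key z hz.1) hclosed hcl
    rw [inner_rotatedNormal, hnr y hyc, mul_zero, zero_add]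
    exact mul_nonpos_of_nonneg_of_nonpos hs.le hyν
  · have hs' : 0 < sin θ' := sin_pos_of_pos_of_lt_pi (hθ.1.trans hθ.2) hlt
    have hd : 0 ≤ sin (θ' - θ) :=
      Real.sin_nonneg_of_nonneg_of_le_pi (by linarith [hθ.2]) (by linarith [hθ.1])
    have h1 := sin_mul_inner_rotatedNormal ν n θ θ' (y - f p)
    have h2 : ⟪n, y - f p⟫ ≤ 0 := by rw [inner_sub_right]; linarith [hle y hy]
    rw [inner_sub_right (rotatedNormal ν n θ') y, hyc, hpc, sub_self, mul_zero, add_zero] at h1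
    have h3 := mul_nonpos_of_nonneg_of_nonpos hd h2
    rw [← h1] at h3
    exact nonpos_of_mul_nonpos_right h3 hs'

/-- The relative interior of the base lies strictly below these planes. -/
theorem relInt_lt {y : R3} (hy : RelInt K (rotatedNormal ν n θ') c y) :
    ⟪rotatedNormal ν n θ, y - f p⟫ < 0 := by
  set u : R3 := sin θ' • n - cos θ' • ν with hu
  have hun : ⟪n, u⟫ = sin θ' := by
    rw [hu, inner_sub_right, inner_smul_right, inner_smul_right, h.inner_nν,
      real_inner_self_eq_norm_sq, h.norm_n]; ring
  have huν : ⟪ν, u⟫ = -cos θ' := by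
    rw [hu, inner_sub_right, inner_smul_right, inner_smul_right, h.inner_νn,
      real_inner_self_eq_norm_sq, h.norm_ν]; ring
  have h1 : ⟪rotatedNormal ν n θ', u⟫ = 0 := by
    rw [inner_rotatedNormal, hun, huν]; ring
  have h2 : 0 < ⟪rotatedNormal ν n θ, u⟫ := by
    rw [inner_rotatedNormal, hun, huν]
    have := sin_pos_of_pos_of_lt_pi (show 0 < θ' - θ by linarith [hθ.2]) (by linarith [hθ.1])
    rw [Real.sin_sub] at this
    linarith
  obtain ⟨s, hs, hs0⟩ := (((hy.eventually_add_smul h1).filter_mono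
    (nhdsWithin_le_nhds (s := Ioi 0))).and self_mem_nhdsWithin).exists
  have hs0' : 0 < s := hs0
  have h3 := h.base_le hf g hp hθ' hθ hs.mem hs.1
  rw [add_sub_right_comm, inner_add_smul] at h3
  have := mul_pos hs0' h2
  linarith

/-- Points near a rim point which are mapped to the base of the body of the cap, and not below the
rotated plane, belong to the cap. -/
theorem eventually_mem_of_base {q : M} (hq : q ∈ C) :
    ∀ᶠ x in 𝓝 q, f x ∈ K → ⟪rotatedNormal ν n θ', f x⟫ = c →
      0 ≤ ⟪rotatedNormal ν n θ, f x - f p⟫ → x ∈ C := by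
  obtain ⟨V, _, A, hV⟩ := hf.exists_localModel q univ_mem
  filter_upwards [hV.mem_nhds, hf.continuous.continuousAt.eventually
    (g.eventually_openCap hf.continuous hq hV.mem_nhds)] with x hxV hx hxK hxc hxθ
  obtain ⟨x', hx'C, hx'V, he⟩ := hx (g.capBody.mem_closure_openCap hxK hxc fun hr =>
    absurd hxθ (not_le.2 (h.relInt_lt hf g hp hθ' hθ hr)))
  rwa [hV.injOn hxV hx'V he.symm]

/-- At a rim point on the rotated plane, where the cap lies in a plane, this plane is the supporting
plane at `p`. Hence the surface does not rise above the rotated plane beyond the cap. -/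
theorem eventually_mem_of_flat {q : M} (hq : q ∈ C) (hqc : ⟪rotatedNormal ν n θ', f q⟫ = c)
    (hqθ : ⟪rotatedNormal ν n θ, f q - f p⟫ = 0) {μ : R3} (hμ : μ ≠ 0)
    (hfl : ∀ᶠ y in 𝓝 (f q), y ∈ openCap K (rotatedNormal ν n θ') c → ⟪μ, y - f q⟫ = 0) :
    ∀ᶠ x in 𝓝 q, 0 ≤ ⟪rotatedNormal ν n θ, f x - f p⟫ → x ∈ C := by
  -- the sign of `μ` may be chosen so that the body lies in the corresponding half-space
  obtain ⟨μ, hμ, hfl, hside⟩ : ∃ μ : R3, μ ≠ 0 ∧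
      (∀ᶠ y in 𝓝 (f q), y ∈ openCap K (rotatedNormal ν n θ') c → ⟪μ, y - f q⟫ = 0) ∧
      ∀ y ∈ K, ⟪μ, y - f q⟫ ≤ 0 := by
    rcases (g.one_sided_of_flat hq hμ hfl univ_mem).1 with hs | hs
    · exact ⟨μ, hμ, hfl, hs⟩
    · exact ⟨-μ, neg_ne_zero.2 hμ, by simpa using hfl, by simpa using hs⟩
  obtain ⟨-, y₁, hy₁o, -, hy₁μ, -⟩ := g.one_sided_of_flat hq hμ hfl univ_mem
  have hK := g.capBody.body
  have hpc := h.inner_eq_of_mem_cap hf g hp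
  have hle := h.cap_le hf g hp
  have hy₁K := hK.frontier_subset hy₁o.1
  have hy₁c : c < ⟪rotatedNormal ν n θ', y₁⟫ := hy₁o.2
  set m := rotatedNormal ν n θ' with hm
  have hmq : ⟪m, f q - f p⟫ = 0 := by rw [inner_sub_right, hqc, hpc, sub_self]
  obtain ⟨hqn, hqν⟩ := inner_eq_zero_of_rotatedNormal hθ hθ' hqθ hmq
  have hs : 0 < sin θ := sin_pos_of_pos_of_lt_pi hθ.1 (hθ.2.trans_le hθ')
  have hd : 0 < sin (θ' - θ) := sin_pos_of_pos_of_lt_pi (by linarith [hθ.2]) (by linarith [hθ.1])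
  -- the rim is a segment of the tangent line near `f q`
  obtain ⟨w, hw0, hwm, hw1, hw2, hwμ⟩ : ∃ w : R3, w ≠ 0 ∧ ⟪m, w⟫ = 0 ∧ f q + w ∈ K ∧
      f q - w ∈ K ∧ ⟪μ, w⟫ = 0 := by
    set e₀ := μ - ⟪m, μ⟫ • m with he₀
    have hm1 : ⟪m, m⟫ = (1 : ℝ) := by
      rw [real_inner_self_eq_norm_sq, g.norm_eq_one, one_pow]
    have hme₀ : ⟪m, e₀⟫ = 0 := by
      rw [he₀, inner_sub_right, inner_smul_right, hm1, mul_one, sub_self]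
    have he₀0 : e₀ ≠ 0 := by
      intro h0
      rw [he₀, sub_eq_zero] at h0
      rw [h0, real_inner_smul_left, inner_sub_right, hqc] at hy₁μ
      rcases mul_eq_zero.1 hy₁μ with h1 | h1
      · rw [h1, zero_smul] at h0; exact hμ h0
      · linarith
    obtain ⟨w, h1, h2, -, h3, h4⟩ := g.exists_segment_of_thin hq hqc (e := ‖e₀‖⁻¹ • e₀)
      (norm_inv_norm_smul he₀0)
      (by rw [inner_smul_right, hme₀, mul_zero]) (by
        filter_upwards [eventually_eventually_nhds.2 hfl] with y hy hyo hyc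
        have h5 : ⟪μ, y - f q⟫ = 0 := by
          have hcl : IsClosed {z : R3 | ⟪μ, z - f q⟫ = 0} :=
            isClosed_eq (by fun_prop) continuous_const
          have : y ∈ closure {z : R3 | ⟪μ, z - f q⟫ = 0} := by
            refine mem_closure_iff_nhds.2 fun N hN => ?_
            obtain ⟨z, hz, hzo⟩ := mem_closure_iff_nhds.1 hyo _ (inter_mem hN hy)
            exact ⟨z, hz.1, hz.2 hzo⟩
          rwa [hcl.closure_eq] at this
        rw [real_inner_smul_left, he₀, inner_sub_left, h5, real_inner_smul_left,
          inner_sub_right m y, hyc,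
          hqc, sub_self, mul_zero, sub_zero, mul_zero])
    refine ⟨w, h1, h2, h3, h4, le_antisymm ?_ ?_⟩
    · have := hside _ h3; rwa [add_sub_cancel_left] at this
    · have := hside _ h4; rw [sub_sub_cancel_left, inner_neg_right] at this; linarith
  have hwθ : ⟪rotatedNormal ν n θ, w⟫ = 0 := by
    have h1 := h.base_le hf g hp hθ' hθ hw1 (by
      rw [inner_add_right, hwm, hqc, add_zero])
    have h2 := h.base_le hf g hp hθ' hθ hw2 (by
      rw [inner_sub_right, hwm, hqc, sub_zero])
    rw [add_sub_right_comm, inner_add_right, hqθ] at h1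
    rw [sub_right_comm, inner_sub_right, hqθ] at h2
    linarith
  obtain ⟨hwn, hwν⟩ := inner_eq_zero_of_rotatedNormal hθ hθ' hwθ hwm
  have hline : ∀ x : R3, ⟪n, x⟫ = 0 → ⟪ν, x⟫ = 0 → x = ⟪T, x⟫ • T := by
    intro x h1 h2
    have := h.decomp x
    rwa [h1, h2, zero_smul, zero_smul, zero_add, add_zero] at this
  have hwT : ⟪T, w⟫ ≠ 0 := fun h0 => hw0 (by rw [hline w hwn hwν, h0, zero_smul])
  have hμT : ⟪μ, T⟫ = 0 := by
    rw [hline w hwn hwν, inner_smul_right] at hwμ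
    exact (mul_eq_zero.1 hwμ).resolve_left hwT
  set A := ⟪n, μ⟫
  set B := ⟪ν, μ⟫
  have hμd : ∀ x, ⟪μ, x⟫ = A * ⟪n, x⟫ + B * ⟪ν, x⟫ := by
    intro x
    have h1 := h.decomp μ
    rw [real_inner_comm μ T, hμT, zero_smul, add_zero] at h1
    conv_lhs => rw [h1]
    rw [inner_add_left, real_inner_smul_left, real_inner_smul_left]
  have hμqp : ⟪μ, f q - f p⟫ = 0 := by rw [hμd, hqn, hqν]; ring
  have hμp : ∀ y : R3, ⟪μ, y - f q⟫ = ⟪μ, y - f p⟫ := fun y => by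
    rw [← sub_sub_sub_cancel_right y (f q) (f p), inner_sub_right, hμqp, sub_zero]
  -- the limit direction at `p` shows that `B ≤ 0`
  have hB0 : B ≤ 0 := by
    obtain ⟨⟨v, h1, h2, h3⟩, -⟩ := h.exists_direction hf g hp
    by_contra! hcon
    have hv : ⟪μ, v⟫ = B * ⟪ν, v⟫ := by rw [hμd, h1, mul_zero, zero_add]
    have hpos := mul_pos hcon h2
    have hμn := norm_pos_iff.2 hμ
    obtain ⟨y, hyo, -, t, ht, hyt⟩ := h3 (B * ⟪ν, v⟫ / 2 / ‖μ‖) (by positivity) univ univ_mem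
    have h4 := (abs_le.1 ((abs_real_inner_le_norm μ (y - f p - t • v)).trans
      (mul_le_mul_of_nonneg_left hyt hμn.le))).1
    have e : ‖μ‖ * (B * ⟪ν, v⟫ / 2 / ‖μ‖ * t) = B * ⟪ν, v⟫ / 2 * t := by
      field_simp
    rw [e, inner_sub_right, inner_smul_right, hv] at h4
    have h5 := hside y (hK.frontier_subset hyo.1)
    rw [hμp] at h5
    have h6 := mul_pos ht hpos
    linarith
  -- the base of the cap and the flat piece show that `B = 0`
  have hy₁n : ⟪n, y₁ - f p⟫ ≤ 0 := by rw [inner_sub_right]; linarith [hle y₁ hy₁K]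
  have hy₁m : 0 < ⟪m, y₁ - f p⟫ := by rw [inner_sub_right, hpc]; linarith
  rw [hμp, hμd] at hy₁μ
  have hBz : B = 0 := by
    obtain ⟨r, hr⟩ := g.capBody.relInt
    have h1 := h.relInt_lt hf g hp hθ' hθ hr
    have h2 : ⟪m, r - f p⟫ = 0 := by rw [inner_sub_right, hr.1, hpc, sub_self]
    have h3 := hside r hr.mem
    rw [hμp, hμd] at h3
    rw [hm, inner_rotatedNormal] at h2 hy₁m
    rw [inner_rotatedNormal] at h1
    generalize ⟪n, r - f p⟫ = ξ at *
    generalize ⟪ν, r - f p⟫ = η at *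
    generalize ⟪n, y₁ - f p⟫ = x at *
    generalize ⟪ν, y₁ - f p⟫ = y at *
    have hsc := Real.sin_sq_add_cos_sq θ'
    have hξ : ξ = (ξ * sin θ' - η * cos θ') * sin θ' := by
      linear_combination (-ξ) * hsc + cos θ' * h2
    have hη : η = -((ξ * sin θ' - η * cos θ') * cos θ') := by
      linear_combination (-η) * hsc + sin θ' * h2
    set κ := ξ * sin θ' - η * cos θ'
    clear_value κ
    rw [Real.sin_sub] at hd
    have h4 : κ * (sin θ' * cos θ - cos θ' * sin θ) < 0 := by
      rw [hξ, hη] at h1; linarith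
    have hκ0 : κ < 0 := by
      by_contra! hcon
      linarith [mul_nonneg hcon hd.le]
    have h5 : κ * (A * sin θ' - B * cos θ') ≤ 0 := by
      rw [hξ, hη] at h3; linarith
    have h6 : 0 ≤ A * sin θ' - B * cos θ' := by
      by_contra! hcon
      linarith [mul_pos_of_neg_of_neg hκ0 hcon]
    have h7 := mul_nonpos_of_nonpos_of_nonneg hy₁n h6
    have h8 : x * (A * sin θ' - B * cos θ') = -B * (cos θ' * x + sin θ' * y) := by
      linear_combination sin θ' * hy₁μ
    rw [h8] at h7
    refine le_antisymm hB0 ?_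
    by_contra! hcon
    linarith [mul_pos (neg_pos.2 hcon) hy₁m]
  have hA0 : A ≠ 0 := by
    intro h0
    have := hμd μ
    rw [h0, hBz, real_inner_self_eq_norm_sq] at this
    have h1 := norm_pos_iff.2 hμ
    have h2 : 0 < ‖μ‖ ^ 2 := by positivity
    linarith
  have hy₁n' : ⟪n, y₁ - f p⟫ = 0 := by
    rw [hBz, zero_mul, add_zero] at hy₁μ
    exact (mul_eq_zero.1 hy₁μ).resolve_left hA0
  have hπ : θ' < Real.pi := by
    refine lt_of_le_of_ne hθ' fun h0 => ?_
    rw [hm, h0, rotatedNormal_pi, inner_neg_left, hy₁n', neg_zero] at hy₁m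
    exact lt_irrefl _ hy₁m
  have hs' : 0 < sin θ' := sin_pos_of_pos_of_lt_pi (hθ.1.trans hθ.2) hπ
  have hlen := h.eventually_le_of_face hf g hp (Or.inl hle) hy₁K
    (by rw [inner_sub_right, sub_eq_zero] at hy₁n'; exact hy₁n') hy₁c hq
    (by rw [inner_sub_right, sub_eq_zero] at hqn; exact hqn)
  have hnear : ∀ᶠ x in 𝓝 q, |⟪T, f x - f q⟫ / ⟪T, w⟫| < 1 := by
    have : Continuous fun x => |⟪T, f x - f q⟫ / ⟪T, w⟫| := by
      have := hf.continuous
      fun_prop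
    have := this.tendsto q
    simp only [sub_self, inner_zero_right, zero_div, abs_zero] at this
    exact this.eventually (gt_mem_nhds one_pos)
  filter_upwards [hlen, hnear, g.eventually_mem_of_rim hf hq hqc,
    h.eventually_mem_of_base hf g hp hθ' hθ hq] with x hxn hxT hx1 hx2 hxθ
  rcases lt_or_ge c ⟪m, f x⟫ with hlt | hge
  · exact hx1 hlt
  have hxn' : ⟪n, f x - f p⟫ ≤ 0 := by rw [inner_sub_right]; linarith
  have hxm' : ⟪m, f x - f p⟫ ≤ 0 := by rw [inner_sub_right, hpc]; linarith
  have e := sin_mul_inner_rotatedNormal ν n θ θ' (f x - f p)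
  rw [← hm] at e
  have h1 := mul_nonpos_of_nonneg_of_nonpos hd.le hxn'
  have h2 := mul_nonpos_of_nonneg_of_nonpos hs.le hxm'
  have h3 := mul_nonneg hs'.le hxθ
  have hxm0 : ⟪m, f x - f p⟫ = 0 :=
    (mul_eq_zero.1 (show sin θ * ⟪m, f x - f p⟫ = 0 by linarith)).resolve_left hs.ne'
  have hxθ0 : ⟪rotatedNormal ν n θ, f x - f p⟫ = 0 :=
    (mul_eq_zero.1 (show sin θ' * ⟪rotatedNormal ν n θ, f x - f p⟫ = 0 by
      linarith)).resolve_left hs'.ne'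
  obtain ⟨h4, h5⟩ := inner_eq_zero_of_rotatedNormal hθ hθ' hxθ0 hxm0
  refine hx2 ?_ (by rw [inner_sub_right, hpc] at hxm0; linarith) hxθ
  -- `f x` lies in the segment between `f q - w` and `f q + w`
  set σ := ⟪T, f x - f q⟫ / ⟪T, w⟫ with hσ
  have hfx : f x = f q + σ • w := by
    have e1 : f x - f q = (f x - f p) - (f q - f p) := by abel
    have h6 := hline (f x - f q) (by rw [e1, inner_sub_right, h4, hqn, sub_zero])
      (by rw [e1, inner_sub_right, h5, hqν, sub_zero])
    rw [hline w hwn hwν, smul_smul, hσ, div_mul_cancel₀ _ hwT, ← h6]; abel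
  obtain ⟨h7, h8⟩ := abs_lt.1 hxT
  have h9 := hK.convex hw1 hw2 (a := (1 + σ) / 2) (b := (1 - σ) / 2) (by linarith) (by linarith)
    (by ring)
  rw [hfx]
  convert h9 using 1
  module

/-- Beyond a cap through `p`, the surface does not rise above the rotated planes of smaller angles.
-/
theorem eventually_mem_of_le {q : M} (hq : q ∈ C) (hqθ : 0 ≤ ⟪rotatedNormal ν n θ, f q - f p⟫) :
    ∀ᶠ x in 𝓝 q, 0 ≤ ⟪rotatedNormal ν n θ, f x - f p⟫ → x ∈ C := by
  have hK := g.capBody.body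
  by_cases hqc : ⟪rotatedNormal ν n θ', f q⟫ = c
  swap
  · filter_upwards [(g.mem_nhds_and_notMem_bdry hf hq
      ((g.le_inner hq).lt_of_ne' hqc)).1] with x hx _ using hx
  have hqK := g.mem_body hq
  have hqθ0 := le_antisymm (h.base_le hf g hp hθ' hθ hqK hqc) hqθ
  obtain ⟨V, _, A, hV⟩ := hf.exists_localModel q univ_mem
  rcases g.agree_or_flat hf.continuous hq hV (g.capBody_of_rim hf hq hqc hV) with
    hagr | ⟨μ, hμ, hfl⟩
  swap
  · exact h.eventually_mem_of_flat hf g hp hθ' hθ hq hqc hqθ0 hμ hfl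
  set m := rotatedNormal ν n θ'
  set k := rotatedNormal ν n θ with hk
  obtain ⟨ε, hε, hagr⟩ := Metric.eventually_nhds_iff_ball.1 hagr
  obtain ⟨y₀, hy₀o, -, hy₀k⟩ := h.exists_cap_above hf g hp
    (θ := θ) ⟨hθ.1, hθ.2.trans_le hθ'⟩ univ_mem
  have hy₀c : c < ⟪m, y₀⟫ := hy₀o.2
  obtain ⟨t, ht, ht0, ht1⟩ := (eventually_lineMap (y₀ - f q) (ball_mem_nhds (f q) hε)).exists
  -- a point of both bodies, above both planes
  set y := f q + t • (y₀ - f q) with hy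
  have hym : c < ⟪m, y⟫ := by
    rw [hy, inner_add_smul, inner_sub_right, hqc]
    have := mul_pos ht0 (sub_pos.2 hy₀c)
    linarith
  have hyk : 0 < ⟪k, y - f p⟫ := by
    have e : y - f p = (f q - f p) + t • ((y₀ - f p) - (f q - f p)) := by rw [hy]; module
    rw [e, inner_add_smul, inner_sub_right _ (y₀ - f p), hqθ0,
      inner_sub_right k y₀]
    have := mul_pos ht0 (sub_pos.2 hy₀k)
    linarith
  have hyA : y ∈ A := (hagr y ht hym).1 (hK.convex.add_smul_sub_mem hqK
    (hK.frontier_subset hy₀o.1) ⟨ht0.le, ht1.le⟩)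
  filter_upwards [hV.mem_nhds, hf.continuous.continuousAt.preimage_mem_nhds
    (ball_mem_nhds (f q) hε), g.eventually_mem_of_rim hf hq hqc,
    h.eventually_mem_of_base hf g hp hθ' hθ hq] with x hxV hxε hx1 hx2 hxk
  rcases lt_or_ge c ⟪m, f x⟫ with hlt | hge
  · exact hx1 hlt
  have hxA : f x ∈ A := hV.body.frontier_subset (hV.maps x hxV)
  -- the intersection of the segment from `f x` to `y` with the plane of the cap
  have hden : 0 < ⟪m, y⟫ - ⟪m, f x⟫ := by linarith
  set τ := (c - ⟪m, f x⟫) / (⟪m, y⟫ - ⟪m, f x⟫) with hτ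
  have hτ0 : 0 ≤ τ := div_nonneg (by linarith) hden.le
  have hτ1 : τ < 1 := (div_lt_one hden).2 (by linarith)
  set b := f x + τ • (y - f x) with hb
  have hbm : ⟪m, b⟫ = c := by
    rw [hb, inner_add_smul, inner_sub_right, hτ, div_mul_cancel₀ _ hden.ne']
    ring
  have hbK : b ∈ K := by
    refine hK.isClosed.mem_of_tendsto (tendsto_lineMap_zero b (y - f x)) ?_
    filter_upwards [Ioo_mem_nhdsGT (show (0 : ℝ) < 1 - τ by linarith)] with s hs
    have e : b + s • (y - f x) = f x + (τ + s) • (y - f x) := by rw [hb]; module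
    have hτs : τ + s ∈ Icc (0 : ℝ) 1 := ⟨by linarith [hs.1], by linarith [hs.2]⟩
    refine (hagr _ ?_ ?_).2 ?_
    · rw [e]
      exact (convex_ball _ _).add_smul_sub_mem hxε ht hτs
    · rw [inner_add_right, hbm, inner_smul_right, inner_sub_right]
      have := mul_pos hs.1 hden
      linarith
    · rw [e]
      exact hV.body.convex.add_smul_sub_mem hxA hyA hτs
  have hbk := h.base_le hf g hp hθ' hθ hbK hbm
  have e : b - f p = (f x - f p) + τ • ((y - f p) - (f x - f p)) := by rw [hb]; module
  have hτz : τ = 0 := by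
    rw [← hk, e, inner_add_smul, inner_sub_right _ (y - f p)] at hbk
    have h1 := mul_nonneg (sub_nonneg.2 hτ1.le) hxk
    have h2 : τ * ⟪k, y - f p⟫ ≤ 0 := by linarith
    by_contra hne
    linarith [mul_pos (hτ0.lt_of_ne' hne) hyk]
  have hbx : b = f x := by rw [hb, hτz, zero_smul, add_zero]
  exact hx2 (hbx ▸ hbK) (hbx ▸ hbm) hxk

/-- A nondegenerate cap through `p` contains the caps which are cut off by the rotated planes of
smaller angles. -/
theorem capModel_capAt : capAt f p ν n θ =
      C ∩ f ⁻¹' halfSpace (rotatedNormal ν n θ) ⟪rotatedNormal ν n θ, f p⟫ ∧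
    CapModel f (capAt f p ν n θ) (K ∩ halfSpace (rotatedNormal ν n θ) ⟪rotatedNormal ν n θ, f p⟫)
      (rotatedNormal ν n θ) ⟪rotatedNormal ν n θ, f p⟫ := by
  have hK := g.capBody.body
  set k := rotatedNormal ν n θ with hk
  set d := ⟪k, f p⟫ with hd
  have hkd : ∀ y : R3, ⟪k, y - f p⟫ = ⟪k, y⟫ - d := fun y => by
    rw [hd, inner_sub_right]
  obtain ⟨r, hr⟩ := g.capBody.relInt
  have hrd : ⟪k, r⟫ < d := by
    have := h.relInt_lt hf g hp hθ' hθ hr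
    rw [← hk, hkd] at this
    linarith
  obtain ⟨y₀, hy₀o, -, hy₀⟩ := h.exists_cap_above hf g hp (θ := θ)
    ⟨hθ.1, hθ.2.trans_le hθ'⟩ univ_mem
  have hy₀K := hK.frontier_subset hy₀o.1
  have hcap : CapBody (K ∩ halfSpace k d) k d := capBody_inter hK hr.mem hrd hy₀K hy₀
  have hopen : openCap (K ∩ halfSpace k d) k d = openCap K k d := openCap_inter_halfSpace K k d
  have hsub : openCap K k d ⊆ openCap K (rotatedNormal ν n θ') c := by
    rintro y ⟨hy, hyd⟩
    have hyd' : d < ⟪k, y⟫ := hyd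
    refine ⟨hy, show c < ⟪_, y⟫ from
      lt_of_le_of_ne (g.capBody.subset (hK.frontier_subset hy)) fun he => ?_⟩
    have := h.base_le hf g hp hθ' hθ (hK.frontier_subset hy) he.symm
    rw [← hk, hkd] at this
    linarith
  set C' := C ∩ f ⁻¹' halfSpace k d with hC'
  have hfC : f '' C' = closure (openCap K k d) := by
    rw [hC', image_inter_preimage, g.image_eq]
    refine Subset.antisymm ?_ fun y hy =>
      ⟨closure_mono hsub hy, CapBody.closure_openCap_subset_halfSpace K k d hy⟩
    rintro y ⟨hy, hyd⟩
    have hyK := CapBody.closure_openCap_subset_frontier _ _ _ hy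
    rcases eq_or_lt_of_le (show d ≤ ⟪k, y⟫ from hyd) with he | hlt
    · rw [← hopen]
      exact hcap.mem_closure_openCap ⟨hK.frontier_subset hyK, hyd⟩ he.symm fun hr' =>
        hyK.2 ((hr'.mono fun y hy _ => hy.1).mem_interior hK hr.mem hrd hy₀K hy₀)
    · exact subset_closure ⟨hyK, hlt⟩
  have hC'c : IsCompact C' :=
    g.isCompact.inter_right ((isClosed_halfSpace k d).preimage hf.continuous)
  have hmodel : CapModel f C' (K ∩ halfSpace k d) k d :=
    ⟨hcap, h.norm_rotatedNormal θ, hC'c, g.injOn.mono inter_subset_left, by rw [hopen]; exact hfC⟩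
  have hcapAt : capAt f p ν n θ = C' := by
    refine connectedComponentIn_eq_of_isolated (N := interior {x | d ≤ ⟪k, f x⟫ → x ∈ C})
      ⟨hp, show d ≤ ⟪k, f p⟫ from le_rfl⟩ (fun x hx => hx.2) hC'c.isClosed
      (hmodel.isCapWith hf.continuous).isConnected.isPreconnected isOpen_interior ?_ ?_
    · intro q hq
      have hq2 : d ≤ ⟪k, f q⟫ := hq.2
      rw [mem_interior_iff_mem_nhds]
      filter_upwards [h.eventually_mem_of_le hf g hp hθ' hθ hq.1
        (by rw [← hk, hkd]; linarith)] with x hx hxd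
      exact hx (by rw [← hk, hkd]; linarith)
    · exact fun x hx hxd => ⟨(interior_subset hx : x ∈ {x | d ≤ ⟪k, f x⟫ → x ∈ C}) hxd, hxd⟩
  rw [hcapAt]
  exact ⟨rfl, hmodel⟩

theorem mem_capAngles_of_cap : θ ∈ capAngles f p ν n := ⟨⟨hθ.1.le, hθ.2.le.trans hθ'⟩,
    (h.capModel_capAt hf g hp hθ' hθ).2.isCapWith hf.continuous⟩

end Rotated

end BoundaryFrame

/-! ### Limits of caps -/

theorem IsConvexBody.capBody_inter_of_interior {K : Set R3} (hK : IsConvexBody K) {m o : R3} {c : ℝ}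
    (hm : m ≠ 0) (ho : o ∈ interior K) (hoc : ⟪m, o⟫ = c) :
    CapBody (K ∩ halfSpace m c) m c := by
  have hm2 : 0 < ‖m‖ ^ 2 := pow_pos (norm_pos_iff.2 hm) 2
  have key : ∀ σ : ℝ, ∃ t : ℝ, 0 < t ∧ o + t • (σ • m) ∈ K := fun σ => by
    obtain ⟨t, ht, ht0, -⟩ := (eventually_lineMap (σ • m) (mem_interior_iff_mem_nhds.1 ho)).exists
    exact ⟨t, ht0, ht⟩
  obtain ⟨t, ht, h1⟩ := key 1
  obtain ⟨s, hs, h2⟩ := key (-1)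
  refine capBody_inter hK h2 ?_ h1 ?_ <;>
    simp only [inner_add_right, inner_smul_right, real_inner_self_eq_norm_sq, hoc] <;> nlinarith

theorem IsConvexBody.mem_closure_openCap {K : Set R3} (hK : IsConvexBody K) {m o b : R3} {c : ℝ}
    (hm : m ≠ 0) (ho : o ∈ interior K) (hoc : ⟪m, o⟫ = c) (hb : b ∈ frontier K) (hbc : ⟪m, b⟫ = c)
    : b ∈ closure (openCap K m c) := by
  have hK₁ := hK.capBody_inter_of_interior hm ho hoc
  have hK₂ := hK.capBody_inter_of_interior (neg_ne_zero.2 hm) ho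
    (show ⟪-m, o⟫ = -c by rw [inner_neg_left, hoc])
  rw [← openCap_inter_halfSpace]
  refine hK₁.mem_closure_openCap ⟨hK.frontier_subset hb, hbc.ge⟩ hbc fun hr => hb.2 ?_
  obtain ⟨k, hk, hkc⟩ := hK₁.exists_interior_gt
  obtain ⟨k', hk', hkc'⟩ := hK₂.exists_interior_gt
  rw [inner_neg_left, neg_lt_neg_iff] at hkc'
  exact (hr.mono fun y hy _ => hy.1).mem_interior hK (interior_subset hk').1 hkc'
    (interior_subset hk).1 hkc

/-- The compact set `C` is mapped into the boundary of the convex body `K`, bijectively away from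
the closed set `B`, which has to be approached from outside: the structure of a limit of an
increasing family of nondegenerate caps, where `B` is the limit of the bases of the caps. -/
structure CoversOff {M : Type*} [TopologicalSpace M] (f : M → R3) (C : Set M) (K B : Set R3) :
    Prop where
  isCompact : IsCompact C
  body : IsConvexBody K
  isClosed : IsClosed B
  maps : ∀ x ∈ C, f x ∈ frontier K
  inj : ∀ x ∈ C, ∀ x' ∈ C, f x ∉ B → f x = f x' → x = x'
  surj : ∀ y ∈ frontier K, y ∉ B → ∃ x ∈ C, f x = y
  dense : C ⊆ closure {x ∈ C | f x ∉ B}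

namespace CoversOff

variable {M : Type*} [TopologicalSpace M] {f : M → R3} {C : Set M} {K B : Set R3}
  {q : M} {U : Set M} {L : Set R3} (h : CoversOff f C K B)

include h

theorem eventually_image (hf : Continuous f) {x : M} (hx : x ∈ C) (hxB : f x ∉ B) {N : Set M}
    (hN : N ∈ 𝓝 x) :
    ∀ᶠ y in 𝓝 (f x), y ∈ frontier K → ∃ x' ∈ N, x' ∈ C ∧ f x' = y := by
  obtain ⟨δ, hδ, hb⟩ := Metric.nhds_basis_closedBall.mem_iff.1
    (h.isClosed.isOpen_compl.mem_nhds hxB)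
  obtain ⟨ε, hε, hs⟩ := (h.isCompact.inter_right
    (isClosed_closedBall.preimage hf)).exists_dist_lt_imp_mem (q := x) hf.continuousOn
    (fun x₁ h₁ x₂ h₂ he => h.inj x₁ h₁.1 x₂ h₂.1 (hb h₁.2) he)
    ⟨hx, mem_closedBall_self hδ.le⟩ hN
  filter_upwards [ball_mem_nhds _ hε, closedBall_mem_nhds _ hδ] with y hy hyδ hyK
  obtain ⟨x', hx', rfl⟩ := h.surj y hyK (hb hyδ)
  exact ⟨x', hs x' ⟨hx', hyδ⟩ hy, hx', rfl⟩

/-- Over a small connected part of `frontier K \ B`, a local model covers everything or nothing. -/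
theorem subset_image [T2Space M] (hf : Continuous f) (hU : LocalModel f q U L) :
    ∃ ε > 0, ∀ S : Set R3, IsPreconnected S →
      (∀ y ∈ S, y ∈ frontier K ∧ y ∉ B ∧ dist y (f q) < ε) → (∃ x ∈ U, x ∈ C ∧ f x ∈ S) →
      S ⊆ f '' (U ∩ C) := by
  obtain ⟨ε, hε, hs⟩ := hU.sep hf (interior_mem_nhds.2 hU.mem_nhds)
  refine ⟨ε, hε, fun S hS hSK ⟨x, hxU, hxC, hxS⟩ =>
    hS.subset_of_relatively_clopen ?_ ?_ ⟨f x, hxS, x, ⟨hxU, hxC⟩, rfl⟩⟩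
  · rintro _ hy ⟨x, ⟨hxU, hxC⟩, rfl⟩
    obtain ⟨-, hyB, hyd⟩ := hSK _ hy
    filter_upwards [h.eventually_image hf hxC hyB (mem_interior_iff_mem_nhds.1 (hs x hxU hyd))]
      with y hy hyS
    obtain ⟨x', h1, h2, h3⟩ := hy (hSK y hyS).1
    exact ⟨x', ⟨h1, h2⟩, h3⟩
  · intro y _ hy
    have hcl : IsClosed (f '' (U ∩ C)) := ((hU.isCompact.inter h.isCompact).image hf).isClosed
    rwa [hcl.closure_eq] at hy

theorem exists_near (hf : Continuous f) (hq : q ∈ C) (hU : U ∈ 𝓝 q) {δ : ℝ} (hδ : 0 < δ)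
    : ∃ x ∈ U, x ∈ C ∧ f x ∉ B ∧ dist (f x) (f q) < δ := by
  obtain ⟨x, ⟨hxU, hxd⟩, hxC, hxB⟩ := mem_closure_iff_nhds.1 (h.dense hq) _
    (inter_mem hU (hf.continuousAt.preimage_mem_nhds (ball_mem_nhds (f q) hδ)))
  exact ⟨x, hxU, hxC, hxB, hxd⟩

/-- If the exceptional set is the base of a cap body, then no points are identified. -/
theorem capModel [ChartedSpace (EuclideanHalfSpace 2) M] [T2Space M] [CompactSpace M]
    (hf : IsRegularImmersion f) {n : R3} {c : ℝ} (hK : CapBody K n c) (hn : ‖n‖ = 1)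
    (hB : ∀ y ∈ K, y ∈ B ↔ ⟪n, y⟫ = c) : CapModel f C K n c := by
  have ho : ∀ y, y ∈ openCap K n c ↔ y ∈ frontier K ∧ y ∉ B := fun y => and_congr_right fun hy => by
      have hyK := h.body.frontier_subset hy
      rw [hB y hyK]
      exact ⟨fun h1 => ne_of_gt h1, fun h1 => (hK.subset hyK).lt_of_ne' h1⟩
  have himg : f '' C = closure (openCap K n c) := by
    refine Subset.antisymm ?_ (closure_minimal (fun y hy => h.surj y ((ho y).1 hy).1
      ((ho y).1 hy).2)
      (h.isCompact.image hf.continuous).isClosed)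
    refine (image_mono h.dense).trans ((image_closure_subset_closure_image hf.continuous).trans
      (closure_mono ?_))
    rintro _ ⟨x, ⟨hx, hxB⟩, rfl⟩
    exact (ho _).2 ⟨h.maps x hx, hxB⟩
  refine ⟨hK, hn, h.isCompact, fun x hx x' hx' he => ?_, himg⟩
  by_contra hne
  obtain ⟨u, v, hu, hv, huv⟩ := t2_separation_nhds hne
  obtain ⟨U, hUu, L, hU⟩ := hf.exists_localModel x hu
  obtain ⟨U', hUv, L', hU'⟩ := hf.exists_localModel x' hv
  obtain ⟨ε, hε, h1⟩ := h.subset_image hf.continuous hU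
  obtain ⟨ε', hε', h1'⟩ := h.subset_image hf.continuous hU'
  obtain ⟨V, hV, hVc, δ, hδ, hVδ⟩ := hK.locally_connected (himg ▸ mem_image_of_mem f hx)
    (lt_min hε hε')
  obtain ⟨x₁, hx₁U, hx₁C, hx₁B, hx₁⟩ := h.exists_near hf.continuous hx hU.mem_nhds hδ
  obtain ⟨x₂, hx₂U, hx₂C, hx₂B, hx₂⟩ := h.exists_near hf.continuous hx' hU'.mem_nhds hδ
  rw [← he] at hx₂ h1'
  have hin : ∀ z ∈ C, f z ∉ B → dist (f z) (f x) < δ → f z ∈ V := fun z hz hzB hzd =>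
    hVδ ⟨(ho _).2 ⟨h.maps z hz, hzB⟩, hzd⟩
  obtain ⟨z, ⟨hzU, hzC⟩, hze⟩ := h1' V hVc (fun y hy => ⟨((ho y).1 (hV hy).1).1,
    ((ho y).1 (hV hy).1).2, lt_of_lt_of_le (hV hy).2 (min_le_right _ _)⟩)
    ⟨x₂, hx₂U, hx₂C, hin x₂ hx₂C hx₂B hx₂⟩ (hin x₁ hx₁C hx₁B hx₁)
  rw [h.inj x₁ hx₁C z hzC hx₁B hze.symm] at hx₁U
  exact disjoint_left.1 huv (hUu hx₁U) (hUv hzU)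

section Section

variable {m o : R3} {c : ℝ}

/-- A local model which covers points of one side of a plane section through the exceptional set `B`
covers also the nearby points of `B`. -/
theorem exists_of_side [T2Space M] (hf : Continuous f) (hU : LocalModel f q U L) (hq : f q ∈ B)
    (hB : B ⊆ frontier K) (hm : m ≠ 0) (hBm : ∀ b ∈ B, ⟪m, b⟫ = c) (ho : o ∈ interior K)
    (hoc : ⟪m, o⟫ = c) :
    ∃ δ > 0, ∀ x ∈ U, x ∈ C → c < ⟪m, f x⟫ → dist (f x) (f q) < δ →
      ∀ b ∈ B, dist b (f q) < δ → b ∈ f '' (U ∩ C) := by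
  obtain ⟨ε, hε, h1⟩ := h.subset_image hf hU
  have hbcl := fun b hb => h.body.mem_closure_openCap hm ho hoc (hB hb) (hBm b hb)
  obtain ⟨V, hV, hVc, δ, hδ, hVδ⟩ := (h.body.capBody_inter_of_interior hm ho hoc).locally_connected
      ((openCap_inter_halfSpace K m c).symm ▸ hbcl _ hq) hε
  rw [openCap_inter_halfSpace] at hV hVδ
  refine ⟨δ, hδ, fun x hxU hxC hxc hxd b hb hbd => ?_⟩
  have h2 := h1 V hVc (fun y hy => ⟨(hV hy).1.1, fun hyB =>
    (ne_of_gt (show c < ⟪m, y⟫ from (hV hy).1.2)) (hBm y hyB), (hV hy).2⟩)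
    ⟨x, hxU, hxC, hVδ ⟨⟨h.maps x hxC, hxc⟩, hxd⟩⟩
  refine closure_minimal h2 ((hU.isCompact.inter h.isCompact).image hf).isClosed
    (closure_mono hVδ ?_)
  have := isOpen_ball.inter_closure ⟨(show b ∈ ball (f q) δ from hbd), hbcl b hb⟩
  rwa [inter_comm] at this

/-- If the exceptional set is convex and contained in a plane section through the interior of the
body, in particular if it is contained in a line, then the whole boundary of the body is covered. If
moreover the part of `C` over the exceptional set is connected, then no points are identified. -/
theorem injOn_of_section [ChartedSpace (EuclideanHalfSpace 2) M] [T2Space M] [CompactSpace M]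
    (hf : IsRegularImmersion f) (hB : B ⊆ frontier K) (hBc : Convex ℝ B) (hm : m ≠ 0)
    (hBm : ∀ b ∈ B, ⟪m, b⟫ = c) (ho : o ∈ interior K) (hoc : ⟪m, o⟫ = c)
    (hG : IsConnected {x ∈ C | f x ∈ B}) : InjOn f C ∧ frontier K ⊆ f '' C := by
  constructor
  swap
  · intro y hy
    by_cases hyB : y ∈ B
    swap
    · exact h.surj y hy hyB
    refine closure_minimal (fun z hz => ?_) (h.isCompact.image hf.continuous).isClosed
      (h.body.mem_closure_openCap hm ho hoc hy (hBm y hyB))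
    exact h.surj z hz.1 fun hzB => ne_of_gt (show c < ⟪m, z⟫ from hz.2) (hBm z hzB)
  set G := {x ∈ C | f x ∈ B}
  have hGc : IsCompact G := h.isCompact.inter_right (h.isClosed.preimage hf.continuous)
  have := isConnected_iff_connectedSpace.1 hG
  have := isCompact_iff_compactSpace.1 hGc
  have hinj : Function.Injective fun x : G => f x := by
    refine (injective_and_convex_range (hf.continuous.comp continuous_subtype_val) ?_).1
    rintro ⟨q, hqC, hqB⟩
    obtain ⟨U, -, L, hU⟩ := hf.exists_localModel q univ_mem
    obtain ⟨δ, hδ, h1⟩ := h.exists_of_side hf.continuous hU hqB hB hm hBm ho hoc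
    obtain ⟨δ', hδ', h2⟩ := h.exists_of_side hf.continuous hU hqB hB (neg_ne_zero.2 hm)
      (c := -c) (fun b hb => by rw [inner_neg_left, hBm b hb]) ho (by rw [inner_neg_left, hoc])
    have hd := lt_min hδ hδ'
    have key : ∀ b ∈ B, dist b (f q) < min δ δ' → b ∈ f '' (U ∩ C) := by
      intro b hb hbd
      have h3 : ∀ x ∈ U, x ∈ C → ⟪m, f x⟫ ≠ c → dist (f x) (f q) < min δ δ' → b ∈ f '' (U ∩ C) := by
        intro x hxU hxC hxc hxd
        rcases lt_or_gt_of_ne hxc with hlt | hgt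
        · exact h2 x hxU hxC (by rw [inner_neg_left]; linarith)
            (hxd.trans_le (min_le_right _ _)) b hb (hbd.trans_le (min_le_right _ _))
        · exact h1 x hxU hxC hgt (hxd.trans_le (min_le_left _ _)) b hb
            (hbd.trans_le (min_le_left _ _))
      obtain ⟨x, hxU, hxC, hxB, hxd⟩ :=
        h.exists_near hf.continuous hqC (interior_mem_nhds.2 hU.mem_nhds) hd
      by_cases hxc : ⟪m, f x⟫ = c
      swap
      · exact h3 x (interior_subset hxU) hxC hxc hxd
      obtain ⟨y, hy, hyo⟩ := mem_closure_iff_nhds.1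
        (h.body.mem_closure_openCap hm ho hoc (h.maps x hxC) hxc) _ (inter_mem
        (h.eventually_image hf.continuous hxC hxB (isOpen_interior.mem_nhds hxU))
        (isOpen_ball.mem_nhds (show f x ∈ ball (f q) _ from hxd)))
      obtain ⟨x', hx'U, hx'C, rfl⟩ := hy.1 hyo.1
      exact h3 x' (interior_subset hx'U) hx'C (ne_of_gt hyo.2) hy.2
    refine ⟨Subtype.val ⁻¹' (U ∩ f ⁻¹' closedBall (f q) (min δ δ' / 2)), ?_, ?_, ?_, ?_⟩
    · exact continuous_subtype_val.continuousAt.preimage_mem_nhds (inter_mem hU.mem_nhds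
        (hf.continuous.continuousAt.preimage_mem_nhds (closedBall_mem_nhds _ (by positivity))))
    · exact (hU.isCompact.isClosed.inter
        (isClosed_closedBall.preimage hf.continuous)).preimage continuous_subtype_val
    · exact fun x hx x' hx' he => Subtype.ext (hU.injOn hx.1 hx'.1 he)
    · convert hBc.inter (convex_closedBall (f q) (min δ δ' / 2)) using 1
      ext y
      constructor
      · rintro ⟨x, hx, rfl⟩
        exact ⟨x.2.2, hx.2⟩
      · rintro ⟨hyB, hyd⟩
        obtain ⟨x, ⟨hxU, hxC⟩, rfl⟩ := key y hyB (lt_of_le_of_lt hyd (half_lt_self hd))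
        exact ⟨⟨x, hxC, hyB⟩, ⟨hxU, hyd⟩, rfl⟩
  intro x hx x' hx' he
  by_cases hxB : f x ∈ B
  · exact congrArg Subtype.val (@hinj ⟨x, hx, hxB⟩ ⟨x', hx', he ▸ hxB⟩ he)
  · exact h.inj x hx x' hx' hxB he

/-- A boundary point of the surface does not belong to a set which is mapped bijectively onto the
boundary of a convex body. -/
theorem notMem_bdry [ChartedSpace (EuclideanHalfSpace 2) M] [T2Space M] [CompactSpace M]
    (hf : IsRegularImmersion f) (hi : InjOn f C) (hs : frontier K ⊆ f '' C) (hq : q ∈ C)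
    : q ∉ bdry M := by
  intro hb
  obtain ⟨U, -, L, hU⟩ := hf.exists_localModel q univ_mem
  obtain ⟨ε, hε, hsep⟩ := h.isCompact.exists_dist_lt_imp_mem hf.continuous.continuousOn hi hq
    hU.mem_nhds
  have hmem : ∀ y ∈ frontier K, y ∈ ball (f q) ε → y ∈ f '' U := by
    intro y hy hyd
    obtain ⟨x, hx, rfl⟩ := hs hy
    exact ⟨x, hsep x hx hyd, rfl⟩
  have hball := ball_mem_nhds (f q) hε
  refine hU.image_notMem_nhdsWithin hf.continuous hb (mem_of_superset (inter_mem
    (h.body.frontier_mem_nhdsWithin hU.body (h.maps q hq) hball fun y hy hyd => ?_)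
    (mem_nhdsWithin_of_mem_nhds hball)) fun y hy => hmem y hy.1 hy.2)
  obtain ⟨x, hx, rfl⟩ := hmem y hy hyd
  exact hU.maps x hx

end Section

end CoversOff

theorem isPreconnected_iInter_of_directed {X ι : Type*} [TopologicalSpace X] [T2Space X]
    [CompactSpace X] [Nonempty ι] {V : ι → Set X} (hV : Directed (· ⊇ ·) V)
    (hcl : ∀ i, IsClosed (V i)) (hc : ∀ i, IsPreconnected (V i)) : IsPreconnected (⋂ i, V i) := by
  rw [isPreconnected_iff_subset_of_fully_disjoint_closed (isClosed_iInter hcl)]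
  intro u v hu hv huv hd
  obtain ⟨u', v', hu', hv', huu, hvv, hd'⟩ := normal_separation hu hv hd
  obtain ⟨i, hi⟩ := exists_subset_nhds_of_isCompact' hV (fun i => (hcl i).isCompact) hcl
    (U := u' ∪ v') fun x hx => (hu'.union hv').mem_nhds ((huv hx).imp (@huu x) (@hvv x))
  rcases (hc i).subset_or_subset hu' hv' hd' hi with h | h
  · exact Or.inl fun x hx => (huv hx).resolve_right fun hxv =>
      disjoint_left.1 hd' (h (mem_iInter.1 hx i)) (hvv hxv)
  · exact Or.inr fun x hx => (huv hx).resolve_left fun hxu =>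
      disjoint_left.1 hd' (huu hxu) (h (mem_iInter.1 hx i))

/-- The height of `y` above the plane through `x₀` with normal `rotatedNormal ν n θ`. -/
noncomputable def height (x₀ ν n : R3) (θ : ℝ) (y : R3) : ℝ := ⟪rotatedNormal ν n θ, y - x₀⟫

theorem height_eq (x₀ ν n : R3) (θ : ℝ) (y : R3) :
    height x₀ ν n θ y = cos θ * ⟪n, y - x₀⟫ + sin θ * ⟪ν, y - x₀⟫ :=
  inner_rotatedNormal ν n θ _

theorem continuous_height_angle (x₀ ν n y : R3) : Continuous fun θ => height x₀ ν n θ y := by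
  simp only [height_eq]; fun_prop

theorem continuous_height (x₀ ν n : R3) (θ : ℝ) : Continuous (height x₀ ν n θ) := by
  unfold height; fun_prop

theorem height_eq_sub (x₀ ν n : R3) (θ : ℝ) (y : R3) : height x₀ ν n θ y =
    ⟪rotatedNormal ν n θ, y⟫ - ⟪rotatedNormal ν n θ, x₀⟫ := inner_sub_right _ _ _

/-- The points of the base of a cap lie below the planes of smaller angles. -/
theorem height_nonpos {x₀ ν n : R3} {θ θ' : ℝ} (hθ : θ ∈ Ioo 0 θ') {y : R3} (hn : ⟪n, y - x₀⟫ ≤ 0)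
    (hθ' : θ' < Real.pi) (hy : height x₀ ν n θ' y = 0) :
    height x₀ ν n θ y ≤ 0 := by
  have h1 := sin_mul_inner_rotatedNormal ν n θ θ' (y - x₀)
  rw [show ⟪rotatedNormal ν n θ', y - x₀⟫ = 0 from hy, mul_zero, add_zero] at h1
  have h2 := sin_pos_of_pos_of_lt_pi (hθ.1.trans hθ.2) hθ'
  have h3 := sin_pos_of_pos_of_lt_pi (x := θ' - θ) (by linarith [hθ.2]) (by linarith [hθ.1])
  exact nonpos_of_mul_nonpos_right (h1.trans_le (mul_nonpos_of_nonneg_of_nonpos h3.le hn)) h2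

namespace CapModel

variable {M : Type*} [TopologicalSpace M] {f : M → R3} {C : Set M} {K : Set R3} {n : R3} {c : ℝ}
  (h : CapModel f C K n c)

include h

theorem isPreconnected_rim (hf : Continuous f) : IsPreconnected {x ∈ C | ⟪n, f x⟫ = c} := by
  refine h.isCompact.isPreconnected_of_image hf.continuousOn h.injOn (fun x hx => hx.1) ?_
  have hpl : IsClosed (plane n c) := isClosed_eq (by fun_prop) continuous_const
  have himg : f '' {x ∈ C | ⟪n, f x⟫ = c} =
      {y ∈ K ∩ plane n c | ¬ RelInt (K ∩ plane n c) n c y} := by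
    ext y
    constructor
    · rintro ⟨x, ⟨hx, hxc⟩, rfl⟩
      exact ⟨⟨h.mem_body hx, hxc⟩, fun hr => h.capBody.not_relInt_of_mem_closure (h.mem_closure hx)
        (hr.mono fun y hy _ => hy.1)⟩
    · rintro ⟨⟨hy, hyc⟩, hr⟩
      obtain ⟨x, hx, rfl⟩ := h.exists_of_mem_plane hy hyc fun h' => hr (h'.mono fun z hz hzc =>
        ⟨hz, hzc⟩)
      exact ⟨x, ⟨hx, hyc⟩, rfl⟩
  rw [himg]
  exact isPreconnected_not_relInt (h.capBody.body.isCompact.inter_right hpl)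
    (h.capBody.body.convex.inter
      (convex_hyperplane (f := fun x => ⟪n, x⟫) (innerSL ℝ n).isLinear c))
    h.capBody.normal_ne_zero inter_subset_right

theorem subset_closure_inner_gt (hf : Continuous f) : C ⊆ closure {x ∈ C | c < ⟪n, f x⟫} := by
  intro q hq
  refine mem_closure_iff_nhds.2 fun N hN => ?_
  obtain ⟨y, hy, hyo⟩ := mem_closure_iff_nhds.1 (h.mem_closure hq) _ (h.eventually_openCap hf hq hN)
  obtain ⟨x, hx, hxN, rfl⟩ := hy (subset_closure hyo)
  exact ⟨x, hxN, hx, hyo.2⟩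

end CapModel

/-- The nondegenerate caps `C θ` through `p` of the angles `θ` between `0` and `τ`, which cut out
each other, with bodies `K θ`. -/
structure CapFamily {M : Type*} [TopologicalSpace M] (f : M → R3) (p : M) (ν n : R3) (τ : ℝ)
    (C : ℝ → Set M) (K : ℝ → Set R3) : Prop where
  pos : 0 < τ
  le_pi : τ ≤ Real.pi
  model : ∀ θ ∈ Ioo 0 τ, CapModel f (C θ) (K θ) (rotatedNormal ν n θ) ⟪rotatedNormal ν n θ, f p⟫
  mem : ∀ θ ∈ Ioo 0 τ, p ∈ C θ
  set_eq : ∀ θ ∈ Ioo 0 τ, ∀ θ' ∈ Ioo θ τ, ∀ x, x ∈ C θ ↔ x ∈ C θ' ∧ 0 ≤ height (f p) ν n θ (f x)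
  body_eq : ∀ θ ∈ Ioo 0 τ, ∀ θ' ∈ Ioo θ τ, ∀ y, y ∈ K θ ↔ y ∈ K θ' ∧ 0 ≤ height (f p) ν n θ y
  le : ∀ θ ∈ Ioo 0 τ, ∀ y ∈ K θ, ⟪n, y - f p⟫ ≤ 0

namespace CapFamily

variable {M : Type*} [TopologicalSpace M] {f : M → R3} {p : M} {ν n : R3} {τ : ℝ}
  {C : ℝ → Set M} {K : ℝ → Set R3}

/-- The limit of the caps. -/
def limit (_ : CapFamily f p ν n τ C K) : Set M := closure (⋃ θ ∈ Ioo 0 τ, C θ)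

/-- The limit of the bodies of the caps. -/
def limitBody (_ : CapFamily f p ν n τ C K) : Set R3 := closure (⋃ θ ∈ Ioo 0 τ, K θ)

/-- The limit of the bases of the caps: the part of the limit body below all the planes. -/
def limitBase (g : CapFamily f p ν n τ C K) : Set R3 :=
  {y ∈ g.limitBody | ∀ θ ∈ Ioo 0 τ, height (f p) ν n θ y ≤ 0}

variable (g : CapFamily f p ν n τ C K)

include g

theorem set_mono {θ θ' : ℝ} (hθ : θ ∈ Ioo 0 τ) (hθ' : θ' ∈ Ico θ τ) : C θ ⊆ C θ' := by
  rcases eq_or_lt_of_le hθ'.1 with rfl | hlt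
  · exact subset_rfl
  · exact fun x hx => ((g.set_eq θ hθ θ' ⟨hlt, hθ'.2⟩ x).1 hx).1

theorem body_mono {θ θ' : ℝ} (hθ : θ ∈ Ioo 0 τ) (hθ' : θ' ∈ Ico θ τ) : K θ ⊆ K θ' := by
  rcases eq_or_lt_of_le hθ'.1 with rfl | hlt
  · exact subset_rfl
  · exact fun x hx => ((g.body_eq θ hθ θ' ⟨hlt, hθ'.2⟩ x).1 hx).1

theorem subset_limit {θ : ℝ} (hθ : θ ∈ Ioo 0 τ) : C θ ⊆ g.limit :=
  (subset_biUnion_of_mem (u := C) hθ).trans subset_closure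

theorem subset_limitBody {θ : ℝ} (hθ : θ ∈ Ioo 0 τ) : K θ ⊆ g.limitBody :=
  (subset_biUnion_of_mem (u := K) hθ).trans subset_closure

theorem mem_of_height_pos [T2Space M] (hf : Continuous f) {θ : ℝ} (hθ : θ ∈ Ioo 0 τ) {x : M}
    (hx : x ∈ g.limit) (hpos : 0 < height (f p) ν n θ (f x)) :
    x ∈ C θ := by
  have ho : IsOpen {z | 0 < height (f p) ν n θ (f z)} :=
    isOpen_lt continuous_const ((continuous_height _ _ _ _).comp hf)
  refine closure_minimal (t := C θ) ?_ (g.model θ hθ).isCompact.isClosed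
    (ho.inter_closure ⟨hpos, hx⟩)
  rintro z ⟨hz, hzU⟩
  obtain ⟨θ', hθ', hzC⟩ := mem_iUnion₂.1 hzU
  rcases le_or_gt θ' θ with hle | hlt
  · exact g.set_mono hθ' ⟨hle, hθ.2⟩ hzC
  · exact (g.set_eq θ hθ θ' ⟨hlt, hθ'.2⟩ z).2 ⟨hzC, le_of_lt hz⟩

theorem mem_body_of_height_pos {θ : ℝ} (hθ : θ ∈ Ioo 0 τ) {y : R3} (hy : y ∈ g.limitBody)
    (hpos : 0 < height (f p) ν n θ y) : y ∈ K θ := by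
  have ho : IsOpen {z | 0 < height (f p) ν n θ z} :=
    isOpen_lt continuous_const (continuous_height _ _ _ _)
  refine closure_minimal (t := K θ) ?_ (g.model θ hθ).capBody.body.isClosed
    (ho.inter_closure ⟨hpos, hy⟩)
  rintro z ⟨hz, hzU⟩
  obtain ⟨θ', hθ', hzC⟩ := mem_iUnion₂.1 hzU
  rcases le_or_gt θ' θ with hle | hlt
  · exact g.body_mono hθ' ⟨hle, hθ.2⟩ hzC
  · exact (g.body_eq θ hθ θ' ⟨hlt, hθ'.2⟩ z).2 ⟨hzC, le_of_lt hz⟩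

theorem mem_openCap_iff {θ : ℝ} (hθ : θ ∈ Ioo 0 τ) {y : R3} :
    y ∈ openCap (K θ) (rotatedNormal ν n θ) ⟪rotatedNormal ν n θ, f p⟫ ↔
      y ∈ frontier g.limitBody ∧ 0 < height (f p) ν n θ y := by
  have ho := isOpen_inner_gt (rotatedNormal ν n θ) ⟪rotatedNormal ν n θ, f p⟫
  rw [openCap, frontier_inter_eq_of_inter_eq (B := g.limitBody) ho, height_eq_sub, sub_pos]
  · rfl
  · ext z
    exact ⟨fun hz => ⟨g.subset_limitBody hθ hz.1, hz.2⟩, fun hz =>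
      ⟨g.mem_body_of_height_pos hθ hz.1 (by rw [height_eq_sub]; exact sub_pos.2 hz.2), hz.2⟩⟩

theorem half_mem : τ / 2 ∈ Ioo 0 τ := ⟨half_pos g.pos, half_lt_self g.pos⟩

theorem convex_limitBody : Convex ℝ g.limitBody := by
  refine Convex.closure ?_
  intro x hx y hy a b ha hb hab
  obtain ⟨θ, hθ, hxK⟩ := mem_iUnion₂.1 hx
  obtain ⟨θ', hθ', hyK⟩ := mem_iUnion₂.1 hy
  have hm : max θ θ' ∈ Ioo 0 τ := ⟨lt_max_of_lt_left hθ.1, max_lt hθ.2 hθ'.2⟩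
  exact mem_iUnion₂.2 ⟨_, hm, (g.model _ hm).capBody.body.convex
    (g.body_mono hθ ⟨le_max_left _ _, hm.2⟩ hxK) (g.body_mono hθ' ⟨le_max_right _ _, hm.2⟩ hyK)
    ha hb hab⟩

theorem isConvexBody_limitBody [CompactSpace M] (hf : Continuous f) : IsConvexBody g.limitBody := by
  refine ⟨?_, g.convex_limitBody, (g.model _ g.half_mem).capBody.body.interior_nonempty.mono
      (interior_mono (g.subset_limitBody g.half_mem))⟩
  refine Metric.isCompact_of_isClosed_isBounded isClosed_closure (Bornology.IsBounded.closure
    ((isBounded_convexHull.2 (isCompact_range hf).isBounded).subset (iUnion₂_subset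
      fun θ hθ => ?_)))
  rw [(g.model θ hθ).capBody.eq_convexHull, ← (g.model θ hθ).image_eq]
  exact convexHull_mono (image_subset_range _ _)

theorem coversOff [T2Space M] [CompactSpace M] (hf : Continuous f) :
    CoversOff f g.limit g.limitBody g.limitBase := by
  have hpos : ∀ y ∈ g.limitBody, y ∉ g.limitBase → ∃ θ ∈ Ioo 0 τ, 0 < height (f p) ν n θ y := by
    intro y hy hyB
    by_contra! hc
    exact hyB ⟨hy, hc⟩
  have hmaps : ∀ x ∈ g.limit, f x ∈ frontier g.limitBody := by
    refine fun x hx => closure_minimal (t := f ⁻¹' frontier g.limitBody) (iUnion₂_subset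
      fun θ hθ z hz => ?_) (isClosed_frontier.preimage hf) hx
    exact closure_minimal (fun y hy => ((g.mem_openCap_iff hθ).1 hy).1) isClosed_frontier
      ((g.model θ hθ).mem_closure hz)
  have hbody := g.isConvexBody_limitBody hf
  refine ⟨isClosed_closure.isCompact, hbody, ?_, hmaps, ?_, ?_, ?_⟩
  · have : g.limitBase = g.limitBody ∩ ⋂ θ ∈ Ioo 0 τ, {y | height (f p) ν n θ y ≤ 0} := by
      ext y; simp [limitBase]
    rw [this]
    exact isClosed_closure.inter (isClosed_biInter fun θ _ =>
      isClosed_le (continuous_height _ _ _ _) continuous_const)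
  · intro x hx x' hx' hxB he
    obtain ⟨θ, hθ, hp⟩ := hpos _ (hbody.frontier_subset (hmaps x hx)) hxB
    exact (g.model θ hθ).injOn (g.mem_of_height_pos hf hθ hx hp)
      (g.mem_of_height_pos hf hθ hx' (he ▸ hp)) he
  · intro y hy hyB
    obtain ⟨θ, hθ, hp⟩ := hpos y (hbody.frontier_subset hy) hyB
    obtain ⟨x, hx, rfl⟩ := (g.model θ hθ).exists_of_mem_openCap ((g.mem_openCap_iff hθ).2 ⟨hy, hp⟩)
    exact ⟨x, g.subset_limit hθ hx, rfl⟩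
  · refine closure_minimal (iUnion₂_subset fun θ hθ => ?_) isClosed_closure
    refine ((g.model θ hθ).subset_closure_inner_gt hf).trans (closure_mono fun x hx =>
      ⟨g.subset_limit hθ hx.1, fun hB => ?_⟩)
    have := hB.2 θ hθ
    rw [height_eq_sub] at this
    linarith [hx.2]

theorem height_nonneg {θ : ℝ} (hθ : θ ∈ Ioo 0 τ) {y : R3} (hy : y ∈ K θ)
    : 0 ≤ height (f p) ν n θ y := by
  rw [height_eq_sub]
  exact sub_nonneg.2 ((g.model θ hθ).capBody.subset hy)

theorem height_nonneg_of_mem {θ : ℝ} (hθ : θ ∈ Ioo 0 τ) {x : M} (hx : x ∈ C θ)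
    : 0 ≤ height (f p) ν n θ (f x) :=
  g.height_nonneg hθ ((g.model θ hθ).mem_body hx)

/-- The part of the limit over the limit of the bases is the limit of the rims of the caps. -/
theorem isConnected_limitBase [T2Space M] [CompactSpace M] (hf : Continuous f) :
    IsConnected {x ∈ g.limit | f x ∈ g.limitBase} := by
  set R : ℝ → Set M := fun θ => {x ∈ C θ | height (f p) ν n θ (f x) = 0}
  have hR : ∀ θ ∈ Ioo 0 τ, IsPreconnected (R θ) := fun θ hθ => by
    simpa only [R, height_eq_sub, sub_eq_zero] using (g.model θ hθ).isPreconnected_rim hf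
  have hpR : ∀ θ ∈ Ioo 0 τ, p ∈ R θ := fun θ hθ => ⟨g.mem θ hθ, by simp [height]⟩
  set E : Ioo 0 τ → Set M := fun θ => closure (⋃ θ' : Ioo (θ : ℝ) τ, R θ')
  have hsub : ∀ θ θ' : ℝ, θ ∈ Ioo 0 τ → θ' ∈ Ioo θ τ → θ' ∈ Ioo 0 τ := fun θ θ' h1 h2 =>
    ⟨h1.1.trans h2.1, h2.2⟩
  have hpE : ∀ θ, p ∈ E θ := fun θ => by
    obtain ⟨θ', hθ'⟩ := exists_between θ.2.2
    exact subset_closure (mem_iUnion.2 ⟨⟨θ', hθ'⟩, hpR _ (hsub _ _ θ.2 hθ')⟩)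
  have hle := (g.coversOff hf).body.frontier_subset
  suffices he : {x ∈ g.limit | f x ∈ g.limitBase} = ⋂ θ, E θ by
    rw [he]
    have : Nonempty (Ioo 0 τ) := ⟨⟨_, g.half_mem⟩⟩
    refine ⟨⟨p, mem_iInter.2 hpE⟩, isPreconnected_iInter_of_directed ?_
      (fun _ => isClosed_closure) fun θ => ?_⟩
    · have hanti : ∀ a b : Ioo 0 τ, a ≤ b → E b ⊆ E a := fun a b hab => closure_mono
        (iUnion_subset fun θ' => subset_iUnion (fun θ' : Ioo (a : ℝ) τ => R θ')
          ⟨θ', lt_of_le_of_lt hab θ'.2.1, θ'.2.2⟩)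
      exact fun a b => ⟨max a b, hanti _ _ (le_max_left _ _), hanti _ _ (le_max_right _ _)⟩
    · exact (isPreconnected_iUnion ⟨p, mem_iInter.2 fun θ' => hpR _ (hsub _ _ θ.2 θ'.2)⟩
        fun θ' => hR _ (hsub _ _ θ.2 θ'.2)).closure
  ext x
  constructor
  · rintro ⟨hx, hxB⟩
    refine mem_iInter.2 fun θ => ?_
    obtain ⟨θ₁, hθ₁⟩ := exists_between θ.2.2
    have hθ₁' := hsub _ _ θ.2 hθ₁
    by_cases hxC : x ∈ C θ₁
    · exact subset_closure (mem_iUnion.2 ⟨⟨θ₁, hθ₁⟩, hxC,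
        le_antisymm (hxB.2 θ₁ hθ₁') (g.height_nonneg_of_mem hθ₁' hxC)⟩)
    -- nearby points of larger caps are on the rim of a cap of intermediate angle
    refine mem_closure_iff_nhds.2 fun N hN => ?_
    obtain ⟨z, ⟨hzN, hzC⟩, hzU⟩ := mem_closure_iff_nhds.1 hx _ (inter_mem hN
      ((g.model θ₁ hθ₁').isCompact.isClosed.isOpen_compl.mem_nhds hxC))
    obtain ⟨θ₂, hθ₂, hz₂⟩ := mem_iUnion₂.1 hzU
    have hlt : θ₁ < θ₂ := by
      by_contra! hle
      exact hzC (g.set_mono hθ₂ ⟨hle, hθ₁.2⟩ hz₂)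
    have hneg : height (f p) ν n θ₁ (f z) < 0 := by
      by_contra! hge
      exact hzC ((g.set_eq θ₁ hθ₁' θ₂ ⟨hlt, hθ₂.2⟩ z).2 ⟨hz₂, hge⟩)
    obtain ⟨θ₃, hθ₃, hz₃⟩ := intermediate_value_Icc hlt.le
      (continuous_height_angle (f p) ν n (f z)).continuousOn
      ⟨hneg.le, g.height_nonneg_of_mem hθ₂ hz₂⟩
    have hθ₃' : θ₃ ∈ Ioo 0 τ := ⟨hθ₁'.1.trans_le hθ₃.1, hθ₃.2.trans_lt hθ₂.2⟩
    refine ⟨z, hzN, mem_iUnion.2 ⟨⟨θ₃, hθ₁.1.trans_le hθ₃.1, hθ₃'.2⟩, ?_, hz₃⟩⟩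
    rcases eq_or_lt_of_le hθ₃.2 with rfl | hlt'
    · exact hz₂
    · exact (g.set_eq θ₃ hθ₃' θ₂ ⟨hlt', hθ₂.2⟩ z).2 ⟨hz₂, hz₃.ge⟩
  · intro hx
    have hxl : x ∈ g.limit := closure_minimal (t := g.limit) (iUnion_subset fun θ' z hz =>
      g.subset_limit (hsub _ _ g.half_mem θ'.2) hz.1) isClosed_closure
      (mem_iInter.1 hx ⟨_, g.half_mem⟩)
    refine ⟨hxl, hle ((g.coversOff hf).maps x hxl), fun θ hθ => ?_⟩
    refine closure_minimal (t := {z | height (f p) ν n θ (f z) ≤ 0}) (iUnion_subset ?_)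
      (isClosed_le ((continuous_height _ _ _ _).comp hf) continuous_const)
      (mem_iInter.1 hx ⟨θ, hθ⟩)
    rintro ⟨θ', hθ'⟩ z ⟨hzC, hz⟩
    have hθ'' := hsub _ _ hθ hθ'
    exact height_nonpos ⟨hθ.1, hθ'.1⟩ (g.le _ hθ'' _ ((g.model _ hθ'').mem_body hzC))
      (hθ'.2.trans_le g.le_pi) hz

theorem inner_limitBody_nonpos {y : R3} (hy : y ∈ g.limitBody) : ⟪n, y - f p⟫ ≤ 0 :=
  closure_minimal (t := {y | ⟪n, y - f p⟫ ≤ 0}) (iUnion₂_subset fun θ hθ z hz => g.le θ hθ z hz)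
    (isClosed_le (by fun_prop) continuous_const) hy

theorem height_limitBody_nonneg {y : R3} (hy : y ∈ g.limitBody) : 0 ≤ height (f p) ν n τ y := by
  refine closure_minimal (t := {y | 0 ≤ height (f p) ν n τ y}) (iUnion₂_subset fun θ hθ z hz => ?_)
    (isClosed_le continuous_const (continuous_height _ _ _ _)) hy
  have := g.height_nonneg hθ hz
  rw [height_eq] at this
  show 0 ≤ height (f p) ν n τ z
  rw [height_eq]
  exact cos_mul_add_sin_mul_nonneg (g.le θ hθ z hz) hθ.1 hθ.2.le g.le_pi this

theorem height_limitBase {y : R3} (hy : y ∈ g.limitBase) : height (f p) ν n τ y = 0 := by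
  refine le_antisymm (le_of_tendsto
    ((continuous_height_angle (f p) ν n y).continuousWithinAt (s := Iio τ)) ?_)
    (g.height_limitBody_nonneg hy.1)
  filter_upwards [Ioo_mem_nhdsLT g.pos] with θ hθ using hy.2 θ hθ

theorem convex_limitBase : Convex ℝ g.limitBase := by
  have : g.limitBase = g.limitBody ∩ ⋂ θ ∈ Ioo 0 τ, {y | ⟪rotatedNormal ν n θ, y⟫ ≤
      ⟪rotatedNormal ν n θ, f p⟫} := by
    ext y; simp [limitBase, height_eq_sub]
  rw [this]
  exact g.convex_limitBody.inter (convex_iInter₂ fun θ _ => convex_halfSpace_le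
    (f := fun y => ⟪rotatedNormal ν n θ, y⟫) (innerSL ℝ _).isLinear _)

variable [ChartedSpace (EuclideanHalfSpace 2) M] [T2Space M] [CompactSpace M] {U : Set M}
  {L : Set R3} {φ : ℝ → bdry M} {T : R3}

/-- The limit of the bases is not contained in a line: otherwise the caps would cover the whole
boundary of the limit body, also near the boundary point `p` of the surface. -/
theorem exists_inner_ne_zero (h : BoundaryFrame f p U L φ T n ν) (hf : IsRegularImmersion f)
    {e : R3} (he : ‖e‖ = 1) (hme : ⟪rotatedNormal ν n τ, e⟫ = 0)
    : ∃ b ∈ g.limitBase, ⟪e, b - f p⟫ ≠ 0 := by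
  by_contra! hB
  set m := rotatedNormal ν n τ
  have hcov := g.coversOff hf.continuous
  obtain ⟨o, ho⟩ := hcov.body.interior_nonempty
  have hneg : ∀ y ∈ g.limitBody, ⟪-m, y⟫ ≤ -⟪m, f p⟫ := fun y hy => by
    have := g.height_limitBody_nonneg hy
    rw [height_eq_sub] at this
    rw [inner_neg_left]; linarith
  have hm0 : -m ≠ 0 := neg_ne_zero.2 (h.rotatedNormal_ne_zero τ)
  have hBc : ∀ b ∈ g.limitBase, ⟪m, b - f p⟫ = 0 := fun b hb => g.height_limitBase hb
  have hon := inner_lt_of_mem_interior hm0 hneg ho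
  -- a plane through the line and through an interior point
  set m' := ⟪e, o - f p⟫ • m - ⟪m, o - f p⟫ • e with hm'
  have hm'B : ∀ x, ⟪m', x - f p⟫ = ⟪e, o - f p⟫ * ⟪m, x - f p⟫ -
      ⟪m, o - f p⟫ * ⟪e, x - f p⟫ := fun x => by
    rw [hm', inner_sub_left, real_inner_smul_left, real_inner_smul_left]
  have hm'0 : m' ≠ 0 := by
    intro h0
    have h1 : ⟪e, m'⟫ = 0 := by rw [h0, inner_zero_right]
    rw [hm', inner_sub_right, inner_smul_right, inner_smul_right, real_inner_comm m e, hme,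
      real_inner_self_eq_norm_sq, he, inner_sub_right m o] at h1
    rw [inner_neg_left] at hon
    linarith
  have hp := subset_limit g g.half_mem (g.mem _ g.half_mem)
  obtain ⟨h1, h2⟩ := hcov.injOn_of_section hf (m := m') (c := ⟪m', f p⟫) (fun b hb =>
    mem_frontier_of_inner_eq hm0 hneg hb.1 (by
      have := hBc b hb
      rw [inner_sub_right] at this
      rw [inner_neg_left]; linarith)) g.convex_limitBase hm'0 (fun b hb => by
      have := hm'B b
      rw [hBc b hb, hB b hb, inner_sub_right] at this
      linarith) ho (by
      have := hm'B o
      rw [inner_sub_right] at this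
      linarith) (g.isConnected_limitBase hf.continuous)
  exact hcov.notMem_bdry hf h1 h2 hp h.mem_bdry

omit g in
/-- If the caps extend up to the angle `π`, then the limit body does not meet the plane orthogonal
to `n` on the side of the conormal. -/
theorem inner_conormal_nonpos (g : CapFamily f p ν n Real.pi C K)
    (h : BoundaryFrame f p U L φ T n ν) (hf : IsRegularImmersion f)
    (hbody : CapBody g.limitBody (-n) (-⟪n, f p⟫)) {y : R3} (hy : y ∈ g.limitBody)
    (hyn : ⟪n, y - f p⟫ = 0) :
    ⟪ν, y - f p⟫ ≤ 0 := by
  by_contra! hpos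
  have hcov := g.coversOff hf.continuous
  have hpm := subset_limit g g.half_mem (g.mem _ g.half_mem)
  have hpK := hcov.body.frontier_subset (hcov.maps p hpm)
  have hhalf : ∀ x, height (f p) ν n (Real.pi / 2) x = ⟪ν, x - f p⟫ := fun x => by
    rw [height_eq, Real.cos_pi_div_two, Real.sin_pi_div_two]; ring
  have hfr : ∀ z ∈ g.limitBody, ⟪n, z - f p⟫ = 0 → z ∈ frontier g.limitBody := fun z hz hzn => by
      rw [inner_sub_right] at hzn
      exact hbody.mem_frontier_of_inner_eq hz (by rw [inner_neg_left]; linarith)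
  -- the segment from `f p` to `y` belongs to the image of each neighborhood of `p`
  have hnice : NiceAt f n ⟪n, f p⟫ p := by
    by_contra hnot
    refine (h.of_not_niceAt hf hnot).1 (y - f p)
      (fun h0 => by rw [h0, inner_zero_right] at hpos; exact lt_irrefl _ hpos) hyn
      (Eventually.frequently ?_)
    have g' := g.model _ g.half_mem
    filter_upwards [eventually_lineMap (y - f p) (g'.eventually_openCap hf.continuous
      (g.mem _ g.half_mem) h.model.mem_nhds)] with t ⟨ht, ht0, ht1⟩
    have hz : f p + t • (y - f p) - f p = t • (y - f p) := add_sub_cancel_left _ _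
    obtain ⟨x, -, hxU, hx⟩ := ht (subset_closure ((g.mem_openCap_iff g.half_mem).2
      ⟨hfr _ (g.convex_limitBody.lineMap_mem_set hpK hy ⟨ht0.le, ht1.le⟩)
        (by rw [hz, inner_smul_right, hyn, mul_zero]),
        by rw [hhalf, hz, inner_smul_right]; exact mul_pos ht0 hpos⟩))
    exact ⟨x, hxU, hx⟩
  obtain ⟨W, hpW, hWc, -, hWi, hWconv, hWn, N, hN, hWN, hNW⟩ := hf.exists_flat_face
    h.norm_n h.mem_bdry rfl hnice h.eventually_le
  have hsin : ∀ θ ∈ Ioo 0 Real.pi, 0 < sin θ := fun θ hθ => sin_pos_of_pos_of_lt_pi hθ.1 hθ.2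
  have hBn : ∀ b ∈ g.limitBase, ⟪n, b - f p⟫ = 0 := fun b hb => by
    simpa [height_eq] using g.height_limitBase hb
  -- the limit of the rims is connected, thus contained in the face through `p`
  have hGW : {x ∈ g.limit | f x ∈ g.limitBase} ⊆ W := by
    refine (g.isConnected_limitBase hf.continuous).isPreconnected.subset_of_relatively_clopen
      (fun x _ hxW => ?_) (fun x _ hx => by rwa [hWc.isClosed.closure_eq] at hx)
      ⟨p, ⟨hpm, hpK, fun θ _ => by simp [height]⟩, hpW⟩
    filter_upwards [hN.mem_nhds (hWN hxW)] with z hz hzG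
    have := hBn _ hzG.2
    rw [inner_sub_right] at this
    exact (hNW z hz).2 (by linarith)
  obtain ⟨b₀, hb₀, hb₀ν⟩ := g.exists_inner_ne_zero h hf h.norm_ν (by
    rw [rotatedNormal_pi, inner_neg_left, h.inner_nν, neg_zero])
  have hb₀' : ⟪ν, b₀ - f p⟫ < 0 := lt_of_le_of_ne (by rw [← hhalf]; exact hb₀.2 _ g.half_mem) hb₀ν
  -- the lowest point of the limit of the bases in the direction of the conormal
  have hFc : IsCompact {z ∈ g.limitBody | ⟪n, z - f p⟫ = 0} :=
    hcov.body.isCompact.inter_right (isClosed_eq (by fun_prop) continuous_const)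
  obtain ⟨b, ⟨hb, hbn⟩, hmin⟩ := hFc.exists_isMinOn ⟨b₀, hb₀.1, hBn _ hb₀⟩
    (f := fun z => ⟪ν, z - f p⟫) (by fun_prop)
  have hbν : ⟪ν, b - f p⟫ < 0 := lt_of_le_of_lt (hmin ⟨hb₀.1, hBn _ hb₀⟩) hb₀'
  have hbc : ⟪-n, b⟫ = -⟪n, f p⟫ := by
    rw [inner_sub_right] at hbn
    rw [inner_neg_left]; linarith
  have hbr : ¬ RelInt g.limitBody (-n) (-⟪n, f p⟫) b := by
    intro hr
    have h1 : ⟪-n, ν⟫ = 0 := by rw [inner_neg_left, h.inner_nν, neg_zero]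
    obtain ⟨s, hs, hs0⟩ := (((hr.eventually_add_smul h1).filter_mono nhdsWithin_le_nhds).and
      (self_mem_nhdsWithin (s := Iio (0 : ℝ)))).exists
    have h2 : b + s • ν - f p = (b - f p) + s • ν := by abel
    have h3 : ⟪ν, b - f p⟫ ≤ ⟪ν, b + s • ν - f p⟫ := hmin ⟨hs.mem, by
      rw [h2, inner_add_smul, hbn, h.inner_nν]; ring⟩
    rw [h2, inner_add_smul, real_inner_self_eq_norm_sq, h.norm_ν] at h3
    linarith [show s < 0 from hs0]
  obtain ⟨q, hq, rfl⟩ : b ∈ f '' g.limit := by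
    refine closure_minimal (fun z hz => hcov.surj z hz.1 fun hzB => ?_)
      (hcov.isCompact.image hf.continuous).isClosed (hbody.mem_closure_openCap hb hbc hbr)
    have h1 := hBn z hzB
    have h2 : -⟪n, f p⟫ < ⟪-n, z⟫ := hz.2
    rw [inner_neg_left] at h2
    rw [inner_sub_right] at h1
    linarith
  have hqW : q ∈ W := hGW ⟨hq, hb, fun θ hθ => by
    rw [height_eq, hbn, mul_zero, zero_add]
    exact (mul_neg_of_pos_of_neg (hsin θ hθ) hbν).le⟩
  refine absurd (h.limit_direction (w := f q - f p) fun η hη N' hN' => ?_).2 (not_le.2 hbν)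
  obtain ⟨ε, hε, hs⟩ := hWc.exists_dist_lt_imp_mem hf.continuous.continuousOn hWi hpW hN'
  obtain ⟨t, htd, ht0, ht1⟩ := (eventually_lineMap (f q - f p) (ball_mem_nhds (f p) hε)).exists
  obtain ⟨x, hxW, hx⟩ := hWconv.lineMap_mem_set (mem_image_of_mem f hpW) (mem_image_of_mem f hqW)
    (t := t) ⟨ht0.le, ht1.le⟩
  refine ⟨x, hs x hxW (by rw [hx]; exact htd), t, ht0, ?_⟩
  rw [hx, add_sub_cancel_left, sub_self, norm_zero]
  positivity

/-- The limit of the caps is a nondegenerate cap. -/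
theorem capModel_limit (h : BoundaryFrame f p U L φ T n ν) (hf : IsRegularImmersion f) :
    CapModel f g.limit g.limitBody (rotatedNormal ν n τ) ⟪rotatedNormal ν n τ, f p⟫ := by
  have hcov := g.coversOff hf.continuous
  have hpm := subset_limit g g.half_mem (g.mem _ g.half_mem)
  have hpK := hcov.body.frontier_subset (hcov.maps p hpm)
  have hbody : CapBody g.limitBody (rotatedNormal ν n τ) ⟪rotatedNormal ν n τ, f p⟫ := by
    refine ⟨hcov.body, h.rotatedNormal_ne_zero τ, fun y hy => ?_, ?_⟩
    · have := g.height_limitBody_nonneg hy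
      rw [height_eq_sub] at this
      exact sub_nonneg.1 this
    rcases relInt_or_subset_line g.convex_limitBody (h.rotatedNormal_ne_zero τ) hpK rfl with
      hr | ⟨e, he, hme, hline⟩
    · exact hr
    · obtain ⟨b, hb, hbe⟩ := g.exists_inner_ne_zero h hf he hme
      refine absurd (hline b hb.1 ?_) hbe
      rw [← sub_eq_zero, ← height_eq_sub]
      exact g.height_limitBase hb
  refine hcov.capModel hf hbody (h.norm_rotatedNormal τ) fun y hy => ⟨fun hyB => ?_, fun hyc => ?_⟩
  · rw [← sub_eq_zero, ← height_eq_sub]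
    exact g.height_limitBase hyB
  rw [← sub_eq_zero, ← height_eq_sub] at hyc
  refine ⟨hy, fun θ hθ => ?_⟩
  have hyn := g.inner_limitBody_nonpos hy
  rcases eq_or_lt_of_le g.le_pi with rfl | hlt
  · have hyn' : ⟪n, y - f p⟫ = 0 := by simpa [height_eq] using hyc
    rw [rotatedNormal_pi, inner_neg_left] at hbody
    rw [height_eq, hyn', mul_zero, zero_add]
    exact mul_nonpos_of_nonneg_of_nonpos (sin_pos_of_pos_of_lt_pi hθ.1 hθ.2).le
      (g.inner_conormal_nonpos h hf hbody hy hyn')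
  · exact height_nonpos hθ hyn hlt hyc

end CapFamily

/-! ### Maximal caps -/

theorem IsCap.capModel_or_convex {M : Type*} [TopologicalSpace M] [CompactSpace M] {f : M → R3}
    {C : Set M} (h : IsCap f C) : IsConnected C ∧ IsCompact C ∧ InjOn f C ∧
      ((∃ K n c, CapModel f C K n c) ∨ Convex ℝ (f '' C)) := by
  obtain ⟨n, c, h⟩ := h
  refine ⟨h.isConnected, h.isClosed.isCompact, h.injOn, ?_⟩
  have hn := norm_pos_iff.2 h.normal_ne_zero
  have h' := h.smul (inv_pos.2 hn)
  rcases h'.image_isCap with hnd | ⟨hd, -⟩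
  · obtain ⟨K, hK, he⟩ := hnd.exists_capBody h'.normal_ne_zero
    refine Or.inl ⟨K, _, _, hK, ?_, h.isClosed.isCompact, h.injOn, he⟩
    rw [norm_smul, norm_inv, norm_norm, inv_mul_cancel₀ hn.ne']
  · exact Or.inr hd.2.2.1

theorem mem_capAt {M : Type*} [TopologicalSpace M] (f : M → R3) (p : M) (ν n : R3) (θ : ℝ) :
    p ∈ capAt f p ν n θ :=
  mem_connectedComponentIn (le_refl ⟪rotatedNormal ν n θ, f p⟫)

theorem CapModel.body_eq {M : Type*} [TopologicalSpace M] {f : M → R3} {C : Set M} {K : Set R3}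
    {n : R3} {c : ℝ} (g : CapModel f C K n c) : K = convexHull ℝ (f '' C) := by
  rw [g.image_eq]; exact g.capBody.eq_convexHull

namespace BoundaryFrame

variable {M : Type*} [TopologicalSpace M] [ChartedSpace (EuclideanHalfSpace 2) M]
  {f : M → R3} {p : M} {U : Set M} {L : Set R3} {φ : ℝ → bdry M} {T n ν : R3}
  {C : Set M} {K : Set R3} {θ θ' c : ℝ}
  (h : BoundaryFrame f p U L φ T n ν)

include h

/-- A cap at `p` of positive angle is nondegenerate. -/
theorem exists_capModel [CompactSpace M] (hf : IsRegularImmersion f) (hθ : θ ∈ capAngles f p ν n)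
    (hθ0 : 0 < θ) :
    ∃ K, CapModel f (capAt f p ν n θ) K (rotatedNormal ν n θ) ⟪rotatedNormal ν n θ, f p⟫ := by
  obtain ⟨hθI, hcap⟩ := hθ
  rcases hcap.image_isCap with hnd | ⟨hd, V, hV, hdis⟩
  · obtain ⟨K, hK, he⟩ := hnd.exists_capBody hcap.normal_ne_zero
    exact ⟨K, hK, h.norm_rotatedNormal θ, hcap.isClosed.isCompact, hcap.injOn, he⟩
  have hVp : V ∈ 𝓝 p := mem_nhdsSet_iff_forall.1 hV p (mem_capAt f p ν n θ)
  have hin : ∀ x ∈ V, ⟪rotatedNormal ν n θ, f p⟫ ≤ ⟪rotatedNormal ν n θ, f x⟫ →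
      ⟪rotatedNormal ν n θ, f x⟫ = ⟪rotatedNormal ν n θ, f p⟫ := by
    intro x hx hle
    have hxC : x ∈ capAt f p ν n θ := by
      by_contra hxC
      exact disjoint_left.1 hdis ⟨x, ⟨hx, hxC⟩, rfl⟩ hle
    exact hd.2.2.2 (mem_image_of_mem f hxC)
  rcases eq_or_lt_of_le hθI.2 with rfl | hlt
  · refine absurd ⟨rotatedNormal ν n Real.pi, ⟪rotatedNormal ν n Real.pi, f p⟫,
      h.rotatedNormal_ne_zero _, ?_⟩ (hf.nonflat p h.mem_bdry _ (inter_mem hVp h.eventually_le))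
    rintro _ ⟨x, ⟨hxV, hx⟩, rfl⟩
    refine hin x hxV ?_
    rw [rotatedNormal_pi, inner_neg_left, inner_neg_left]
    exact neg_le_neg hx
  · obtain ⟨x, hx, hlt'⟩ := h.exists_above ⟨hθ0, hlt⟩ hVp
    exact absurd (hin x hx hlt'.le) hlt'.ne'

/-- A compact set through `p` which is mapped bijectively onto a convex set lies in the tangent
plane at `p`. -/
theorem inner_eq_of_convex (hf : Continuous f) (hC : IsCompact C) (hi : InjOn f C)
    (hconv : Convex ℝ (f '' C)) (hp : p ∈ C) {x : M} (hx : x ∈ C)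
    : ⟪n, f x⟫ = ⟪n, f p⟫ := by
  rw [← sub_eq_zero, ← inner_sub_right]
  refine (h.limit_direction (w := f x - f p) fun η hη N hN => ?_).1
  obtain ⟨ε, hε, hs⟩ := hC.exists_dist_lt_imp_mem hf.continuousOn hi hp hN
  obtain ⟨t, htd, ht0, ht1⟩ := (eventually_lineMap (f x - f p) (ball_mem_nhds (f p) hε)).exists
  obtain ⟨z, hz, hze⟩ := hconv.lineMap_mem_set (mem_image_of_mem f hp) (mem_image_of_mem f hx)
    (t := t) ⟨ht0.le, ht1.le⟩
  refine ⟨z, hs z hz (by rw [hze]; exact htd), t, ht0, ?_⟩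
  rw [hze, add_sub_cancel_left, sub_self, norm_zero]
  positivity

variable [T2Space M] [CompactSpace M]

/-- A nondegenerate cap through `p` is the limit of the caps at `p` of smaller angles. -/
theorem cap_eq_closure (hf : IsRegularImmersion f) (g : CapModel f C K (rotatedNormal ν n θ') c)
    (hp : p ∈ C) (hθ' : θ' ∈ Ioc 0 Real.pi) :
    C = closure (⋃ θ ∈ Ioo 0 θ', capAt f p ν n θ) := by
  refine Subset.antisymm ((g.subset_closure_inner_gt hf.continuous).trans (closure_mono ?_))
    (closure_minimal (iUnion₂_subset fun θ hθ => ?_) g.isCompact.isClosed)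
  · rintro x ⟨hx, hxc⟩
    rw [← h.inner_eq_of_mem_cap hf g hp, ← sub_pos, ← height_eq_sub] at hxc
    obtain ⟨θ, hpos, hθ⟩ := ((((continuous_height_angle (f p) ν n (f x)).continuousWithinAt
      (s := Iio θ')).eventually_const_lt hxc).and (Ioo_mem_nhdsLT hθ'.1)).exists
    refine mem_iUnion₂.2 ⟨θ, hθ, ?_⟩
    rw [(h.capModel_capAt hf g hp hθ'.2 hθ).1]
    rw [height_eq_sub] at hpos
    exact ⟨hx, (sub_pos.1 hpos).le⟩
  · rw [(h.capModel_capAt hf g hp hθ'.2 hθ).1]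
    exact inter_subset_left

theorem capFamily (hf : IsRegularImmersion f) {τ : ℝ} (hτ : τ ∈ Ioc 0 Real.pi)
    (hmod : ∀ θ ∈ Ioo 0 τ, ∃ K, CapModel f (capAt f p ν n θ) K (rotatedNormal ν n θ)
      ⟪rotatedNormal ν n θ, f p⟫) :
    CapFamily f p ν n τ (capAt f p ν n) fun θ => convexHull ℝ (f '' capAt f p ν n θ) := by
  have hmod' : ∀ θ ∈ Ioo 0 τ, CapModel f (capAt f p ν n θ) (convexHull ℝ (f '' capAt f p ν n θ))
      (rotatedNormal ν n θ) ⟪rotatedNormal ν n θ, f p⟫ := fun θ hθ => by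
    obtain ⟨K, hK⟩ := hmod θ hθ
    rwa [← hK.body_eq]
  have hcut : ∀ θ ∈ Ioo 0 τ, ∀ θ' ∈ Ioo θ τ, _ := fun θ hθ θ' hθ' =>
    h.capModel_capAt hf (hmod' θ' ⟨hθ.1.trans hθ'.1, hθ'.2⟩) (mem_capAt f p ν n θ')
      (hθ'.2.le.trans hτ.2) ⟨hθ.1, hθ'.1⟩
  refine ⟨hτ.1, hτ.2, hmod', fun θ _ => mem_capAt f p ν n θ, fun θ hθ θ' hθ' x => ?_,
    fun θ hθ θ' hθ' y => ?_, fun θ hθ y hy => ?_⟩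
  · rw [(hcut θ hθ θ' hθ').1, height_eq_sub, sub_nonneg]
    rfl
  · rw [← (hcut θ hθ θ' hθ').2.body_eq, height_eq_sub, sub_nonneg]
    rfl
  · rw [inner_sub_right, sub_nonpos]
    exact h.cap_le hf (hmod' θ hθ) (mem_capAt f p ν n θ) y hy

end BoundaryFrame

theorem mainTheorem5 {M : Type*} [TopologicalSpace M] [ChartedSpace (EuclideanHalfSpace 2) M]
    [T2Space M] [CompactSpace M] [ConnectedSpace M] (f : M → R3) (hf : IsLocallyConvexImmersion f)
    (hreg : BoundaryRegular f 2) (hinfl : NoBoundaryInflections f)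
    (hflat : LocallyNonflatAlongBoundary f) (p : bdry M) :
    ∃ ν n : R3, IsConormal f p ν ∧ IsOutwardNormal f (p : M) n ∧
      (capAngles f (p : M) ν n).Nonempty ∧
      Ioo 0 (sSup (capAngles f (p : M) ν n)) ⊆ capAngles f (p : M) ν n ∧
      ∃ C : Set M, (p : M) ∈ C ∧ IsMaximalCap f C ∧ Tendsto (capAt f (p : M) ν n)
          (𝓝[capAngles f (p : M) ν n] (sSup (capAngles f (p : M) ν n)))
          (@nhds (Set M) (TopologicalSpace.vietoris M) C) := by
  replace hf : IsRegularImmersion f := ⟨hf, hreg, hinfl, hflat⟩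
  obtain ⟨φ, hφ, hφp⟩ := hreg p
  obtain ⟨U, -, L, hU⟩ := hf.exists_localModel (p : M) univ_mem
  obtain ⟨T, n, ν, h⟩ := hU.exists_boundaryFrame hf.toIsLocallyConvexImmersion hφ
    (congrArg Subtype.val hφp)
  set Θ := capAngles f (p : M) ν n
  set τ := sSup Θ
  have hne : Θ.Nonempty := h.capAngles_nonempty hf
  have hbdd : BddAbove Θ := ⟨Real.pi, fun θ hθ => hθ.1.2⟩
  have hτπ : τ ≤ Real.pi := csSup_le hne fun θ hθ => hθ.1.2
  have hle : ∀ θ ∈ Θ, θ ≤ τ := fun θ hθ => le_csSup hbdd hθ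
  have hmod : ∀ θ ∈ Ioo 0 τ, θ ∈ Θ := by
    intro θ hθ
    obtain ⟨θ', hθ', hlt⟩ := exists_lt_of_lt_csSup hne hθ.2
    obtain ⟨K, hK⟩ := h.exists_capModel hf hθ' (hθ.1.trans hlt)
    exact h.mem_capAngles_of_cap hf hK (mem_capAt f p ν n θ') hθ'.1.2 ⟨hθ.1, hlt⟩
  -- a nondegenerate cap through `p` is the limit of caps at `p` of angles less than `τ`
  have hnd : ∀ C K m c, CapModel f C K m c → (p : M) ∈ C →
      0 < τ ∧ C ⊆ closure (⋃ θ ∈ Ioo 0 τ, capAt f p ν n θ) := by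
    intro C K m c g hp
    obtain ⟨θ', hθ', rfl⟩ := (h.exists_direction hf g hp).2
    have hle' : θ' ≤ τ := le_of_forall_lt_imp_le_of_dense fun θ hθ => by
      rcases le_or_gt θ 0 with h0 | h0
      · exact h0.trans (hne.elim fun θ₀ hθ₀ => hθ₀.1.1.trans (hle _ hθ₀))
      · exact hle _ (h.mem_capAngles_of_cap hf g hp hθ'.2 ⟨h0, hθ⟩)
    refine ⟨hθ'.1.trans_le hle', ?_⟩
    rw [h.cap_eq_closure hf g hp hθ']
    exact closure_mono (biUnion_subset_biUnion_left (Ioo_subset_Ioo_right hle'))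
  refine ⟨ν, n, h.isConormal hf.continuous, h.isOutwardNormal hf.continuous, hne, hmod, ?_⟩
  rcases le_or_gt τ 0 with hτ0 | hτ0
  · have hzero : ∀ θ ∈ Θ, θ = 0 := fun θ hθ => le_antisymm ((hle θ hθ).trans hτ0) hθ.1.1
    have h0 : 0 ∈ Θ := hne.elim fun θ hθ => hzero θ hθ ▸ hθ
    have hΘ0 : Θ = {0} := Subset.antisymm hzero (singleton_subset_iff.2 h0)
    have hτ' : τ = 0 := le_antisymm hτ0 (hle 0 h0)
    refine ⟨capAt f p ν n 0, mem_capAt f p ν n 0, ⟨⟨_, _, h0.2⟩, fun C' hC' hsub => ?_⟩, ?_⟩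
    · obtain ⟨hconn, hcomp, hi, hor⟩ := hC'.capModel_or_convex
      have hp := hsub (mem_capAt f p ν n 0)
      rcases hor with ⟨K, m, c, g⟩ | hconv
      · exact absurd (hnd C' K m c g hp).1 (not_lt.2 hτ0)
      · refine Subset.antisymm (hconn.isPreconnected.subset_connectedComponentIn hp fun x hx => ?_)
          hsub
        rw [rotatedNormal_zero]
        exact (h.inner_eq_of_convex hf.continuous hcomp hi hconv hp hx).ge
    · change Tendsto _ (𝓝[Θ] τ) _
      rw [hΘ0, hτ', nhdsWithin_singleton]
      let _ := TopologicalSpace.vietoris M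
      exact tendsto_pure_nhds _ _
  have g := h.capFamily hf ⟨hτ0, hτπ⟩ fun θ hθ => h.exists_capModel hf (hmod θ hθ) hθ.1
  have hlim := g.capModel_limit h hf
  have hp := g.subset_limit g.half_mem (g.mem _ g.half_mem)
  refine ⟨g.limit, hp, ⟨⟨_, _, hlim.isCapWith hf.continuous⟩, fun C' hC' hsub => ?_⟩, ?_⟩
  · obtain ⟨-, hcomp, hi, ⟨K, m, c, g'⟩ | hconv⟩ := hC'.capModel_or_convex
    · exact Subset.antisymm (hnd C' K m c g' (hsub hp)).2 hsub
    -- a nondegenerate cap is not contained in a plane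
    exfalso
    have hn : ∀ y ∈ g.limitBody, ⟪n, y⟫ = ⟪n, f p⟫ := by
      rw [hlim.body_eq]
      refine convexHull_min ?_ (convex_hyperplane (f := fun x => ⟪n, x⟫) (innerSL ℝ n).isLinear _)
      rintro _ ⟨x, hx, rfl⟩
      exact h.inner_eq_of_convex hf.continuous hcomp hi hconv (hsub hp) (hsub hx)
    obtain ⟨k, hk⟩ := hlim.capBody.body.interior_nonempty
    exact (inner_lt_of_mem_interior h.n_ne_zero (fun y hy => (hn y hy).le) hk).ne
      (hn k (interior_subset hk))
  · -- the caps increase to their limit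
    have hmono : ∀ θ₀ ∈ Ioo 0 τ, ∀ θ ∈ Θ, θ₀ < θ →
        capAt f p ν n θ₀ ⊆ capAt f p ν n θ ∧ capAt f p ν n θ ⊆ g.limit := by
      intro θ₀ hθ₀ θ hθ hlt
      rcases eq_or_lt_of_le (hle θ hθ) with he | hlt'
      · obtain ⟨K, hK⟩ := h.exists_capModel hf hθ (hθ₀.1.trans hlt)
        have := h.cap_eq_closure hf hK (mem_capAt f p ν n θ) ⟨hθ₀.1.trans hlt, hθ.1.2⟩
        rw [he] at this
        rw [he, this]
        exact ⟨g.subset_limit hθ₀, subset_rfl⟩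
      · exact ⟨g.set_mono hθ₀ ⟨hlt.le, hlt'⟩, g.subset_limit ⟨hθ₀.1.trans hlt, hlt'⟩⟩
    have hev : ∀ θ₀ ∈ Ioo 0 τ, ∀ᶠ θ in 𝓝[Θ] τ, capAt f p ν n θ₀ ⊆ capAt f p ν n θ ∧
        capAt f p ν n θ ⊆ g.limit := fun θ₀ hθ₀ => by
      filter_upwards [self_mem_nhdsWithin, mem_nhdsWithin_of_mem_nhds (Ioi_mem_nhds hθ₀.2)]
        with θ hθ hlt using hmono θ₀ hθ₀ θ hθ hlt
    refine TopologicalSpace.tendsto_nhds_generateFrom_iff.2 ?_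
    rintro s (⟨V, hV, rfl⟩ | ⟨V, hV, rfl⟩) hs
    · filter_upwards [hev _ g.half_mem] with θ hθ using hθ.2.trans hs
    · obtain ⟨x, hx, hxV⟩ := hs
      obtain ⟨z, hzV, hz⟩ := mem_closure_iff.1 hx V hV hxV
      obtain ⟨θ₀, hθ₀, hzθ⟩ := mem_iUnion₂.1 hz
      filter_upwards [hev θ₀ hθ₀] with θ hθ using ⟨z, hθ.1 hzθ, hzV⟩
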